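/- Let $q=\exp(\hbar)\in\mathbb C[[\hbar]]$, $[n]_q=\frac{q^n-q^{-n}}{q-q^{-1}}$, $[s]_q!=[s]_q\cdots[1]_q$, $\binom{s}{k}_q=\frac{[s]_q!}{[k]_q!\,[s-k]_q!}$. Let $(a_{ij})_{i,j\in\{0,1\}}$ be the generalized Cartan matrix of type $A_1^{(1)}$, i.e. $a_{ii}=2$ and $a_{ij}=-2$ for $i\ne j$; let $g_{ij}(z)=\frac{q^{a_{ij}}-z}{1-q^{a_{ij}}z}$, expanded as a Taylor series at $z=0$, and $\delta(z)=\sum_{n\in\mathbb Z}z^n$. All topologies are $\hbar$-adic and $\widehat\otimes$ is the $\hbar$-adically completed tensor product over $\mathbb C[[\hbar]]$. For a set $G$, the $\mathbb C[[\hbar]]$-algebra topologically generated by $G$ subject to a set of relations is the quotient of $\mathbb C\langle G\rangle[[\hbar]]$ (the $\hbar$-adic completion of the free $\mathbb C[[\hbar]]$-algebra on $G$) by the closed two-sided ideal generated by the relations. Relations between generating series are imposed coefficientwise, and in each such relation common powers of $\hbar$ are cancelled: a relation $\hbar^k f=0$ with $f\in\mathbb C\langle G\rangle[[\hbar]]$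 is read as $f=0$. Let $\mathcal U$ be the $\mathbb C[[\hbar]]$-algebra topologically generated by $h_{i,n}$, $x^\pm_{i,n}$, $c$ ($i\in\{0,1\}$, $n\in\mathbb Z$), subject to the following relations, where $$\phi_i^\pm(z)=q^{\pm h_{i,0}}\exp\Big(\pm(q-q^{-1})\sum_{\pm n>0}h_{i,n}z^{-n}\Big),\qquad x_i^\pm(z)=\sum_{n\in\mathbb Z}x^\pm_{i,n}z^{-n},$$ $i,j\in\{0,1\}$, and $i\neq j$ in (Q7), (Q8), (Q9): - (Q1) $c$ is central, $[\phi_i^\pm(z),\phi_j^\pm(w)]=0$; - (Q2) $\phi_i^+(z)\phi_j^-(w)=\phi_j^-(w)\phi_i^+(z)\,g_{ij}(q^cw/z)^{-1}g_{ij}(q^{-c}w/z)$; - (Q3) $\phi_i^+(z)x_j^\pm(w)=x_j^\pm(w)\phi_i^+(z)\,g_{ij}(q^{\mp c/2}w/z)^{\pm1}$; - (Q4) $\phi_i^-(z)x_j^\pm(w)=x_j^\pm(w)\phi_i^-(z)\,g_{ji}(q^{\mp c/2}z/w)^{\mp1}$; - (Q5) $[x_i^+(z),x_j^-(w)]=\frac{\delta_{ij}}{q-q^{-1}}\Big(\phi_i^+(zq^{-c/2})\,\delta\big(\tfrac{q^cw}{z}\big)-\phi_i^-(zq^{c/2})\,\delta\big(\tfrac{q^{-c}w}{z}\big)\Big)$;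 - (Q6) $(z-q^{\pm2}w)x_i^\pm(z)x_i^\pm(w)=(q^{\pm2}z-w)x_i^\pm(w)x_i^\pm(z)$; - (Q7) $(z-q^{\mp2}w)(z-w)x_i^\pm(z)x_j^\pm(w)=(q^{\mp2}z-w)(z-w)x_j^\pm(w)x_i^\pm(z)$; - (Q8) $\big[x_i^\pm(z_1),\,(z_2-q^{\mp2}w)x_i^\pm(z_2)x_j^\pm(w)-(q^{\mp2}z_2-w)x_j^\pm(w)x_i^\pm(z_2)\big]=0$; - (Q9) $\sum_{\sigma\in S_3}\sum_{r=0}^3(-1)^r\binom3r_q x_i^\pm(z_{\sigma(1)})\cdots x_i^\pm(z_{\sigma(r)})\,x_j^\pm(w)\,x_i^\pm(z_{\sigma(r+1)})\cdots x_i^\pm(z_{\sigma(3)})=0$. Let $\mathcal U^+$, $\mathcal U^-$ and $\mathcal H$ be the closed $\mathbb C[[\hbar]]$-subalgebras of $\mathcal U$ generated by the $x^+_{i,m}$, by the $x^-_{i,m}$, and by the $h_{i,m}$ and $c$, respectively ($i\in\{0,1\}$, $m\in\mathbb Z$). **Theorem.** $(\mathcal U^-,\mathcal H,\mathcal U^+)$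 is a triangular decomposition of $\mathcal U$: the multiplication $x^-\otimes h\otimes x^+\mapsto x^-hx^+$ induces an isomorphism of $\mathbb C[[\hbar]]$-modules $\mathcal U^-\,\widehat\otimes\,\mathcal H\,\widehat\otimes\,\mathcal U^+\to\mathcal U$. Moreover, $\mathcal U^+$ (resp. $\mathcal U^-$; resp. $\mathcal H$) is isomorphic, by an isomorphism matching the generators, to the $\mathbb C[[\hbar]]$-algebra topologically generated by the $x^+_{i,m}$ (resp. the $x^-_{i,m}$; resp. the $h_{i,m}$ and $c$), subject to the relations (Q6)–(Q9) with sign "$+$" (resp. (Q6)–(Q9) with sign "$-$"; resp. (Q1)–(Q2), where "$c$ is central" means that $c$ commutes with the $h_{i,m}$). -/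

import Mathlib

open scoped TensorProduct PowerSeries Nat

noncomputable section

namespace QuantumToroidal

/-! ### The base ring `ℂ⟦ħ⟧` and quantum numbers -/

/-- The ring `ℂ⟦ħ⟧`; the variable `ħ` is `PowerSeries.X`. -/
abbrev Base : Type := ℂ⟦X⟧

/-- Shortcut instance: the commutative semiring underlying the commutative ring `ℂ⟦ħ⟧`. -/
instance : CommSemiring Base := CommRing.toCommSemiring

/-- The element `ħ`. -/
def hbar : Base := PowerSeries.X

/-- The ideal `(ħ)` of `ℂ⟦ħ⟧`, which defines the `ħ`-adic topology. -/
def hbarIdeal : Ideal Base := Ideal.span {hbar}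

/-- `q ^ s = exp (s ħ)`, where `q = exp ħ`. -/
def qPow (s : ℂ) : Base := PowerSeries.rescale s (PowerSeries.exp ℂ)

theorem qPow_mul (s t : ℂ) : qPow s * qPow t = qPow (s + t) :=
  PowerSeries.exp_mul_exp_eq_exp_add s t

theorem qPow_zero : qPow 0 = 1 := by
  simp [qPow, PowerSeries.rescale_zero]

/-- `q ^ s` as a unit of `ℂ⟦ħ⟧`. -/
def qPowUnit (s : ℂ) : Baseˣ where
  val := qPow s
  inv := qPow (-s)
  val_inv := by rw [qPow_mul, add_neg_cancel, qPow_zero]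
  inv_val := by rw [qPow_mul, neg_add_cancel, qPow_zero]

/-- The quantum integer `[n]_q = (q^n - q^{-n}) / (q - q^{-1}) = ∑_{k < n} q^{n - 1 - 2k}`. -/
def qInt (n : ℕ) : Base := ∑ k ∈ Finset.range n, qPow ((n : ℂ) - 1 - 2 * (k : ℂ))

/-- The defining property of `[n]_q` (`q - q⁻¹` is not a zero divisor in `ℂ⟦ħ⟧`). -/
theorem qInt_mul (n : ℕ) :
    qInt n * (qPow 1 - qPow (-1)) = qPow n - qPow (-n) := by
  have key : ∀ k : ℕ, qPow ((n : ℂ) - 1 - 2 * (k : ℂ)) * (qPow 1 - qPow (-1))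
      = qPow ((n : ℂ) - 2 * (k : ℂ)) - qPow ((n : ℂ) - 2 * ((k + 1 : ℕ) : ℂ)) := by
    intro k
    rw [mul_sub, qPow_mul, qPow_mul]
    congr 2 <;> push_cast <;> ring
  rw [qInt, Finset.sum_mul, Finset.sum_congr rfl (fun k _ => key k),
    Finset.sum_range_sub' (fun k : ℕ => qPow ((n : ℂ) - 2 * (k : ℂ)))]
  congr 2 <;> push_cast <;> ring

/-- `[n]_q! = [n]_q ⋯ [1]_q`. -/
def qFact (n : ℕ) : Base := ∏ k ∈ Finset.range n, qInt (k + 1)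

/-- The quantum binomial coefficient. The quantum factorials have constant term `n!`, so they are
invertible in `ℂ⟦ħ⟧`. -/
def qBinom (s k : ℕ) : Base := qFact s * (qFact k * qFact (s - k))⁻¹

/-! ### The Cartan matrix of type `A₁⁽¹⁾` and the series `g_{ij}` -/

/-- The generalized Cartan matrix of type `A₁⁽¹⁾`. -/
def cartan (i j : Fin 2) : ℤ := if i = j then 2 else -2

/-- The polynomial `q^a - z` in `ℂ⟦ħ⟧⟦z⟧`. -/
def gNum (a : ℤ) : Base⟦X⟧ := PowerSeries.C (qPow a) - PowerSeries.X

/-- The polynomial `1 - q^a z` in `ℂ⟦ħ⟧⟦z⟧`. -/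
def gDen (a : ℤ) : Base⟦X⟧ := 1 - PowerSeries.C (qPow a) * PowerSeries.X

/-- `g_{ij}(z) = (q^{a_{ij}} - z) / (1 - q^{a_{ij}} z)`, expanded at `z = 0`, as a unit of
`ℂ⟦ħ⟧⟦z⟧`. -/
def gUnit (i j : Fin 2) : (Base⟦X⟧)ˣ where
  val := gNum (cartan i j) * PowerSeries.invOfUnit (gDen (cartan i j)) 1
  inv := gDen (cartan i j) *
    PowerSeries.invOfUnit (gNum (cartan i j)) (qPowUnit (cartan i j))
  val_inv := by
    have h1 := PowerSeries.mul_invOfUnit (gDen (cartan i j)) 1 (by simp [gDen])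
    have h2 := PowerSeries.mul_invOfUnit (gNum (cartan i j)) (qPowUnit (cartan i j))
      (by simp [gNum, qPowUnit])
    rw [mul_mul_mul_comm, mul_comm (PowerSeries.invOfUnit (gDen (cartan i j)) 1),
      mul_mul_mul_comm, h1, h2, one_mul]
  inv_val := by
    have h1 := PowerSeries.mul_invOfUnit (gDen (cartan i j)) 1 (by simp [gDen])
    have h2 := PowerSeries.mul_invOfUnit (gNum (cartan i j)) (qPowUnit (cartan i j))
      (by simp [gNum, qPowUnit])
    rw [mul_mul_mul_comm, mul_comm (PowerSeries.invOfUnit (gNum (cartan i j)) _),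
      mul_mul_mul_comm, h1, h2, one_mul]

/-! ### Currents

Throughout, `B` is a `ℂ`-algebra containing the (images of the) generators; all the expressions
below live in `B⟦ħ⟧`. A current in `z` is given by its coefficients. -/

section Currents

variable {B : Type} [Ring B] [Algebra ℂ B]

/-- Scalars: the central embedding `ℂ⟦ħ⟧ → B⟦ħ⟧`. -/
def scalar : Base →+* B⟦X⟧ := PowerSeries.map (algebraMap ℂ B)

/-- `q ^ (s b) = exp (s ħ b) = ∑ₙ sⁿ bⁿ ħⁿ / n!` in `B⟦ħ⟧`, for `b` in `B`. -/
def qExp (s : ℂ) (b : B) : B⟦X⟧ :=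
  PowerSeries.mk fun n => (s ^ n / (n ! : ℂ)) • b ^ n

/-- The exponential `∑ₖ fᵏ / k!` of a power series `f` without constant term over a ring `R`
(then `fᵏ` contributes to the coefficient of degree `m` only for `k ≤ m`). -/
def formalExp {R : Type} [Ring R] [Algebra ℂ R] (f : R⟦X⟧) : R⟦X⟧ :=
  PowerSeries.mk fun m =>
    ∑ k ∈ Finset.range (m + 1), ((k ! : ℂ)⁻¹) • PowerSeries.coeff m (f ^ k)

/-- The series `± (q - q⁻¹) ∑_{±n > 0} h_{i,n} z^{-n}` as a power series in `z^{∓1}`. -/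
def phiExponent (h : Fin 2 → ℤ → B) (ε : ℤˣ) (i : Fin 2) : (B⟦X⟧)⟦X⟧ :=
  PowerSeries.mk fun n => if n = 0 then 0 else
    scalar (((ε : ℤ) : Base) * (qPow 1 - qPow (-1))) * PowerSeries.C (h i ((ε : ℤ) * (n : ℤ)))

/-- The coefficient of `z^{∓m}` in
`φ_i^±(z) = q^{± h_{i,0}} exp (± (q - q⁻¹) ∑_{±n > 0} h_{i,n} z^{-n})`, for `m : ℕ`. -/
def phi (h : Fin 2 → ℤ → B) (ε : ℤˣ) (i : Fin 2) (m : ℕ) : B⟦X⟧ :=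
  qExp ((ε : ℤ) : ℂ) (h i 0) * PowerSeries.coeff m (formalExp (phiExponent h ε i))

/-- The coefficient of `z^{-k}` in `φ_i^±(z)`, for `k : ℤ`. -/
def phiMode (h : Fin 2 → ℤ → B) (ε : ℤˣ) (i : Fin 2) (k : ℤ) : B⟦X⟧ :=
  if 0 ≤ (ε : ℤ) * k then phi h ε i k.natAbs else 0

/-- The coefficient of `u^k` in `G(q^{s c} u)`, for a power series `G` over `ℂ⟦ħ⟧`. -/
def twist (c : B) (G : Base⟦X⟧) (s : ℂ) (k : ℕ) : B⟦X⟧ :=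
  scalar (PowerSeries.coeff k G) * qExp (s * (k : ℂ)) c

/-- The coefficient of `u^k` in `g_{ij}(q^c u)⁻¹ g_{ij}(q^{-c} u)`. -/
def twistPair (c : B) (i j : Fin 2) (k : ℕ) : B⟦X⟧ :=
  ∑ p ∈ Finset.HasAntidiagonal.antidiagonal k,
    twist c ((gUnit i j)⁻¹ : (Base⟦X⟧)ˣ).val 1 p.1 * twist c (gUnit i j).val (-1) p.2

/-! ### The relations

Each relation "left side = right side" between currents is the family of the coefficients of
"left side - right side". -/

/-- The relations (Q1), without those that involve the `x`'s, and (Q2):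
* `c h_{i,m} = h_{i,m} c`;
* the coefficients of `z^{∓m} w^{∓n}` in `[φ_i^±(z), φ_j^±(w)]`;
* the coefficients of `z^{-m} w^n` in
  `φ_i^+(z) φ_j^-(w) - φ_j^-(w) φ_i^+(z) g_{ij}(q^c w/z)⁻¹ g_{ij}(q^{-c} w/z)`. -/
def relCartan (c : B) (h : Fin 2 → ℤ → B) : Set B⟦X⟧ :=
  {r | ∃ (i : Fin 2) (m : ℤ), r = PowerSeries.C (c * h i m - h i m * c)} ∪
  {r | ∃ (ε : ℤˣ) (i j : Fin 2) (m n : ℕ),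
    r = phi h ε i m * phi h ε j n - phi h ε j n * phi h ε i m} ∪
  {r | ∃ (i j : Fin 2) (m n : ℕ),
    r = phi h 1 i m * phi h (-1) j n -
      ∑ k ∈ Finset.range (min m n + 1),
        phi h (-1) j (n - k) * phi h 1 i (m - k) * twistPair c i j k}

/-- The rest of (Q1), and (Q3), (Q4):
* `c x_{i,m}^± = x_{i,m}^± c`;
* the coefficients of `z^{-m} w^{-n}` in
  `φ_i^+(z) x_j^±(w) - x_j^±(w) φ_i^+(z) g_{ij}(q^{∓c/2} w/z)^{±1}`;
* the coefficients of `z^m w^{-n}` in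
  `φ_i^-(z) x_j^±(w) - x_j^±(w) φ_i^-(z) g_{ji}(q^{∓c/2} z/w)^{∓1}`. -/
def relMixed (c : B) (h : Fin 2 → ℤ → B) (x : ℤˣ → Fin 2 → ℤ → B) : Set B⟦X⟧ :=
  {r | ∃ (ε : ℤˣ) (i : Fin 2) (m : ℤ), r = PowerSeries.C (c * x ε i m - x ε i m * c)} ∪
  {r | ∃ (ε : ℤˣ) (i j : Fin 2) (m : ℕ) (n : ℤ),
    r = phi h 1 i m * PowerSeries.C (x ε j n) -
      ∑ k ∈ Finset.range (m + 1),
        PowerSeries.C (x ε j (n + (k : ℤ))) * phi h 1 i (m - k) *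
          twist c (gUnit i j ^ (ε : ℤ) : (Base⟦X⟧)ˣ).val (-((ε : ℤ) : ℂ) / 2) k} ∪
  {r | ∃ (ε : ℤˣ) (i j : Fin 2) (m : ℕ) (n : ℤ),
    r = phi h (-1) i m * PowerSeries.C (x ε j n) -
      ∑ k ∈ Finset.range (m + 1),
        PowerSeries.C (x ε j (n - (k : ℤ))) * phi h (-1) i (m - k) *
          twist c (gUnit j i ^ (-(ε : ℤ)) : (Base⟦X⟧)ˣ).val (-((ε : ℤ) : ℂ) / 2) k}

/-- The relation (Q5), multiplied by `q - q⁻¹`: the coefficients of `z^{-m} w^{-n}` in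
`(q - q⁻¹) [x_i^+(z), x_j^-(w)] -
  δ_{ij} (φ_i^+(z q^{-c/2}) δ(q^c w/z) - φ_i^-(z q^{c/2}) δ(q^{-c} w/z))`,
where `δ(z) = ∑ₙ zⁿ`. -/
def relQ5 (c : B) (h : Fin 2 → ℤ → B) (x : ℤˣ → Fin 2 → ℤ → B) : Set B⟦X⟧ :=
  {r | ∃ (i j : Fin 2) (m n : ℤ),
    r = scalar (qPow 1 - qPow (-1)) *
        PowerSeries.C (x 1 i m * x (-1) j n - x (-1) j n * x 1 i m) -
      if i = j then
        phiMode h 1 i (m + n) * qExp (((m + n : ℤ) : ℂ) / 2) c * qExp (-(n : ℂ)) c -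
        phiMode h (-1) i (m + n) * qExp (-((m + n : ℤ) : ℂ) / 2) c * qExp (n : ℂ) c
      else 0}

/-- The coefficient of `z^{-m} w^{-n}` in
`(z - q^{± a_{ij}} w) x_i^±(z) x_j^±(w) - (q^{± a_{ij}} z - w) x_j^±(w) x_i^±(z)`;
here `x` is the family of the modes of the currents `x_i^±` for a fixed sign `± = ε`. -/
def quad (ε : ℤˣ) (x : Fin 2 → ℤ → B) (i j : Fin 2) (m n : ℤ) : B⟦X⟧ :=
  (PowerSeries.C (x i (m + 1) * x j n) -
      scalar (qPow (((ε : ℤ) * cartan i j : ℤ) : ℂ)) * PowerSeries.C (x i m * x j (n + 1))) -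
    (scalar (qPow (((ε : ℤ) * cartan i j : ℤ) : ℂ)) * PowerSeries.C (x j n * x i (m + 1)) -
      PowerSeries.C (x j (n + 1) * x i m))

/-- The coefficient of `z₁^{-m 0} z₂^{-m 1} z₃^{-m 2} w^{-n}` in
`∑_{σ ∈ S₃} ∑_{r=0}^{3} (-1)^r [3 choose r]_q
  x_i(z_{σ(1)}) ⋯ x_i(z_{σ(r)}) x_j(w) x_i(z_{σ(r+1)}) ⋯ x_i(z_{σ(3)})`. -/
def serre (x : Fin 2 → ℤ → B) (i j : Fin 2) (m : Fin 3 → ℤ) (n : ℤ) : B⟦X⟧ :=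
  ∑ σ : Equiv.Perm (Fin 3), ∑ r ∈ Finset.range 4,
    scalar ((-1) ^ r * qBinom 3 r) *
      PowerSeries.C (((List.ofFn fun p => x i (m (σ p))).take r).prod * x j n *
        ((List.ofFn fun p => x i (m (σ p))).drop r).prod)

/-- The relations (Q6), (Q7), (Q8), (Q9) for a fixed sign `ε`:
* the coefficients of `(z - q^{±2} w) x_i^±(z) x_i^±(w) - (q^{±2} z - w) x_i^±(w) x_i^±(z)`;
* for `i ≠ j`, the coefficients of
  `(z - q^{∓2} w) (z - w) x_i^±(z) x_j^±(w) - (q^{∓2} z - w) (z - w) x_j^±(w) x_i^±(z)`;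
* for `i ≠ j`, the coefficients of
  `[x_i^±(z₁), (z₂ - q^{∓2} w) x_i^±(z₂) x_j^±(w) - (q^{∓2} z₂ - w) x_j^±(w) x_i^±(z₂)]`;
* for `i ≠ j`, the coefficients of the quantum Serre relation. -/
def relHalf (ε : ℤˣ) (x : Fin 2 → ℤ → B) : Set B⟦X⟧ :=
  {r | ∃ (i : Fin 2) (m n : ℤ), r = quad ε x i i m n} ∪
  {r | ∃ (i j : Fin 2) (m n : ℤ), i ≠ j ∧
    r = quad ε x i j (m + 1) n - quad ε x i j m (n + 1)} ∪
  {r | ∃ (i j : Fin 2) (l m n : ℤ), i ≠ j ∧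
    r = PowerSeries.C (x i l) * quad ε x i j m n - quad ε x i j m n * PowerSeries.C (x i l)} ∪
  {r | ∃ (i j : Fin 2) (m : Fin 3 → ℤ) (n : ℤ), i ≠ j ∧ r = serre x i j m n}

/-- Cancel common powers of `ħ`: a relation `ħᵏ f = 0` is read as the relation `f = 0`.
(`B⟦ħ⟧` has no `ħ`-torsion, so `f` is determined by `k` and `ħᵏ f`.) -/
def cancelHbar (R : Set B⟦X⟧) : Set B⟦X⟧ :=
  {f | ∃ k : ℕ, PowerSeries.X ^ k * f ∈ R}

end Currents

/-! ### Topologically presented `ℂ⟦ħ⟧`-algebras -/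

/-- The `ℂ⟦ħ⟧`-algebra topologically freely generated by a set `G`, that is, the `ħ`-adic
completion `ℂ⟨G⟩⟦ħ⟧` of the free `ℂ⟦ħ⟧`-algebra on `G`. -/
abbrev FreeTop (G : Type) : Type := (FreeAlgebra ℂ G)⟦X⟧

/-- `ℂ⟨G⟩⟦ħ⟧` as an algebra over `ℂ⟦ħ⟧`. -/
instance (G : Type) : Algebra Base (FreeTop G) :=
  RingHom.toAlgebra' scalar (by
    intro a f
    ext n
    rw [PowerSeries.coeff_mul, PowerSeries.coeff_mul, ← Finset.Nat.sum_antidiagonal_swap]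
    refine Finset.sum_congr rfl fun p _ => ?_
    simp only [scalar, PowerSeries.coeff_map, Prod.fst_swap, Prod.snd_swap]
    exact Algebra.commutes _ _)

/-- Closedness of a subset in the `ħ`-adic topology of a `ℂ⟦ħ⟧`-module. -/
def IsHbarClosed {M : Type} [AddCommGroup M] [Module Base M] (S : Set M) : Prop :=
  ∀ y : M, (∀ n : ℕ, ∃ s ∈ S, ∃ t : M, y = s + hbar ^ n • t) → y ∈ S

/-- The closed two-sided ideal generated by a set. -/
def closedIdeal {A : Type} [Ring A] [Algebra Base A] (R : Set A) : Ideal A :=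
  sInf {I : Ideal A | I.IsTwoSided ∧ IsHbarClosed (I : Set A) ∧ R ⊆ I}

instance {A : Type} [Ring A] [Algebra Base A] (R : Set A) : (closedIdeal R).IsTwoSided where
  mul_mem_of_left := by
    intro a b ha
    rw [closedIdeal, Submodule.mem_sInf] at ha ⊢
    intro I hI
    exact hI.1.mul_mem_of_left b (ha I hI)

/-- The closed subalgebra generated by a set. -/
def closedAdjoin {A : Type} [Ring A] [Algebra Base A] (S : Set A) : Subalgebra Base A :=
  sInf {T : Subalgebra Base A | IsHbarClosed (T : Set A) ∧ S ⊆ T}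

/-- The `ℂ⟦ħ⟧`-algebra topologically generated by `G`, subject to the relations `r = 0` for `r`
in `R`, where common powers of `ħ` are cancelled in every relation. -/
abbrev Presented (G : Type) (R : Set (FreeTop G)) : Type :=
  FreeTop G ⧸ closedIdeal (cancelHbar R)

/-- The image of a generator in the presented algebra. -/
def Presented.gen {G : Type} (R : Set (FreeTop G)) (g : G) : Presented G R :=
  Ideal.Quotient.mk _ (PowerSeries.C (FreeAlgebra.ι ℂ g))

/-! ### The quantum toroidal algebra of type `A₁` -/

/-- The generators `x_{i,n}^±`, `h_{i,n}`, `c`. -/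
inductive Gen : Type
  | x (ε : ℤˣ) (i : Fin 2) (n : ℤ)
  | h (i : Fin 2) (n : ℤ)
  | c

/-- The generators `h_{i,n}`, `c`. -/
inductive CartanGen : Type
  | h (i : Fin 2) (n : ℤ)
  | c

/-- The generators `x_{i,n}` (for a fixed sign). -/
inductive HalfGen : Type
  | x (i : Fin 2) (n : ℤ)

/-- The relations (Q1)-(Q9). -/
def relations : Set (FreeTop Gen) :=
  let c := FreeAlgebra.ι ℂ Gen.c
  let h := fun i n => FreeAlgebra.ι ℂ (Gen.h i n)
  let x := fun ε i n => FreeAlgebra.ι ℂ (Gen.x ε i n)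
  relCartan c h ∪ relMixed c h x ∪ relQ5 c h x ∪ ⋃ ε : ℤˣ, relHalf ε (x ε)

/-- The quantum toroidal algebra `𝒰`. -/
abbrev U : Type := Presented Gen relations

/-- The elements `x_{i,n}^±` of `𝒰`. -/
def U.x (ε : ℤˣ) (i : Fin 2) (n : ℤ) : U := Presented.gen relations (Gen.x ε i n)

/-- The elements `h_{i,n}` of `𝒰`. -/
def U.h (i : Fin 2) (n : ℤ) : U := Presented.gen relations (Gen.h i n)

/-- The element `c` of `𝒰`. -/
def U.c : U := Presented.gen relations Gen.c

/-- The closed subalgebra `𝒰^±` of `𝒰` generated by the `x_{i,m}^±`. -/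
def UHalf (ε : ℤˣ) : Subalgebra Base U :=
  closedAdjoin {y | ∃ (i : Fin 2) (m : ℤ), y = U.x ε i m}

/-- The closed subalgebra `ℋ` of `𝒰` generated by the `h_{i,m}` and `c`. -/
def UCartan : Subalgebra Base U :=
  closedAdjoin ({y | ∃ (i : Fin 2) (m : ℤ), y = U.h i m} ∪ {U.c})

/-- The relations (Q6)-(Q9) with sign `ε` between the generators `x_{i,m}`. -/
def halfRelations (ε : ℤˣ) : Set (FreeTop HalfGen) :=
  relHalf ε fun i n => FreeAlgebra.ι ℂ (HalfGen.x i n)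

/-- The relations (Q1)-(Q2) between the generators `h_{i,m}`, `c`. -/
def cartanRelations : Set (FreeTop CartanGen) :=
  relCartan (FreeAlgebra.ι ℂ CartanGen.c) fun i n => FreeAlgebra.ι ℂ (CartanGen.h i n)

/-- `(A⁻, H, A⁺)` is a triangular decomposition of the `ℂ⟦ħ⟧`-algebra `A`: these are closed
subalgebras, and `x⁻ ⊗ h ⊗ x⁺ ↦ x⁻ h x⁺` induces an isomorphism of `ℂ⟦ħ⟧`-modules from the
`ħ`-adically completed tensor product `A⁻ ⊗̂ H ⊗̂ A⁺` to `A`. -/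
def IsTriangularDecomposition {A : Type} [Ring A] [Algebra Base A]
    (Am H Ap : Subalgebra Base A) : Prop :=
  IsHbarClosed (Am : Set A) ∧ IsHbarClosed (H : Set A) ∧ IsHbarClosed (Ap : Set A) ∧
  ∃ e : AdicCompletion hbarIdeal ((Am ⊗[Base] H) ⊗[Base] Ap) ≃ₗ[Base] A,
    ∀ (a : Am) (h : H) (b : Ap),
      e (AdicCompletion.of hbarIdeal ((Am ⊗[Base] H) ⊗[Base] Ap) ((a ⊗ₜ[Base] h) ⊗ₜ[Base] b)) =
        (a : A) * (h : A) * (b : A)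

end QuantumToroidal

end

/-!
# The triangular decomposition of the quantum toroidal algebra

The difficulty is that `U` is given by generators and relations, so that it could a priori be
smaller than the three factors suggest. It is shown to be large enough by means of an explicit
representation, and small enough by a computation modulo `ħ`.

*The representation.* The space `VermaSpace = ℂ⟨x⁻⟩ ⊗ ℂ[h, c] ⊗ ℂ⟨y⟩` involves no relations among
the letters `x⁻` or among the letters `y`. On it `x⁻` acts by left multiplication, `c` and the
`h_{i,n}` act on `ℂ[h, c]` as a Heisenberg algebra, and `x⁺` acts on `ℂ[h, c] ⊗ ℂ⟨y⟩` by moving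
past the polynomial in the `h_{i,n}` and then by multiplication by `y`. The action of `h` and `x⁺`
on the words in `x⁻` is then forced by the values of their commutators with `x⁻` (`indSeries`),
and operators are compared by means of their commutators with the `x⁻` and their restrictions to
the empty word (`eq_zero_of_commute_prepend`). In this way (Q1)-(Q5) hold exactly
(`Verma.isCartanAction`, `Verma.isCurrent_xp`, `Verma.xp_xm`), while (Q6)-(Q9) hold modulo the
closed submodule `Verma.relSpace` generated by `I⁻ ⊗ ℂ[h, c] ⊗ ℂ⟨y⟩` and `ℂ⟨x⁻⟩ ⊗ ℂ[h, c] ⊗ I⁺`,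
where `I^±` are the closed ideals of the relations (Q6)-(Q9) in the free algebras. So
`VermaSpace⟦ħ⟧ / relSpace` is a representation of `U` (`Verma.rep_smul_mem`).

*The stability of `relSpace`.* The point is that the commutator of one of the relations (Q6)-(Q9)
of one half with a generator `y` of the other half is a consequence of the preceding relations
(`half_commutator_mem`). By (Q5) the commutator of `y` with a current `x_i` is, up to the factor
`q - q⁻¹`, a difference of two currents `P`, `P'` coming from `φ⁺` and `φ⁻`, which satisfy the
relations `(z - t w) P(z) x_j(w) = (t z - w) x_j(w) P(z)` (`IsCartanAction.phi_currentRel`). For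
(Q6) and (Q7) this makes the commutator vanish. For (Q8) and (Q9) one multiplies by the factors
`z - t w` which are needed to move `P` to the right of the other currents; the result is a
combination of quadratic relations, and the factors can be cancelled since the modes of `P` vanish
on one side (`current_quadRel_commute`, `serreHitLast_sum_eq_zero`, `serreHitFirst_sum_eq_zero`).
The commutator with `h_{i,n}` only shifts the modes (`shift_commutator_mem`).

*Coordinates.* The action on the vacuum vector `1 ⊗ 1 ⊗ 1` maps `x⁻ h x⁺` to the corresponding
element of the quotient. Hence for every trilinear map `T` on the three presented algebras with
values in `M` there is a linear map `coord T` from `U` to the completion of `M` with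
`x⁻ h x⁺ ↦ T(x⁻, h, x⁺)` (`exists_coord`). Applied to augmentations this shows that the three presented
algebras embed into `U` with closed images (`exists_halfMap_extension`,
`exists_cartanMap_extension`, `isHbarClosed_range`); applied to the tensor product it shows that
the multiplication map is injective and that it induces the `ħ`-adic topology of its source.

*Spanning.* To leading order in `ħ` the relations (Q1)-(Q5) express the commutators of the
generators of different factors (`KillsLeading`), so that the products `x⁻ h x⁺` span `U` modulo
`ħ` (`exists_triangular_add_hbar_smul`), and normally ordered monomials span the Cartan part
(`cartanAlg_mem_of_closed`). As `U` is complete and separated, it is the completion of the tensor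
product (`exists_completion_equiv`).
-/

noncomputable section

set_option linter.unusedSectionVars false

namespace QuantumToroidal

open PowerSeries Finset

/-! ### Continuous extension of homomorphisms to formal series -/

section Tools
variable {B : Type} [Ring B] [Algebra ℂ B]

theorem scalar_commute (s : Base) (f : B⟦X⟧) : Commute (scalar s) f := by
  ext n
  rw [coeff_mul, coeff_mul, ← Finset.Nat.sum_antidiagonal_swap]
  refine Finset.sum_congr rfl fun p _ => ?_
  simp only [scalar, coeff_map, Prod.fst_swap, Prod.snd_swap]
  exact Algebra.commutes _ _

theorem scalar_C (a : ℂ) : (scalar (PowerSeries.C a) : B⟦X⟧) = PowerSeries.C (algebraMap ℂ B a) := by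
  simp [scalar]

theorem scalar_X : (scalar hbar : B⟦X⟧) = X := by
  simp [scalar, hbar]

/-- Two additive maps between power series which commute with multiplication by the variable and
agree on constants are equal. -/
theorem addHom_ext_of_C {K : Type} [Ring K] {f g : B⟦X⟧ →+ K⟦X⟧}
    (hf : ∀ b, f (X * b) = X * f b) (hg : ∀ b, g (X * b) = X * g b)
    (h : ∀ b : B, f (PowerSeries.C b) = g (PowerSeries.C b)) : f = g := by
  suffices H : ∀ (n : ℕ) (b : B⟦X⟧), coeff n (f b) = coeff n (g b) by
    ext b n; exact H n b
  intro n
  induction n with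
  | zero =>
    intro b
    rw [eq_X_mul_shift_add_const b]
    simp [hf, hg, h]
  | succ n ih =>
    intro b
    rw [eq_X_mul_shift_add_const b]
    simp [hf, hg, h, ih]

/-- The `ħ`-adically continuous extension to `B⟦ħ⟧` of a homomorphism from `B` to `K⟦ħ⟧`. -/
def liftTopAux {K : Type} [Ring K] (f : B →+ K⟦X⟧) : B⟦X⟧ →+ K⟦X⟧ where
  toFun g := PowerSeries.mk fun n => ∑ p ∈ antidiagonal n, coeff p.2 (f (coeff p.1 g))
  map_zero' := by ext n; simp
  map_add' a b := by ext n; simp [Finset.sum_add_distrib]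

theorem liftTopAux_X_mul {K : Type} [Ring K] (f : B →+ K⟦X⟧) (g : B⟦X⟧) :
    liftTopAux f (X * g) = X * liftTopAux f g := by
  ext n
  cases n with
  | zero => simp [liftTopAux]
  | succ n =>
    rw [coeff_succ_X_mul]
    simp [liftTopAux, Finset.Nat.antidiagonal_succ, coeff_succ_X_mul]

theorem liftTopAux_C {K : Type} [Ring K] (f : B →+ K⟦X⟧) (b : B) :
    liftTopAux f (PowerSeries.C b) = f b := by
  ext n
  simp only [liftTopAux, AddMonoidHom.coe_mk, ZeroHom.coe_mk, coeff_mk]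
  rw [Finset.sum_eq_single (0, n)]
  · simp
  · rintro ⟨i, j⟩ hp hne
    have : i ≠ 0 := by
      rintro rfl
      simp at hp
      simp [hp] at hne
    simp [coeff_C, this]
  · simp

/-- The `ħ`-adically continuous extension to `B⟦ħ⟧` of a ring homomorphism from `B` to `K⟦ħ⟧`. -/
def liftTop {K : Type} [Ring K] (f : B →+* K⟦X⟧) : B⟦X⟧ →+* K⟦X⟧ where
  __ := liftTopAux f.toAddMonoidHom
  map_one' := by
    have := liftTopAux_C f.toAddMonoidHom 1
    simpa using this
  map_mul' a b := by
    change liftTopAux f.toAddMonoidHom (a * b) = liftTopAux f.toAddMonoidHom a * liftTopAux f.toAddMonoidHom b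
    set F := liftTopAux f.toAddMonoidHom with hF
    have hX : ∀ b, F (X * b) = X * F b := liftTopAux_X_mul _
    have hC : ∀ b, F (PowerSeries.C b) = f b := liftTopAux_C _
    have key : ∀ (b : B⟦X⟧) (c : B), F (PowerSeries.C c * b) = f c * F b := by
      intro b c
      have := addHom_ext_of_C (f := F.comp (AddMonoidHom.mulLeft (PowerSeries.C c)))
        (g := (AddMonoidHom.mulLeft (f c)).comp F)
        (fun b => by
          simp only [AddMonoidHom.comp_apply, AddMonoidHom.coe_mulLeft]
          rw [← mul_assoc, (commute_X (PowerSeries.C c)).eq, mul_assoc, hX]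
          )
        (fun b => by
          simp only [AddMonoidHom.comp_apply, AddMonoidHom.coe_mulLeft]
          rw [hX, ← mul_assoc, ← mul_assoc, (commute_X (f c)).eq])
        (fun b => by
          simp only [AddMonoidHom.comp_apply, AddMonoidHom.coe_mulLeft]
          rw [← map_mul, hC, hC, map_mul])
      exact DFunLike.congr_fun this b
    have := addHom_ext_of_C (f := F.comp (AddMonoidHom.mulRight b))
        (g := (AddMonoidHom.mulRight (F b)).comp F)
        (fun a => by
          simp only [AddMonoidHom.comp_apply, AddMonoidHom.coe_mulRight]
          rw [mul_assoc, hX])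
        (fun a => by
          simp only [AddMonoidHom.comp_apply, AddMonoidHom.coe_mulRight]
          rw [hX, mul_assoc])
        (fun c => by
          simp only [AddMonoidHom.comp_apply, AddMonoidHom.coe_mulRight]
          rw [key, hC])
    exact DFunLike.congr_fun this a

theorem liftTop_C {K : Type} [Ring K] (f : B →+* K⟦X⟧) (b : B) :
    liftTop f (PowerSeries.C b) = f b := liftTopAux_C _ _

theorem liftTop_X {K : Type} [Ring K] (f : B →+* K⟦X⟧) :
    liftTop f X = X := by
  have := liftTopAux_X_mul f.toAddMonoidHom 1
  rw [mul_one] at this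
  refine this.trans ?_
  rw [show liftTopAux f.toAddMonoidHom 1 = liftTop f 1 from rfl, map_one, mul_one]

theorem ringHom_ext_of_C {K : Type} [Ring K] {f g : B⟦X⟧ →+* K⟦X⟧}
    (hf : f X = X) (hg : g X = X)
    (h : ∀ b : B, f (PowerSeries.C b) = g (PowerSeries.C b)) : f = g := by
  have := addHom_ext_of_C (f := f.toAddMonoidHom) (g := g.toAddMonoidHom)
    (fun b => by simp [hf]) (fun b => by simp [hg]) h
  ext1 b
  exact DFunLike.congr_fun this b

theorem liftTop_scalar {K : Type} [Ring K] [Algebra ℂ K] (f : B →ₐ[ℂ] K⟦X⟧) (s : Base) :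
    liftTop (f : B →+* K⟦X⟧) (scalar s) = scalar s := by
  have : (liftTop (f : B →+* K⟦X⟧)).comp scalar = (scalar : Base →+* K⟦X⟧) := by
    refine ringHom_ext_of_C ?_ ?_ ?_
    · rw [RingHom.comp_apply]; erw [scalar_X]; exact liftTop_X _
    · exact scalar_X
    · intro b
      rw [RingHom.comp_apply, scalar_C, liftTop_C, scalar_C]
      simp [PowerSeries.algebraMap_apply]
  exact DFunLike.congr_fun this s

/-! ### Exponentials -/

/-- The exponentials of commuting elements multiply: `q^b q^b' = q^(b + b')`. -/
theorem qExp_mul_qExp_of_commute {b b' : B} (h : Commute b b') :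
    qExp 1 b * qExp 1 b' = qExp 1 (b + b') := by
  ext n
  simp only [qExp, one_pow, coeff_mul, coeff_mk]
  rw [h.add_pow', Finset.smul_sum]
  refine Finset.sum_congr rfl fun p hp => ?_
  have hn := mem_antidiagonal.1 hp
  rw [smul_mul_smul_comm, ← Nat.cast_smul_eq_nsmul ℂ, smul_smul]
  congr 1
  have := Nat.choose_mul_factorial_mul_factorial (n := n) (k := p.1) (by omega)
  rw [show n - p.1 = p.2 by omega] at this
  have h1 : (p.1 ! : ℂ) ≠ 0 := by exact_mod_cast Nat.factorial_ne_zero _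
  have h2 : (p.2 ! : ℂ) ≠ 0 := by exact_mod_cast Nat.factorial_ne_zero _
  have h3 : (n ! : ℂ) ≠ 0 := by exact_mod_cast Nat.factorial_ne_zero _
  rw [← this] at h3 ⊢
  push_cast at h3 ⊢
  have h4 : (n.choose p.1 : ℂ) ≠ 0 := fun h => h3 (by simp [h])
  field_simp

theorem qExp_eq (s : ℂ) (b : B) : qExp s b = qExp 1 (s • b) := by
  ext n
  simp [qExp, smul_pow, smul_smul]
  congr 1
  ring

theorem qExp_zero (b : B) : qExp 0 b = 1 := by
  ext n
  cases n <;> simp [qExp, coeff_one]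

theorem qExp_add (s t : ℂ) (b : B) : qExp (s + t) b = qExp s b * qExp t b := by
  rw [qExp_eq s, qExp_eq t, qExp_mul_qExp_of_commute ((Commute.refl b).smul_left s |>.smul_right t),
    ← add_smul, ← qExp_eq]

/-- The two meanings of `q ^ s` agree: as an element of `ℂ⟦ħ⟧`, and as the exponential of a scalar
in `B`. -/
theorem scalar_qPow (s : ℂ) : (scalar (qPow s) : B⟦X⟧) = qExp 1 (algebraMap ℂ B s) := by
  ext n
  simp [scalar, qPow, qExp, exp, Algebra.smul_def]
  exact (Algebra.commutes ((n ! : ℂ)⁻¹) _).symm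

theorem commute_C_iff {b : B} {f : B⟦X⟧} :
    Commute (PowerSeries.C b) f ↔ ∀ n, Commute b (coeff n f) := by
  constructor
  · intro h n
    have := congrArg (coeff n) h.eq
    simp only [coeff_mul_C, coeff_C_mul] at this
    exact this
  · intro h
    ext n
    simpa [coeff_mul_C, coeff_C_mul] using (h n).eq

theorem qExp_commute {b : B} {f : B⟦X⟧} (h : Commute (PowerSeries.C b) f) (s : ℂ) :
    Commute (qExp s b) f := by
  rw [commute_C_iff] at h
  ext n
  rw [coeff_mul, coeff_mul, ← Finset.Nat.sum_antidiagonal_swap]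
  refine Finset.sum_congr rfl fun p _ => ?_
  simp only [qExp, coeff_mk, Prod.fst_swap, Prod.snd_swap]
  exact (((h _).pow_left _).smul_left _).eq

/-- If `[b, f] = a f` for a scalar `a`, then `exp(sħb) f = exp(sħa) f exp(sħb)`. -/
theorem qExp_mul_of_commutator {b : B} {f : B⟦X⟧} {a : ℂ}
    (h : PowerSeries.C b * f - f * PowerSeries.C b = a • f) (s : ℂ) :
    qExp s b * f = scalar (qPow (s * a)) * (f * qExp s b) := by
  have hb : ∀ n, b * coeff n f = coeff n f * (b + algebraMap ℂ B a) := by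
    intro n
    have := congrArg (coeff n) h
    rw [map_sub, coeff_C_mul, coeff_mul_C, show coeff n (a • f) = a • coeff n f from rfl] at this
    rw [mul_add, ← Algebra.commutes, ← Algebra.smul_def, ← this]
    abel
  have hp : ∀ k n, b ^ k * coeff n f = coeff n f * (b + algebraMap ℂ B a) ^ k := by
    intro k n
    exact (SemiconjBy.pow_right (show SemiconjBy (coeff n f) _ _ from (hb n).symm) k).eq.symm
  have h1 : qExp s b * f = f * qExp s (b + algebraMap ℂ B a) := by
    ext n
    rw [coeff_mul, coeff_mul, ← Finset.Nat.sum_antidiagonal_swap]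
    refine Finset.sum_congr rfl fun p _ => ?_
    simp only [qExp, coeff_mk, Prod.fst_swap, Prod.snd_swap]
    rw [smul_mul_assoc, hp, mul_smul_comm]
  rw [h1, qExp_eq s (b + _), smul_add,
    ← qExp_mul_qExp_of_commute ((Algebra.commute_algebraMap_right a b).smul_left s |>.smul_right s), ← qExp_eq,
    show s • algebraMap ℂ B a = algebraMap ℂ B (s * a) by simp [Algebra.smul_def],
    ← scalar_qPow, ← (scalar_commute _ (qExp s b)).eq, ← mul_assoc, ← (scalar_commute _ f).eq, mul_assoc]

/-! ### Division by `q - q⁻¹` -/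

theorem constantCoeff_qPow (s : ℂ) : constantCoeff (qPow s) = 1 := by
  rw [← coeff_zero_eq_constantCoeff_apply]
  simp [qPow, exp]

theorem coeff_one_qPow (s : ℂ) : coeff 1 (qPow s) = s := by
  simp [qPow, exp]

/-- The element `(q - q⁻¹) / ħ`. -/
def qDiff : Base := PowerSeries.mk fun n => coeff (n + 1) (qPow 1 - qPow (-1))

theorem X_mul_qDiff : X * qDiff = qPow 1 - qPow (-1) := by
  ext n
  cases n with
  | zero => simp [constantCoeff_qPow]
  | succ n => simp [coeff_succ_X_mul, qDiff]

theorem constantCoeff_qDiff : constantCoeff qDiff = 2 := by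
  rw [← coeff_zero_eq_constantCoeff_apply, qDiff, coeff_mk, zero_add, map_sub, coeff_one_qPow,
    coeff_one_qPow]
  norm_num

theorem qDiff_mul_inv : qDiff * qDiff⁻¹ = 1 :=
  PowerSeries.mul_inv_cancel _ (by rw [constantCoeff_qDiff]; norm_num)

theorem X_mul_inj {f g : B⟦X⟧} : X * f = X * g ↔ f = g := by
  constructor
  · intro h
    ext n
    have := congrArg (coeff (n + 1)) h
    simpa [coeff_succ_X_mul] using this
  · rintro rfl; rfl

theorem X_pow_mul_inj {f g : B⟦X⟧} (k : ℕ) : X ^ k * f = X ^ k * g ↔ f = g := by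
  induction k with
  | zero => simp
  | succ k ih => rw [pow_succ', mul_assoc, mul_assoc, X_mul_inj, ih]

/-- `q - q⁻¹` in `B⟦ħ⟧`. -/
abbrev qd : B⟦X⟧ := scalar (qPow 1 - qPow (-1))

theorem qd_eq : (qd : B⟦X⟧) = X * scalar qDiff := by
  rw [qd, ← X_mul_qDiff, map_mul]
  exact congrArg (· * _) scalar_X

theorem scalar_qDiff_mul_inv : (scalar qDiff * scalar qDiff⁻¹ : B⟦X⟧) = 1 := by
  rw [← map_mul, qDiff_mul_inv, map_one]

theorem qd_mul_inj {f g : B⟦X⟧} : qd * f = qd * g ↔ f = g := by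
  constructor
  · intro h
    rw [qd_eq, mul_assoc, mul_assoc, X_mul_inj] at h
    have := congrArg (scalar qDiff⁻¹ * ·) h
    simpa only [← mul_assoc, ← map_mul, mul_comm qDiff⁻¹, qDiff_mul_inv, map_one, one_mul] using this
  · rintro rfl; rfl

/-- Division by `q - q⁻¹` in `B⟦ħ⟧`, for series without constant term. -/
def qdDiv (f : B⟦X⟧) : B⟦X⟧ := scalar qDiff⁻¹ * PowerSeries.mk fun n => coeff (n + 1) f

theorem qd_mul_qdDiv {f : B⟦X⟧} (h : constantCoeff f = 0) : qd * qdDiv f = f := by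
  rw [qd_eq, qdDiv, mul_assoc, ← mul_assoc (scalar qDiff), scalar_qDiff_mul_inv, one_mul]
  conv_rhs => rw [eq_X_mul_shift_add_const f, h]
  simp


/-! ### Logarithmic derivatives -/

/-- The derivation `u d/du` of `R⟦u⟧`. -/
def eulerD {R : Type} [Ring R] : R⟦X⟧ →+ R⟦X⟧ where
  toFun f := PowerSeries.mk fun n => n • coeff n f
  map_zero' := by ext n; simp
  map_add' a b := by ext n; simp [smul_add]

section Euler
variable {R : Type} [Ring R]

theorem coeff_eulerD (n : ℕ) (f : R⟦X⟧) : coeff n (eulerD f) = n • coeff n f := by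
  simp [eulerD]

theorem eulerD_mul (f g : R⟦X⟧) : eulerD (f * g) = eulerD f * g + f * eulerD g := by
  ext n
  rw [map_add, coeff_eulerD, coeff_mul, coeff_mul, coeff_mul, ← Finset.sum_add_distrib,
    Finset.smul_sum]
  refine Finset.sum_congr rfl fun p hp => ?_
  rw [coeff_eulerD, coeff_eulerD, smul_mul_assoc, mul_smul_comm, ← add_smul, mem_antidiagonal.1 hp]

theorem eulerD_one : eulerD (1 : R⟦X⟧) = 0 := by
  ext n
  rw [coeff_eulerD]
  cases n <;> simp [coeff_one]

theorem eulerD_pow {f : R⟦X⟧} (h : Commute f (eulerD f)) (k : ℕ) :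
    eulerD (f ^ (k + 1)) = (k + 1) • (eulerD f * f ^ k) := by
  induction k with
  | zero => simp
  | succ k ih =>
    rw [pow_succ, eulerD_mul, ih, smul_mul_assoc, mul_assoc, ← pow_succ, (h.pow_left (k+1)).eq,
      ← succ_nsmul]

theorem coeff_pow_of_lt {f : R⟦X⟧} (h : constantCoeff f = 0) {m k : ℕ} (hmk : m < k) :
    coeff m (f ^ k) = 0 := by
  induction k generalizing m with
  | zero => omega
  | succ k ih =>
    rw [pow_succ, coeff_mul]
    refine Finset.sum_eq_zero fun p hp => ?_
    have := mem_antidiagonal.1 hp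
    rcases Nat.eq_zero_or_pos p.2 with h2 | h2
    · rw [h2, coeff_zero_eq_constantCoeff_apply, h, mul_zero]
    · rw [ih (by omega), zero_mul]

theorem coeff_formalExp [Algebra ℂ R] {f : R⟦X⟧} (h : constantCoeff f = 0) {m N : ℕ} (hN : m < N) :
    coeff m (formalExp f) = ∑ k ∈ range N, ((k ! : ℂ)⁻¹) • coeff m (f ^ k) := by
  rw [formalExp, coeff_mk]
  refine Finset.sum_subset (fun k hk => ?_) fun k _ hk => ?_
  · simp at hk ⊢; omega
  · rw [coeff_pow_of_lt h (by simpa using hk), smul_zero]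

/-- The logarithmic derivative of `exp f` is the derivative of `f`, if these two commute. -/
theorem eulerD_formalExp [Algebra ℂ R] {f : R⟦X⟧} (h : constantCoeff f = 0)
    (hc : Commute f (eulerD f)) : eulerD (formalExp f) = eulerD f * formalExp f := by
  ext m
  rw [coeff_eulerD, coeff_formalExp h (show m < m + 1 + 1 by omega), Finset.sum_range_succ', coeff_mul]
  have h1 : ∀ p ∈ antidiagonal m, coeff p.1 (eulerD f) * coeff p.2 (formalExp f) =
      ∑ k ∈ range (m + 1), coeff p.1 (eulerD f) * (((k ! : ℂ)⁻¹) • coeff p.2 (f ^ k)) := by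
    intro p hp
    have := mem_antidiagonal.1 hp
    rw [coeff_formalExp h (show p.2 < m + 1 by omega), Finset.mul_sum]
  rw [Finset.sum_congr rfl h1, Finset.sum_comm, smul_add, Finset.smul_sum]
  have h2 : m • (((0 ! : ℂ)⁻¹) • coeff m (f ^ 0)) = 0 := by
    cases m <;> simp [coeff_one]
  rw [h2, add_zero]
  refine Finset.sum_congr rfl fun k _ => ?_
  rw [smul_comm, ← coeff_eulerD, eulerD_pow hc, ← Nat.cast_smul_eq_nsmul ℂ,
    show coeff m (((k + 1 : ℕ) : ℂ) • (eulerD f * f ^ k)) = ((k + 1 : ℕ) : ℂ) • coeff m (eulerD f * f ^ k) from rfl,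
    smul_smul, coeff_mul, Finset.smul_sum]
  refine Finset.sum_congr rfl fun p _ => ?_
  rw [mul_smul_comm]
  congr 1
  rw [Nat.factorial_succ]
  push_cast
  have : (k : ℂ) + 1 ≠ 0 := by exact_mod_cast Nat.succ_ne_zero k
  have h2 : (k ! : ℂ) ≠ 0 := by exact_mod_cast Nat.factorial_ne_zero _
  field_simp

theorem map_coeff_formalExp {R' : Type} [Ring R'] [Algebra ℂ R] [Algebra ℂ R'] (F : R →ₐ[ℂ] R')
    (f : R⟦X⟧) (m : ℕ) : F (coeff m (formalExp f)) =
      coeff m (formalExp (PowerSeries.map (F : R →+* R') f)) := by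
  simp only [formalExp, coeff_mk, map_sum, map_smul, ← map_pow, coeff_map]
  rfl

theorem nsmul_inj_of_complex [Algebra ℂ R] {m : ℕ} (hm : m ≠ 0) {x y : R} (h : m • x = m • y) : x = y := by
  rw [← Nat.cast_smul_eq_nsmul ℂ, ← Nat.cast_smul_eq_nsmul ℂ] at h
  have : (m : ℂ) ≠ 0 := by exact_mod_cast hm
  simpa [smul_smul, this] using congrArg ((m : ℂ)⁻¹ • ·) h

/-- A sum over nested antidiagonals, reordered. -/
theorem sum_antidiagonal_rotate {M : Type} [AddCommMonoid M] (m : ℕ) (F : ℕ → ℕ → ℕ → M) :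
    ∑ p ∈ antidiagonal m, ∑ r ∈ antidiagonal p.2, F p.1 r.1 r.2 =
      ∑ p ∈ antidiagonal m, ∑ r ∈ antidiagonal p.2, F r.1 p.1 r.2 := by
  rw [Finset.sum_sigma', Finset.sum_sigma']
  refine Finset.sum_nbij' (fun x => ⟨(x.2.1, x.1.1 + x.2.2), (x.1.1, x.2.2)⟩)
    (fun x => ⟨(x.2.1, x.1.1 + x.2.2), (x.1.1, x.2.2)⟩) ?_ ?_ ?_ ?_ ?_
  all_goals
    rintro ⟨⟨i, j⟩, ⟨k, l⟩⟩ h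
    simp only [mem_sigma, HasAntidiagonal.mem_antidiagonal] at h
    obtain ⟨h1, h2⟩ := h
    subst h2
    first | rfl | (simp only [mem_sigma, HasAntidiagonal.mem_antidiagonal, and_true]; omega)

theorem sum_antidiagonal_assoc {M : Type} [AddCommMonoid M] (m : ℕ) (F : ℕ → ℕ → ℕ → M) :
    ∑ p ∈ antidiagonal m, ∑ r ∈ antidiagonal p.2, F p.1 r.1 r.2 =
      ∑ p ∈ antidiagonal m, ∑ r ∈ antidiagonal p.1, F r.1 r.2 p.2 := by
  rw [Finset.sum_sigma', Finset.sum_sigma']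
  refine Finset.sum_nbij' (fun x => ⟨(x.1.1 + x.2.1, x.2.2), (x.1.1, x.2.1)⟩)
    (fun x => ⟨(x.2.1, x.2.2 + x.1.2), (x.2.2, x.1.2)⟩) ?_ ?_ ?_ ?_ ?_
  all_goals
    rintro ⟨⟨i, j⟩, ⟨k, l⟩⟩ h
    simp only [mem_sigma, HasAntidiagonal.mem_antidiagonal] at h
    obtain ⟨h1, h2⟩ := h
    subst h2
    first | rfl | (simp only [mem_sigma, HasAntidiagonal.mem_antidiagonal, and_true]; omega)

/-- Commutation of a series with a logarithmic derivative past a current: if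
`u E' = (∑ k a_k u^k) E`, `u G' = (∑ k λ_k u^k) G` and `[a_k, y_n] = λ_k y_{n ± k}`, then
`E(u) y(w) = G(u w^{∓ 1}) y(w) E(u)` as soon as this holds for the constant terms in `u`. -/
theorem mul_current_of_eulerD [Algebra ℂ R] {a l E G : ℕ → R} {y : ℤ → R} {s : ℤ}
    (hE : ∀ m, m • E m = ∑ p ∈ antidiagonal m, p.1 • (a p.1 * E p.2))
    (hG : ∀ m, m • G m = ∑ p ∈ antidiagonal m, p.1 • (l p.1 * G p.2))
    (hay : ∀ k n, 0 < k → a k * y n = y n * a k + l k * y (n + s * k))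
    (haG : ∀ k k', Commute (a k) (G k')) (hlG : ∀ k k', Commute (l k) (G k'))
    (h0 : ∀ n, E 0 * y n = G 0 * (y n * E 0)) (m : ℕ) (n : ℤ) :
    E m * y n = ∑ p ∈ antidiagonal m, G p.1 * (y (n + s * p.1) * E p.2) := by
  induction m using Nat.strong_induction_on generalizing n with
  | _ m ih =>
  rcases Nat.eq_zero_or_pos m with rfl | hm
  · simp [h0]
  refine nsmul_inj_of_complex hm.ne' ?_
  have e1 : ∀ p ∈ antidiagonal m, p.1 • (a p.1 * E p.2) * y n =
      ∑ r ∈ antidiagonal p.2, (p.1 • (G r.1 * (y (n + s * r.1) * (a p.1 * E r.2))) +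
        p.1 • (l p.1 * G r.1 * (y (n + s * (p.1 + r.1)) * E r.2))) := by
    intro p hp
    have hp' := mem_antidiagonal.1 hp
    rcases Nat.eq_zero_or_pos p.1 with h | h
    · simp [h]
    rw [smul_mul_assoc, mul_assoc, ih p.2 (by omega), Finset.mul_sum, Finset.smul_sum]
    refine Finset.sum_congr rfl fun r _ => ?_
    rw [← smul_add]
    congr 1
    rw [← mul_assoc, (haG _ _).eq, mul_assoc, ← mul_assoc (a p.1), hay _ _ h, add_mul, mul_add,
      (hlG _ _).eq, mul_assoc (y _), mul_assoc (G r.1), mul_assoc (l p.1),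
      show n + s * r.1 + s * p.1 = n + s * (p.1 + r.1) by ring]
  rw [← smul_mul_assoc, hE, Finset.sum_mul, Finset.sum_congr rfl e1]
  simp only [Finset.sum_add_distrib]
  rw [sum_antidiagonal_rotate m fun i j k => i • (G j * (y (n + s * j) * (a i * E k)))]
  have e2 : ∀ p ∈ antidiagonal m, ∑ r ∈ antidiagonal p.2,
      r.1 • (G p.1 * (y (n + s * p.1) * (a r.1 * E r.2))) =
        p.2 • (G p.1 * (y (n + s * p.1) * E p.2)) := by
    intro p _
    rw [← mul_smul_comm, ← mul_smul_comm, hE, Finset.mul_sum, Finset.mul_sum]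
    simp only [mul_smul_comm]
  rw [Finset.sum_congr rfl e2]
  have e3 : ∑ p ∈ antidiagonal m, ∑ r ∈ antidiagonal p.2,
        p.1 • (l p.1 * G r.1 * (y (n + s * (p.1 + r.1)) * E r.2)) =
      ∑ p ∈ antidiagonal m, p.1 • (G p.1 * (y (n + s * p.1) * E p.2)) := by
    have := sum_antidiagonal_assoc m fun i j k =>
      i • (l i * G j * (y (n + s * ((i : ℤ) + j)) * E k))
    rw [this]
    refine Finset.sum_congr rfl fun p _ => ?_
    rw [← smul_mul_assoc, hG, Finset.sum_mul]
    refine Finset.sum_congr rfl fun r hr => ?_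
    rw [smul_mul_assoc, ← mem_antidiagonal.1 hr]
    push_cast
    rfl
  rw [e3, ← Finset.sum_add_distrib, Finset.smul_sum]
  refine Finset.sum_congr rfl fun p hp => ?_
  rw [← add_smul, add_comm, mem_antidiagonal.1 hp]

end Euler
end Tools

/-! ### Formal series in several variables -/

section Families
variable {R : Type} [CommRing R]

/-- Families of elements of `Q` indexed by `ℤ⁴`, viewed as formal series in four variables. -/
abbrev Fam (Q : Type) : Type := (Fin 4 → ℤ) → Q

variable {Q : Type} [AddCommGroup Q] [Module R Q]

/-- The multiplication by the `i`-th variable, as an endomorphism of the formal series. -/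
def famShift (i : Fin 4) : Module.End R (Fam Q) where
  toFun F m := F (m + Pi.single i 1)
  map_add' _ _ := rfl
  map_smul' _ _ := rfl

variable (R Q) in
theorem famShift_comm : ∀ a ∈ Set.range (famShift (R := R) (Q := Q)),
    ∀ b ∈ Set.range (famShift (R := R) (Q := Q)), a * b = b * a := by
  rintro _ ⟨i, rfl⟩ _ ⟨j, rfl⟩
  refine LinearMap.ext fun F => funext fun m => ?_
  exact congrArg F (add_right_comm _ _ _)

variable (R Q) in
/-- The action of polynomials on formal series. -/
def famAction : MvPolynomial (Fin 4) R →+* Module.End R (Fam Q) :=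
  letI : CommRing (Algebra.adjoin R (Set.range (famShift (R := R) (Q := Q)))) :=
    { (inferInstance : Ring (Algebra.adjoin R (Set.range (famShift (R := R) (Q := Q))))) with
      mul_comm := (Algebra.isMulCommutative_adjoin R (famShift_comm R Q)).is_comm.comm }
  ((Algebra.adjoin R (Set.range (famShift (R := R) (Q := Q)))).val : _ →+* _).comp
    (MvPolynomial.aeval (R := R) (fun i => (⟨famShift i, Algebra.subset_adjoin ⟨i, rfl⟩⟩ :
      Algebra.adjoin R (Set.range (famShift (R := R) (Q := Q)))))).toRingHom

/-- The multiplication of formal series by polynomials. -/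
instance famModule : Module (MvPolynomial (Fin 4) R) (Fam Q) :=
  Module.compHom (Fam Q) (famAction R Q)

theorem fam_X_smul (i : Fin 4) (F : Fam Q) (m : Fin 4 → ℤ) :
    ((MvPolynomial.X i : MvPolynomial (Fin 4) R) • F) m = F (m + Pi.single i 1) := by
  change (famAction R Q (MvPolynomial.X i)) F m = _
  simp [famAction, famShift]

theorem fam_C_smul (r : R) (F : Fam Q) (m : Fin 4 → ℤ) :
    ((MvPolynomial.C r : MvPolynomial (Fin 4) R) • F) m = r • F m := by
  change (famAction R Q (MvPolynomial.C r)) F m = _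
  simp [famAction]

/-- The linear polynomial `a z_0 - b z_s`. -/
def linPoly (a b : R) (s : Fin 4) : MvPolynomial (Fin 4) R :=
  MvPolynomial.C a * MvPolynomial.X 0 - MvPolynomial.C b * MvPolynomial.X s

theorem linPoly_smul (a b : R) (s : Fin 4) (F : Fam Q) (m : Fin 4 → ℤ) :
    (linPoly a b s • F) m = a • F (m + Pi.single 0 1) - b • F (m + Pi.single s 1) := by
  rw [linPoly, sub_smul, mul_smul, mul_smul, Pi.sub_apply, fam_C_smul, fam_C_smul, fam_X_smul,
    fam_X_smul]

/-- The coefficients of `F` vanish for small or for large exponents of the variable `z_0`. -/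
def OneSided (F : Fam Q) : Prop :=
  (∃ N : ℤ, ∀ m, m 0 < N → F m = 0) ∨ (∃ N : ℤ, ∀ m, N < m 0 → F m = 0)

theorem OneSided.linPoly_smul {F : Fam Q} (h : OneSided F) (a b : R) {s : Fin 4} (hs : s ≠ 0) :
    OneSided (linPoly a b s • F) := by
  rcases h with ⟨N, h⟩ | ⟨N, h⟩
  · refine Or.inl ⟨N - 1, fun m hm => ?_⟩
    rw [QuantumToroidal.linPoly_smul, h, h] <;> simp [hs.symm] <;> omega
  · refine Or.inr ⟨N, fun m hm => ?_⟩
    rw [QuantumToroidal.linPoly_smul, h, h] <;> simp [hs.symm] <;> omega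

/-- A linear polynomial with invertible coefficients can be cancelled from a series which is
one-sided in `z_0`. -/
theorem OneSided.eq_zero {F : Fam Q} (h : OneSided F) {a b a' b' : R} (ha : a' * a = 1)
    (hb : b' * b = 1) {s : Fin 4} (hs : s ≠ 0) (hF : linPoly a b s • F = 0) : F = 0 := by
  have key : ∀ m : Fin 4 → ℤ, a • F (m + Pi.single 0 1) = b • F (m + Pi.single s 1) := fun m => by
    have := congrFun hF m
    rw [QuantumToroidal.linPoly_smul] at this
    exact sub_eq_zero.1 this
  -- the relation between the coefficients propagates the vanishing in the direction of `z_0`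
  rcases h with ⟨N, h⟩ | ⟨N, h⟩
  · have H : ∀ (k : ℕ) m, m 0 < N + k → F m = 0 := by
      intro k
      induction k with
      | zero => simpa using h
      | succ k ih =>
        intro m hm
        have := key (m - Pi.single 0 1)
        rw [sub_add_cancel, ih (m - Pi.single 0 1 + Pi.single s 1)
          (by simp [hs.symm]; push_cast at hm; omega), smul_zero] at this
        simpa [smul_smul, ha] using congrArg (a' • ·) this
    funext m
    exact H (m 0 - N + 1).toNat m (by omega)
  · have H : ∀ (k : ℕ) m, N - k < m 0 → F m = 0 := by
      intro k
      induction k with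
      | zero => simpa using h
      | succ k ih =>
        intro m hm
        have := key (m - Pi.single s 1)
        rw [sub_add_cancel, ih (m - Pi.single s 1 + Pi.single 0 1)
          (by simp [hs.symm]; push_cast at hm; omega), smul_zero] at this
        simpa [smul_smul, hb] using congrArg (b' • ·) this.symm
    funext m
    exact H (N - m 0 + 1).toNat m (by omega)

end Families

/-! ### Currents with quadratic commutation relations -/

section Compat
variable {R A : Type} [CommRing R] [Ring A] [Algebra R A]

/-- The relation `(z - t w) Φ(z) e(w) = (t z - w) e(w) Φ(z)` between two currents. -/
def CurrentRel (t : R) (P e : ℤ → A) : Prop :=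
  ∀ k l, P (k + 1) * e l - t • (P k * e (l + 1)) = t • (e l * P (k + 1)) - e (l + 1) * P k

/-- The coefficients of `(z - t w) e(z) f(w) - (t z - w) f(w) e(z)`. -/
def quadRel (t : R) (e f : ℤ → A) (m n : ℤ) : A :=
  (e (m + 1) * f n - t • (e m * f (n + 1))) - (t • (f n * e (m + 1)) - f (n + 1) * e m)

/-- The sum over the orderings of three modes `e_a`, `e_b`, `e_c` of
`f e e e - s e f e e + s e e f e - e e e f`. -/
def serreRel (s : R) (e f : ℤ → A) (a b c n : ℤ) : A :=
  let W := fun a b c : ℤ => f n * e a * e b * e c - s • (e a * f n * e b * e c) +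
    s • (e a * e b * f n * e c) - e a * e b * e c * f n
  W a b c + W a c b + W b a c + W b c a + W c a b + W c b a

/-- If `k D = P - P'` and `k` is not a zero divisor, `D` satisfies the relations which `P` and
`P'` have in common. -/
theorem CurrentRel.of_smul {t k : R} {P P' D e : ℤ → A} (hk : ∀ a b : A, k • a = k • b → a = b)
    (hD : ∀ m, k • D m = P m - P' m) (h : CurrentRel t P e) (h' : CurrentRel t P' e) :
    CurrentRel t D e := by
  have e1 : ∀ m x, k • (D m * x) = P m * x - P' m * x := fun m x => by
    rw [← smul_mul_assoc, hD, sub_mul]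
  have e2 : ∀ m x, k • (x * D m) = x * P m - x * P' m := fun m x => by
    rw [← mul_smul_comm, hD, mul_sub]
  intro m l
  apply hk
  rw [smul_sub, smul_sub, smul_comm k t, smul_comm k t, e1, e1, e2, e2, smul_sub, smul_sub,
    sub_sub_sub_comm (P _ * _), h m l, h' m l, sub_sub_sub_comm]

/-- If the commutator of `y` with the modes of `e` is a current with the same commutation
relations as `e`, then `y` commutes with the quadratic relations of `e`. -/
theorem quadRel_self_commute {t : R} {e D : ℤ → A} {y : A} (hy : ∀ m, e m * y - y * e m = D m)
    (h : CurrentRel t D e) (m n : ℤ) : quadRel t e e m n * y = y * quadRel t e e m n := by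
  have h1 := h m n
  have h2 := h n m
  simp only [← hy] at h1 h2
  rw [← sub_eq_zero] at h1 h2 ⊢
  rw [← add_zero (0 : A)]
  nth_rewrite 2 [← h1]
  rw [← h2]
  simp only [quadRel, sub_mul, mul_sub, smul_sub, smul_mul_assoc, mul_smul_comm, mul_assoc]
  abel

theorem quadRel_commute_left {t : R} {e f D : ℤ → A} {y : A} (hy : ∀ m, e m * y - y * e m = D m)
    (hf : ∀ m, f m * y = y * f m)
    (h : CurrentRel t D f) (m n : ℤ) : quadRel t e f m n * y = y * quadRel t e f m n := by
  have h1 := h m n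
  simp only [← hy] at h1
  rw [← sub_eq_zero] at h1 ⊢
  rw [← h1]
  simp only [quadRel, sub_mul, mul_sub, smul_sub, smul_mul_assoc, mul_smul_comm, mul_assoc, hf]
  simp only [← mul_assoc, hf]
  abel

theorem quadRel_commute_right {t : R} {e f D : ℤ → A} {y : A} (hy : ∀ m, f m * y - y * f m = D m)
    (he : ∀ m, e m * y = y * e m)
    (h : CurrentRel t D e) (m n : ℤ) : quadRel t e f m n * y = y * quadRel t e f m n := by
  have h1 := h n m
  simp only [← hy] at h1
  rw [← sub_eq_zero] at h1 ⊢
  rw [← h1]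
  simp only [quadRel, sub_mul, mul_sub, smul_sub, smul_mul_assoc, mul_smul_comm, mul_assoc, he]
  simp only [← mul_assoc, he]
  abel


section Chain
variable {Q : Type} [AddCommGroup Q] [Module R Q] (mk : A →ₗ[R] Q)

/-- A current `P` with mode index `m 0` is moved past a current with mode index `m s`. -/
theorem linPoly_smul_swap {a b : R} {P g : ℤ → A} {s : Fin 4} (hs : s ≠ 0)
    (h : ∀ k l, a • (P (k + 1) * g l) - b • (P k * g (l + 1)) =
      b • (g l * P (k + 1)) - a • (g (l + 1) * P k))
    (u v : (Fin 4 → ℤ) → A) (hu : ∀ m, u (m + Pi.single 0 1) = u m)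
    (hu' : ∀ m, u (m + Pi.single s 1) = u m) (hv : ∀ m, v (m + Pi.single 0 1) = v m)
    (hv' : ∀ m, v (m + Pi.single s 1) = v m) :
    linPoly a b s • (fun m => mk (u m * (P (m 0) * (g (m s) * v m))) : Fam Q) =
      linPoly b a s • (fun m => mk (u m * (g (m s) * (P (m 0) * v m))) : Fam Q) := by
  funext m
  rw [linPoly_smul, linPoly_smul, hu, hu', hv, hv']
  simp only [Pi.add_apply, Pi.single_eq_same, Pi.single_eq_of_ne hs, Pi.single_eq_of_ne hs.symm,
    add_zero, ← map_smul, ← map_sub]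
  congr 1
  have := congrArg (fun x => u m * (x * v m)) (h (m 0) (m s))
  simpa only [sub_mul, mul_sub, smul_mul_assoc, mul_smul_comm, mul_assoc] using this

/-- Moving a current `P` to the right of three other currents, after multiplication by the
denominators `a z_0 - b z_s`. -/
theorem chain_move {P g₁ g₂ g₃ : ℤ → A} {a₁ b₁ a₂ b₂ a₃ b₃ : R} {s₁ s₂ s₃ : Fin 4}
    (hs₁ : s₁ ≠ 0) (hs₂ : s₂ ≠ 0) (hs₃ : s₃ ≠ 0) (h12 : s₁ ≠ s₂) (h13 : s₁ ≠ s₃) (h23 : s₂ ≠ s₃)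
    (h₁ : ∀ k l, a₁ • (P (k + 1) * g₁ l) - b₁ • (P k * g₁ (l + 1)) =
      b₁ • (g₁ l * P (k + 1)) - a₁ • (g₁ (l + 1) * P k))
    (h₂ : ∀ k l, a₂ • (P (k + 1) * g₂ l) - b₂ • (P k * g₂ (l + 1)) =
      b₂ • (g₂ l * P (k + 1)) - a₂ • (g₂ (l + 1) * P k))
    (h₃ : ∀ k l, a₃ • (P (k + 1) * g₃ l) - b₃ • (P k * g₃ (l + 1)) =
      b₃ • (g₃ l * P (k + 1)) - a₃ • (g₃ (l + 1) * P k)) :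
    let M : Fam Q := fun m => mk (g₁ (m s₁) * (g₂ (m s₂) * (g₃ (m s₃) * P (m 0))))
    (linPoly a₁ b₁ s₁ * linPoly a₂ b₂ s₂ * linPoly a₃ b₃ s₃) •
        (fun m => mk (P (m 0) * (g₁ (m s₁) * (g₂ (m s₂) * g₃ (m s₃)))) : Fam Q) =
      (linPoly b₁ a₁ s₁ * linPoly b₂ a₂ s₂ * linPoly b₃ a₃ s₃) • M ∧
    (linPoly a₂ b₂ s₂ * linPoly a₃ b₃ s₃) •
        (fun m => mk (g₁ (m s₁) * (P (m 0) * (g₂ (m s₂) * g₃ (m s₃)))) : Fam Q) =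
      (linPoly b₂ a₂ s₂ * linPoly b₃ a₃ s₃) • M ∧
    linPoly a₃ b₃ s₃ •
        (fun m => mk (g₁ (m s₁) * (g₂ (m s₂) * (P (m 0) * g₃ (m s₃)))) : Fam Q) =
      linPoly b₃ a₃ s₃ • M := by
  intro M
  have e1 := linPoly_smul_swap mk hs₁ h₁ (fun _ => 1) (fun m => g₂ (m s₂) * g₃ (m s₃))
    (by simp) (by simp) (by simp [hs₂, hs₃]) (by simp [h12.symm, h13.symm])
  have e2 := linPoly_smul_swap mk hs₂ h₂ (fun m => g₁ (m s₁)) (fun m => g₃ (m s₃))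
    (by simp [hs₁]) (by simp [h12]) (by simp [hs₃]) (by simp [h23.symm])
  have e3 := linPoly_smul_swap mk hs₃ h₃ (fun m => g₁ (m s₁) * g₂ (m s₂)) (fun m => 1)
    (by simp [hs₁, hs₂]) (by simp [h13, h23]) (by simp) (by simp)
  simp only [one_mul, mul_one, mul_assoc] at e1 e2 e3
  have f2 : (linPoly a₂ b₂ s₂ * linPoly a₃ b₃ s₃) •
        (fun m => mk (g₁ (m s₁) * (P (m 0) * (g₂ (m s₂) * g₃ (m s₃)))) : Fam Q) =
      (linPoly b₂ a₂ s₂ * linPoly b₃ a₃ s₃) • M := by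
    rw [mul_comm, mul_smul, e2, smul_comm, e3, mul_smul]
  refine ⟨?_, f2, e3⟩
  rw [mul_assoc, mul_comm, mul_smul, e1, smul_comm, f2, mul_assoc (linPoly b₁ a₁ s₁), mul_smul (linPoly b₁ a₁ s₁)]

end Chain

end Compat

/-! ### One-sided currents and the Serre relation -/

section SerreCompat
variable {R A : Type} [CommRing R] [Ring A] [Algebra R A]

/-- The coefficients of `P` vanish on one side. -/
def OneSidedModes (P : ℤ → A) : Prop :=
  (∃ N : ℤ, ∀ m, m < N → P m = 0) ∨ (∃ N : ℤ, ∀ m, N < m → P m = 0)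

/-- The terms that a Serre word contributes to the commutator with an element which only fails to
commute with `f`, the result `p` of the commutator replacing `f`. -/
def serreHitLast (t : R) (p x y z : A) : A :=
  t • (p * (x * (y * z))) - (t ^ 2 + t + 1) • (x * (p * (y * z))) +
    (t ^ 2 + t + 1) • (x * (y * (p * z))) - t • (x * (y * (z * p)))

/-- The terms that the Serre words contribute to the commutator with an element which only fails
to commute with `e`, the result `p` of the commutator replacing one of the three `e`'s. -/
def serreHitFirst (t : R) (p x y f : A) : A :=
  t • (f * (p * (x * y)) + f * (x * (p * y)) + f * (x * (y * p))) -
    (t ^ 2 + t + 1) • (p * (f * (x * y)) + x * (f * (p * y)) + x * (f * (y * p))) +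
    (t ^ 2 + t + 1) • (p * (x * (f * y)) + x * (p * (f * y)) + x * (y * (f * p))) -
    t • (p * (x * (y * f)) + x * (p * (y * f)) + x * (y * (p * f)))

variable {Q : Type} [AddCommGroup Q] [Module R Q] (mk : A →ₗ[R] Q)

theorem OneSidedModes.oneSided {P : ℤ → A} (h : OneSidedModes P) {F : Fam Q}
    (hF : ∀ m, P (m 0) = 0 → F m = 0) : OneSided F := by
  rcases h with ⟨N, h⟩ | ⟨N, h⟩
  · exact Or.inl ⟨N, fun m hm => hF m (h _ hm)⟩
  · exact Or.inr ⟨N, fun m hm => hF m (h _ hm)⟩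

/-- Three linear factors can be cancelled from a series which is one-sided in `z_0`. -/
theorem OneSided.eq_zero_of_three {F : Fam Q} (h : OneSided F) {a₁ b₁ a₂ b₂ a₃ b₃ : R}
    (ha₁ : IsUnit a₁) (hb₁ : IsUnit b₁) (ha₂ : IsUnit a₂) (hb₂ : IsUnit b₂) (ha₃ : IsUnit a₃)
    (hb₃ : IsUnit b₃) {s₁ s₂ s₃ : Fin 4} (hs₁ : s₁ ≠ 0) (hs₂ : s₂ ≠ 0) (hs₃ : s₃ ≠ 0)
    (hF : (linPoly a₁ b₁ s₁ * linPoly a₂ b₂ s₂ * linPoly a₃ b₃ s₃) • F = 0) : F = 0 := by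
  obtain ⟨a₁', ha₁⟩ := ha₁.exists_left_inv
  obtain ⟨b₁', hb₁⟩ := hb₁.exists_left_inv
  obtain ⟨a₂', ha₂⟩ := ha₂.exists_left_inv
  obtain ⟨b₂', hb₂⟩ := hb₂.exists_left_inv
  obtain ⟨a₃', ha₃⟩ := ha₃.exists_left_inv
  obtain ⟨b₃', hb₃⟩ := hb₃.exists_left_inv
  rw [mul_assoc, mul_smul, mul_smul] at hF
  have h3 := h.linPoly_smul a₃ b₃ hs₃
  have h2 := h3.linPoly_smul a₂ b₂ hs₂
  exact h.eq_zero ha₃ hb₃ hs₃ (h3.eq_zero ha₂ hb₂ hs₂ (h2.eq_zero ha₁ hb₁ hs₁ hF))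

theorem currentRel_iff_one {t : R} {P e : ℤ → A} :
    CurrentRel t P e ↔ ∀ k l, (1 : R) • (P (k + 1) * e l) - t • (P k * e (l + 1)) =
      t • (e l * P (k + 1)) - (1 : R) • (e (l + 1) * P k) := by
  simp [CurrentRel]

/-- The relation with `t⁻¹`, multiplied by `t`. -/
theorem CurrentRel.inv {t t' : R} (ht : t * t' = 1) {P e : ℤ → A} (h : CurrentRel t' P e) (k l : ℤ) :
    t • (P (k + 1) * e l) - (1 : R) • (P k * e (l + 1)) =
      (1 : R) • (e l * P (k + 1)) - t • (e (l + 1) * P k) := by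
  have := congrArg (t • ·) (h k l)
  simpa [smul_sub, smul_smul, ht] using this

/-- The commutator of the Serre relation with an element which only fails to commute with `f`, the
modes of `P` replacing those of `f`. After multiplication by the denominators `t z_0 - z_s`, one
can move `P` to the right in all terms. The coefficients of the words in `e`, which multiply `P`,
then form a combination of quadratic relations with coefficients divisible by `t² - 1`. -/
theorem serreHitLast_sum_eq_zero {t t' : R} (ht : t * t' = 1) {P e : ℤ → A} (hP : CurrentRel t' P e)
    (hs : OneSidedModes P)
    (h₁ : ∀ k l x, (t ^ 2 - 1) • mk (quadRel t e e k l * x) = 0)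
    (h₂ : ∀ k l m x, (t ^ 2 - 1) • mk (e m * (quadRel t e e k l * x)) = 0) (a b c n : ℤ) :
    mk (serreHitLast t (P n) (e a) (e b) (e c) + serreHitLast t (P n) (e a) (e c) (e b) +
      serreHitLast t (P n) (e b) (e a) (e c) + serreHitLast t (P n) (e b) (e c) (e a) +
      serreHitLast t (P n) (e c) (e a) (e b) + serreHitLast t (P n) (e c) (e b) (e a)) = 0 := by
  set S : Fam Q := fun m => mk (
      serreHitLast t (P (m 0)) (e (m 1)) (e (m 2)) (e (m 3)) +
      serreHitLast t (P (m 0)) (e (m 1)) (e (m 3)) (e (m 2)) +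
      serreHitLast t (P (m 0)) (e (m 2)) (e (m 1)) (e (m 3)) +
      serreHitLast t (P (m 0)) (e (m 2)) (e (m 3)) (e (m 1)) +
      serreHitLast t (P (m 0)) (e (m 3)) (e (m 1)) (e (m 2)) +
      serreHitLast t (P (m 0)) (e (m 3)) (e (m 2)) (e (m 1))) with hS
  suffices H : S = 0 by
    have := congrFun H ![n, a, b, c]
    simpa [hS] using this
  have hu : IsUnit t := IsUnit.of_mul_eq_one _ ht
  refine (hs.oneSided fun m hm => by simp [hS, hm, serreHitLast]).eq_zero_of_three
    hu isUnit_one hu isUnit_one hu isUnit_one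
    (show (1 : Fin 4) ≠ 0 by decide) (show (2 : Fin 4) ≠ 0 by decide)
    (show (3 : Fin 4) ≠ 0 by decide) ?_
  have hc := hP.inv ht
  obtain ⟨V₀, hV₀⟩ : ∃ V : Fin 4 → Fin 4 → Fin 4 → Fam Q, V = fun i j k m =>
    mk (P (m 0) * (e (m i) * (e (m j) * e (m k)))) := ⟨_, rfl⟩
  obtain ⟨V₁, hV₁⟩ : ∃ V : Fin 4 → Fin 4 → Fin 4 → Fam Q, V = fun i j k m =>
    mk (e (m i) * (P (m 0) * (e (m j) * e (m k)))) := ⟨_, rfl⟩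
  obtain ⟨V₂, hV₂⟩ : ∃ V : Fin 4 → Fin 4 → Fin 4 → Fam Q, V = fun i j k m =>
    mk (e (m i) * (e (m j) * (P (m 0) * e (m k)))) := ⟨_, rfl⟩
  obtain ⟨V₃, hV₃⟩ : ∃ V : Fin 4 → Fin 4 → Fin 4 → Fam Q, V = fun i j k m =>
    mk (e (m i) * (e (m j) * (e (m k) * P (m 0)))) := ⟨_, rfl⟩
  obtain ⟨Y, hY⟩ : ∃ Y : Fin 4 → MvPolynomial (Fin 4) R, Y = MvPolynomial.X := ⟨_, rfl⟩
  obtain ⟨T, hT⟩ : ∃ T : MvPolynomial (Fin 4) R, T = MvPolynomial.C t := ⟨_, rfl⟩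
  have ch : ∀ i j k : Fin 4, (i ≠ 0 ∧ j ≠ 0 ∧ k ≠ 0 ∧ i ≠ j ∧ i ≠ k ∧ j ≠ k) →
      ((T * Y 0 - Y i) * (T * Y 0 - Y j) * (T * Y 0 - Y k)) • V₀ i j k =
        ((Y 0 - T * Y i) * (Y 0 - T * Y j) * (Y 0 - T * Y k)) • V₃ i j k ∧
      ((T * Y 0 - Y j) * (T * Y 0 - Y k)) • V₁ i j k =
        ((Y 0 - T * Y j) * (Y 0 - T * Y k)) • V₃ i j k ∧
      (T * Y 0 - Y k) • V₂ i j k = (Y 0 - T * Y k) • V₃ i j k := by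
    rintro i j k ⟨hi, hj, hk, hij, hik, hjk⟩
    have := chain_move mk hi hj hk hij hik hjk hc hc hc
    simp only [linPoly, map_one, one_mul] at this
    rw [hV₀, hV₁, hV₂, hV₃, hY, hT]
    exact this
  have hC : T ^ 2 - 1 = MvPolynomial.C (t ^ 2 - 1) := by rw [hT]; simp
  have sw₁ : ∀ i j k : Fin 4, (i ≠ 0 ∧ j ≠ 0 ∧ i ≠ j ∧ i ≠ k ∧ j ≠ k) →
      (T ^ 2 - 1) • ((Y i - T * Y j) • V₃ i j k + (Y j - T * Y i) • V₃ j i k) = 0 := by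
    rintro i j k ⟨hi, hj, hij, hik, hjk⟩
    funext m
    have := h₁ (m i) (m j) (e (m k) * P (m 0))
    rw [hC, fam_C_smul, Pi.add_apply, sub_smul (Y i), sub_smul (Y j), mul_smul, mul_smul, Pi.sub_apply,
      Pi.sub_apply, hT, fam_C_smul, fam_C_smul, hY, fam_X_smul, fam_X_smul, fam_X_smul, fam_X_smul, hV₃]
    simp only [Pi.add_apply, Pi.single_eq_same, Pi.single_eq_of_ne hij, Pi.single_eq_of_ne hij.symm,
      Pi.single_eq_of_ne hik.symm, Pi.single_eq_of_ne hjk.symm, Pi.single_eq_of_ne hi.symm,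
      Pi.single_eq_of_ne hj.symm, add_zero, ← map_smul, ← map_sub, ← map_add, Pi.zero_apply]
    simp only [← map_smul] at this
    rw [← this]
    congr 2
    simp only [quadRel, sub_mul, smul_mul_assoc, mul_assoc]
    abel
  have sw₂ : ∀ i j k : Fin 4, (j ≠ 0 ∧ k ≠ 0 ∧ i ≠ j ∧ i ≠ k ∧ j ≠ k) →
      (T ^ 2 - 1) • ((Y j - T * Y k) • V₃ i j k + (Y k - T * Y j) • V₃ i k j) = 0 := by
    rintro i j k ⟨hj, hk, hij, hik, hjk⟩
    funext m
    have := h₂ (m j) (m k) (m i) (P (m 0))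
    rw [hC, fam_C_smul, Pi.add_apply, sub_smul (Y j), sub_smul (Y k), mul_smul, mul_smul, Pi.sub_apply,
      Pi.sub_apply, hT, fam_C_smul, fam_C_smul, hY, fam_X_smul, fam_X_smul, fam_X_smul, fam_X_smul, hV₃]
    simp only [Pi.add_apply, Pi.single_eq_same, Pi.single_eq_of_ne hij, Pi.single_eq_of_ne hjk,
      Pi.single_eq_of_ne hik, Pi.single_eq_of_ne hjk.symm, Pi.single_eq_of_ne hk.symm,
      Pi.single_eq_of_ne hj.symm, add_zero, ← map_smul, ← map_sub, ← map_add, Pi.zero_apply]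
    simp only [← map_smul] at this
    rw [← this]
    congr 2
    simp only [quadRel, sub_mul, mul_sub, smul_mul_assoc, mul_smul_comm, mul_assoc]
    abel
  -- `q` is `t [3]_q` for `t = q^{±2}`
  obtain ⟨q, hq⟩ : ∃ q : MvPolynomial (Fin 4) R, q = T ^ 2 + T + 1 := ⟨_, rfl⟩
  have hqC : q = MvPolynomial.C (t ^ 2 + t + 1) := by rw [hq, hT]; simp
  have hS' : S =
      (T • V₀ 1 2 3 - q • V₁ 1 2 3 + q • V₂ 1 2 3 - T • V₃ 1 2 3) +
      (T • V₀ 1 3 2 - q • V₁ 1 3 2 + q • V₂ 1 3 2 - T • V₃ 1 3 2) +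
      (T • V₀ 2 1 3 - q • V₁ 2 1 3 + q • V₂ 2 1 3 - T • V₃ 2 1 3) +
      (T • V₀ 2 3 1 - q • V₁ 2 3 1 + q • V₂ 2 3 1 - T • V₃ 2 3 1) +
      (T • V₀ 3 1 2 - q • V₁ 3 1 2 + q • V₂ 3 1 2 - T • V₃ 3 1 2) +
      (T • V₀ 3 2 1 - q • V₁ 3 2 1 + q • V₂ 3 2 1 - T • V₃ 3 2 1) := by
    funext m
    simp only [Pi.add_apply, Pi.sub_apply]
    rw [hT, hqC]
    simp only [fam_C_smul]
    simp only [hS, hV₀, hV₁, hV₂, hV₃, serreHitLast, map_add, map_sub, map_smul]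
  rw [hS', linPoly, linPoly, linPoly, map_one, one_mul, one_mul, one_mul, ← hT, ← hY]
  linear_combination (norm := (rw [hq]; module))
      T • (ch 1 2 3 (by decide)).1 -
      (q * (T * Y 0 - Y 1)) • (ch 1 2 3 (by decide)).2.1 +
      (q * (T * Y 0 - Y 1) * (T * Y 0 - Y 2)) • (ch 1 2 3 (by decide)).2.2
      + T • (ch 1 3 2 (by decide)).1 -
      (q * (T * Y 0 - Y 1)) • (ch 1 3 2 (by decide)).2.1 +
      (q * (T * Y 0 - Y 1) * (T * Y 0 - Y 3)) • (ch 1 3 2 (by decide)).2.2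
      + T • (ch 2 1 3 (by decide)).1 -
      (q * (T * Y 0 - Y 2)) • (ch 2 1 3 (by decide)).2.1 +
      (q * (T * Y 0 - Y 2) * (T * Y 0 - Y 1)) • (ch 2 1 3 (by decide)).2.2
      + T • (ch 2 3 1 (by decide)).1 -
      (q * (T * Y 0 - Y 2)) • (ch 2 3 1 (by decide)).2.1 +
      (q * (T * Y 0 - Y 2) * (T * Y 0 - Y 3)) • (ch 2 3 1 (by decide)).2.2
      + T • (ch 3 1 2 (by decide)).1 -
      (q * (T * Y 0 - Y 3)) • (ch 3 1 2 (by decide)).2.1 +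
      (q * (T * Y 0 - Y 3) * (T * Y 0 - Y 1)) • (ch 3 1 2 (by decide)).2.2
      + T • (ch 3 2 1 (by decide)).1 -
      (q * (T * Y 0 - Y 3)) • (ch 3 2 1 (by decide)).2.1 +
      (q * (T * Y 0 - Y 3) * (T * Y 0 - Y 2)) • (ch 3 2 1 (by decide)).2.2
      + (T ^ 2 * Y 0 * Y 3 - Y 0 ^ 2) • sw₁ 1 2 3 (by decide)
      + (T ^ 2 * Y 0 * Y 2 - Y 0 ^ 2) • sw₁ 1 3 2 (by decide)
      + (T ^ 2 * Y 0 * Y 1 - Y 0 ^ 2) • sw₁ 2 3 1 (by decide)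
      + (T ^ 2 * Y 0 ^ 2 - Y 0 * Y 3) • sw₂ 3 1 2 (by decide)
      + (T ^ 2 * Y 0 ^ 2 - Y 0 * Y 2) • sw₂ 2 1 3 (by decide)
      + (T ^ 2 * Y 0 ^ 2 - Y 0 * Y 1) • sw₂ 1 2 3 (by decide)

/-- The commutator of the Serre relation with an element which only fails to commute with `e`, the
modes of `P` replacing one of the three factors `e`. The reason is the same as in
`serreHitLast_sum_eq_zero`; besides the quadratic relations of `e`, the relations `[e, (e, f)] =
0` are needed, where `(e, f)` are the quadratic expressions in `e` and `f`. -/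
theorem serreHitFirst_sum_eq_zero {t t' : R} (ht : t * t' = 1) {P e f : ℤ → A}
    (hPe : CurrentRel t P e) (hPf : CurrentRel t' P f) (hs : OneSidedModes P)
    (h₁ : ∀ k l x, (t ^ 2 - 1) • mk (quadRel t e e k l * x) = 0)
    (h₂ : ∀ k l m x, (t ^ 2 - 1) • mk (f m * (quadRel t e e k l * x)) = 0)
    (h₃ : ∀ k l m x, (t ^ 2 - 1) •
      mk ((e k * quadRel t' e f l m - quadRel t' e f l m * e k) * x) = 0) (a b c n : ℤ) :
    mk (serreHitFirst t (P a) (e b) (e c) (f n) + serreHitFirst t (P a) (e c) (e b) (f n)) = 0 := by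
  set S : Fam Q := fun m => mk (
      serreHitFirst t (P (m 0)) (e (m 1)) (e (m 2)) (f (m 3)) +
      serreHitFirst t (P (m 0)) (e (m 2)) (e (m 1)) (f (m 3))) with hS
  suffices H : S = 0 by
    have := congrFun H ![a, b, c, n]
    simpa [hS] using this
  have hu : IsUnit t := IsUnit.of_mul_eq_one _ ht
  refine (hs.oneSided fun m hm => by simp [hS, hm, serreHitFirst]).eq_zero_of_three
    isUnit_one hu isUnit_one hu hu isUnit_one
    (show (1 : Fin 4) ≠ 0 by decide) (show (2 : Fin 4) ≠ 0 by decide)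
    (show (3 : Fin 4) ≠ 0 by decide) ?_
  have hc := hPf.inv ht
  have hc' := currentRel_iff_one.1 hPe
  obtain ⟨g, hg⟩ : ∃ g : Fin 4 → ℤ → A, g = ![e, e, e, f] := ⟨_, rfl⟩
  obtain ⟨α, hα⟩ : ∃ α : Fin 4 → R, α = ![1, 1, 1, t] := ⟨_, rfl⟩
  obtain ⟨β, hβ⟩ : ∃ β : Fin 4 → R, β = ![t, t, t, 1] := ⟨_, rfl⟩
  have hgen : ∀ i k l, α i • (P (k + 1) * g i l) - β i • (P k * g i (l + 1)) =
      β i • (g i l * P (k + 1)) - α i • (g i (l + 1) * P k) := by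
    rw [hg, hα, hβ]
    intro i
    fin_cases i
    exacts [hc', hc', hc', hc]
  obtain ⟨V₀, hV₀⟩ : ∃ V : Fin 4 → Fin 4 → Fin 4 → Fam Q, V = fun i j k m =>
    mk (P (m 0) * (g i (m i) * (g j (m j) * g k (m k)))) := ⟨_, rfl⟩
  obtain ⟨V₁, hV₁⟩ : ∃ V : Fin 4 → Fin 4 → Fin 4 → Fam Q, V = fun i j k m =>
    mk (g i (m i) * (P (m 0) * (g j (m j) * g k (m k)))) := ⟨_, rfl⟩
  obtain ⟨V₂, hV₂⟩ : ∃ V : Fin 4 → Fin 4 → Fin 4 → Fam Q, V = fun i j k m =>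
    mk (g i (m i) * (g j (m j) * (P (m 0) * g k (m k)))) := ⟨_, rfl⟩
  obtain ⟨V₃, hV₃⟩ : ∃ V : Fin 4 → Fin 4 → Fin 4 → Fam Q, V = fun i j k m =>
    mk (g i (m i) * (g j (m j) * (g k (m k) * P (m 0)))) := ⟨_, rfl⟩
  obtain ⟨D, hD⟩ : ∃ D : Fin 4 → MvPolynomial (Fin 4) R, D = fun i => linPoly (α i) (β i) i :=
    ⟨_, rfl⟩
  obtain ⟨N, hN⟩ : ∃ N : Fin 4 → MvPolynomial (Fin 4) R, N = fun i => linPoly (β i) (α i) i :=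
    ⟨_, rfl⟩
  have ch : ∀ i j k : Fin 4, (i ≠ 0 ∧ j ≠ 0 ∧ k ≠ 0 ∧ i ≠ j ∧ i ≠ k ∧ j ≠ k) →
      (D i * D j * D k) • V₀ i j k = (N i * N j * N k) • V₃ i j k ∧
      (D j * D k) • V₁ i j k = (N j * N k) • V₃ i j k ∧
      D k • V₂ i j k = N k • V₃ i j k := by
    rintro i j k ⟨hi, hj, hk, hij, hik, hjk⟩
    rw [hV₀, hV₁, hV₂, hV₃, hD, hN]
    exact chain_move mk hi hj hk hij hik hjk (hgen i) (hgen j) (hgen k)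
  obtain ⟨Y, hY⟩ : ∃ Y : Fin 4 → MvPolynomial (Fin 4) R, Y = MvPolynomial.X := ⟨_, rfl⟩
  obtain ⟨T, hT⟩ : ∃ T : MvPolynomial (Fin 4) R, T = MvPolynomial.C t := ⟨_, rfl⟩
  have hC : T ^ 2 - 1 = MvPolynomial.C (t ^ 2 - 1) := by rw [hT]; simp
  have k₁ : (T ^ 2 - 1) • ((Y 1 - T * Y 2) • V₃ 3 1 2 + (Y 2 - T * Y 1) • V₃ 3 2 1) = 0 := by
    funext m
    have := h₂ (m 1) (m 2) (m 3) (P (m 0))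
    rw [hC, fam_C_smul, Pi.add_apply, sub_smul (Y 1), sub_smul (Y 2), mul_smul, mul_smul,
      Pi.sub_apply, Pi.sub_apply, hT, fam_C_smul, fam_C_smul, hY, fam_X_smul, fam_X_smul,
      fam_X_smul, fam_X_smul, hV₃]
    simp only [← map_smul] at this
    rw [Pi.zero_apply, ← this]
    simp only [← map_smul, ← map_sub, ← map_add]
    congr 2
    simp [quadRel, hg, sub_mul, mul_sub, mul_assoc]
    abel
  have k₂ : (T ^ 2 - 1) • ((Y 1 - T * Y 2) • V₃ 1 2 3 + (Y 2 - T * Y 1) • V₃ 2 1 3) = 0 := by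
    funext m
    have := h₁ (m 1) (m 2) (f (m 3) * P (m 0))
    rw [hC, fam_C_smul, Pi.add_apply, sub_smul (Y 1), sub_smul (Y 2), mul_smul, mul_smul,
      Pi.sub_apply, Pi.sub_apply, hT, fam_C_smul, fam_C_smul, hY, fam_X_smul, fam_X_smul,
      fam_X_smul, fam_X_smul, hV₃]
    simp only [← map_smul] at this
    rw [Pi.zero_apply, ← this]
    simp only [← map_smul, ← map_sub, ← map_add]
    congr 2
    simp [quadRel, hg, sub_mul, mul_assoc]
    abel
  have k₃ : ∀ i j : Fin 4, (i = 1 ∧ j = 2 ∨ i = 2 ∧ j = 1) →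
      (T ^ 2 - 1) • ((T * Y i - Y 3) • V₃ j i 3 - (Y i - T * Y 3) • V₃ j 3 i -
        (T * Y i - Y 3) • V₃ i 3 j + (Y i - T * Y 3) • V₃ 3 i j) = 0 := by
    intro i j hij
    funext m
    have := congrArg (t • ·) (h₃ (m j) (m i) (m 3) (P (m 0)))
    rw [hC, fam_C_smul, Pi.add_apply, Pi.sub_apply, Pi.sub_apply]
    simp only [sub_smul (Y i), sub_smul (T * Y i), mul_smul]
    rw [hT]
    simp only [Pi.sub_apply, fam_C_smul]
    rw [hY]
    simp only [fam_X_smul]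
    rw [hV₃]
    simp only [smul_zero] at this
    rw [smul_comm] at this
    simp only [← map_smul] at this
    rw [Pi.zero_apply, ← this]
    simp only [← map_smul, ← map_sub, ← map_add]
    congr 2
    have ht'' : ∀ x : A, t • t' • x = x := fun x => by rw [smul_smul, ht, one_smul]
    rcases hij with ⟨rfl, rfl⟩ | ⟨rfl, rfl⟩
    all_goals
      simp [quadRel, hg, sub_mul, mul_sub, mul_assoc, smul_sub, ht'']
      abel
  obtain ⟨q, hq⟩ : ∃ q : MvPolynomial (Fin 4) R, q = T ^ 2 + T + 1 := ⟨_, rfl⟩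
  have hqC : q = MvPolynomial.C (t ^ 2 + t + 1) := by rw [hq, hT]; simp
  have hS' : S =
      (T • (V₁ 3 1 2 + V₂ 3 1 2 + V₃ 3 1 2) - q • (V₀ 3 1 2 + V₂ 1 3 2 + V₃ 1 3 2) +
        q • (V₀ 1 3 2 + V₁ 1 3 2 + V₃ 1 2 3) - T • (V₀ 1 2 3 + V₁ 1 2 3 + V₂ 1 2 3)) +
      (T • (V₁ 3 2 1 + V₂ 3 2 1 + V₃ 3 2 1) - q • (V₀ 3 2 1 + V₂ 2 3 1 + V₃ 2 3 1) +
        q • (V₀ 2 3 1 + V₁ 2 3 1 + V₃ 2 1 3) - T • (V₀ 2 1 3 + V₁ 2 1 3 + V₂ 2 1 3)) := by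
    funext m
    simp only [Pi.add_apply, Pi.sub_apply]
    rw [hT, hqC]
    simp only [fam_C_smul, Pi.add_apply]
    simp only [hS, hV₀, hV₁, hV₂, hV₃, serreHitFirst, map_add, map_sub, map_smul]
    simp [hg]
  have hD₁ : D 1 = Y 0 - T * Y 1 := by rw [hD, hY, hT, hα, hβ]; simp [linPoly]
  have hD₂ : D 2 = Y 0 - T * Y 2 := by rw [hD, hY, hT, hα, hβ]; simp [linPoly]
  have hD₃ : D 3 = T * Y 0 - Y 3 := by rw [hD, hY, hT, hα, hβ]; simp [linPoly]
  have hN₁ : N 1 = T * Y 0 - Y 1 := by rw [hN, hY, hT, hα, hβ]; simp [linPoly]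
  have hN₂ : N 2 = T * Y 0 - Y 2 := by rw [hN, hY, hT, hα, hβ]; simp [linPoly]
  have hN₃ : N 3 = Y 0 - T * Y 3 := by rw [hN, hY, hT, hα, hβ]; simp [linPoly]
  rw [hS', linPoly, linPoly, linPoly, map_one, one_mul, one_mul, ← hT, ← hY]
  linear_combination (norm := (rw [hD₁, hD₂, hD₃, hN₁, hN₂, hN₃, hq]; module))
      (T * D 3) • (ch 3 1 2 (by decide)).2.1
      - q • (ch 3 1 2 (by decide)).1
      + (T * D 3 * D 1) • (ch 3 1 2 (by decide)).2.2
      + (q) • (ch 1 3 2 (by decide)).1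
      + (q * D 1) • (ch 1 3 2 (by decide)).2.1
      - (q * D 1 * D 3) • (ch 1 3 2 (by decide)).2.2
      - (T) • (ch 1 2 3 (by decide)).1
      - (T * D 1) • (ch 1 2 3 (by decide)).2.1
      - (T * D 1 * D 2) • (ch 1 2 3 (by decide)).2.2
      - (q) • (ch 3 2 1 (by decide)).1
      + (T * D 3) • (ch 3 2 1 (by decide)).2.1
      + (T * D 3 * D 2) • (ch 3 2 1 (by decide)).2.2
      + (q) • (ch 2 3 1 (by decide)).1
      + (q * D 2) • (ch 2 3 1 (by decide)).2.1
      - (q * D 2 * D 3) • (ch 2 3 1 (by decide)).2.2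
      - (T) • (ch 2 1 3 (by decide)).1
      - (T * D 2) • (ch 2 1 3 (by decide)).2.1
      - (T * D 2 * D 1) • (ch 2 1 3 (by decide)).2.2
      + (Y 0 * (Y 0 - T ^ 2 * Y 3)) • k₁ + (Y 0 * (Y 3 - T ^ 2 * Y 0)) • k₂
      + (q * Y 0 * (Y 2 - Y 0)) • k₃ 1 2 (by decide) + (q * Y 0 * (Y 1 - Y 0)) • k₃ 2 1 (by decide)

end SerreCompat

/-! ### Commutators of the relations (Q8) and (Q9) with an element of the other half -/

section CommutatorIdeal
variable {R A : Type} [CommRing R] [Ring A] [Algebra R A]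
variable {Q : Type} [AddCommGroup Q] [Module R Q] (mk : A →ₗ[R] Q)

/-- A one-sided current commutes with the quadratic expressions `quadRel` in `e` and `f`, as soon
as the products of these expressions with `z - w` vanish. -/
theorem current_quadRel_commute {t t' : R} (ht : t * t' = 1) {P e f : ℤ → A}
    (hPe : CurrentRel t P e) (hPf : CurrentRel t' P f) (hs : OneSidedModes P)
    (h : ∀ k l x, (t ^ 2 - 1) •
      mk ((quadRel t' e f (k + 1) l - quadRel t' e f k (l + 1)) * x) = 0) (a k l : ℤ) :
    mk (P a * quadRel t' e f k l - quadRel t' e f k l * P a) = 0 := by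
  have hu : IsUnit t := IsUnit.of_mul_eq_one _ ht
  have ht'' : ∀ x : A, t • t' • x = x := fun x => by rw [smul_smul, ht, one_smul]
  have hc := hPf.inv ht
  have hc' := currentRel_iff_one.1 hPe
  -- `chain_move` is used with the constant family `1` as a third current
  have h1 : ∀ k l : ℤ, (1 : R) • (P (k + 1) * (fun _ : ℤ => (1 : A)) l) - (1 : R) •
      (P k * (fun _ : ℤ => (1 : A)) (l + 1)) = (1 : R) • ((fun _ : ℤ => (1 : A)) l * P (k + 1)) -
      (1 : R) • ((fun _ : ℤ => (1 : A)) (l + 1) * P k) := by simp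
  obtain ⟨V, hV⟩ : ∃ V : Fam Q, V = fun m => mk (P (m 0) * (e (m 1) * f (m 2))) := ⟨_, rfl⟩
  obtain ⟨V', hV'⟩ : ∃ V : Fam Q, V = fun m => mk (P (m 0) * (f (m 2) * e (m 1))) := ⟨_, rfl⟩
  obtain ⟨W, hW⟩ : ∃ V : Fam Q, V = fun m => mk (e (m 1) * (f (m 2) * P (m 0))) := ⟨_, rfl⟩
  obtain ⟨W', hW'⟩ : ∃ V : Fam Q, V = fun m => mk (f (m 2) * (e (m 1) * P (m 0))) := ⟨_, rfl⟩
  have e₁ := (chain_move mk (show (3 : Fin 4) ≠ 0 by decide) (show (1 : Fin 4) ≠ 0 by decide)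
    (show (2 : Fin 4) ≠ 0 by decide) (by decide) (by decide) (by decide) h1 hc' hc).2.1
  have e₂ := (chain_move mk (show (3 : Fin 4) ≠ 0 by decide) (show (2 : Fin 4) ≠ 0 by decide)
    (show (1 : Fin 4) ≠ 0 by decide) (by decide) (by decide) (by decide) h1 hc hc').2.1
  simp only [one_mul] at e₁ e₂
  rw [← hV, ← hW] at e₁
  rw [← hV', ← hW'] at e₂
  set S : Fam Q := fun m => t • mk (P (m 0) * quadRel t' e f (m 1) (m 2) -
    quadRel t' e f (m 1) (m 2) * P (m 0)) with hS
  suffices H : S = 0 by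
    have := congrArg (t' • ·) (congrFun H ![a, k, l, 0])
    simpa [hS, smul_smul, mul_comm t', ht] using this
  obtain ⟨Y, hY⟩ : ∃ Y : Fin 4 → MvPolynomial (Fin 4) R, Y = MvPolynomial.X := ⟨_, rfl⟩
  obtain ⟨T, hT⟩ : ∃ T : MvPolynomial (Fin 4) R, T = MvPolynomial.C t := ⟨_, rfl⟩
  have hC : T ^ 2 - 1 = MvPolynomial.C (t ^ 2 - 1) := by rw [hT]; simp
  have hs1 : OneSided S := hs.oneSided fun m hm => by simp [hS, hm]
  have hs2 : OneSided (linPoly t 1 2 • S) := hs1.linPoly_smul _ _ (by decide)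
  have hS' : S = (T * Y 1 - Y 2) • (V - W) - (Y 1 - T * Y 2) • (V' - W') := by
    funext m
    simp only [Pi.sub_apply, smul_sub, sub_smul, mul_smul]
    rw [hT]
    simp only [fam_C_smul, hY, fam_X_smul, hV, hV', hW, hW', hS]
    simp only [← map_smul, ← map_sub]
    congr 1
    simp [quadRel, sub_mul, mul_sub, mul_assoc, smul_sub, ht'']
    abel
  have k₁ : (T ^ 2 - 1) • ((Y 1 - Y 2) • ((T * Y 1 - Y 2) • W - (Y 1 - T * Y 2) • W')) = 0 := by
    funext m
    have := congrArg (t • ·) (h (m 1) (m 2) (P (m 0)))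
    rw [hC, fam_C_smul]
    simp only [sub_smul (Y _), sub_smul (T * Y _), mul_smul, smul_sub (Y _)]
    rw [hT]
    simp only [Pi.sub_apply, fam_C_smul, hY, fam_X_smul, hW, hW']
    simp only [smul_zero] at this
    rw [smul_comm] at this
    simp only [← map_smul] at this
    rw [Pi.zero_apply, ← this]
    simp only [← map_smul, ← map_sub]
    congr 2
    simp [quadRel, sub_mul, mul_assoc, smul_sub, ht'']
  have ht1 : t' * t = 1 := by rw [mul_comm, ht]
  refine hs1.eq_zero (a := t) (b := 1) ht1 (one_mul 1) (show (2 : Fin 4) ≠ 0 by decide)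
    (hs2.eq_zero (a := 1) (b := t) (one_mul 1) ht1 (show (1 : Fin 4) ≠ 0 by decide) ?_)
  rw [← mul_smul, hS']
  simp only [linPoly, map_one, one_mul, ← hT, ← hY] at e₁ e₂ ⊢
  linear_combination (norm := module) (T * Y 1 - Y 2) • e₁ - (Y 1 - T * Y 2) • e₂ + Y 0 • k₁

theorem smul_serreHitFirst {t k : R} {d p p' : A} (h : k • d = p - p') (x y f : A) :
    k • serreHitFirst t d x y f = serreHitFirst t p x y f - serreHitFirst t p' x y f := by
  have e1 : ∀ x, k • (d * x) = p * x - p' * x := fun x => by rw [← smul_mul_assoc, h, sub_mul]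
  have e2 : ∀ x z, k • (z * (d * x)) = z * (p * x) - z * (p' * x) := fun x z => by
    rw [← mul_smul_comm, e1, mul_sub]
  have e3 : ∀ x z w, k • (w * (z * (d * x))) = w * (z * (p * x)) - w * (z * (p' * x)) :=
    fun x z w => by rw [← mul_smul_comm, e2, mul_sub]
  have e4 : ∀ z, k • (z * d) = z * p - z * p' := fun z => by rw [← mul_smul_comm, h, mul_sub]
  have e5 : ∀ z w, k • (w * (z * d)) = w * (z * p) - w * (z * p') := fun z w => by
    rw [← mul_smul_comm, e4, mul_sub]
  have e6 : ∀ z w u, k • (u * (w * (z * d))) = u * (w * (z * p)) - u * (w * (z * p')) :=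
    fun z w u => by rw [← mul_smul_comm, e5, mul_sub]
  simp only [serreHitFirst, smul_add, smul_sub, smul_comm k, e1, e2, e3, e6]
  abel

theorem smul_serreHitLast {t k : R} {d p p' : A} (h : k • d = p - p') (x y f : A) :
    k • serreHitLast t d x y f = serreHitLast t p x y f - serreHitLast t p' x y f := by
  have e1 : ∀ x, k • (d * x) = p * x - p' * x := fun x => by rw [← smul_mul_assoc, h, sub_mul]
  have e2 : ∀ x z, k • (z * (d * x)) = z * (p * x) - z * (p' * x) := fun x z => by
    rw [← mul_smul_comm, e1, mul_sub]
  have e3 : ∀ x z w, k • (w * (z * (d * x))) = w * (z * (p * x)) - w * (z * (p' * x)) :=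
    fun x z w => by rw [← mul_smul_comm, e2, mul_sub]
  have e4 : ∀ z, k • (z * d) = z * p - z * p' := fun z => by rw [← mul_smul_comm, h, mul_sub]
  have e5 : ∀ z w, k • (w * (z * d)) = w * (z * p) - w * (z * p') := fun z w => by
    rw [← mul_smul_comm, e4, mul_sub]
  have e6 : ∀ z w u, k • (u * (w * (z * d))) = u * (w * (z * p)) - u * (w * (z * p')) :=
    fun z w u => by rw [← mul_smul_comm, e5, mul_sub]
  simp only [serreHitLast, smul_add, smul_sub, smul_comm k, e1, e2, e3, e6]
  abel

variable {T : Submodule R A} {k : R}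

/-- Relations are considered modulo `k T`, in order that they can be divided by `k` afterwards;
the elements of `T` themselves only vanish after multiplication by multiples of `k`. -/
theorem smul_mk_eq_zero_of_dvd {v r : R} (hv : r = k * v) {x : A} (hx : x ∈ T) :
    r • (T.map (LinearMap.lsmul R A k)).mkQ x = 0 := by
  rw [← map_smul, Submodule.mkQ_apply, Submodule.Quotient.mk_eq_zero, hv, mul_smul]
  exact ⟨v • x, T.smul_mem _ hx, rfl⟩

theorem mem_of_smul_mk_eq_zero (hk : ∀ a b : A, k • a = k • b → a = b) {x : A}
    (hx : (T.map (LinearMap.lsmul R A k)).mkQ (k • x) = 0) : x ∈ T := by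
  rw [Submodule.mkQ_apply, Submodule.Quotient.mk_eq_zero] at hx
  obtain ⟨s, hs, h⟩ := hx
  rwa [← hk _ _ h]

variable {t t' v : R} {e f D P P' : ℤ → A} {y : A}

/-- The relation (Q8): its commutator with `y` is a consequence of (Q7), if `y` commutes with `f`.
-/
theorem quad_commutator_mem (ht : t * t' = 1) (hv : t ^ 2 - 1 = k * v)
    (hk : ∀ a b : A, k • a = k • b → a = b) (hT : ∀ a ∈ T, ∀ b, a * b ∈ T)
    (hD : ∀ m, k • D m = P m - P' m) (hy : ∀ m, e m * y - y * e m = D m)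
    (hf : ∀ m, f m * y = y * f m) (hPe : CurrentRel t P e) (hPf : CurrentRel t' P f)
    (hP'e : CurrentRel t P' e) (hP'f : CurrentRel t' P' f) (hs : OneSidedModes P)
    (hs' : OneSidedModes P')
    (h : ∀ m n, quadRel t' e f (m + 1) n - quadRel t' e f m (n + 1) ∈ T) (l m n : ℤ) :
    (e l * quadRel t' e f m n - quadRel t' e f m n * e l) * y -
      y * (e l * quadRel t' e f m n - quadRel t' e f m n * e l) ∈ T := by
  have hq := quadRel_commute_left hy hf (hPf.of_smul hk hD hP'f) m n
  set q := quadRel t' e f m n with hqd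
  have e1 : (e l * q - q * e l) * y - y * (e l * q - q * e l) = D l * q - q * D l := by
    rw [← hy]
    simp only [sub_mul, mul_sub, mul_assoc, hq]
    simp only [← mul_assoc, hq]
    abel
  rw [e1]
  apply mem_of_smul_mk_eq_zero hk
  have e2 : k • (D l * q - q * D l) = (P l * q - q * P l) - (P' l * q - q * P' l) := by
    rw [smul_sub, ← smul_mul_assoc, ← mul_smul_comm, hD]
    noncomm_ring
  rw [e2, map_sub, hqd, current_quadRel_commute _ ht hPe hPf hs, current_quadRel_commute _ ht hP'e hP'f hs', sub_zero]
  all_goals exact fun k' l x => smul_mk_eq_zero_of_dvd hv (hT _ (h _ _) _)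

/-- The relation (Q9): its commutator with `y` is a consequence of (Q6), if `y` commutes with `e`.
-/
theorem serre_commutator_mem_of_last (ht : t * t' = 1) (hv : t ^ 2 - 1 = k * v)
    {s : R} (hst : t * s = t ^ 2 + t + 1)
    (hk : ∀ a b : A, k • a = k • b → a = b) (hT : ∀ a ∈ T, ∀ b, a * b ∈ T)
    (hTe : ∀ a ∈ T, ∀ m, e m * a ∈ T)
    (hD : ∀ m, k • D m = P m - P' m) (hy : ∀ m, f m * y - y * f m = D m)
    (he : ∀ m, e m * y = y * e m) (hPe : CurrentRel t' P e)
    (hP'e : CurrentRel t' P' e) (hs : OneSidedModes P)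
    (hs' : OneSidedModes P')
    (h : ∀ m n, quadRel t e e m n ∈ T) (a b c n : ℤ) :
    serreRel s e f a b c n * y - y * serreRel s e f a b c n ∈ T := by
  have e1 : t • (serreRel s e f a b c n * y - y * serreRel s e f a b c n) =
      serreHitLast t (D n) (e a) (e b) (e c) + serreHitLast t (D n) (e a) (e c) (e b) +
      serreHitLast t (D n) (e b) (e a) (e c) + serreHitLast t (D n) (e b) (e c) (e a) +
      serreHitLast t (D n) (e c) (e a) (e b) + serreHitLast t (D n) (e c) (e b) (e a) := by
    have hy1 : f n * y = y * f n + D n := by rw [← hy]; abel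
    have hy2 : ∀ x, f n * (y * x) = y * (f n * x) + D n * x := fun x => by
      rw [← mul_assoc, hy1, add_mul, mul_assoc]
    have he2 : ∀ m x, e m * (y * x) = y * (e m * x) := fun m x => by
      rw [← mul_assoc, he, mul_assoc]
    simp only [serreRel, serreHitLast, ← hst, add_mul, sub_mul, mul_add, mul_sub, mul_assoc, he, hy1, hy2, he2,
      smul_mul_assoc, mul_smul_comm, smul_add, smul_sub, mul_smul]
    abel
  have e2 : t • (serreRel s e f a b c n * y - y * serreRel s e f a b c n) ∈ T := by
    rw [e1]
    apply mem_of_smul_mk_eq_zero hk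
    simp only [smul_add, smul_serreHitLast (hD n)]
    have h1 := serreHitLast_sum_eq_zero (T.map (LinearMap.lsmul R A k)).mkQ ht hPe hs
      (fun _ _ x => smul_mk_eq_zero_of_dvd hv (hT _ (h _ _) x))
      (fun _ _ m x => smul_mk_eq_zero_of_dvd hv (hTe _ (hT _ (h _ _) x) m)) a b c n
    have h2 := serreHitLast_sum_eq_zero (T.map (LinearMap.lsmul R A k)).mkQ ht hP'e hs'
      (fun _ _ x => smul_mk_eq_zero_of_dvd hv (hT _ (h _ _) x))
      (fun _ _ m x => smul_mk_eq_zero_of_dvd hv (hTe _ (hT _ (h _ _) x) m)) a b c n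
    have h3 := congrArg₂ (· - ·) h1 h2
    simp only [← map_sub, sub_zero] at h3
    rw [← h3]
    congr 1
    abel
  have := T.smul_mem t' e2
  rwa [smul_smul, mul_comm, ht, one_smul] at this

/-- The relation (Q9): its commutator with `y` is a consequence of (Q6) and (Q8), if `y` commutes
with `f`. -/
theorem serre_commutator_mem_of_first (ht : t * t' = 1) (hv : t ^ 2 - 1 = k * v)
    {s : R} (hst : t * s = t ^ 2 + t + 1)
    (hk : ∀ a b : A, k • a = k • b → a = b) (hT : ∀ a ∈ T, ∀ b, a * b ∈ T)
    (hTf : ∀ a ∈ T, ∀ m, f m * a ∈ T)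
    (hD : ∀ m, k • D m = P m - P' m) (hy : ∀ m, e m * y - y * e m = D m)
    (hf : ∀ m, f m * y = y * f m) (hPe : CurrentRel t P e) (hPf : CurrentRel t' P f)
    (hP'e : CurrentRel t P' e) (hP'f : CurrentRel t' P' f) (hs : OneSidedModes P)
    (hs' : OneSidedModes P')
    (h : ∀ m n, quadRel t e e m n ∈ T)
    (h' : ∀ l m n, e l * quadRel t' e f m n - quadRel t' e f m n * e l ∈ T) (a b c n : ℤ) :
    serreRel s e f a b c n * y - y * serreRel s e f a b c n ∈ T := by
  have e1 : t • (serreRel s e f a b c n * y - y * serreRel s e f a b c n) =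
      (serreHitFirst t (D a) (e b) (e c) (f n) + serreHitFirst t (D a) (e c) (e b) (f n)) +
      (serreHitFirst t (D b) (e a) (e c) (f n) + serreHitFirst t (D b) (e c) (e a) (f n)) +
      (serreHitFirst t (D c) (e a) (e b) (f n) + serreHitFirst t (D c) (e b) (e a) (f n)) := by
    have hy1 : ∀ m, e m * y = y * e m + D m := fun m => by rw [← hy]; abel
    have hy2 : ∀ m x, e m * (y * x) = y * (e m * x) + D m * x := fun m x => by
      rw [← mul_assoc, hy1, add_mul, mul_assoc]
    have he2 : ∀ m x, f m * (y * x) = y * (f m * x) := fun m x => by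
      rw [← mul_assoc, hf, mul_assoc]
    simp only [serreRel, serreHitFirst, ← hst, add_mul, sub_mul, mul_add, mul_sub, mul_assoc, hf, hy1, hy2, he2,
      smul_mul_assoc, mul_smul_comm, smul_add, smul_sub, mul_smul]
    abel
  have hit : ∀ a b c, serreHitFirst t (D a) (e b) (e c) (f n) +
      serreHitFirst t (D a) (e c) (e b) (f n) ∈ T := by
    intro a b c
    apply mem_of_smul_mk_eq_zero hk
    simp only [smul_add, smul_serreHitFirst (hD a)]
    have h1 := serreHitFirst_sum_eq_zero (T.map (LinearMap.lsmul R A k)).mkQ ht hPe hPf hs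
      (fun _ _ x => smul_mk_eq_zero_of_dvd hv (hT _ (h _ _) x))
      (fun _ _ m x => smul_mk_eq_zero_of_dvd hv (hTf _ (hT _ (h _ _) x) m))
      (fun _ _ _ x => smul_mk_eq_zero_of_dvd hv (hT _ (h' _ _ _) x)) a b c n
    have h2 := serreHitFirst_sum_eq_zero (T.map (LinearMap.lsmul R A k)).mkQ ht hP'e hP'f hs'
      (fun _ _ x => smul_mk_eq_zero_of_dvd hv (hT _ (h _ _) x))
      (fun _ _ m x => smul_mk_eq_zero_of_dvd hv (hTf _ (hT _ (h _ _) x) m))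
      (fun _ _ _ x => smul_mk_eq_zero_of_dvd hv (hT _ (h' _ _ _) x)) a b c n
    have h3 := congrArg₂ (· - ·) h1 h2
    simp only [← map_sub, sub_zero] at h3
    rw [← h3]
    congr 1
    abel
  have e2 : t • (serreRel s e f a b c n * y - y * serreRel s e f a b c n) ∈ T := by
    rw [e1]
    exact T.add_mem (T.add_mem (hit _ _ _) (hit _ _ _)) (hit _ _ _)
  have := T.smul_mem t' e2
  rwa [smul_smul, mul_comm, ht, one_smul] at this

end CommutatorIdeal

/-! ### Derivations and exponentials -/

section Deriv
variable {R : Type} [Ring R] [Algebra ℂ R]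

/-- A derivation of `R⟦u⟧` which acts on each coefficient separately sends `exp f` to
`f' exp f`. -/
theorem derivation_formalExp {δ : R⟦X⟧ →+ R⟦X⟧} {d : ℕ → R →ₗ[ℂ] R}
    (hd : ∀ m f, coeff m (δ f) = d m (coeff m f)) (hmul : ∀ f g, δ (f * g) = δ f * g + f * δ g)
    {f : R⟦X⟧} (h : constantCoeff f = 0) (hc : Commute f (δ f)) :
    δ (formalExp f) = δ f * formalExp f := by
  have h1 : δ 1 = 0 := by simpa using hmul 1 1
  have hpow : ∀ k, δ (f ^ (k + 1)) = (k + 1) • (δ f * f ^ k) := by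
    intro k
    induction k with
    | zero => simp
    | succ k ih =>
      rw [pow_succ, hmul, ih, smul_mul_assoc, mul_assoc, ← pow_succ, (hc.pow_left (k+1)).eq,
        ← succ_nsmul]
  ext m
  rw [hd, coeff_formalExp h (show m < m + 1 + 1 by omega), map_sum, Finset.sum_range_succ',
    coeff_mul]
  have h1' : ∀ p ∈ antidiagonal m, coeff p.1 (δ f) * coeff p.2 (formalExp f) =
      ∑ k ∈ range (m + 1), coeff p.1 (δ f) * (((k ! : ℂ)⁻¹) • coeff p.2 (f ^ k)) := by
    intro p hp
    have := mem_antidiagonal.1 hp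
    rw [coeff_formalExp h (show p.2 < m + 1 by omega), Finset.mul_sum]
  rw [Finset.sum_congr rfl h1', Finset.sum_comm]
  simp only [map_smul, ← hd]
  rw [pow_zero, h1, map_zero, smul_zero, add_zero]
  refine Finset.sum_congr rfl fun k _ => ?_
  rw [hpow, ← Nat.cast_smul_eq_nsmul ℂ,
    show coeff m (((k + 1 : ℕ) : ℂ) • (δ f * f ^ k)) =
      ((k + 1 : ℕ) : ℂ) • coeff m (δ f * f ^ k) from rfl,
    smul_smul, coeff_mul, Finset.smul_sum]
  refine Finset.sum_congr rfl fun p _ => ?_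
  rw [mul_smul_comm]
  congr 1
  rw [Nat.factorial_succ]
  push_cast
  have : (k : ℂ) + 1 ≠ 0 := by exact_mod_cast Nat.succ_ne_zero k
  have h2 : (k ! : ℂ) ≠ 0 := by exact_mod_cast Nat.factorial_ne_zero _
  field_simp

theorem commute_formalExp {z : R} {f : R⟦X⟧} (h : ∀ n, Commute z (coeff n f)) (m : ℕ) :
    Commute z (coeff m (formalExp f)) := by
  rw [formalExp, coeff_mk]
  refine Commute.sum_right _ _ _ fun k _ => Commute.smul_right ?_ _
  have := (commute_C_iff.2 h).pow_right k
  exact commute_C_iff.1 this m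

/-- If `[z, f] = g` commutes with `f`, then `[z, exp f] = g exp f`; coefficientwise in the
variable of the series. -/
theorem commutator_formalExp {z : R} {f : R⟦X⟧} {g : R⟦X⟧} (h : constantCoeff f = 0)
    (hz : ∀ n, z * coeff n f - coeff n f * z = coeff n g) (hc : Commute f g) (m : ℕ) :
    z * coeff m (formalExp f) - coeff m (formalExp f) * z = coeff m (g * formalExp f) := by
  let δ : R⟦X⟧ →+ R⟦X⟧ :=
    AddMonoidHom.mulLeft (PowerSeries.C z) - AddMonoidHom.mulRight (PowerSeries.C z)
  have hδ : ∀ m f, coeff m (δ f) =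
      (LinearMap.mulLeft ℂ z - LinearMap.mulRight ℂ z) (coeff m f) := fun m f => by
    simp [δ, coeff_C_mul, coeff_mul_C]
  have hfg : δ f = g := by
    ext n
    rw [hδ]
    exact hz n
  have := derivation_formalExp (δ := δ) hδ
    (fun f g => by simp [δ, sub_mul, mul_sub, mul_assoc]) h (hfg ▸ hc)
  have := congrArg (coeff m) this
  rw [hδ, hfg] at this
  exact this

end Deriv

/-! ### Continuous extensions and the modes of `φ_i^±(z)` -/

section Mode
variable {B K : Type} [Ring B] [Algebra ℂ B] [Ring K] [Algebra ℂ K]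

/-- The `ħ`-adically continuous extension of an algebra homomorphism, as an algebra
homomorphism. -/
def liftTopAlg (f : B →ₐ[ℂ] K⟦X⟧) : B⟦X⟧ →ₐ[ℂ] K⟦X⟧ where
  __ := liftTop (f : B →+* K⟦X⟧)
  commutes' a := by
    have := liftTop_C (f : B →+* K⟦X⟧) (algebraMap ℂ B a)
    have h2 := this.trans (f.commutes a)
    rw [← h2]
    simp [PowerSeries.algebraMap_apply]

theorem liftTopAlg_C (f : B →ₐ[ℂ] K⟦X⟧) (b : B) : liftTopAlg f (PowerSeries.C b) = f b :=
  liftTop_C _ _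

theorem liftTopAlg_X (f : B →ₐ[ℂ] K⟦X⟧) : liftTopAlg f X = X := liftTop_X _

theorem liftTopAlg_scalar (f : B →ₐ[ℂ] K⟦X⟧) (s : Base) :
    liftTopAlg f (scalar s) = scalar s := liftTop_scalar f s

theorem coeff_liftTopAlg (f : B →ₐ[ℂ] K⟦X⟧) (g : B⟦X⟧) (n : ℕ) : coeff n (liftTopAlg f g) =
    ∑ p ∈ antidiagonal n, coeff p.2 (f (coeff p.1 g)) := by
  change coeff n (liftTopAux (f : B →+* K⟦X⟧).toAddMonoidHom g) = _
  rw [liftTopAux]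
  simp

theorem liftTopAlg_qExp (f : B →ₐ[ℂ] K⟦X⟧) {b : B} {b' : K} (h : f b = PowerSeries.C b') (s : ℂ) :
    liftTopAlg f (qExp s b) = qExp s b' := by
  ext n
  have hp : ∀ i, f (coeff i (qExp s b)) = PowerSeries.C (coeff i (qExp s b')) := fun i => by
    simp only [qExp, coeff_mk, map_smul, map_pow, h]
    rw [← map_pow]
    ext k
    rw [coeff_smul, coeff_C, coeff_C]
    split_ifs <;> simp
  rw [coeff_liftTopAlg, Finset.sum_eq_single (n, 0)]
  · rw [hp, coeff_C, if_pos rfl]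
  · rintro ⟨i, j⟩ hp' hne
    have hj : j ≠ 0 := by
      rintro rfl
      simp at hp'
      simp [hp'] at hne
    rw [hp, coeff_C, if_neg hj]
  · simp

variable (c : K) (b : Fin 2 → K) (H : Fin 2 → ℤ → K⟦X⟧)

/-- The series `± (q - q⁻¹) ∑_{±n > 0} H_{i,n} z^{-n}` in `z^{∓1}`, for arbitrary elements
`H_{i,n}` of `K⟦ħ⟧`. -/
def phiOpExponent (σ : ℤˣ) (i : Fin 2) : (K⟦X⟧)⟦X⟧ :=
  PowerSeries.mk fun n => if n = 0 then 0 else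
    scalar (((σ : ℤ) : Base) * (qPow 1 - qPow (-1))) * H i ((σ : ℤ) * (n : ℤ))

/-- The modes of `φ_i^±(z)` for arbitrary elements `H_{i,n}` of `K⟦ħ⟧` in place of the `h_{i,n}`,
where `H_{i,0}` is the constant `b i`. -/
def phiOp (σ : ℤˣ) (i : Fin 2) (m : ℕ) : K⟦X⟧ :=
  qExp ((σ : ℤ) : ℂ) (b i) * coeff m (formalExp (phiOpExponent H σ i))

/-- The coefficient of `z^{-k}` in `φ_i^±(z)`, for `k : ℤ`; see `phiOp`. -/
def phiOpMode (σ : ℤˣ) (i : Fin 2) (k : ℤ) : K⟦X⟧ :=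
  if 0 ≤ (σ : ℤ) * k then phiOp b H σ i k.natAbs else 0

variable {c b H}

theorem liftTopAlg_phi (f : B →ₐ[ℂ] K⟦X⟧) {h : Fin 2 → ℤ → B} (hH : ∀ i n, f (h i n) = H i n)
    (hb : ∀ i, H i 0 = PowerSeries.C (b i)) (σ : ℤˣ) (i : Fin 2) (m : ℕ) :
    liftTopAlg f (phi h σ i m) = phiOp b H σ i m := by
  rw [phi, phiOp, map_mul, liftTopAlg_qExp f ((hH i 0).trans (hb i)), map_coeff_formalExp]
  congr 3
  ext1 n
  rw [coeff_map, phiExponent, phiOpExponent, coeff_mk, coeff_mk]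
  split_ifs with hn
  · exact map_zero _
  · change liftTopAlg f _ = _
    rw [map_mul, liftTopAlg_scalar, liftTopAlg_C, hH]

theorem liftTopAlg_phiMode (f : B →ₐ[ℂ] K⟦X⟧) {h : Fin 2 → ℤ → B} (hH : ∀ i n, f (h i n) = H i n)
    (hb : ∀ i, H i 0 = PowerSeries.C (b i)) (σ : ℤˣ) (i : Fin 2) (k : ℤ) :
    liftTopAlg f (phiMode h σ i k) = phiOpMode b H σ i k := by
  rw [phiMode, phiOpMode]
  split_ifs
  · exact liftTopAlg_phi f hH hb σ i _
  · exact map_zero _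

theorem liftTopAlg_twist (f : B →ₐ[ℂ] K⟦X⟧) {c' : B} (hc : f c' = PowerSeries.C c)
    (G : Base⟦X⟧) (s : ℂ) (k : ℕ) : liftTopAlg f (twist c' G s k) = twist c G s k := by
  rw [twist, twist, map_mul, liftTopAlg_scalar, liftTopAlg_qExp f hc]

theorem liftTopAlg_twistPair (f : B →ₐ[ℂ] K⟦X⟧) {c' : B} (hc : f c' = PowerSeries.C c)
    (i j : Fin 2) (k : ℕ) : liftTopAlg f (twistPair c' i j k) = twistPair c i j k := by
  simp only [twistPair, map_sum, map_mul, liftTopAlg_twist f hc]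

end Mode

/-! ### The series `g_{ij}` -/

/-- The series `g(z) = (q^a - z) / (1 - q^a z)`. -/
def gSeries (a : ℤ) : Base⟦X⟧ := gNum a * invOfUnit (gDen a) 1

theorem gDen_mul_gSeries (a : ℤ) : gDen a * gSeries a = gNum a := by
  rw [gSeries, mul_left_comm, mul_invOfUnit _ _ (by simp [gDen]), mul_one]

theorem gSeries_coeff_zero (a : ℤ) : coeff 0 (gSeries a) = qPow a := by
  have := congrArg (coeff 0) (gDen_mul_gSeries a)
  simpa [gDen, gNum] using this

theorem gSeries_coeff_succ (a : ℤ) (k : ℕ) : coeff (k + 1) (gSeries a) =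
    qPow a * coeff k (gSeries a) - if k = 0 then 1 else 0 := by
  have := congrArg (coeff (k + 1)) (gDen_mul_gSeries a)
  rw [gDen, gNum, sub_mul, one_mul, mul_assoc, map_sub, coeff_C_mul, coeff_succ_X_mul, map_sub,
    coeff_C, coeff_X] at this
  simp at this
  rw [sub_eq_iff_eq_add] at this
  rw [this]
  ring

theorem gSeries_unique {a : ℤ} {f : Base⟦X⟧} (h : gDen a * f = gNum a) : f = gSeries a := by
  have h1 := mul_invOfUnit (gDen a) 1 (by simp [gDen])
  rw [gSeries, ← h, mul_comm, ← mul_assoc, mul_comm (invOfUnit _ _), h1, one_mul]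

theorem gUnit_eq (i j : Fin 2) : (gUnit i j).val = gSeries (cartan i j) := rfl

/-- `g_{ij}⁻¹` is the series `g` for `-a_{ij}`, so that all signs are treated at once. -/
theorem gUnit_inv_eq (i j : Fin 2) : (gUnit i j)⁻¹.val = gSeries (-cartan i j) := by
  apply gSeries_unique
  set a := cartan i j
  have e : qPow (-a : ℂ) * qPow a = 1 := by rw [qPow_mul, neg_add_cancel, qPow_zero]
  have hC : (PowerSeries.C (qPow (-a : ℂ)) : Base⟦X⟧) * PowerSeries.C (qPow a) = 1 := by
    rw [← map_mul, e, map_one]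
  have h2 : gDen (-a) = PowerSeries.C (qPow (-a : ℂ)) * gNum a := by
    rw [gDen, gNum]; push_cast; linear_combination -hC
  have h3 : gNum (-a) = PowerSeries.C (qPow (-a : ℂ)) * gDen a := by
    rw [gDen, gNum]; push_cast; linear_combination X * hC
  have h4 : gNum a * (gUnit i j)⁻¹.val = gDen a := by
    change gNum a * (gDen a * invOfUnit (gNum a) (qPowUnit a)) = _
    rw [mul_left_comm, mul_invOfUnit _ _ (by simp [gNum, qPowUnit]), mul_one]
  rw [h2, h3, mul_assoc, h4]

theorem gUnit_zpow_eq (i j : Fin 2) (ε : ℤˣ) :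
    (gUnit i j ^ (ε : ℤ) : (Base⟦X⟧)ˣ).val = gSeries (ε * cartan i j) := by
  rcases Int.units_eq_one_or ε with rfl | rfl
  · simp [gUnit_eq]
  · simp [gUnit_inv_eq]

theorem cartan_symm (i j : Fin 2) : cartan i j = cartan j i := by
  simp [cartan, eq_comm]

/-- The series `∑_{l > 0} (q^{la} - q^{-la}) u^l`, the logarithmic derivative of `g`. -/
def gLog (a : ℤ) : Base⟦X⟧ := PowerSeries.mk fun l => qPow (l * a) - qPow (-(l * a))

theorem gDen_mul_geom (a : ℤ) : gDen a * PowerSeries.mk (fun l : ℕ => qPow (l * a)) = 1 := by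
  ext1 n
  rw [gDen, sub_mul, one_mul, mul_assoc, map_sub, coeff_C_mul]
  cases n with
  | zero => simp [qPow_zero]
  | succ n =>
    rw [coeff_succ_X_mul, coeff_mk, coeff_mk, qPow_mul, coeff_one, if_neg n.succ_ne_zero,
      sub_eq_zero]
    congr 1
    push_cast; ring

/-- The logarithmic derivative of `g`. -/
theorem eulerD_gSeries (a : ℤ) : eulerD (gSeries a) = gLog a * gSeries a := by
  have hC : (PowerSeries.C (qPow (-a : ℂ)) : Base⟦X⟧) * PowerSeries.C (qPow a) = 1 := by
    rw [← map_mul, qPow_mul, neg_add_cancel, qPow_zero, map_one]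
  have h1 := gDen_mul_gSeries a
  have h2 := congrArg eulerD h1
  have eX : eulerD (X : Base⟦X⟧) = X := by
    ext1 n
    rw [coeff_eulerD, coeff_X]
    split_ifs with h <;> simp [h]
  have eC : ∀ s : Base, eulerD (PowerSeries.C s) = 0 := fun s => by
    ext1 n
    rw [coeff_eulerD, coeff_C]
    split_ifs with h <;> simp [h]
  have e1 : eulerD (gDen a) = - (PowerSeries.C (qPow a) * X) := by
    rw [gDen, map_sub, eulerD_one, eulerD_mul, eC, eX]; ring
  have e2 : eulerD (gNum a) = - X := by
    rw [gNum, map_sub, eC, eX]; ring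
  rw [eulerD_mul, e1, e2] at h2
  have g1 := gDen_mul_geom a
  have g2 := gDen_mul_geom (-a)
  have hL : gLog a = PowerSeries.mk (fun l : ℕ => qPow (l * a)) -
      PowerSeries.mk (fun l : ℕ => qPow (l * (-a : ℤ))) := by
    ext1 n
    simp [gLog]
  have g3 : gDen (-a) = PowerSeries.C (qPow (-a : ℂ)) * gNum a := by
    rw [gDen, gNum]; push_cast; linear_combination -hC
  set p := PowerSeries.mk (fun l : ℕ => qPow (l * a))
  set p' := PowerSeries.mk (fun l : ℕ => qPow (l * (-a : ℤ)))
  have hu : ∀ {f g : Base⟦X⟧}, gDen a * f = gDen a * g → f = g := fun {f g} h => by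
    have := congrArg (p * ·) h
    simpa only [← mul_assoc, mul_comm p (gDen a), g1, one_mul] using this
  apply hu
  apply hu
  rw [hL]
  have k1 : gNum a = PowerSeries.C (qPow a) - X := rfl
  have k2 : gDen a = 1 - PowerSeries.C (qPow a) * X := rfl
  set t : Base⟦X⟧ := PowerSeries.C (qPow a)
  set t' : Base⟦X⟧ := PowerSeries.C (qPow (-a : ℂ))
  have k3 : gNum a = t * gDen (-a) := by rw [g3]; linear_combination -gNum a * hC
  have k4 : t * gDen (-a) = t - X := by rw [← k3, k1]
  have g5 : gNum a * p' = t := by rw [k3, mul_assoc, g2, mul_one]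
  have l1 : gDen a * (gDen a * eulerD (gSeries a)) = X * (t ^ 2 - 1) := by
    linear_combination gDen a * h2 + t * X * h1 + t * X * k1 - X * k2
  have l2 : gDen a * (gDen a * ((p - p') * gSeries a)) = gNum a - t * gDen a := by
    linear_combination gDen a * (p - p') * h1 + gNum a * g1 - gDen a * g5
  rw [l1, l2, k1, k2]
  ring

/-! ### The commutation relations of the Cartan currents -/

theorem commute_of_coeff {R : Type} [Ring R] {f g : R⟦X⟧}
    (h : ∀ m n, Commute (coeff m f) (coeff n g)) : Commute f g := by
  ext n
  rw [coeff_mul, coeff_mul, ← Finset.Nat.sum_antidiagonal_swap]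
  exact Finset.sum_congr rfl fun p _ => h _ _

/-- The number `[l a]_q / l`, with value `a` for `l = 0`. -/
def nu (a l : ℤ) : Base := if l = 0 then PowerSeries.C (a : ℂ) else
  PowerSeries.C ((l : ℂ)⁻¹) *
    (qDiff⁻¹ * PowerSeries.mk fun n => coeff (n + 1) (qPow (l * a) - qPow (-(l * a))))

theorem qd_mul_nu (a l : ℤ) : (l : Base) * ((qPow 1 - qPow (-1)) * nu a l) =
    qPow (l * a) - qPow (-(l * a)) := by
  rw [nu]
  split_ifs with h
  · simp [h]
  · have h1 : X * PowerSeries.mk (fun n => coeff (n + 1) (qPow (l * a) - qPow (-(l * a)))) =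
        qPow (l * a) - qPow (-(l * a)) := by
      ext n
      cases n with
      | zero => simp [constantCoeff_qPow]
      | succ n => rw [coeff_succ_X_mul, coeff_mk]
    have h2 : (l : Base) * PowerSeries.C ((l : ℂ)⁻¹) = 1 := by
      rw [← map_intCast (PowerSeries.C (R := ℂ)), ← map_mul, mul_inv_cancel₀ (by exact_mod_cast h),
        map_one]
    rw [← X_mul_qDiff]
    conv_rhs => rw [← h1]
    linear_combination (X * PowerSeries.mk (fun n => coeff (n + 1)
      (qPow (l * a) - qPow (-(l * a))))) * (h2 * qDiff * qDiff⁻¹ + qDiff_mul_inv)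

theorem nu_neg_left (a l : ℤ) : nu (-a) l = -nu a l := by
  rw [nu, nu]
  split_ifs
  · simp
  · rw [← mul_neg, ← mul_neg]
    congr 1
    rw [← mul_neg]
    congr 1
    ext1 n
    simp only [coeff_mk, map_neg, map_sub, neg_sub, Int.cast_neg, mul_neg, neg_neg]

theorem nu_neg_right (a l : ℤ) : nu a (-l) = nu a l := by
  rw [nu, nu]
  by_cases h : l = 0
  · simp [h]
  · rw [if_neg h, if_neg (by omega)]
    push_cast
    rw [inv_neg, map_neg, neg_mul, ← mul_neg, ← mul_neg]
    congr 2
    ext1 n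
    simp only [coeff_mk, map_neg, map_sub, neg_sub, neg_mul, neg_neg]

theorem nu_zero_right (a : ℤ) : nu a 0 = PowerSeries.C (a : ℂ) := by simp [nu]

theorem nu_units_mul (σ : ℤˣ) (a l : ℤ) : nu (σ * a) l = ((σ : ℤ) : Base) * nu a l := by
  rcases Int.units_eq_one_or σ with rfl | rfl
  · simp
  · simp [nu_neg_left]

theorem nu_units_mul_right (σ : ℤˣ) (a l : ℤ) : nu a (σ * l) = nu a l := by
  rcases Int.units_eq_one_or σ with rfl | rfl
  · simp
  · simp [nu_neg_right]

section Action
variable {K : Type} [Ring K] [Algebra ℂ K]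

/-- The coefficient `κ` in `[h_{i,m}, x^ε_{j,n}] = κ x^ε_{j,m+n}`, for `a = ε a_{ij}`. -/
def kappa (c : K) (ε : ℤˣ) (a m : ℤ) : K⟦X⟧ :=
  scalar (nu (ε * a) m) * qExp (-((ε : ℤ) : ℂ) / 2 * ((|m| : ℤ) : ℂ)) c

/-- The value of `[h_{i,m}, h_{j,-m}]`, for `a = a_{ij}`. -/
def mu (c : K) (a m : ℤ) : K⟦X⟧ := scalar (nu a m) * qdDiv (qExp (m : ℂ) c - qExp (-m : ℂ) c)

theorem constantCoeff_qExp (s : ℂ) (c : K) : constantCoeff (qExp s c) = 1 := by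
  rw [← coeff_zero_eq_constantCoeff_apply]
  simp [qExp]

theorem qd_mul_mu (c : K) (a m : ℤ) :
    qd * mu c a m = scalar (nu a m) * (qExp (m : ℂ) c - qExp (-m : ℂ) c) := by
  rw [mu, ← mul_assoc, (scalar_commute _ (scalar (nu a m))).eq, mul_assoc, qd_mul_qdDiv]
  rw [map_sub, constantCoeff_qExp, constantCoeff_qExp, sub_self]

/-- The elements `C c` and `H i n` satisfy the commutation relations of the `h_{i,n}`. -/
structure IsCartanAction (c : K) (b : Fin 2 → K) (H : Fin 2 → ℤ → K⟦X⟧) : Prop where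
  commute_c : ∀ i m, Commute (PowerSeries.C c) (H i m)
  zero : ∀ i, H i 0 = PowerSeries.C (b i)
  comm : ∀ i j m n, H i m * H j n - H j n * H i m =
    if m + n = 0 then mu c (cartan i j) m else 0

/-- The elements `y n` satisfy the commutation relations of the `x^ε_{j,n}` with `c` and the
`h_{i,m}`. -/
structure IsCurrent (c : K) (H : Fin 2 → ℤ → K⟦X⟧) (ε : ℤˣ) (j : Fin 2) (y : ℤ → K⟦X⟧) :
    Prop where
  commute_c : ∀ n, Commute (PowerSeries.C c) (y n)
  comm : ∀ i m n, H i m * y n - y n * H i m = kappa c ε (cartan i j) m * y (m + n)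

variable {c : K} {b : Fin 2 → K} {H : Fin 2 → ℤ → K⟦X⟧}

theorem commute_twist {z : K⟦X⟧} (hz : Commute (PowerSeries.C c) z) (G : Base⟦X⟧) (s : ℂ)
    (k : ℕ) : Commute (twist c G s k) z :=
  (scalar_commute _ _).mul_left (qExp_commute hz _)

/-- The logarithmic derivative of `g(q^{s c} u)`, written in terms of the numbers `[l a]_q / l`.
-/
theorem twist_newton (c : K) (a : ℤ) (s : ℂ) (m : ℕ) : m • twist c (gSeries a) s m =
    ∑ p ∈ antidiagonal m, p.1 • ((scalar ((qPow 1 - qPow (-1)) * nu a p.1) *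
      qExp (s * p.1) c) * twist c (gSeries a) s p.2) := by
  have h := congrArg (coeff m) (eulerD_gSeries a)
  rw [coeff_eulerD, coeff_mul] at h
  rw [twist, ← smul_mul_assoc, ← map_nsmul, h, map_sum, Finset.sum_mul]
  refine Finset.sum_congr rfl fun p hp => ?_
  have e1 : coeff p.1 (gLog a) = (p.1 : Base) * ((qPow 1 - qPow (-1)) * nu a p.1) := by
    have := qd_mul_nu a p.1
    push_cast at this
    rw [this, gLog, coeff_mk]
  have e2 : qExp (s * m) c = qExp (s * p.1) c * qExp (s * p.2) c := by
    rw [← qExp_add, ← HasAntidiagonal.mem_antidiagonal.1 hp]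
    push_cast; ring_nf
  rw [e1, e2, twist, map_mul, map_mul scalar (p.1 : Base), map_natCast, nsmul_eq_mul]
  simp only [mul_assoc]
  rw [(scalar_commute (coeff p.2 (gSeries a)) (qExp (s * p.1) c * _)).eq,
    mul_assoc (qExp (s * p.1) c), (scalar_commute (coeff p.2 (gSeries a)) (qExp _ c)).eq]

theorem coeff_phiOpExponent (σ : ℤˣ) (i : Fin 2) (n : ℕ) : coeff n (phiOpExponent H σ i) =
    if n = 0 then 0 else
    scalar (((σ : ℤ) : Base) * (qPow 1 - qPow (-1))) * H i ((σ : ℤ) * (n : ℤ)) := by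
  simp [phiOpExponent]

theorem constantCoeff_phiOpExponent (σ : ℤˣ) (i : Fin 2) :
    constantCoeff (phiOpExponent H σ i) = 0 := by
  rw [← coeff_zero_eq_constantCoeff_apply, coeff_phiOpExponent, if_pos rfl]

theorem commute_phiOp {z : K⟦X⟧} {σ : ℤˣ} {i : Fin 2} (hb : Commute (PowerSeries.C (b i)) z)
    (hH : ∀ n : ℕ, 0 < n → Commute z (H i (σ * n))) (m : ℕ) : Commute z (phiOp b H σ i m) := by
  refine Commute.mul_right (qExp_commute hb _).symm (commute_formalExp (fun n => ?_) m)
  rw [coeff_phiOpExponent]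
  split_ifs with h
  · exact Commute.zero_right _
  · exact Commute.mul_right (scalar_commute _ _).symm (hH n (Nat.pos_of_ne_zero h))

theorem phiOp_zero (σ : ℤˣ) (i : Fin 2) : phiOp b H σ i 0 = qExp ((σ : ℤ) : ℂ) (b i) := by
  simp [phiOp, formalExp]

namespace IsCartanAction
variable (hH : IsCartanAction c b H)
include hH

theorem commute_of_ne {m n : ℤ} (h : m + n ≠ 0) (i j : Fin 2) : Commute (H i m) (H j n) := by
  have := hH.comm i j m n
  rwa [if_neg h, sub_eq_zero] at this

theorem commute_b (i j : Fin 2) (m : ℤ) : Commute (PowerSeries.C (b i)) (H j m) := by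
  by_cases h : m = 0
  · have := hH.comm i j 0 m
    rw [h, hH.zero] at this
    have h0 : mu c (cartan i j) 0 = 0 := by
      rw [← qd_mul_inj, qd_mul_mu]
      simp
    rw [h0, ite_self, sub_eq_zero] at this
    rw [h]
    exact this
  · rw [← hH.zero]
    exact hH.commute_of_ne (by omega) i j

theorem commute_expo (σ : ℤˣ) (i j : Fin 2) (m n : ℕ) :
    Commute (coeff m (phiOpExponent H σ i)) (coeff n (phiOpExponent H σ j)) := by
  rw [coeff_phiOpExponent, coeff_phiOpExponent]
  split_ifs with h1 h2 h2
  · exact Commute.zero_left _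
  · exact Commute.zero_left _
  · exact Commute.zero_right _
  · refine Commute.mul_left (scalar_commute _ _) (Commute.mul_right (scalar_commute _ _).symm
      (hH.commute_of_ne ?_ _ _))
    rcases Int.units_eq_one_or σ with rfl | rfl <;> simp <;> omega

/-- The logarithmic derivative of `φ_i^±(z)`. -/
theorem phi_newton (σ : ℤˣ) (i : Fin 2) (m : ℕ) : m • phiOp b H σ i m =
    ∑ p ∈ antidiagonal m, p.1 • (coeff p.1 (phiOpExponent H σ i) * phiOp b H σ i p.2) := by
  have hc : Commute (phiOpExponent H σ i) (eulerD (phiOpExponent H σ i)) := by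
    refine commute_of_coeff fun m n => ?_
    rw [coeff_eulerD]
    exact (hH.commute_expo σ i i _ _).smul_right _
  have h0 := eulerD_formalExp (constantCoeff_phiOpExponent (H := H) σ i) hc
  have h : coeff m (eulerD (formalExp (phiOpExponent H σ i))) = coeff m
      (eulerD (phiOpExponent H σ i) * formalExp (phiOpExponent H σ i)) := by rw [h0]
  rw [coeff_eulerD, coeff_mul] at h
  rw [phiOp, ← mul_smul_comm, h, Finset.mul_sum]
  refine Finset.sum_congr rfl fun p _ => ?_
  have hq : Commute (qExp ((σ : ℤ) : ℂ) (b i)) (coeff p.1 (phiOpExponent H σ i)) := by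
    refine qExp_commute ?_ _
    rw [coeff_phiOpExponent]
    split_ifs
    · exact Commute.zero_right _
    · exact Commute.mul_right (scalar_commute _ _).symm (hH.commute_b _ _ _)
  rw [coeff_eulerD, smul_mul_assoc, mul_smul_comm, ← mul_assoc, hq.eq, mul_assoc, phiOp]

theorem phi_commute (σ : ℤˣ) (i j : Fin 2) (m n : ℕ) :
    Commute (phiOp b H σ i m) (phiOp b H σ j n) := by
  refine commute_phiOp (commute_phiOp ?_ (fun n hn => ?_) _) (fun n hn => ?_) n
  · rw [← hH.zero j]
    exact (hH.commute_b i j 0).symm.symm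
  · exact hH.commute_b _ _ _
  · refine (commute_phiOp (hH.commute_b _ _ _) (fun k hk => ?_) _).symm
    refine hH.commute_of_ne ?_ _ _
    rcases Int.units_eq_one_or σ with rfl | rfl <;> simp <;> omega

theorem commute_c_phi (σ : ℤˣ) (i : Fin 2) (m : ℕ) : Commute (PowerSeries.C c) (phiOp b H σ i m) := by
  refine commute_phiOp ?_ (fun n hn => hH.commute_c _ _) m
  rw [← hH.zero]
  exact (hH.commute_c _ _).symm

theorem commute_c_phiMode (σ : ℤˣ) (i : Fin 2) (m : ℤ) :
    Commute (PowerSeries.C c) (phiOpMode b H σ i m) := by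
  rw [phiOpMode]
  split_ifs
  · exact hH.commute_c_phi σ i _
  · exact Commute.zero_right _

theorem commute_b_phiMode (σ : ℤˣ) (i j : Fin 2) (m : ℤ) :
    Commute (PowerSeries.C (b i)) (phiOpMode b H σ j m) := by
  rw [phiOpMode]
  split_ifs
  · refine commute_phiOp ?_ (fun n hn => hH.commute_b _ _ _) _
    rw [← hH.zero j]
    exact (hH.commute_b i j 0).symm
  · exact Commute.zero_right _

/-- The relations (Q3) and (Q4), for all signs. -/
theorem phi_mul_current {ε : ℤˣ} {j : Fin 2} {y : ℤ → K⟦X⟧} (hy : IsCurrent c H ε j y)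
    (σ : ℤˣ) (i : Fin 2) (m : ℕ) (n : ℤ) : phiOp b H σ i m * y n =
      ∑ p ∈ antidiagonal m, twist c (gSeries (σ * ε * cartan i j)) (-((ε : ℤ) : ℂ) / 2) p.1 *
        (y (n + σ * p.1) * phiOp b H σ i p.2) := by
  have hcy : ∀ (k : ℕ), Commute (PowerSeries.C c) (coeff k (phiOpExponent H σ i)) := fun k => by
    rw [coeff_phiOpExponent]
    split_ifs
    · exact Commute.zero_right _
    · exact Commute.mul_right (scalar_commute _ _).symm (hH.commute_c _ _)
  refine mul_current_of_eulerD (a := fun k => coeff k (phiOpExponent H σ i))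
    (l := fun k : ℕ => scalar ((qPow 1 - qPow (-1)) * nu (σ * ε * cartan i j) k) *
      qExp (-((ε : ℤ) : ℂ) / 2 * k) c) (E := fun m => phiOp b H σ i m)
    (G := fun k => twist c (gSeries (σ * ε * cartan i j)) (-((ε : ℤ) : ℂ) / 2) k) (s := (σ : ℤ))
    (hH.phi_newton σ i) (twist_newton c _ _) (fun k n hk => ?_)
    (fun k k' => (commute_twist (hcy k) _ _ _).symm) (fun k k' => ?_) (fun n => ?_) m n
  · have h := hy.comm i (σ * k) n
    rw [sub_eq_iff_eq_add'] at h
    rw [coeff_phiOpExponent, if_neg hk.ne', mul_assoc, h, mul_add, ← mul_assoc, ← mul_assoc (y n),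
      (scalar_commute _ (y n)).eq, add_right_inj, add_comm n, ← mul_assoc, kappa, ← mul_assoc,
      ← map_mul]
    have e1 : ((σ : ℤ) : Base) * (qPow 1 - qPow (-1)) * nu (ε * cartan i j) (σ * k) =
        (qPow 1 - qPow (-1)) * nu (σ * ε * cartan i j) k := by
      rw [nu_units_mul_right, mul_assoc (σ : ℤ), nu_units_mul σ]; ring
    have e2 : ((|(σ : ℤ) * k| : ℤ) : ℂ) = k := by
      rw [abs_mul]
      rcases Int.units_eq_one_or σ with rfl | rfl <;> simp
    rw [e1, e2]
  · exact Commute.mul_left (scalar_commute _ _) (qExp_commute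
      (commute_twist (Commute.refl _) _ _ _).symm _)
  · have h := hy.comm i 0 n
    rw [hH.zero, zero_add] at h
    have h2 : PowerSeries.C (b i) * y n - y n * PowerSeries.C (b i) =
        ((ε * cartan i j : ℤ) : ℂ) • y n := by
      rw [h, kappa, nu_zero_right, scalar_C, abs_zero, Int.cast_zero, mul_zero, qExp_zero, mul_one,
        ← PowerSeries.algebraMap_apply, Algebra.smul_def]
    have := qExp_mul_of_commutator h2 ((σ : ℤ) : ℂ)
    rw [phiOp_zero, this, twist, gSeries_coeff_zero, Nat.cast_zero, mul_zero, qExp_zero, mul_one]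
    congr 3
    push_cast; ring

/-- The commutator of `h_{i,k}` with the modes of `φ_j^±(z)`. It vanishes unless `h_{i,k}` belongs
to the opposite half of the Heisenberg algebra. -/
theorem H_comm_phi (σ : ℤˣ) (i j : Fin 2) (k n : ℤ) :
    H i k * phiOpMode b H σ j n - phiOpMode b H σ j n * H i k =
      if (σ : ℤ) * k < 0 then scalar (((σ : ℤ) : Base) * nu (cartan i j) k) *
        ((qExp (k : ℂ) c - qExp (-k : ℂ) c) * phiOpMode b H σ j (n + k)) else 0 := by
  have hσ2 : (σ : ℤ) * σ = 1 := by rw [← Units.val_mul, Int.units_mul_self, Units.val_one]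
  by_cases hn : 0 ≤ (σ : ℤ) * n
  swap
  · have : phiOpMode b H σ j n = 0 := by rw [phiOpMode, if_neg hn]
    rw [this, mul_zero, zero_mul, sub_zero]
    split_ifs with hk
    · rw [phiOpMode, if_neg (by rw [mul_add]; omega), mul_zero, mul_zero]
    · rfl
  rw [phiOpMode, if_pos hn]
  set N := n.natAbs with hN
  have hnN : n = σ * N := by
    rcases Int.units_eq_one_or σ with rfl | rfl <;> simp at hn ⊢ <;> omega
  split_ifs with hk
  · -- only the coefficient of `z^{∓l}` in the exponent fails to commute with `h_{i,k}`
    set l := k.natAbs with hl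
    have hkl : k = - (σ * l) := by
      rcases Int.units_eq_one_or σ with rfl | rfl <;> simp at hk ⊢ <;> omega
    have hl0 : l ≠ 0 := by rintro h; rw [h] at hkl; simp [hkl] at hk
    set lam : K⟦X⟧ := scalar ((σ : ℤ) : Base) * (qd * mu c (cartan i j) k) with hlam
    have hcl : ∀ z, Commute (PowerSeries.C c) z → Commute z lam := fun z hz => by
      rw [hlam, qd_mul_mu]
      exact Commute.mul_right (scalar_commute _ _).symm (Commute.mul_right (scalar_commute _ _).symm
        (Commute.sub_right (qExp_commute hz _).symm (qExp_commute hz _).symm))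
    have hexp : ∀ m, Commute (PowerSeries.C c) (coeff m (phiOpExponent H σ j)) := fun m => by
      rw [coeff_phiOpExponent]
      split_ifs
      · exact Commute.zero_right _
      · exact Commute.mul_right (scalar_commute _ _).symm (hH.commute_c _ _)
    have key := commutator_formalExp (z := H i k) (f := phiOpExponent H σ j)
      (g := PowerSeries.C lam * X ^ l) (constantCoeff_phiOpExponent σ j) (fun m => ?_) ?_ N
    · have hb : Commute (H i k) (qExp ((σ : ℤ) : ℂ) (b j)) := (qExp_commute (hH.commute_b j i k) _).symm
      have e1 : H i k * phiOp b H σ j N - phiOp b H σ j N * H i k =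
          qExp ((σ : ℤ) : ℂ) (b j) * (H i k * coeff N (formalExp (phiOpExponent H σ j)) -
            coeff N (formalExp (phiOpExponent H σ j)) * H i k) := by
        rw [phiOp, ← mul_assoc, hb.eq, mul_sub, mul_assoc, mul_assoc]
      rw [e1, key, mul_assoc, coeff_C_mul, coeff_X_pow_mul']
      have hlam2 : scalar (((σ : ℤ) : Base) * nu (cartan i j) k) *
        (qExp (k : ℂ) c - qExp (-k : ℂ) c) = lam := by
        rw [hlam, qd_mul_mu, map_mul, mul_assoc]
      have hlb : Commute (qExp ((σ : ℤ) : ℂ) (b j)) lam := hcl _ (qExp_commute (by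
        rw [← hH.zero]; exact (hH.commute_c _ _).symm) _).symm
      rw [← mul_assoc (scalar _), hlam2, ← mul_assoc, hlb.eq, mul_assoc]
      congr 1
      have hnk : (σ : ℤ) * (n + k) = N - l := by
        rw [hnN, hkl]; linear_combination ((N : ℤ) - l) * hσ2
      rw [phiOpMode, hnk]
      have : (n + k).natAbs = ((σ : ℤ) * (n + k)).natAbs := by
        rcases Int.units_eq_one_or σ with rfl | rfl <;> simp <;> omega
      rw [this, hnk]
      by_cases hlN : l ≤ N
      · rw [if_pos hlN, if_pos (by omega), phiOp, show ((N : ℤ) - l).natAbs = N - l by omega]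
      · rw [if_neg hlN, if_neg (by omega), mul_zero]
    · rw [coeff_phiOpExponent, coeff_C_mul, coeff_X_pow]
      split_ifs with h1 h2 h2
      · omega
      · simp
      · have := hH.comm i j k (σ * m)
        rw [if_pos (by rw [hkl, h2]; ring)] at this
        rw [mul_one, hlam, ← this, ← mul_assoc (H i k), ← (scalar_commute _ (H i k)).eq, mul_assoc,
          mul_assoc, ← mul_sub, qd, ← mul_assoc (scalar ((σ : ℤ) : Base)), ← map_mul]
      · have : Commute (H i k) (H j (σ * m)) := hH.commute_of_ne (by
          rw [hkl]; intro h
          apply h2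
          have : (σ : ℤ) * (m - l) = 0 := by linear_combination h
          rcases Int.units_eq_one_or σ with rfl | rfl <;> simp at this <;> omega) _ _
        rw [← mul_assoc (H i k), ← (scalar_commute _ (H i k)).eq, mul_assoc, mul_assoc, this.eq,
          sub_self, mul_zero]
    · exact Commute.mul_right (commute_C_iff.2 fun n => (hcl _ (hexp n)).symm).symm
        (commute_X_pow _ _)
  · rw [sub_eq_zero]
    refine commute_phiOp (hH.commute_b j i k) (fun n hn => hH.commute_of_ne ?_ _ _) _
    intro h
    have : (σ : ℤ) * k + n = 0 := by linear_combination (σ : ℤ) * h - n * hσ2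
    omega

end IsCartanAction
end Action

/-! ### Exchanging the currents `φ⁺` and `φ⁻` -/

section Newton
variable {R : Type} [Ring R]

/-- The logarithmic derivative of a product of commuting series is the sum of those of the
factors. -/
theorem newton_mul {l₁ l₂ G₁ G₂ : ℕ → R}
    (h₁ : ∀ m, m • G₁ m = ∑ p ∈ antidiagonal m, p.1 • (l₁ p.1 * G₁ p.2))
    (h₂ : ∀ m, m • G₂ m = ∑ p ∈ antidiagonal m, p.1 • (l₂ p.1 * G₂ p.2))
    (hc : ∀ k k', Commute (l₂ k) (G₁ k')) (m : ℕ) :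
    m • ∑ p ∈ antidiagonal m, G₁ p.1 * G₂ p.2 = ∑ p ∈ antidiagonal m,
      p.1 • ((l₁ p.1 + l₂ p.1) * ∑ r ∈ antidiagonal p.2, G₁ r.1 * G₂ r.2) := by
  set g₁ := PowerSeries.mk G₁
  set g₂ := PowerSeries.mk G₂
  set L₁ := PowerSeries.mk fun k => k • l₁ k
  set L₂ := PowerSeries.mk fun k => k • l₂ k
  have e₁ : eulerD g₁ = L₁ * g₁ := by
    ext m; rw [coeff_eulerD, coeff_mul]; simp only [g₁, L₁, coeff_mk, h₁, smul_mul_assoc]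
  have e₂ : eulerD g₂ = L₂ * g₂ := by
    ext m; rw [coeff_eulerD, coeff_mul]; simp only [g₂, L₂, coeff_mk, h₂, smul_mul_assoc]
  have e : eulerD (g₁ * g₂) = (L₁ + L₂) * (g₁ * g₂) := by
    have : Commute L₂ g₁ := commute_of_coeff fun m n => by
      simpa [L₂, g₁] using (hc m n).smul_left m
    rw [eulerD_mul, e₁, e₂, add_mul, ← mul_assoc g₁, ← this.eq, mul_assoc, mul_assoc]
  have h := congrArg (fun f => coeff m f) e
  simp only [coeff_eulerD, coeff_mul] at h
  simp only [g₁, g₂, L₁, L₂, coeff_mk, map_add] at h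
  rw [h]
  refine Finset.sum_congr rfl fun p _ => ?_
  rw [← smul_add, smul_mul_assoc]

end Newton

section Action
variable {K : Type} [Ring K] [Algebra ℂ K] {c : K} {b : Fin 2 → K} {H : Fin 2 → ℤ → K⟦X⟧}

theorem twistPair_zero (i j : Fin 2) : twistPair c i j 0 = 1 := by
  simp only [twistPair, Finset.Nat.antidiagonal_zero, sum_singleton]
  rw [gUnit_inv_eq, gUnit_eq]
  simp only [twist, gSeries_coeff_zero, Nat.cast_zero, mul_zero, qExp_zero, mul_one]
  rw [← map_mul, qPow_mul]
  push_cast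
  rw [neg_add_cancel, qPow_zero, map_one]

theorem commute_twistPair {z : K⟦X⟧} (hz : Commute (PowerSeries.C c) z) (i j : Fin 2)
    (k : ℕ) : Commute (twistPair c i j k) z :=
  Commute.sum_left _ _ _ fun _ _ => (commute_twist hz _ _ _).mul_left (commute_twist hz _ _ _)

theorem twist_gSeries_succ (c : K) (a : ℤ) (s : ℂ) (k : ℕ) : twist c (gSeries a) s (k + 1) =
    scalar (qPow a) * (qExp s c * twist c (gSeries a) s k) - if k = 0 then qExp s c else 0 := by
  have e : qExp (s * ((k + 1 : ℕ) : ℂ)) c = qExp s c * qExp (s * k) c := by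
    rw [← qExp_add]; push_cast; ring_nf
  rw [twist, twist, gSeries_coeff_succ, e, map_sub, map_mul, sub_mul, ← mul_assoc (qExp s c),
    ← (scalar_commute (coeff k (gSeries a)) (qExp s c)).eq]
  split_ifs with h
  · simp [h, mul_assoc, qExp_zero]
  · simp [mul_assoc]

theorem sum_antidiagonal_eq_sum_range_min {M : Type} [AddCommMonoid M] (f : ℕ → ℕ → M) {m n : ℕ}
    (h : ∀ k l, n < k → f k l = 0) :
    ∑ p ∈ antidiagonal m, f p.1 p.2 = ∑ k ∈ range (min m n + 1), f k (m - k) := by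
  rw [Finset.Nat.sum_antidiagonal_eq_sum_range_succ f]
  symm
  refine Finset.sum_subset (fun k hk => by simp at hk ⊢; omega) fun k hk hk' => h _ _ ?_
  simp at hk hk'
  omega

namespace IsCartanAction
variable (hH : IsCartanAction c b H)
include hH

/-- The relation (Q2). The modes of `φ_j^-` behave as a current with respect to the `h_{i,k}` with
`k > 0`, so that `mul_current_of_eulerD` applies as for (Q3). -/
theorem phi_mul_phi (i j : Fin 2) (m n : ℕ) : phiOp b H 1 i m * phiOp b H (-1) j n =
    ∑ k ∈ range (min m n + 1),
      phiOp b H (-1) j (n - k) * phiOp b H 1 i (m - k) * twistPair c i j k := by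
  set a := cartan i j with ha
  have hexp : ∀ k, Commute (PowerSeries.C c) (coeff k (phiOpExponent H 1 i)) := fun k => by
    rw [coeff_phiOpExponent]
    split_ifs
    · exact Commute.zero_right _
    · exact Commute.mul_right (scalar_commute _ _).symm (hH.commute_c _ _)
  have hT : ∀ k, ∑ p ∈ antidiagonal k, twist c (gSeries (-a)) 1 p.1 * twist c (gSeries a) (-1) p.2
      = twistPair c i j k := fun k => by
    rw [twistPair, gUnit_inv_eq, gUnit_eq]
  have key := mul_current_of_eulerD (a := fun k => coeff k (phiOpExponent H 1 i))
    (E := fun m => phiOp b H 1 i m) (G := fun k => twistPair c i j k)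
    (l := fun k : ℕ => scalar ((qPow 1 - qPow (-1)) * nu (-a) k) * qExp (1 * k) c +
      scalar ((qPow 1 - qPow (-1)) * nu a k) * qExp (-1 * k) c)
    (y := fun k => phiOpMode b H (-1) j k) (s := 1)
    (hH.phi_newton 1 i) (fun m => ?_) (fun k n hk => ?_)
    (fun k k' => (commute_twistPair (hexp k) _ _ _).symm) (fun k k' => ?_) (fun n => ?_) m (-n)
  · have e0 : phiOpMode b H (-1) j (-(n : ℤ)) = phiOp b H (-1) j n := by
      simp [phiOpMode]
    have e1 := sum_antidiagonal_eq_sum_range_min (m := m) (n := n) (fun k l =>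
      twistPair c i j k * (phiOpMode b H (-1) j (-n + 1 * k) * phiOp b H 1 i l)) fun k l hk => by
        rw [phiOpMode, if_neg (by simp; omega), zero_mul, mul_zero]
    rw [e0, e1] at key
    rw [key]
    refine Finset.sum_congr rfl fun k hk => ?_
    simp at hk
    rw [phiOpMode, if_pos (by simp; omega), show (-(n : ℤ) + 1 * k).natAbs = n - k by omega]
    exact (commute_twistPair ((hH.commute_c_phi (-1) j (n - k)).mul_right
      (hH.commute_c_phi 1 i (m - k))) i j k).eq
  · have h1 := twist_newton c (-a) 1
    have h2 := twist_newton c a (-1)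
    have h3 := newton_mul
      (l₁ := fun k : ℕ => scalar ((qPow 1 - qPow (-1)) * nu (-a) k) * qExp (1 * k) c)
      (l₂ := fun k : ℕ => scalar ((qPow 1 - qPow (-1)) * nu a k) * qExp (-1 * k) c)
      (G₁ := fun k => twist c (gSeries (-a)) 1 k) (G₂ := fun k => twist c (gSeries a) (-1) k)
      h1 h2 (fun k k' => Commute.mul_left (scalar_commute _ _) (qExp_commute
        (commute_twist (Commute.refl _) _ _ _).symm _)) m
    simp only [hT] at h3
    exact h3
  · have h := hH.H_comm_phi (-1) i j k n
    rw [if_pos (by simpa using hk), sub_eq_iff_eq_add'] at h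
    rw [coeff_phiOpExponent, if_neg hk.ne', mul_assoc]
    simp only [Units.val_one, one_mul] at h ⊢
    rw [h, mul_add, ← mul_assoc, ← mul_assoc (phiOpMode _ _ _ _ _),
      (scalar_commute _ (phiOpMode b H (-1) j n)).eq, add_right_inj, ← mul_assoc, ← map_mul,
      ← mul_assoc]
    congr 1
    rw [nu_neg_left, mul_sub]
    simp only [map_mul, map_neg, neg_mul, Units.val_neg, Units.val_one, Int.cast_neg, Int.cast_one,
      mul_neg, sub_neg_eq_add, one_mul]
    rw [sub_eq_add_neg, Int.cast_natCast]
  · refine Commute.add_left ?_ ?_ <;>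
    exact Commute.mul_left (scalar_commute _ _) (qExp_commute
        (commute_twistPair (Commute.refl _) _ _ _).symm _)
  · rw [phiOp_zero, twistPair_zero, one_mul]
    exact (qExp_commute (hH.commute_b_phiMode _ _ _ _) _).eq

/-- The relations (Q3) and (Q4), multiplied by the denominator of `g`. -/
theorem phi_two_term {ε : ℤˣ} {j : Fin 2} {y : ℤ → K⟦X⟧} (hy : IsCurrent c H ε j y)
    (σ : ℤˣ) (i : Fin 2) {F : ℤ → K⟦X⟧} (hF : ∀ m, F m = phiOpMode b H σ i (σ * m)) (m n : ℤ) :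
    F (m + 1) * y n - scalar (qPow ((σ * ε * cartan i j : ℤ) : ℂ)) *
        (qExp (-((ε : ℤ) : ℂ) / 2) c * (F m * y (n + σ))) =
      scalar (qPow ((σ * ε * cartan i j : ℤ) : ℂ)) * (y n * F (m + 1)) -
        qExp (-((ε : ℤ) : ℂ) / 2) c * (y (n + σ) * F m) := by
  have hσ2 : (σ : ℤ) * σ = 1 := by rw [← Units.val_mul, Int.units_mul_self, Units.val_one]
  have hF' : ∀ m, F m = if 0 ≤ m then phiOp b H σ i m.natAbs else 0 := fun m => by
    rw [hF, phiOpMode, ← mul_assoc, hσ2, one_mul, Int.natAbs_mul, Int.natAbs_of_isUnit (Units.isUnit σ), one_mul]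
  set a := (σ : ℤ) * ε * cartan i j with ha
  have G0 : twist c (gSeries a) (-((ε : ℤ) : ℂ) / 2) 0 = scalar (qPow (a : ℂ)) := by
    simp [twist, gSeries_coeff_zero, qExp_zero]
  -- for `m = -1` only the leading mode `F 0` contributes
  rcases lt_trichotomy m (-1) with hm | rfl | hm
  · rw [hF', hF', if_neg (by omega), if_neg (by omega)]; simp
  · have := hH.phi_mul_current hy σ i 0 n
    rw [hF', hF', if_pos (by omega), if_neg (by omega)]
    simp only [Finset.Nat.antidiagonal_zero, sum_singleton, ← ha] at this
    rw [G0] at this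
    simpa using this
  · lift m to ℕ using (by omega)
    rw [hF', hF', if_pos (by omega), if_pos (by omega)]
    rw [show ((m : ℤ) + 1).natAbs = m + 1 by omega, Int.natAbs_natCast,
      hH.phi_mul_current hy, hH.phi_mul_current hy, Finset.Nat.sum_antidiagonal_succ, ← ha]
    dsimp only
    rw [G0]
    simp only [Nat.cast_zero, mul_zero, add_zero]
    rw [add_sub_assoc, sub_eq_add_neg (scalar _ * _), add_right_inj, Finset.mul_sum, Finset.mul_sum,
      ← Finset.sum_sub_distrib, Finset.sum_eq_single (0, m)]
    · dsimp only
      rw [twist_gSeries_succ, if_pos rfl, Nat.cast_succ, Nat.cast_zero, zero_add, mul_one, mul_zero,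
        add_zero, sub_mul]
      simp only [mul_assoc]
      abel
    · rintro ⟨k, l⟩ hp hkl
      have hk : k ≠ 0 := by
        rintro rfl
        rw [HasAntidiagonal.mem_antidiagonal] at hp
        dsimp only at hp
        rw [zero_add] at hp
        exact hkl (by rw [hp])
      dsimp only
      rw [twist_gSeries_succ, if_neg hk, sub_zero, Nat.cast_succ, sub_eq_zero]
      simp only [mul_assoc]
      ring_nf
    · simp

end IsCartanAction
end Action

/-! ### The currents on the right hand side of (Q5) -/

/-- `K⟦ħ⟧` as an algebra over `ℂ⟦ħ⟧`. -/
abbrev seriesAlgebra (K : Type) [Ring K] [Algebra ℂ K] : Algebra Base K⟦X⟧ :=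
  RingHom.toAlgebra' scalar fun a f => (scalar_commute a f).eq

/-- Solving `Y - S⁻¹ Z = S⁻¹ W - V` for `Z`; this exchanges a two-term relation with its inverse.
-/
theorem solve_two_term {A : Type} [Ring A] {S S' Y Z V W : A} (h : S * S' = 1)
    (h' : Y - S' * Z = S' * W - V) : Z - S * Y = S * V - W := by
  have e := congrArg (S * ·) h'
  simp only [mul_sub, ← mul_assoc, h, one_mul] at e
  rw [sub_eq_sub_iff_add_eq_add] at e ⊢
  rw [add_comm Z, ← e, add_comm]
section Action
variable {K : Type} [Ring K] [Algebra ℂ K] {c : K} {b : Fin 2 → K} {H : Fin 2 → ℤ → K⟦X⟧}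

/-- The coefficients of `z^{-m} w^{-n}` in `φ_i^±(z q^{∓c/2}) δ(q^{±c} w / z)`. -/
def phiDelta (c : K) (b : Fin 2 → K) (H : Fin 2 → ℤ → K⟦X⟧) (σ : ℤˣ) (i : Fin 2) (m n : ℤ) :
    K⟦X⟧ :=
  phiOpMode b H σ i (m + n) * qExp (((σ : ℤ) : ℂ) * ((m : ℂ) - n) / 2) c

namespace IsCartanAction
variable (hH : IsCartanAction c b H)
include hH

section
attribute [local instance] seriesAlgebra

/-- The modes of `φ_i^±(z q^{∓c/2}) δ(q^{±c} w / z)`, as a current in `z` or in `w`, commute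
with the currents `x_j^ε` in the same way as `x_i^ε` does. -/
theorem phi_currentRel {ε : ℤˣ} {j : Fin 2} {y : ℤ → K⟦X⟧} (hy : IsCurrent c H ε j y)
    (σ : ℤˣ) (i : Fin 2) (s : ℤ) : CurrentRel (qPow ((ε * cartan i j : ℤ) : ℂ))
      (fun m => phiOpMode b H σ i (m + s) * qExp (((σ : ℤ) : ℂ) * ((ε : ℤ) : ℂ) * ((m : ℂ) - s) / 2) c)
      y := by
  intro k l
  have hQ : ∀ r n, Commute (qExp r c) (y n) := fun r n => qExp_commute (hy.commute_c n) r
  have hQF : ∀ r n, Commute (qExp r c) (phiOpMode b H σ i n) := fun r n =>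
    qExp_commute (hH.commute_c_phiMode σ i n) r
  have e1 : ∀ n m r, phiOpMode b H σ i n * qExp r c * y m = phiOpMode b H σ i n * y m * qExp r c :=
    fun n m r => by rw [mul_assoc, (hQ _ _).eq, mul_assoc]
  have e2 : ∀ n m r r', qExp r' c * (phiOpMode b H σ i n * y m) * qExp r c =
      phiOpMode b H σ i n * y m * qExp (r' + r) c := fun n m r r' => by
    rw [((hQF r' n).mul_right (hQ r' m)).eq, mul_assoc, qExp_add]
  have e3 : ∀ n m r r', qExp r' c * (y m * phiOpMode b H σ i n) * qExp r c =
      y m * phiOpMode b H σ i n * qExp (r' + r) c := fun n m r r' => by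
    rw [((hQ r' m).mul_right (hQF r' n)).eq, mul_assoc, qExp_add]
  rw [e1, e1, ← mul_assoc (y _), ← mul_assoc (y _)]
  rcases Int.units_eq_one_or σ with rfl | rfl
  · have h := hH.phi_two_term hy 1 i (F := phiOpMode b H 1 i) (fun m => by simp) (k + s) l
    have h' := congrArg (· * qExp (((ε : ℤ) : ℂ) * ((k : ℂ) + 1 - s) / 2) c) h
    simp only [sub_mul, mul_assoc (scalar _)] at h'
    rw [e2, e3] at h'
    simp only [Units.val_one, Int.cast_one, one_mul] at h' ⊢
    push_cast at h' ⊢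
    have e4 : -((ε : ℤ) : ℂ) / 2 + ((ε : ℤ) : ℂ) * ((k : ℂ) + 1 - s) / 2 =
      ((ε : ℤ) : ℂ) * ((k : ℂ) - s) / 2 := by ring
    rw [e4] at h'
    rw [add_right_comm k 1 s]
    exact h'
  · have h := hH.phi_two_term hy (-1) i (F := fun m => phiOpMode b H (-1) i (-m))
      (fun m => by simp) (-k - 1 - s) (l + 1)
    have h' := congrArg (· * qExp (-((ε : ℤ) : ℂ) * ((k : ℂ) - s) / 2) c) h
    simp only [sub_mul, mul_assoc (scalar _)] at h'
    rw [e2, e3] at h'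
    have e4 : -((ε : ℤ) : ℂ) / 2 + -((ε : ℤ) : ℂ) * ((k : ℂ) - s) / 2 =
      -((ε : ℤ) : ℂ) * ((k : ℂ) + 1 - s) / 2 := by ring
    have e5 : (scalar (qPow ((ε * cartan i j : ℤ) : ℂ)) : K⟦X⟧) *
        scalar (qPow (((-1 : ℤˣ) * ε * cartan i j : ℤ) : ℂ)) = 1 := by
      rw [← map_mul, qPow_mul]
      rw [show (((ε * cartan i j : ℤ) : ℂ) + (((-1 : ℤˣ) * ε * cartan i j : ℤ) : ℂ)) = 0 by simp,
        qPow_zero, map_one]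
    rw [e4, show l + 1 + ((-1 : ℤˣ) : ℤ) = l by simp, show -(-k - 1 - s + 1) = k + s by ring,
      show -(-k - 1 - s) = k + 1 + s by ring] at h'
    simp only [Units.val_neg, Units.val_one] at h' ⊢
    push_cast at h' ⊢
    simp only [neg_mul, one_mul] at h' ⊢
    simp only [Units.val_neg, Units.val_one] at e5
    push_cast at e5
    simp only [neg_mul, one_mul] at e5
    exact solve_two_term e5 h'

end

/-- The Jacobi identity for `h_{k,l}`, `x_i^+` and `x_i^-`, verified for the values which (Q5)
prescribes for the commutators. -/
theorem H_comm_of_qd_mul {i : Fin 2} {D : ℤ → ℤ → K⟦X⟧}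
    (hD : ∀ m n, qd * D m n = phiDelta c b H 1 i m n - phiDelta c b H (-1) i m n) (k : Fin 2)
    (l m n : ℤ) : H k l * D m n - D m n * H k l =
      kappa c 1 (cartan k i) l * D (m + l) n + kappa c (-1) (cartan k i) l * D m (n + l) := by
  rw [← qd_mul_inj]
  set N : K⟦X⟧ := scalar (nu (cartan k i) l) with hN
  have hQF : ∀ r n σ, Commute (qExp r c) (phiOpMode b H σ i n) := fun r n σ =>
    qExp_commute (hH.commute_c_phiMode σ i n) r
  have kap1 : kappa c 1 (cartan k i) l = N * qExp (-((|l| : ℤ) : ℂ) / 2) c := by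
    rw [kappa, Units.val_one, one_mul]; congr 2; push_cast; ring
  have kap2 : kappa c (-1) (cartan k i) l = -N * qExp (((|l| : ℤ) : ℂ) / 2) c := by
    rw [kappa, Units.val_neg, Units.val_one, neg_mul, one_mul, nu_neg_left, map_neg]
    congr 2; push_cast; ring
  have hq : ∀ (z w : K⟦X⟧), qd * (z * w) = z * (qd * w) := fun z w => by
    rw [← mul_assoc, (scalar_commute _ z).eq, mul_assoc]
  have hm : ∀ r r' σ n, qExp r c * (phiOpMode b H σ i n * qExp r' c) =
      phiOpMode b H σ i n * qExp (r + r') c := fun r r' σ n => by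
    rw [← mul_assoc, (hQF _ _ _).eq, mul_assoc, ← qExp_add]
  have hcom : ∀ σ : ℤˣ, H k l * phiDelta c b H σ i m n - phiDelta c b H σ i m n * H k l =
      if (σ : ℤ) * l < 0 then ((σ : ℤ) : K⟦X⟧) * (N * (phiOpMode b H σ i (m + n + l) *
        qExp ((l : ℂ) + ((σ : ℤ) : ℂ) * ((m : ℂ) - n) / 2) c) -
        N * (phiOpMode b H σ i (m + n + l) *
        qExp (-(l : ℂ) + ((σ : ℤ) : ℂ) * ((m : ℂ) - n) / 2) c)) else 0 := by
    intro σ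
    have h := hH.H_comm_phi σ k i l (m + n)
    rw [phiDelta, ← mul_assoc, mul_assoc (phiOpMode _ _ _ _ _) _ (H k l),
      (qExp_commute (hH.commute_c k l) _).eq, ← mul_assoc, ← sub_mul, h]
    split_ifs
    · rw [map_mul, map_intCast, ← mul_sub N, mul_assoc, mul_assoc]
      simp only [mul_assoc]
      rw [sub_mul, hm, hm]
    · rw [zero_mul]
  rw [mul_add, kap1, kap2, mul_sub]
  have hL : qd * (H k l * D m n) - qd * (D m n * H k l) =
      (H k l * phiDelta c b H 1 i m n - phiDelta c b H 1 i m n * H k l) -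
      (H k l * phiDelta c b H (-1) i m n - phiDelta c b H (-1) i m n * H k l) := by
    rw [hq, ← mul_assoc qd, hD]
    noncomm_ring
  rw [hL, hcom, hcom]
  simp only [neg_mul, mul_neg, mul_assoc, hq, hD]
  simp only [phiDelta, mul_sub, hm, Units.val_one, Units.val_neg, one_mul, Int.cast_one, neg_mul,
    Int.cast_neg]
  rw [show m + l + n = m + n + l by ring, show m + (n + l) = m + n + l by ring]
  simp only [Int.cast_add]
  rcases lt_trichotomy l 0 with hl | rfl | hl
  · rw [abs_of_neg hl, if_pos (by omega), if_neg (by omega)]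
    simp only [Int.cast_neg]
    rw [show -(-(l : ℂ)) / 2 + ((m : ℂ) + l - n) / 2 = l + ((m : ℂ) - n) / 2 by ring,
      show (-(l : ℂ)) / 2 + ((m : ℂ) - (n + l)) / 2 = -l + ((m : ℂ) - n) / 2 by ring,
      show -(-(l : ℂ)) / 2 + (-((m : ℂ) + l) - -n) / 2 = (-(m : ℂ) - -n) / 2 by ring,
      show (-(l : ℂ)) / 2 + (-(m : ℂ) - -(n + l)) / 2 = (-(m : ℂ) - -n) / 2 by ring]
    abel
  · simp
  · rw [abs_of_pos hl, if_neg (by omega), if_pos (by omega)]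
    rw [show -(l : ℂ) / 2 + ((m : ℂ) + l - n) / 2 = ((m : ℂ) - n) / 2 by ring,
      show (l : ℂ) / 2 + ((m : ℂ) - (n + l)) / 2 = ((m : ℂ) - n) / 2 by ring,
      show -(l : ℂ) / 2 + (-((m : ℂ) + l) - -n) / 2 = -l + (-(m : ℂ) - -n) / 2 by ring,
      show (l : ℂ) / 2 + (-(m : ℂ) - -(n + l)) / 2 = l + (-(m : ℂ) - -n) / 2 by ring]
    abel

end IsCartanAction

/-! ### The relations (Q1)-(Q5) -/

section Relations
variable {B : Type} [Ring B] [Algebra ℂ B] (f : B →ₐ[ℂ] K⟦X⟧) {c' : B} {h : Fin 2 → ℤ → B}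
  {x : ℤˣ → Fin 2 → ℤ → B}

/-- The relations (Q1) and (Q2) hold for operators with the commutation relations of the
`h_{i,n}`. -/
theorem liftTopAlg_relCartan (hH : IsCartanAction c b H) (hc : f c' = PowerSeries.C c)
    (hh : ∀ i n, f (h i n) = H i n) {r : B⟦X⟧} (hr : r ∈ relCartan c' h) :
    liftTopAlg f r = 0 := by
  have hphi := liftTopAlg_phi f hh hH.zero
  rcases hr with (⟨i, m, rfl⟩ | ⟨ε, i, j, m, n, rfl⟩) | ⟨i, j, m, n, rfl⟩
  · rw [liftTopAlg_C, map_sub, map_mul, map_mul, hc, hh, (hH.commute_c i m).eq, sub_self]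
  · rw [map_sub, map_mul, map_mul, hphi, hphi, (hH.phi_commute ε i j m n).eq, sub_self]
  · simp only [map_sub, map_mul, map_sum, hphi, liftTopAlg_twistPair f hc]
    rw [hH.phi_mul_phi, sub_self]

/-- The relations (Q3) and (Q4) hold for operators with the commutation relations of the `h_{i,n}`
and `x_{i,n}^±`. -/
theorem liftTopAlg_relMixed (hH : IsCartanAction c b H) (hc : f c' = PowerSeries.C c)
    (hh : ∀ i n, f (h i n) = H i n) (hx : ∀ ε j, IsCurrent c H ε j fun n => f (x ε j n))
    {r : B⟦X⟧} (hr : r ∈ relMixed c' h x) : liftTopAlg f r = 0 := by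
  have hphi := liftTopAlg_phi f hh hH.zero
  have key : ∀ (σ ε : ℤˣ) (i j : Fin 2) (m : ℕ) (n : ℤ), phiOp b H σ i m * f (x ε j n) =
      ∑ k ∈ range (m + 1), f (x ε j (n + σ * k)) * phiOp b H σ i (m - k) *
        twist c (gSeries (σ * ε * cartan i j)) (-((ε : ℤ) : ℂ) / 2) k := by
    intro σ ε i j m n
    rw [hH.phi_mul_current (hx ε j), Finset.Nat.sum_antidiagonal_eq_sum_range_succ
      (fun k l => twist c (gSeries (σ * ε * cartan i j)) (-((ε : ℤ) : ℂ) / 2) k *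
        (f (x ε j (n + σ * k)) * phiOp b H σ i l))]
    refine Finset.sum_congr rfl fun k _ => ?_
    have h1 := (hx ε j).commute_c (n + σ * k)
    have h2 := hH.commute_c_phi σ i (m - k)
    exact (commute_twist (h1.mul_right h2) _ _ _).eq
  rcases hr with (⟨ε, i, m, rfl⟩ | ⟨ε, i, j, m, n, rfl⟩) | ⟨ε, i, j, m, n, rfl⟩
  · rw [liftTopAlg_C, map_sub, map_mul, map_mul, hc, ((hx ε i).commute_c m).eq, sub_self]
  · simp only [map_sub, map_mul, map_sum, hphi, liftTopAlg_twist f hc, liftTopAlg_C, key,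
      gUnit_zpow_eq]
    simp
  · have e : ∀ ε : ℤˣ, (gUnit j i ^ (-(ε : ℤ)) : (Base⟦X⟧)ˣ).val =
        gSeries ((-1 : ℤˣ) * ε * cartan i j) := fun ε => by
      rw [← Units.val_neg, gUnit_zpow_eq, cartan_symm]
      simp
    simp only [map_sub, map_mul, map_sum, hphi, liftTopAlg_twist f hc, liftTopAlg_C, key, e]
    simp [sub_eq_add_neg]

theorem liftTopAlg_phiDelta (hH : IsCartanAction c b H) (hc : f c' = PowerSeries.C c)
    (hh : ∀ i n, f (h i n) = H i n) (σ : ℤˣ) (i : Fin 2) (m n : ℤ) :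
    liftTopAlg f (phiMode h σ i (m + n) * qExp (((σ : ℤ) : ℂ) * ((m + n : ℤ) : ℂ) / 2) c' *
      qExp (-((σ : ℤ) : ℂ) * (n : ℂ)) c') = phiDelta c b H σ i m n := by
  rw [mul_assoc, ← qExp_add, map_mul, liftTopAlg_phiMode f hh hH.zero, liftTopAlg_qExp f hc,
    phiDelta]
  congr 2
  push_cast; ring

end Relations
end Action

/-! ### Formal series of vectors -/

/-- `(End V)⟦ħ⟧` as an algebra over `ℂ⟦ħ⟧`. -/
instance endSeriesAlgebra (V : Type) [AddCommGroup V] [Module ℂ V] :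
    Algebra Base (Module.End ℂ V)⟦X⟧ := seriesAlgebra _

/-- The `ℂ⟦ħ⟧`-module `V⟦ħ⟧`, for a complex vector space `V`. -/
def Ser (V : Type) : Type := ℕ → V

section Ser
variable {V : Type} [AddCommGroup V] [Module ℂ V]

instance : AddCommGroup (Ser V) := inferInstanceAs (AddCommGroup (ℕ → V))

/-- The action of `(End V)⟦ħ⟧` on `V⟦ħ⟧`. -/
instance : Module (Module.End ℂ V)⟦X⟧ (Ser V) where
  smul f v := fun n => ∑ p ∈ antidiagonal n, coeff p.1 f (v p.2)
  one_smul v := by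
    funext n
    change ∑ p ∈ antidiagonal n, coeff p.1 (1 : (Module.End ℂ V)⟦X⟧) (v p.2) = v n
    rw [Finset.sum_eq_single (0, n)]
    · simp
    · rintro ⟨i, j⟩ hp hne
      have hi : i ≠ 0 := by
        rintro rfl
        simp at hp
        simp [hp] at hne
      simp [coeff_one, hi]
    · simp
  mul_smul f g v := by
    funext n
    change ∑ p ∈ antidiagonal n, coeff p.1 (f * g) (v p.2) =
      ∑ p ∈ antidiagonal n, coeff p.1 f (∑ r ∈ antidiagonal p.2, coeff r.1 g (v r.2))
    simp only [coeff_mul, LinearMap.sum_apply, map_sum, Module.End.mul_apply]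
    exact (sum_antidiagonal_assoc n fun i j k => coeff i f (coeff j g (v k))).symm
  smul_zero f := by
    funext n
    change ∑ p ∈ antidiagonal n, coeff p.1 f 0 = 0
    simp
  smul_add f v w := by
    funext n
    change ∑ p ∈ antidiagonal n, coeff p.1 f (v p.2 + w p.2) =
      ∑ p ∈ antidiagonal n, coeff p.1 f (v p.2) + ∑ p ∈ antidiagonal n, coeff p.1 f (w p.2)
    simp [Finset.sum_add_distrib]
  add_smul f g v := by
    funext n
    change ∑ p ∈ antidiagonal n, coeff p.1 (f + g) (v p.2) =
      ∑ p ∈ antidiagonal n, coeff p.1 f (v p.2) + ∑ p ∈ antidiagonal n, coeff p.1 g (v p.2)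
    simp [Finset.sum_add_distrib]
  zero_smul v := by
    funext n
    change ∑ p ∈ antidiagonal n, coeff p.1 (0 : (Module.End ℂ V)⟦X⟧) (v p.2) = 0
    simp

theorem Ser.smul_apply (f : (Module.End ℂ V)⟦X⟧) (v : Ser V) (n : ℕ) :
    (f • v) n = ∑ p ∈ antidiagonal n, coeff p.1 f (v p.2) := rfl

instance : Module Base (Ser V) := Module.compHom (Ser V) (scalar (B := Module.End ℂ V))

theorem Ser.base_smul_def (a : Base) (v : Ser V) :
    a • v = (scalar a : (Module.End ℂ V)⟦X⟧) • v := rfl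

instance : SMulCommClass (Module.End ℂ V)⟦X⟧ Base (Ser V) where
  smul_comm f a v := by
    rw [Ser.base_smul_def, Ser.base_smul_def, ← mul_smul, ← mul_smul, (scalar_commute a f).eq]

/-- The action of an element of `(End V)⟦ħ⟧`, as a `ℂ⟦ħ⟧`-linear map. -/
def Ser.act (f : (Module.End ℂ V)⟦X⟧) : Ser V →ₗ[Base] Ser V where
  toFun v := f • v
  map_add' := smul_add f
  map_smul' a v := smul_comm f a v

/-- The constant series. -/
def Ser.const (v : V) : Ser V := fun n => if n = 0 then v else 0

theorem Ser.const_add (v w : V) : Ser.const (v + w) = Ser.const v + Ser.const w := by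
  funext n
  change (if n = 0 then v + w else 0) = (if n = 0 then v else 0) + (if n = 0 then w else 0)
  split_ifs <;> simp

theorem Ser.smul_const_apply (f : (Module.End ℂ V)⟦X⟧) (v : V) (n : ℕ) :
    (f • Ser.const v) n = coeff n f v := by
  rw [Ser.smul_apply, Finset.sum_eq_single (n, 0)]
  · simp [Ser.const]
  · rintro ⟨i, j⟩ hp hne
    have hj : j ≠ 0 := by
      rintro rfl
      simp at hp
      simp [hp] at hne
    simp [Ser.const, hj]
  · simp

theorem Ser.C_smul_const (f : Module.End ℂ V) (v : V) :
    (PowerSeries.C f : (Module.End ℂ V)⟦X⟧) • Ser.const v = Ser.const (f v) := by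
  funext n
  rw [Ser.smul_const_apply, coeff_C]
  simp only [Ser.const]
  split_ifs <;> rfl

theorem Ser.const_smul (a : ℂ) (v : V) :
    Ser.const (a • v) = (PowerSeries.C a : Base) • Ser.const v := by
  rw [Ser.base_smul_def, scalar_C, Ser.C_smul_const]
  rfl

theorem Ser.X_pow_smul_apply (k : ℕ) (v : Ser V) (n : ℕ) :
    ((X : (Module.End ℂ V)⟦X⟧) ^ k • v) n = if k ≤ n then v (n - k) else 0 := by
  rw [Ser.smul_apply]
  split_ifs with h
  · rw [Finset.sum_eq_single (k, n - k)]
    · simp [coeff_X_pow]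
    · rintro ⟨i, j⟩ hp hne
      have hi : i ≠ k := by
        rintro rfl
        rw [HasAntidiagonal.mem_antidiagonal] at hp
        dsimp only at hp
        exact hne (by simp; omega)
      simp [coeff_X_pow, hi]
    · intro hh
      exact absurd (HasAntidiagonal.mem_antidiagonal.2 (by dsimp only; omega)) hh
  · refine Finset.sum_eq_zero fun p hp => ?_
    rw [HasAntidiagonal.mem_antidiagonal] at hp
    rw [coeff_X_pow, if_neg (by omega), LinearMap.zero_apply]

theorem Ser.hbar_pow_smul_apply (k : ℕ) (v : Ser V) (n : ℕ) :
    (hbar ^ k • v) n = if k ≤ n then v (n - k) else 0 := by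
  rw [Ser.base_smul_def, map_pow, scalar_X, Ser.X_pow_smul_apply]

/-- The series without its constant term, divided by `ħ`. -/
def Ser.tail (v : Ser V) : Ser V := fun n => v (n + 1)

theorem Ser.eq_const_add (v : Ser V) : v = Ser.const (v 0) + hbar • Ser.tail v := by
  funext n
  have := Ser.hbar_pow_smul_apply 1 (Ser.tail v) n
  rw [pow_one] at this
  change v n = Ser.const (v 0) n + _
  rw [this]
  cases n <;> simp [Ser.const, Ser.tail]

end Ser

/-! ### Closed submodules -/

section Closed
variable {M M' : Type} [AddCommGroup M] [Module Base M] [AddCommGroup M'] [Module Base M']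

theorem IsHbarClosed.preimage {S : Set M'} (hS : IsHbarClosed S) (f : M →ₗ[Base] M') :
    IsHbarClosed (f ⁻¹' S) := by
  intro y hy
  refine hS _ fun n => ?_
  obtain ⟨s, hs, t, rfl⟩ := hy n
  exact ⟨f s, hs, f t, by simp⟩

theorem IsHbarClosed.sInter {F : Set (Set M)} (h : ∀ S ∈ F, IsHbarClosed S) :
    IsHbarClosed (⋂₀ F) := by
  intro y hy S hS
  refine h S hS y fun n => ?_
  obtain ⟨s, hs, t, rfl⟩ := hy n
  exact ⟨s, hs S hS, t, rfl⟩

theorem IsHbarClosed.inter {S S' : Set M} (h : IsHbarClosed S) (h' : IsHbarClosed S') :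
    IsHbarClosed (S ∩ S') := by
  rw [← Set.sInter_pair]
  exact IsHbarClosed.sInter (by rintro _ (rfl | rfl) <;> assumption)

theorem IsHbarClosed.iInter {ι : Sort*} {S : ι → Set M} (h : ∀ i, IsHbarClosed (S i)) :
    IsHbarClosed (⋂ i, S i) :=
  IsHbarClosed.sInter (by rintro _ ⟨i, rfl⟩; exact h i)

/-- A closed submodule whose translates by `ħ M` cover `M` is everything. -/
theorem Submodule.eq_top_of_closed {S : Submodule Base M} (hS : IsHbarClosed (S : Set M))
    (h : ∀ v : M, ∃ s ∈ S, ∃ t, v = s + hbar • t) (v : M) : v ∈ S := by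
  refine hS v fun n => ?_
  induction n with
  | zero => exact ⟨0, S.zero_mem, v, by simp⟩
  | succ n ih =>
    obtain ⟨s, hs, t, rfl⟩ := ih
    obtain ⟨s', hs', t', rfl⟩ := h t
    exact ⟨s + hbar ^ n • s', S.add_mem hs (S.smul_mem _ hs'), t', by
      rw [smul_add, ← add_assoc, smul_smul, ← pow_succ]⟩

theorem Ser.mem_of_const {V : Type} [AddCommGroup V] [Module ℂ V] {S : Submodule Base (Ser V)}
    (hS : IsHbarClosed (S : Set (Ser V))) (h : ∀ v : V, Ser.const v ∈ S) (v : Ser V) : v ∈ S :=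
  Submodule.eq_top_of_closed hS (fun v => ⟨Ser.const (v 0), h _, Ser.tail v, Ser.eq_const_add v⟩) v

end Closed

section ClosedIdeal
variable {A : Type} [Ring A] [Algebra Base A]

theorem subset_closedIdeal (R : Set A) : R ⊆ closedIdeal R := by
  intro r hr
  rw [SetLike.mem_coe, closedIdeal, Submodule.mem_sInf]
  exact fun I hI => hI.2.2 hr

theorem isHbarClosed_closedIdeal (R : Set A) : IsHbarClosed (closedIdeal R : Set A) := by
  intro y hy
  rw [SetLike.mem_coe, closedIdeal, Submodule.mem_sInf]
  intro I hI
  refine hI.2.1 y fun n => ?_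
  obtain ⟨s, hs, t, rfl⟩ := hy n
  exact ⟨s, by rw [SetLike.mem_coe, closedIdeal, Submodule.mem_sInf] at hs; exact hs I hI, t, rfl⟩

/-- To show that the elements of a closed ideal satisfy a closed additive condition, it suffices
to check this condition on the generators and that it is stable under multiplications. -/
theorem closedIdeal_induction {R : Set A} {S : Submodule Base A} (hS : IsHbarClosed (S : Set A))
    (hR : ∀ r ∈ R, r ∈ S) (hl : ∀ a, ∀ r ∈ S, a * r ∈ S) (hr : ∀ a, ∀ r ∈ S, r * a ∈ S) {x : A}
    (hx : x ∈ closedIdeal R) : x ∈ S := by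
  rw [closedIdeal, Submodule.mem_sInf] at hx
  let I : Ideal A := { S with smul_mem' := fun a r hr' => hl a r hr' }
  exact hx I ⟨⟨fun b ha => hr b _ ha⟩, hS, hR⟩

end ClosedIdeal

section FreeTop
variable {G : Type}

theorem FreeTop.smul_def (a : Base) (f : FreeTop G) : a • f = scalar a * f := rfl

theorem FreeTop.hbar_smul (f : FreeTop G) : hbar • f = X * f := by
  rw [FreeTop.smul_def, scalar_X]

/-- A closed submodule of `ℂ⟨G⟩⟦ħ⟧` which contains the constants and is stable under
multiplication by the generators on the left is everything. -/
theorem FreeTop.mem_of_gen_mul {S : Submodule Base (FreeTop G)}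
    (hS : IsHbarClosed (S : Set (FreeTop G))) (h1 : 1 ∈ S)
    (h : ∀ g, ∀ f ∈ S, PowerSeries.C (FreeAlgebra.ι ℂ g) * f ∈ S) (f : FreeTop G) : f ∈ S := by
  have hmul : ∀ (a : FreeAlgebra ℂ G), ∀ f ∈ S, PowerSeries.C a * f ∈ S := by
    intro a
    induction a with
    | grade0 r =>
      intro f hf
      rw [← scalar_C]
      exact S.smul_mem _ hf
    | grade1 g => exact h g
    | mul a b ha hb => intro f hf; rw [map_mul, mul_assoc]; exact ha _ (hb _ hf)
    | add a b ha hb => intro f hf; rw [map_add, add_mul]; exact S.add_mem (ha _ hf) (hb _ hf)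
  refine Submodule.eq_top_of_closed hS (fun v => ⟨PowerSeries.C (coeff 0 v), ?_,
    PowerSeries.mk fun n => coeff (n + 1) v, ?_⟩) f
  · simpa using hmul (coeff 0 v) 1 h1
  · rw [FreeTop.hbar_smul, add_comm]
    simpa using eq_X_mul_shift_add_const v

/-- To show that the elements of a closed ideal satisfy a closed linear condition, it suffices to
check this condition on the generators of the ideal and that it is stable under multiplications by
generators of the algebra. -/
theorem FreeTop.closedIdeal_induction {R : Set (FreeTop G)} {S : Submodule Base (FreeTop G)}
    (hS : IsHbarClosed (S : Set (FreeTop G))) (hR : ∀ r ∈ R, r ∈ S)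
    (hl : ∀ g, ∀ r ∈ S, PowerSeries.C (FreeAlgebra.ι ℂ g) * r ∈ S)
    (hr : ∀ g, ∀ r ∈ S, r * PowerSeries.C (FreeAlgebra.ι ℂ g) ∈ S) {x : FreeTop G}
    (hx : x ∈ closedIdeal R) : x ∈ S := by
  have hl' : ∀ a, ∀ r ∈ S, a * r ∈ S := by
    intro a r hr
    have := FreeTop.mem_of_gen_mul (S := S.comap (LinearMap.mulRight Base r))
      (hS.preimage _) (by simpa using hr) (fun g f hf => by
        simp only [Submodule.mem_comap, LinearMap.mulRight_apply] at hf ⊢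
        rw [mul_assoc]
        exact hl g _ hf) a
    simpa using this
  have hr' : ∀ a, ∀ r ∈ S, r * a ∈ S := by
    intro a
    let T : Submodule Base (FreeTop G) :=
      { carrier := {a | ∀ r ∈ S, r * a ∈ S}
        zero_mem' := fun r _ => by simp
        add_mem' := fun ha hb r hr => by rw [mul_add]; exact S.add_mem (ha r hr) (hb r hr)
        smul_mem' := fun c a ha r hr => by rw [mul_smul_comm]; exact S.smul_mem _ (ha r hr) }
    refine FreeTop.mem_of_gen_mul (S := T) ?_ (fun r hr => by simpa using hr)
      (fun g f hf r hr' => ?_) a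
    · have : (T : Set (FreeTop G)) = ⋂ r : S, (LinearMap.mulLeft Base (r : FreeTop G)) ⁻¹' S := by
        ext a
        simp [T]
      rw [this]
      exact IsHbarClosed.iInter fun r => hS.preimage _
    · rw [← mul_assoc]
      exact hf _ (hr g _ hr')
  exact QuantumToroidal.closedIdeal_induction hS hR hl' hr' hx

end FreeTop

/-! ### Operators on spaces of words -/

/-- The direct sum of copies of `W` indexed by the words in the alphabet `L`. -/
def Words (L W : Type) [Zero W] : Type := List L →₀ W

section Words
variable {L W : Type} [AddCommGroup W] [Module ℂ W]

instance : AddCommGroup (Words L W) := inferInstanceAs (AddCommGroup (List L →₀ W))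

instance : Module ℂ (Words L W) := inferInstanceAs (Module ℂ (List L →₀ W))

/-- The embedding of `W` as the component of the word `w`. -/
def Words.single (w : List L) : W →ₗ[ℂ] Words L W := Finsupp.lsingle w

/-- The linear map with given restrictions to the components. -/
def Words.lift {M : Type} [AddCommGroup M] [Module ℂ M] (f : List L → W →ₗ[ℂ] M) :
    Words L W →ₗ[ℂ] M := Finsupp.lsum ℂ f

theorem Words.lift_single {M : Type} [AddCommGroup M] [Module ℂ M] (f : List L → W →ₗ[ℂ] M)
    (w : List L) (u : W) : Words.lift f (Words.single w u) = f w u := by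
  simp only [Words.lift, Words.single]
  exact Finsupp.sum_single_index (map_zero _)

theorem Words.hom_ext {M : Type} [AddCommGroup M] [Module ℂ M] {f g : Words L W →ₗ[ℂ] M}
    (h : ∀ w u, f (Words.single w u) = g (Words.single w u)) : f = g :=
  Finsupp.lhom_ext h

/-- The operator on `Words L W` which prepends the letter `x`. -/
def prepend (x : L) : Module.End ℂ (Words L W) := Words.lift fun w => Words.single (x :: w)

theorem prepend_single (x : L) (w : List L) (u : W) :
    prepend x (Words.single w u) = Words.single (x :: w) u :=
  Words.lift_single _ _ _

/-- The embedding of `W` as the component of the empty word. -/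
def emb : W →ₗ[ℂ] Words L W := Words.single []

/-- The value on the component of a word of the operator `indOp`. -/
def indAux (d : W →ₗ[ℂ] Words L W) (D : L → Module.End ℂ (Words L W)) :
    List L → (W →ₗ[ℂ] Words L W)
  | [] => d
  | x :: w => prepend x ∘ₗ indAux d D w + D x ∘ₗ Words.single w

/-- The operator whose restriction to `W` is `d` and whose commutator with the operator which
prepends `x` is `D x`. -/
def indOp (d : W →ₗ[ℂ] Words L W) (D : L → Module.End ℂ (Words L W)) :
    Module.End ℂ (Words L W) := Words.lift (indAux d D)

theorem indOp_emb (d : W →ₗ[ℂ] Words L W) (D : L → Module.End ℂ (Words L W)) (u : W) :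
    indOp d D (emb u) = d u := Words.lift_single _ _ _

theorem indOp_mul_prepend (d : W →ₗ[ℂ] Words L W) (D : L → Module.End ℂ (Words L W))
    (x : L) : indOp d D * prepend x = prepend x * indOp d D + D x := by
  refine Words.hom_ext fun w u => ?_
  simp only [Module.End.mul_apply, LinearMap.add_apply, prepend_single]
  simp only [indOp, Words.lift_single, indAux]
  rfl

/-- The restriction of `D` to `W` is `f`. -/
def Extends (D : (Module.End ℂ (Words L W))⟦X⟧) (f : (Module.End ℂ W)⟦X⟧) : Prop :=
  ∀ n u, coeff n D (emb u) = emb (coeff n f u)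

/-- The series of operators whose restriction to `W` is `f` and whose commutator with the operator
which prepends `x` is `D x`. -/
def indSeries (f : (Module.End ℂ W)⟦X⟧) (D : L → (Module.End ℂ (Words L W))⟦X⟧) :
    (Module.End ℂ (Words L W))⟦X⟧ :=
  PowerSeries.mk fun n => indOp (emb ∘ₗ coeff n f) fun x => coeff n (D x)

theorem extends_indSeries (f : (Module.End ℂ W)⟦X⟧)
    (D : L → (Module.End ℂ (Words L W))⟦X⟧) : Extends (indSeries f D) f := fun n u => by
  rw [indSeries, coeff_mk, indOp_emb]
  rfl

theorem indSeries_comm (f : (Module.End ℂ W)⟦X⟧) (D : L → (Module.End ℂ (Words L W))⟦X⟧)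
    (x : L) : indSeries f D * PowerSeries.C (prepend x) -
      PowerSeries.C (prepend x) * indSeries f D = D x := by
  rw [sub_eq_iff_eq_add']
  ext1 n
  rw [map_add, coeff_mul_C, coeff_C_mul, indSeries, coeff_mk]
  exact indOp_mul_prepend _ _ x

/-- A series of operators which commutes with the letters and vanishes on the empty word is zero.
This is how identities between operators on `Words L W` are verified: by comparing commutators
with the letters, and the restrictions to `W`. -/
theorem eq_zero_of_commute_prepend {Z : (Module.End ℂ (Words L W))⟦X⟧}
    (h : ∀ x, Commute Z (PowerSeries.C (prepend x))) (h0 : Extends Z 0) : Z = 0 := by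
  ext1 n
  refine Words.hom_ext fun w => ?_
  induction w with
  | nil => intro u; exact (h0 n u).trans (by simp)
  | cons x w ih =>
    intro u
    have := commute_C_iff.1 (h x).symm n
    rw [← prepend_single, ← Module.End.mul_apply, ← this.eq, Module.End.mul_apply, ih]
    simp

namespace Extends
variable {D D' : (Module.End ℂ (Words L W))⟦X⟧} {f f' : (Module.End ℂ W)⟦X⟧}

theorem sub (h : Extends D f) (h' : Extends D' f') : Extends (D - D') (f - f') := fun n u => by
  simp [h n u, h' n u]

theorem mul (h : Extends D f) (h' : Extends D' f') : Extends (D * D') (f * f') := fun n u => by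
  simp [coeff_mul, h' _ u, h _ _]

theorem scalar (a : Base) : Extends (L := L) (W := W) (scalar a) (QuantumToroidal.scalar a) :=
  fun n u => by simp [QuantumToroidal.scalar, Module.algebraMap_end_apply]

theorem mk_shift (h : Extends D f) : Extends (PowerSeries.mk fun n => coeff (n + 1) D)
    (PowerSeries.mk fun n => coeff (n + 1) f) := fun n u => by
  simp [h _ u]

theorem qExp {a : Module.End ℂ (Words L W)} {a' : Module.End ℂ W}
    (h : ∀ u, a (emb u) = emb (a' u)) (s : ℂ) :
    Extends (qExp s a) (QuantumToroidal.qExp s a') := fun n u => by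
  have : ∀ n, (a ^ n) (emb u) = emb ((a' ^ n) u) := by
    intro n
    induction n with
    | zero => rfl
    | succ n ih => rw [pow_succ', pow_succ', Module.End.mul_apply, ih, h]; rfl
  simp [QuantumToroidal.qExp, this]

theorem C {a : Module.End ℂ (Words L W)} {a' : Module.End ℂ W}
    (h : ∀ u, a (emb u) = emb (a' u)) : Extends (PowerSeries.C a) (PowerSeries.C a') := fun n u => by
  rw [coeff_C, coeff_C]
  split_ifs
  · exact h u
  · simp

theorem kappa {a : Module.End ℂ (Words L W)} {a' : Module.End ℂ W}
    (h : ∀ u, a (emb u) = emb (a' u)) (ε : ℤˣ) (k m : ℤ) :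
    Extends (kappa a ε k m) (QuantumToroidal.kappa a' ε k m) :=
  (scalar _).mul (qExp h _)

theorem mu {a : Module.End ℂ (Words L W)} {a' : Module.End ℂ W}
    (h : ∀ u, a (emb u) = emb (a' u)) (k m : ℤ) :
    Extends (mu a k m) (QuantumToroidal.mu a' k m) :=
  (scalar _).mul ((scalar _).mul ((qExp h _).sub (qExp h _)).mk_shift)

end Extends
end Words

/-! ### The structure constants of the Cartan part -/

section Kappa
variable {K : Type} [Ring K] [Algebra ℂ K] {c : K}

theorem commute_kappa {z : K⟦X⟧} (hz : Commute (PowerSeries.C c) z) (ε : ℤˣ) (a m : ℤ) :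
    Commute (kappa c ε a m) z :=
  (scalar_commute _ _).mul_left (qExp_commute hz _)

theorem commute_mu {z : K⟦X⟧} (hz : Commute (PowerSeries.C c) z) (a m : ℤ) :
    Commute (mu c a m) z := by
  have h : Commute (qd * mu c a m) z := by
    rw [qd_mul_mu]
    exact (scalar_commute _ _).mul_left ((qExp_commute hz _).sub_left (qExp_commute hz _))
  have h2 := h.eq
  rw [mul_assoc, ← mul_assoc z, ← (scalar_commute _ z).eq, mul_assoc] at h2
  exact qd_mul_inj.1 h2

theorem mu_neg (a m : ℤ) : mu c a (-m) = -mu c a m := by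
  rw [← qd_mul_inj, mul_neg, qd_mul_mu, qd_mul_mu, nu_neg_right]
  push_cast
  rw [neg_neg, ← mul_neg, neg_sub]

theorem mu_zero (a : ℤ) : mu c a 0 = 0 := by
  rw [← qd_mul_inj, qd_mul_mu]
  simp

end Kappa

/-! ### Polynomials in the Cartan generators and words in one half -/

/-- The polynomial algebra on the Cartan generators. -/
abbrev CartanPoly : Type := MvPolynomial CartanGen ℂ

/-- The space `ℂ[h_{i,n}, c] ⊗ ℂ⟨y_{i,n}⟩`. -/
abbrev HighestSpace : Type := Words HalfGen CartanPoly

/-- Multiplication by a polynomial. -/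
def polyMul : CartanPoly →ₐ[ℂ] Module.End ℂ HighestSpace :=
  AlgHom.ofLinearMap
    { toFun := fun p => Words.lift fun w => Words.single w ∘ₗ LinearMap.mulLeft ℂ p
      map_add' := fun p r => Words.hom_ext fun w u => by
        simp [Words.lift_single, add_mul]
      map_smul' := fun a p => Words.hom_ext fun w u => by
        simp [Words.lift_single] }
    (Words.hom_ext fun w u => by simp [Words.lift_single])
    fun p r => Words.hom_ext fun w u => by simp [Words.lift_single]

theorem polyMul_single (p : CartanPoly) (w : List HalfGen) (r : CartanPoly) :
    polyMul p (Words.single w r) = Words.single w (p * r) :=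
  Words.lift_single _ _ _

/-- The partial derivatives. -/
def polyDeriv (g : CartanGen) : Module.End ℂ HighestSpace :=
  Words.lift fun w => Words.single w ∘ₗ (MvPolynomial.pderiv g).toLinearMap

theorem polyDeriv_single (g : CartanGen) (w : List HalfGen) (p : CartanPoly) :
    polyDeriv g (Words.single w p) = Words.single w (MvPolynomial.pderiv g p) :=
  Words.lift_single _ _ _

open Classical in
theorem polyDeriv_mul_polyMul (g g' : CartanGen) :
    polyDeriv g * polyMul (MvPolynomial.X g') = polyMul (MvPolynomial.X g') * polyDeriv g +
      if g = g' then 1 else 0 := by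
  refine Words.hom_ext fun w p => ?_
  simp only [Module.End.mul_apply, LinearMap.add_apply, polyMul_single, polyDeriv_single,
    Derivation.leibniz, MvPolynomial.pderiv_X, smul_eq_mul, map_add]
  congr 1
  by_cases h : g = g'
  · subst h; simp
  · rw [Pi.single_eq_of_ne (Ne.symm h)]; simp [h]

theorem polyDeriv_polyMul_commute {g g' : CartanGen} (h : g ≠ g') :
    Commute (polyDeriv g) (polyMul (MvPolynomial.X g')) := by
  have := polyDeriv_mul_polyMul g g'
  rwa [if_neg h, add_zero] at this

theorem polyMul_commute (p r : CartanPoly) : Commute (polyMul p) (polyMul r) := by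
  rw [commute_iff_eq, ← map_mul, mul_comm, map_mul]

/-- A family of operators which vanish on the words and whose commutators with the multiplications
by the variables are expressed by operators of the family is zero. -/
theorem eq_zero_of_polyMul {I : Type} {Z : I → (Module.End ℂ HighestSpace)⟦X⟧}
    (a : CartanGen → (Module.End ℂ HighestSpace)⟦X⟧) (s : CartanGen → I → I)
    (h : ∀ i g, Z i * PowerSeries.C (polyMul (MvPolynomial.X g)) =
      PowerSeries.C (polyMul (MvPolynomial.X g)) * Z i + a g * Z (s g i))
    (h0 : ∀ i n w, coeff n (Z i) (Words.single w 1) = 0) (i : I) : Z i = 0 := by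
  ext1 n
  refine Words.hom_ext fun w p => ?_
  rw [map_zero, LinearMap.zero_apply]
  induction p using MvPolynomial.induction_on generalizing i n with
  | C r => rw [← mul_one (MvPolynomial.C r), ← MvPolynomial.smul_eq_C_mul, map_smul, map_smul, h0,
      smul_zero]
  | add p q hp hq => rw [map_add, map_add, hp, hq, add_zero]
  | mul_X p g hp =>
    have := congrArg (fun f : (Module.End ℂ HighestSpace)⟦X⟧ => coeff n f (Words.single w p)) (h i g)
    rw [coeff_mul_C, map_add, coeff_C_mul, LinearMap.add_apply, Module.End.mul_apply,
      Module.End.mul_apply, polyMul_single, hp, map_zero, zero_add, coeff_mul,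
      LinearMap.sum_apply] at this
    rw [mul_comm, this]
    exact Finset.sum_eq_zero fun x _ => by rw [Module.End.mul_apply, hp, map_zero]

theorem polyDeriv_commute (g g' : CartanGen) : Commute (polyDeriv g) (polyDeriv g') := by
  have hC : ∀ g u : CartanGen, ∃ r : ℂ, (PowerSeries.C (polyDeriv g) : (Module.End ℂ _)⟦X⟧) *
      PowerSeries.C (polyMul (MvPolynomial.X u)) =
      PowerSeries.C (polyMul (MvPolynomial.X u)) * PowerSeries.C (polyDeriv g) +
        scalar (PowerSeries.C r) := by
    intro g u
    classical
    refine ⟨if g = u then 1 else 0, ?_⟩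
    rw [← map_mul, polyDeriv_mul_polyMul, map_add, map_mul]
    split_ifs <;> simp
  have := eq_zero_of_polyMul (I := Unit) (Z := fun _ => PowerSeries.C (polyDeriv g) *
    PowerSeries.C (polyDeriv g') - PowerSeries.C (polyDeriv g') * PowerSeries.C (polyDeriv g))
    (fun _ => 0) (fun _ i => i) (fun _ u => ?_) (fun _ n w => ?_) ()
  · have h := congrArg (coeff 0) this
    rw [← map_mul, ← map_mul, ← map_sub, coeff_zero_C, map_zero] at h
    exact sub_eq_zero.1 h
  · obtain ⟨r, h1⟩ := hC g u
    obtain ⟨r', h2⟩ := hC g' u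
    rw [zero_mul, add_zero, sub_mul, mul_assoc, mul_assoc, h1, h2, mul_add, mul_add, ← mul_assoc,
      ← mul_assoc, h1, h2, ← (scalar_commute _ (PowerSeries.C (polyDeriv g))).eq,
      ← (scalar_commute _ (PowerSeries.C (polyDeriv g'))).eq]
    noncomm_ring
  · rw [← map_mul, ← map_mul, ← map_sub, coeff_C]
    split_ifs
    · simp [polyDeriv_single]
    · simp

/-- The action of `c` on `ℂ[h_{i,n}, c] ⊗ ℂ⟨y_{i,n}⟩`. -/
def highestC : Module.End ℂ HighestSpace := polyMul (MvPolynomial.X CartanGen.c)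

/-- The action of `h_{i,m}` on `ℂ[h_{i,n}, c] ⊗ ℂ⟨y_{i,n}⟩`: creation operators for `m ≤ 0`,
creation plus annihilation operators for `m > 0`. -/
def highestH (i : Fin 2) (m : ℤ) : (Module.End ℂ HighestSpace)⟦X⟧ :=
  PowerSeries.C (polyMul (MvPolynomial.X (CartanGen.h i m))) + if 0 < m then
    ∑ j, mu highestC (cartan i j) m * PowerSeries.C (polyDeriv (CartanGen.h j (-m))) else 0

theorem highestC_commute_deriv (i : Fin 2) (m : ℤ) :
    Commute (PowerSeries.C highestC) (PowerSeries.C (polyDeriv (CartanGen.h i m))) := by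
  rw [commute_iff_eq, ← map_mul, ← map_mul]
  congr 1
  exact (polyDeriv_polyMul_commute (by simp)).symm

theorem highestC_commute_mul (p : CartanPoly) :
    Commute (PowerSeries.C highestC) (PowerSeries.C (polyMul p)) := by
  rw [commute_iff_eq, ← map_mul, ← map_mul]
  congr 1
  exact polyMul_commute _ _

/-- The operators `highestH` satisfy the Heisenberg relations. -/
theorem highest_isCartanAction : IsCartanAction highestC
    (fun i => polyMul (MvPolynomial.X (CartanGen.h i 0))) highestH where
  commute_c i m := by
    rw [highestH]
    refine (highestC_commute_mul (MvPolynomial.X (CartanGen.h i m))).add_right ?_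
    split_ifs
    · exact Commute.sum_right _ _ _ fun j _ => (commute_mu (Commute.refl
        (PowerSeries.C highestC)) (cartan i j) m).symm.mul_right (highestC_commute_deriv j (-m))
    · exact Commute.zero_right _
  zero i := by simp [highestH]
  comm i j m n := by
    set M : CartanPoly → (Module.End ℂ HighestSpace)⟦X⟧ := fun p => PowerSeries.C (polyMul p)
    set d : Fin 2 → ℤ → (Module.End ℂ HighestSpace)⟦X⟧ :=
      fun i m => PowerSeries.C (polyDeriv (CartanGen.h i m))
    have hmM : ∀ a m p, Commute (mu highestC a m) (M p) := fun a m p =>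
      commute_mu (highestC_commute_mul p) _ _
    have hmd : ∀ a m i k, Commute (mu highestC a m) (d i k) := fun a m i k =>
      commute_mu (highestC_commute_deriv i k) _ _
    have hmm : ∀ a m a' m', Commute (mu highestC a m) (mu highestC a' m') := fun a m a' m' =>
      commute_mu (commute_mu (Commute.refl (PowerSeries.C highestC)) a' m').symm a m
    have hMM : ∀ p r, Commute (M p) (M r) := fun p r => by
      rw [commute_iff_eq, ← map_mul PowerSeries.C, ← map_mul PowerSeries.C, (polyMul_commute p r).eq]
    have hdd : ∀ i k j l, Commute (d i k) (d j l) := fun i k j l => by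
      rw [commute_iff_eq, ← map_mul, ← map_mul, (polyDeriv_commute _ _).eq]
    -- the commutator of the annihilation part of `h_{i,m}` with a creation operator
    have hdM : ∀ (i j : Fin 2) (m n : ℤ), 0 < m →
        (∑ k, mu highestC (cartan i k) m * d k (-m)) * M (MvPolynomial.X (CartanGen.h j n)) -
        M (MvPolynomial.X (CartanGen.h j n)) * (∑ k, mu highestC (cartan i k) m * d k (-m)) =
        if m + n = 0 then mu highestC (cartan i j) m else 0 := by
      intro i j m n hm
      rw [Finset.sum_mul, Finset.mul_sum, ← Finset.sum_sub_distrib]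
      have : ∀ k, mu highestC (cartan i k) m * d k (-m) * M (MvPolynomial.X (CartanGen.h j n)) -
          M (MvPolynomial.X (CartanGen.h j n)) * (mu highestC (cartan i k) m * d k (-m)) =
          if k = j then (if m + n = 0 then mu highestC (cartan i k) m else 0) else 0 := by
        intro k
        have e := congrArg (PowerSeries.C (R := Module.End ℂ HighestSpace))
          (polyDeriv_mul_polyMul (CartanGen.h k (-m)) (CartanGen.h j n))
        rw [map_add, map_mul, map_mul] at e
        change d k (-m) * M _ = M _ * d k (-m) + _ at e
        rw [← mul_assoc (M _), ← (hmM _ _ _).eq, mul_assoc, mul_assoc, e, mul_add,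
          add_sub_cancel_left]
        simp only [CartanGen.h.injEq]
        by_cases hk : k = j
        · by_cases hmn : m + n = 0
          · rw [if_pos ⟨hk, by omega⟩, if_pos hk, if_pos hmn, map_one, mul_one]
          · rw [if_neg (by omega), if_pos hk, if_neg hmn, map_zero, mul_zero]
        · rw [if_neg (by tauto), if_neg hk, map_zero, mul_zero]
      rw [Finset.sum_congr rfl fun k _ => this k]
      simp
    have hdd' : ∀ (i j : Fin 2) (m n : ℤ), Commute (∑ k, mu highestC (cartan i k) m * d k (-m))
        (∑ k, mu highestC (cartan j k) n * d k (-n)) := fun i j m n =>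
      Commute.sum_left _ _ _ fun k _ => Commute.sum_right _ _ _ fun l _ =>
        ((hmm _ _ _ _).mul_right (hmd _ _ _ _)).mul_left
          ((hmd _ _ _ _).symm.mul_right (hdd _ _ _ _))
    have hH : ∀ i m, highestH i m = M (MvPolynomial.X (CartanGen.h i m)) +
      if 0 < m then ∑ k, mu highestC (cartan i k) m * d k (-m) else 0 := fun i m => rfl
    have hsymm : ∀ m : ℤ, mu highestC (cartan i j) (-m) = -mu highestC (cartan j i) m := fun m => by
      rw [mu_neg, cartan_symm]
    rw [hH, hH]
    have e0 := (hMM (MvPolynomial.X (CartanGen.h i m)) (MvPolynomial.X (CartanGen.h j n))).eq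
    have e1 := hdM i j m n
    have e2 := hdM j i n m
    have e3 := (hdd' i j m n).eq
    set A := M (MvPolynomial.X (CartanGen.h i m))
    set B := M (MvPolynomial.X (CartanGen.h j n))
    set S := ∑ k, mu highestC (cartan i k) m * d k (-m)
    set T := ∑ k, mu highestC (cartan j k) n * d k (-n)
    by_cases hm : 0 < m <;> by_cases hn : 0 < n
    · rw [if_pos hm, if_pos hn, if_neg (by omega)]
      have e1 := e1 hm
      have e2 := e2 hn
      rw [if_neg (by omega), sub_eq_zero] at e1 e2
      simp only [add_mul, mul_add, e0, e1, e2, e3]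
      abel
    · rw [if_pos hm, if_neg hn, ← e1 hm]
      simp only [add_mul, mul_add, e0, add_zero]
      abel
    · rw [if_neg hm, if_pos hn]
      have e2 := e2 hn
      simp only [add_mul, mul_add, e0, add_zero]
      rw [show B * A + (A * T) - (B * A + T * A) = - (T * A - A * T) by abel, e2]
      by_cases h : m + n = 0
      · rw [if_pos h, if_pos (by omega), show m = -n by omega, hsymm]
      · rw [if_neg h, if_neg (by omega), neg_zero]
    · rw [if_neg hm, if_neg hn, add_zero, add_zero, e0, sub_self]
      split_ifs with h
      · rw [show m = 0 by omega, mu_zero]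
      · rfl

section Naturality
variable {B K : Type} [Ring B] [Algebra ℂ B] [Ring K] [Algebra ℂ K] (f : B →ₐ[ℂ] K)

theorem map_scalar (s : Base) : PowerSeries.map (f : B →+* K) (scalar s) = scalar s := by
  ext n
  simp [scalar]

theorem map_qExp (s : ℂ) (b : B) : PowerSeries.map (f : B →+* K) (qExp s b) = qExp s (f b) := by
  ext n
  simp [qExp]

theorem map_kappa (c : B) (ε : ℤˣ) (a m : ℤ) :
    PowerSeries.map (f : B →+* K) (kappa c ε a m) = kappa (f c) ε a m := by
  rw [kappa, map_mul, map_scalar, map_qExp, kappa]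

end Naturality

/-! ### The action of `x⁺` on words in one half -/

/-- The homomorphism from `ℂ[h_{i,n}, c]` to `ℂ[h_{i,n}, c][T, T⁻¹]⟦ħ⟧` with
`h_{i,n} ↦ h_{i,n} - κ_{ij,n} T^n`. -/
def shiftHom (j : Fin 2) : CartanPoly →ₐ[ℂ] (AddMonoidAlgebra CartanPoly ℤ)⟦X⟧ :=
  MvPolynomial.aeval fun g => PowerSeries.C (algebraMap CartanPoly _ (MvPolynomial.X g)) -
    match g with
    | CartanGen.h i l => PowerSeries.map (algebraMap CartanPoly (AddMonoidAlgebra CartanPoly ℤ))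
        (kappa (MvPolynomial.X CartanGen.c) 1 (cartan i j) l) *
          PowerSeries.C (AddMonoidAlgebra.single l 1)
    | CartanGen.c => 0

/-- The linear map `p T^k ↦ p ⊗ y_{j,m+k} w`: the variable `T` of `shiftHom` keeps track of the
mode. -/
def insertMode (j : Fin 2) (m : ℤ) (w : List HalfGen) :
    AddMonoidAlgebra CartanPoly ℤ →ₗ[ℂ] HighestSpace :=
  (Finsupp.lsum ℂ fun t : ℤ => Words.single (HalfGen.x j (m + t) :: w)) ∘ₗ
    (AddMonoidAlgebra.coeffLinearEquiv ℂ).toLinearMap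

theorem insertMode_single (j : Fin 2) (m : ℤ) (w : List HalfGen) (t : ℤ) (p : CartanPoly) :
    insertMode j m w (AddMonoidAlgebra.single t p) = Words.single (HalfGen.x j (m + t) :: w) p := by
  exact Finsupp.sum_single_index (map_zero _)

theorem insertMode_algebraMap_mul (j : Fin 2) (m : ℤ) (w : List HalfGen) (p : CartanPoly)
    (k : AddMonoidAlgebra CartanPoly ℤ) :
    insertMode j m w (algebraMap _ _ p * k) = polyMul p (insertMode j m w k) := by
  induction k using AddMonoidAlgebra.induction_linear with
  | zero => simp
  | add k l hk hl => rw [mul_add, map_add, hk, hl, map_add, map_add]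
  | single t r =>
    rw [AddMonoidAlgebra.coe_algebraMap, Function.comp_apply, AddMonoidAlgebra.single_mul_single,
      zero_add, insertMode_single, insertMode_single, polyMul_single]
    rfl

theorem insertMode_single_mul (j : Fin 2) (m : ℤ) (w : List HalfGen) (l : ℤ)
    (k : AddMonoidAlgebra CartanPoly ℤ) :
    insertMode j m w (AddMonoidAlgebra.single l 1 * k) = insertMode j (m + l) w k := by
  induction k using AddMonoidAlgebra.induction_linear with
  | zero => simp
  | add k k' hk hl => rw [mul_add, map_add, hk, hl, map_add]
  | single t r =>
    rw [AddMonoidAlgebra.single_mul_single, insertMode_single, insertMode_single, one_mul, add_assoc]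

/-- The action of `x_{j,m}^+` on `ℂ[h_{i,n}, c] ⊗ ℂ⟨y_{i,n}⟩`: the polynomial `p` is moved past
`x_{j,m}^+` by means of `shiftHom`, which also shifts `m`, and then the letter `y_{j,m}` is
prepended. -/
def highestX (j : Fin 2) (m : ℤ) : (Module.End ℂ HighestSpace)⟦X⟧ :=
  PowerSeries.mk fun n => Words.lift fun w =>
    insertMode j m w ∘ₗ (coeff n).restrictScalars ℂ ∘ₗ (shiftHom j).toLinearMap

theorem coeff_highestX (j : Fin 2) (m : ℤ) (n : ℕ) (w : List HalfGen) (p : CartanPoly) :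
    coeff n (highestX j m) (Words.single w p) = insertMode j m w (coeff n (shiftHom j p)) := by
  rw [highestX, coeff_mk, Words.lift_single]
  rfl

theorem coeff_highestX_one (j : Fin 2) (m : ℤ) (n : ℕ) (w : List HalfGen) :
    coeff n (highestX j m) (Words.single w 1) =
      if n = 0 then Words.single (HalfGen.x j m :: w) 1 else 0 := by
  rw [coeff_highestX, map_one, coeff_one]
  split_ifs
  · rw [AddMonoidAlgebra.one_def, insertMode_single, add_zero]
  · simp

/-- The operators `highestX` pass the creation operators according to `shiftHom`. -/
theorem highestX_mul_h (j : Fin 2) (m : ℤ) (i : Fin 2) (l : ℤ) :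
    highestX j m * PowerSeries.C (polyMul (MvPolynomial.X (CartanGen.h i l))) =
      PowerSeries.C (polyMul (MvPolynomial.X (CartanGen.h i l))) * highestX j m +
        -kappa highestC 1 (cartan i j) l * highestX j (m + l) := by
  ext1 n
  refine Words.hom_ext fun w p => ?_
  have hk : kappa highestC 1 (cartan i j) l = PowerSeries.map
      (polyMul : CartanPoly →+* Module.End ℂ HighestSpace)
      (kappa (MvPolynomial.X CartanGen.c) 1 (cartan i j) l) := by
    rw [map_kappa]; rfl
  rw [coeff_mul_C, map_add, coeff_C_mul, LinearMap.add_apply, Module.End.mul_apply,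
    Module.End.mul_apply, polyMul_single, coeff_highestX, coeff_highestX, map_mul]
  have hS : shiftHom j (MvPolynomial.X (CartanGen.h i l)) =
      PowerSeries.C (algebraMap CartanPoly _ (MvPolynomial.X (CartanGen.h i l))) -
      PowerSeries.map (algebraMap CartanPoly (AddMonoidAlgebra CartanPoly ℤ))
        (kappa (MvPolynomial.X CartanGen.c) 1 (cartan i j) l) *
          PowerSeries.C (AddMonoidAlgebra.single l 1) := by
    rw [shiftHom, MvPolynomial.aeval_X]
  rw [hS, sub_mul, map_sub, map_sub, coeff_C_mul, insertMode_algebraMap_mul, neg_mul, map_neg,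
    LinearMap.neg_apply, ← sub_eq_add_neg]
  congr 1
  rw [mul_assoc, coeff_mul, coeff_mul, map_sum, LinearMap.sum_apply]
  refine Finset.sum_congr rfl fun q _ => ?_
  rw [coeff_map, coeff_C_mul, insertMode_algebraMap_mul, insertMode_single_mul, Module.End.mul_apply,
    coeff_highestX, hk, coeff_map]
  rfl

theorem highestX_mul_c (j : Fin 2) (m : ℤ) :
    highestX j m * PowerSeries.C highestC = PowerSeries.C highestC * highestX j m := by
  ext1 n
  refine Words.hom_ext fun w p => ?_
  rw [coeff_mul_C, coeff_C_mul, Module.End.mul_apply, Module.End.mul_apply, highestC,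
    polyMul_single, coeff_highestX, coeff_highestX, map_mul]
  have hS : shiftHom j (MvPolynomial.X CartanGen.c) =
      PowerSeries.C (algebraMap CartanPoly _ (MvPolynomial.X CartanGen.c)) := by
    rw [shiftHom, MvPolynomial.aeval_X]
    simp
  rw [hS, coeff_C_mul, insertMode_algebraMap_mul]

theorem highestX_commute_deriv (j : Fin 2) (i : Fin 2) (l m : ℤ) :
    Commute (PowerSeries.C (polyDeriv (CartanGen.h i l))) (highestX j m) := by
  have key := eq_zero_of_polyMul (I := ℤ)
    (Z := fun m => PowerSeries.C (polyDeriv (CartanGen.h i l)) * highestX j m -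
      highestX j m * PowerSeries.C (polyDeriv (CartanGen.h i l)))
    (fun g => match g with
      | CartanGen.h i' l' => -kappa highestC 1 (cartan i' j) l'
      | CartanGen.c => 0)
    (fun g m => match g with
      | CartanGen.h i' l' => m + l'
      | CartanGen.c => m)
    (fun m g => ?_) (fun m n w => ?_) m
  · exact sub_eq_zero.1 key
  · set d : (Module.End ℂ HighestSpace)⟦X⟧ := PowerSeries.C (polyDeriv (CartanGen.h i l))
    cases g with
    | c =>
      have h1 := highestX_mul_c j m
      have h2 : Commute (PowerSeries.C highestC) d := highestC_commute_deriv i l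
      change (d * highestX j m - highestX j m * d) * PowerSeries.C highestC =
        PowerSeries.C highestC * (d * highestX j m - highestX j m * d) + 0 * _
      rw [zero_mul, add_zero, sub_mul, mul_assoc, mul_assoc, h1, ← h2.eq, ← mul_assoc, ← mul_assoc,
        ← h2.eq, h1]
      noncomm_ring
    | h i' l' =>
      have h1 := highestX_mul_h j m i' l'
      have hk : Commute (kappa highestC 1 (cartan i' j) l') d :=
        commute_kappa (highestC_commute_deriv i l) _ _ _
      obtain ⟨r, h2⟩ : ∃ r : Base, d * PowerSeries.C (polyMul (MvPolynomial.X (CartanGen.h i' l'))) =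
          PowerSeries.C (polyMul (MvPolynomial.X (CartanGen.h i' l'))) * d + scalar r := by
        classical
        refine ⟨if CartanGen.h i l = CartanGen.h i' l' then 1 else 0, ?_⟩
        rw [← map_mul PowerSeries.C, polyDeriv_mul_polyMul, map_add, map_mul]
        split_ifs <;> simp [d]
      dsimp only
      set M : (Module.End ℂ HighestSpace)⟦X⟧ :=
        PowerSeries.C (polyMul (MvPolynomial.X (CartanGen.h i' l')))
      set k := kappa highestC 1 (cartan i' j) l'
      rw [sub_mul, mul_assoc, mul_assoc, h1, h2, mul_add, mul_add, ← mul_assoc d M, h2,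
        ← mul_assoc (highestX j m) M, h1, ← (scalar_commute r (highestX j m)).eq, neg_mul, neg_mul,
        mul_neg, ← mul_assoc d k, ← hk.eq]
      noncomm_ring
  · rw [map_sub, coeff_C_mul, coeff_mul_C, LinearMap.sub_apply, Module.End.mul_apply,
      Module.End.mul_apply, polyDeriv_single, coeff_highestX_one]
    split_ifs <;> simp [polyDeriv_single]

/-- The operators `highestX` have the commutation relations of the `x^+_{j,m}`. The derivatives in
`h_{i,m}` commute with them, since `shiftHom` only translates the variables; the commutator comes
from the multiplication by `h_{i,m}`. -/
theorem highestX_isCurrent (j : Fin 2) : IsCurrent highestC highestH 1 j (highestX j) where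
  commute_c m := (highestX_mul_c j m).symm
  comm i m n := by
    have h1 := highestX_mul_h j n i m
    have h2 : Commute (if 0 < m then ∑ k, mu highestC (cartan i k) m *
        PowerSeries.C (polyDeriv (CartanGen.h k (-m))) else 0) (highestX j n) := by
      split_ifs
      · exact Commute.sum_left _ _ _ fun k _ => (commute_mu (highestX_mul_c j n).symm
          (cartan i k) m).mul_left (highestX_commute_deriv j k (-m) n)
      · exact Commute.zero_left _
    rw [highestH, add_mul, mul_add, h1, h2.eq, neg_mul, add_comm n m]
    abel

section ConstantCoeff
variable {K : Type} [Ring K] [Algebra ℂ K] (c : K) (b : Fin 2 → K) (H : Fin 2 → ℤ → K⟦X⟧)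

theorem constantCoeff_phiOpMode (σ : ℤˣ) (i : Fin 2) (k : ℤ) :
    constantCoeff (phiOpMode b H σ i k) = if k = 0 then 1 else 0 := by
  have h0 : PowerSeries.map (constantCoeff (R := K)) (phiOpExponent H σ i) = 0 := by
    ext n
    rw [coeff_map, coeff_phiOpExponent]
    split_ifs
    · simp
    · have : (constantCoeff (R := K)) (scalar (((σ : ℤ) : Base) * (qPow 1 - qPow (-1)))) = 0 := by
        rw [map_mul, map_mul]
        have : constantCoeff (scalar (B := K) (qPow 1 - qPow (-1))) = 0 := by
          rw [← coeff_zero_eq_constantCoeff_apply, scalar, coeff_map]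
          simp [constantCoeff_qPow]
        rw [this, mul_zero]
      rw [map_mul, this, zero_mul, map_zero]
  have h1 : ∀ m, constantCoeff (coeff m (formalExp (phiOpExponent H σ i))) =
      if m = 0 then 1 else 0 := by
    intro m
    rw [formalExp, coeff_mk, map_sum, Finset.sum_eq_single 0]
    · simp only [Nat.factorial_zero, Nat.cast_one, inv_one, pow_zero, one_smul, coeff_one]
      split_ifs <;> simp
    · intro k _ hk
      have : constantCoeff (coeff m (phiOpExponent H σ i ^ k)) = 0 := by
        rw [← coeff_map, map_pow, h0, zero_pow hk, map_zero]
      rw [← coeff_zero_eq_constantCoeff_apply] at this ⊢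
      rw [show ∀ (a : ℂ) (f : K⟦X⟧), coeff 0 (a • f) = a • coeff 0 f from fun _ _ => rfl, this,
        smul_zero]
    · simp
  rw [phiOpMode]
  split_ifs with h2 h3 h3
  · rw [phiOp, map_mul, constantCoeff_qExp, h1, h3]; simp
  · rw [phiOp, map_mul, h1, if_neg (by omega), mul_zero]
  · exact absurd (by rw [h3, mul_zero]) h2
  · exact map_zero _

theorem constantCoeff_phiDelta (σ : ℤˣ) (i : Fin 2) (m n : ℤ) :
    constantCoeff (phiDelta c b H σ i m n) = if m + n = 0 then 1 else 0 := by
  rw [phiDelta, map_mul, constantCoeff_qExp, mul_one, constantCoeff_phiOpMode]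

/-- The value of `[x_{i,m}^+, x_{i,n}^-]` prescribed by (Q5). -/
def commutatorMode (i : Fin 2) (m n : ℤ) : K⟦X⟧ :=
  qdDiv (phiDelta c b H 1 i m n - phiDelta c b H (-1) i m n)

theorem qd_mul_commutatorMode (i : Fin 2) (m n : ℤ) : qd * commutatorMode c b H i m n =
    phiDelta c b H 1 i m n - phiDelta c b H (-1) i m n :=
  qd_mul_qdDiv (by rw [map_sub, constantCoeff_phiDelta, constantCoeff_phiDelta, sub_self])

variable {c b H}

theorem commute_of_qd_mul {z D : K⟦X⟧} (h : Commute z (qd * D)) : Commute z D := by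
  have h2 := h.eq
  rw [← mul_assoc, show z * qd = qd * z from (scalar_commute _ z).eq.symm, mul_assoc,
    mul_assoc] at h2
  exact qd_mul_inj.1 h2

theorem IsCartanAction.commute_c_commutatorMode (hH : IsCartanAction c b H) (i : Fin 2) (m n : ℤ) :
    Commute (PowerSeries.C c) (commutatorMode c b H i m n) := by
  have h : ∀ σ, Commute (PowerSeries.C c) (phiDelta c b H σ i m n) := fun σ =>
    (hH.commute_c_phiMode σ i _).mul_right (qExp_commute (Commute.refl _) _).symm
  refine commute_of_qd_mul ?_
  rw [qd_mul_commutatorMode]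
  exact (h 1).sub_right (h (-1))

end ConstantCoeff

/-! ### The module `ℂ⟨x⁻⟩ ⊗ ℂ[h, c] ⊗ ℂ⟨x⁺⟩` -/

/-- The space `ℂ⟨x^-_{i,n}⟩ ⊗ ℂ[h_{i,n}, c] ⊗ ℂ⟨y_{i,n}⟩`. -/
abbrev VermaSpace : Type := Words HalfGen HighestSpace

/-- The extension of an operator to the space of words, acting on the right factor. -/
def extOp {L W : Type} [AddCommGroup W] [Module ℂ W] (a : Module.End ℂ W) :
    Module.End ℂ (Words L W) := indOp (emb ∘ₗ a) 0

theorem extOp_emb {L W : Type} [AddCommGroup W] [Module ℂ W] (a : Module.End ℂ W) (u : W) :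
    extOp (L := L) a (emb u) = emb (a u) := indOp_emb _ _ _

theorem extOp_commute {L W : Type} [AddCommGroup W] [Module ℂ W] (a : Module.End ℂ W) (x : L) :
    Commute (PowerSeries.C (extOp (L := L) a)) (PowerSeries.C (prepend x)) := by
  rw [commute_iff_eq, ← map_mul, ← map_mul, extOp, indOp_mul_prepend]
  simp

/-- An operator on the right factor commutes with `f` if it commutes with the restriction of `f`
to the empty word and with the commutators of `f` with the letters. -/
theorem commute_C_extOp {L W : Type} [AddCommGroup W] [Module ℂ W] {a : Module.End ℂ W}
    {f : (Module.End ℂ (Words L W))⟦X⟧} {g : (Module.End ℂ W)⟦X⟧} (hf : Extends f g)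
    (hg : Commute (PowerSeries.C a) g)
    (h : ∀ x, Commute (PowerSeries.C (extOp a))
      (f * PowerSeries.C (prepend x) - PowerSeries.C (prepend x) * f)) :
    Commute (PowerSeries.C (extOp a)) f := by
  refine sub_eq_zero.1 (eq_zero_of_commute_prepend (fun x => ?_) ?_)
  · have h1 := extOp_commute a x
    have h2 := h x
    rw [commute_iff_eq] at h1 h2 ⊢
    rw [← sub_eq_zero] at h1 h2 ⊢
    set A := PowerSeries.C (extOp (L := L) a)
    set P := PowerSeries.C (prepend (W := W) x)
    have : (A * f - f * A) * P - P * (A * f - f * A) =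
      (A * (f * P - P * f) - (f * P - P * f) * A) + ((A * P - P * A) * f - f * (A * P - P * A)) := by
      noncomm_ring
    rw [this, h1, h2]; simp
  · have := ((Extends.C (extOp_emb (L := L) a)).mul hf).sub (hf.mul (Extends.C (extOp_emb (L := L) a)))
    rwa [hg.eq, sub_self] at this

namespace Verma

/-- The action of `c`. -/
def c : Module.End ℂ VermaSpace := extOp highestC

/-- The action of `x^-_{j,n}`. -/
def xm (j : Fin 2) (n : ℤ) : (Module.End ℂ VermaSpace)⟦X⟧ := PowerSeries.C (prepend (HalfGen.x j n))

/-- The action of `h_{i,l}`. -/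
def h (i : Fin 2) (l : ℤ) : (Module.End ℂ VermaSpace)⟦X⟧ :=
  indSeries (highestH i l) fun x => match x with
    | HalfGen.x j n => kappa c (-1) (cartan i j) l * xm j (l + n)

/-- The action of `h_{i,0}`. -/
def h0 (i : Fin 2) : Module.End ℂ VermaSpace :=
  indOp (emb ∘ₗ polyMul (MvPolynomial.X (CartanGen.h i 0))) fun x => match x with
    | HalfGen.x j n => (-(cartan i j : ℂ)) • prepend (HalfGen.x j n)

/-- The action of `x^+_{j,m}`. -/
def xp (j : Fin 2) (m : ℤ) : (Module.End ℂ VermaSpace)⟦X⟧ :=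
  indSeries (highestX j m) fun x => match x with
    | HalfGen.x k n => if j = k then commutatorMode c h0 h j m n else 0

/-- The operator which prepends a letter to the word in the right factor. -/
def y (g : HalfGen) : Module.End ℂ VermaSpace := extOp (prepend g)

theorem commute_c_xm (j : Fin 2) (n : ℤ) : Commute (PowerSeries.C c) (xm j n) := extOp_commute _ _

/-- By construction, the commutators of the `h_{i,l}` with the `x^-_{j,n}` are the prescribed
ones. -/
theorem h_xm (i j : Fin 2) (l n : ℤ) : h i l * xm j n - xm j n * h i l =
    kappa c (-1) (cartan i j) l * xm j (l + n) := indSeries_comm _ _ _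

/-- By construction, (Q5) holds. -/
theorem xp_xm (j k : Fin 2) (m n : ℤ) : xp j m * xm k n - xm k n * xp j m =
    if j = k then commutatorMode c h0 h j m n else 0 := indSeries_comm _ _ _

theorem commute_y_xm (g : HalfGen) (j : Fin 2) (n : ℤ) : Commute (PowerSeries.C (y g)) (xm j n) :=
  extOp_commute _ _

theorem h_zero (i : Fin 2) : h i 0 = PowerSeries.C (h0 i) := by
  refine sub_eq_zero.1 (eq_zero_of_commute_prepend (fun x => ?_) ?_)
  · obtain ⟨j, n⟩ := x
    have h1 := h_xm i j 0 n
    have h2 : PowerSeries.C (h0 i) * xm j n - xm j n * PowerSeries.C (h0 i) =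
        kappa c (-1) (cartan i j) 0 * xm j (0 + n) := by
      rw [xm, ← map_mul, ← map_mul, ← map_sub, h0, indOp_mul_prepend, add_sub_cancel_left, kappa,
        nu_zero_right, scalar_C, abs_zero, Int.cast_zero, mul_zero, qExp_zero, mul_one, zero_add,
        xm, ← map_mul, ← Algebra.smul_def]
      simp
    rw [commute_iff_eq, ← sub_eq_zero]
    change (h i 0 - PowerSeries.C (h0 i)) * xm j n - xm j n * (h i 0 - PowerSeries.C (h0 i)) = 0
    rw [sub_mul, mul_sub, sub_sub_sub_comm, h1, h2, sub_self]
  · have h1 : Extends (h i 0) _ := extends_indSeries _ _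
    have h2 : Extends (L := HalfGen) (PowerSeries.C (h0 i))
      (PowerSeries.C (polyMul (MvPolynomial.X (CartanGen.h i 0)))) := Extends.C (indOp_emb _ _)
    have := h1.sub h2
    rwa [highestH, if_neg (lt_irrefl _), add_zero, sub_self] at this

theorem commute_c_h (i : Fin 2) (l : ℤ) : Commute (PowerSeries.C c) (h i l) := by
  refine commute_C_extOp (extends_indSeries _ _) (highest_isCartanAction.commute_c i l) ?_
  rintro ⟨j, n⟩
  rw [show h i l * PowerSeries.C (prepend (HalfGen.x j n)) -
    PowerSeries.C (prepend (HalfGen.x j n)) * h i l = _ from h_xm i j l n]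
  exact (commute_kappa (Commute.refl _) _ _ _).symm.mul_right (commute_c_xm _ _)

theorem jacobi {R : Type} [Ring R] (a b p : R) : (a * b - b * a) * p - p * (a * b - b * a) =
    (a * (b * p - p * b) - (b * p - p * b) * a) - (b * (a * p - p * a) - (a * p - p * a) * b) := by
  noncomm_ring

theorem commutator_mul_of_commute {R : Type} [Ring R] {a k : R} (hk : Commute k a) (x : R) :
    a * (k * x) - k * x * a = k * (a * x - x * a) := by
  rw [← mul_assoc, ← hk.eq]; noncomm_ring

/-- The Heisenberg relations hold on words in the `x^-`: by the Jacobi identity both sides have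
the same commutators with the `x^-`. -/
theorem isCartanAction : IsCartanAction c h0 h where
  commute_c := commute_c_h
  zero := h_zero
  comm i j m n := by
    refine sub_eq_zero.1 (eq_zero_of_commute_prepend (fun x => ?_) ?_)
    · obtain ⟨k, l⟩ := x
      rw [commute_iff_eq, ← sub_eq_zero]
      change (_ - _) * xm k l - xm k l * (_ - _) = 0
      have hmu : Commute (if m + n = 0 then mu c (cartan i j) m else 0) (xm k l) := by
        split_ifs
        · exact commute_mu (commute_c_xm k l) _ _
        · exact Commute.zero_left _
      rw [sub_mul, mul_sub, hmu.eq, sub_sub_sub_cancel_right, jacobi, h_xm, h_xm,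
        commutator_mul_of_commute (commute_kappa (commute_c_h i m) _ _ _),
        commutator_mul_of_commute (commute_kappa (commute_c_h j n) _ _ _), h_xm, h_xm,
        ← mul_assoc, ← mul_assoc, (commute_kappa (commute_kappa (Commute.refl _) _ _ _).symm _ _ _).eq,
        add_left_comm, sub_self]
    · have e : ∀ i m, Extends (h i m) (highestH i m) := fun i m => extends_indSeries _ _
      have := (((e i m).mul (e j n)).sub ((e j n).mul (e i m))).sub
        (f' := if m + n = 0 then mu highestC (cartan i j) m else 0)
        (D' := if m + n = 0 then mu c (cartan i j) m else 0) (by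
          split_ifs
          · exact Extends.mu (extOp_emb _) _ _
          · intro n u; simp)
      rwa [highest_isCartanAction.comm, sub_self] at this

theorem isCurrent_xm (j : Fin 2) : IsCurrent c h (-1) j (xm j) where
  commute_c := commute_c_xm j
  comm i m n := h_xm i j m n

theorem commute_c_xp (j : Fin 2) (m : ℤ) : Commute (PowerSeries.C c) (xp j m) := by
  refine commute_C_extOp (extends_indSeries _ _) ((highestX_isCurrent j).commute_c m) ?_
  rintro ⟨k, n⟩
  rw [show xp j m * PowerSeries.C (prepend (HalfGen.x k n)) -
    PowerSeries.C (prepend (HalfGen.x k n)) * xp j m = _ from xp_xm j k m n]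
  split_ifs
  · exact isCartanAction.commute_c_commutatorMode _ _ _
  · exact Commute.zero_right _

/-- The commutation relations of `x^+` with the `h_{i,m}`: both sides have the same commutators
with the `x^-`, by `IsCartanAction.H_comm_of_qd_mul`. -/
theorem isCurrent_xp (j : Fin 2) : IsCurrent c h 1 j (xp j) where
  commute_c := commute_c_xp j
  comm i m n := by
    refine sub_eq_zero.1 (eq_zero_of_commute_prepend (fun x => ?_) ?_)
    · obtain ⟨k, l⟩ := x
      rw [commute_iff_eq, ← sub_eq_zero]
      change (_ - _) * xm k l - xm k l * (_ - _) = 0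
      have hk := commute_kappa (commute_c_xm k l) 1 (cartan i j) m
      rw [sub_mul, mul_sub, sub_sub_sub_comm, jacobi, h_xm,
        commutator_mul_of_commute (commute_kappa (commute_c_xp j n) _ _ _), ← mul_assoc (xm k l),
        ← hk.eq, mul_assoc (kappa c 1 (cartan i j) m), mul_assoc (kappa c 1 (cartan i j) m),
        ← mul_sub (kappa c 1 (cartan i j) m), xp_xm, xp_xm, xp_xm]
      split_ifs with hjk
      · subst hjk
        rw [isCartanAction.H_comm_of_qd_mul (qd_mul_commutatorMode c h0 h j), add_comm l m,
          add_comm n m]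
        abel
      · simp
    · have e : Extends (h i m) (highestH i m) := extends_indSeries _ _
      have e' : ∀ n, Extends (xp j n) (highestX j n) := fun n => extends_indSeries _ _
      have := ((e.mul (e' n)).sub ((e' n).mul e)).sub
        ((Extends.kappa (extOp_emb highestC) 1 (cartan i j) m).mul (e' (m + n)))
      rwa [(highestX_isCurrent j).comm, sub_self] at this

theorem commute_y_c (g : HalfGen) : Commute (PowerSeries.C (y g)) (PowerSeries.C c) := by
  refine commute_C_extOp (Extends.C (extOp_emb _)) ?_ fun x => ?_
  · rw [commute_iff_eq, ← map_mul, ← map_mul]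
    congr 1
    refine Words.hom_ext fun w p => ?_
    simp [highestC, polyMul_single, prepend_single]
  · rw [sub_eq_zero.2 (show PowerSeries.C c * PowerSeries.C (prepend x) =
      PowerSeries.C (prepend x) * PowerSeries.C c from (extOp_commute highestC x).eq)]
    exact Commute.zero_right _

/-- The right multiplication operators `y` commute with everything except the `x^+`, which is what
makes the right factor a tensor factor. -/
theorem commute_y_h (g : HalfGen) (i : Fin 2) (l : ℤ) :
    Commute (PowerSeries.C (y g)) (h i l) := by
  refine commute_C_extOp (extends_indSeries _ _) ?_ fun x => ?_
  · have hM : ∀ p, Commute (PowerSeries.C (prepend g)) (PowerSeries.C (polyMul p)) := fun p => by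
      rw [commute_iff_eq, ← map_mul, ← map_mul]
      congr 1
      refine Words.hom_ext fun w p => ?_
      simp [polyMul_single, prepend_single]
    have hd : ∀ u, Commute (PowerSeries.C (prepend g)) (PowerSeries.C (polyDeriv u)) := fun u => by
      rw [commute_iff_eq, ← map_mul, ← map_mul]
      congr 1
      refine Words.hom_ext fun w p => ?_
      simp [polyDeriv_single, prepend_single]
    rw [highestH]
    refine (hM _).add_right ?_
    split_ifs
    · exact Commute.sum_right _ _ _ fun k _ => (commute_mu (hM _).symm _ _).symm.mul_right (hd _)
    · exact Commute.zero_right _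
  · obtain ⟨j, n⟩ := x
    rw [show h i l * PowerSeries.C (prepend (HalfGen.x j n)) -
      PowerSeries.C (prepend (HalfGen.x j n)) * h i l = _ from h_xm i j l n]
    exact (commute_kappa (commute_y_c g).symm _ _ _).symm.mul_right (commute_y_xm _ _ _)

/-- The vacuum vectors `1 ⊗ 1 ⊗ w`, where `w` is a word. -/
def vac (w : List HalfGen) : VermaSpace := emb (Words.single w 1)

theorem y_vac (g : HalfGen) (w : List HalfGen) : y g (vac w) = vac (g :: w) := by
  rw [y, vac, extOp_emb, prepend_single]
  rfl

theorem xp_vac (j : Fin 2) (m : ℤ) (w : List HalfGen) :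
    xp j m • Ser.const (vac w) = Ser.const (vac (HalfGen.x j m :: w)) := by
  funext n
  rw [Ser.smul_const_apply, vac, xp, extends_indSeries, coeff_highestX_one, Ser.const]
  split_ifs
  · rfl
  · exact map_zero _

theorem c_emb_single (w : List HalfGen) (p : CartanPoly) :
    c (emb (Words.single w p)) = emb (Words.single w (MvPolynomial.X CartanGen.c * p)) := by
  rw [c, extOp_emb, highestC, polyMul_single]

/-- The `h_{i,l}` act on `ℂ[h, c]` by multiplication, as long as no derivative contributes. -/
theorem h_emb_single (i : Fin 2) (l : ℤ) (w : List HalfGen) (p : CartanPoly)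
    (hp : 0 < l → MvPolynomial.pderiv (CartanGen.h 0 (-l)) p = 0 ∧
      MvPolynomial.pderiv (CartanGen.h 1 (-l)) p = 0) :
    h i l • Ser.const (emb (Words.single w p) : VermaSpace) =
      Ser.const (emb (Words.single w (MvPolynomial.X (CartanGen.h i l) * p))) := by
  funext n
  rw [Ser.smul_const_apply, h, extends_indSeries, highestH, map_add, LinearMap.add_apply, map_add,
    Ser.const]
  have h2 : coeff n ((if 0 < l then ∑ j, mu highestC (cartan i j) l *
      PowerSeries.C (polyDeriv (CartanGen.h j (-l))) else 0 : (Module.End ℂ HighestSpace)⟦X⟧))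
      (Words.single w p) = 0 := by
    split_ifs with hl
    · obtain ⟨e0, e1⟩ := hp hl
      rw [map_sum, LinearMap.sum_apply, Fin.sum_univ_two]
      simp [coeff_mul_C, polyDeriv_single, e0, e1]
    · simp
  rw [h2, map_zero, add_zero, coeff_C]
  split_ifs
  · rw [polyMul_single]
  · simp

end Verma

/-! ### The relations between the `x`'s of one sign -/

theorem qFact_mul_inv (n : ℕ) : qFact n * (qFact n)⁻¹ = 1 := by
  refine PowerSeries.mul_inv_cancel _ ?_
  rw [qFact, map_prod]
  refine Finset.prod_ne_zero_iff.2 fun k _ => ?_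
  rw [qInt, map_sum, Finset.sum_congr rfl fun k _ => constantCoeff_qPow _]
  simp only [sum_const, card_range, nsmul_eq_mul, mul_one]
  exact_mod_cast Nat.succ_ne_zero k

theorem qInt_one : qInt 1 = 1 := by simp [qInt, qPow_zero]

theorem qFact_three : qFact 3 = qInt 3 * qFact 2 := by
  simp only [qFact, Finset.prod_range_succ, Finset.prod_range_zero]
  ring

theorem qBinom_three_zero : qBinom 3 0 = 1 := by
  rw [qBinom, show qFact 0 = 1 by simp [qFact], one_mul]; exact qFact_mul_inv 3

theorem qBinom_three_three : qBinom 3 3 = 1 := by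
  rw [qBinom, show qFact (3 - 3) = 1 by simp [qFact], mul_one]; exact qFact_mul_inv 3

theorem qBinom_three_one : qBinom 3 1 = qInt 3 := by
  rw [qBinom, show qFact 1 = 1 by simp [qFact, qInt_one], one_mul, qFact_three, mul_assoc]
  change qInt 3 * (qFact 2 * (qFact 2)⁻¹) = _
  rw [qFact_mul_inv, mul_one]

theorem qBinom_three_two : qBinom 3 2 = qInt 3 := by
  rw [qBinom, show qFact (3 - 2) = 1 by simp [qFact, qInt_one], mul_one, qFact_three, mul_assoc,
    qFact_mul_inv, mul_one]

theorem qInt_three : qInt 3 = qPow 2 + 1 + qPow (-2) := by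
  simp only [qInt, Finset.sum_range_succ, Finset.sum_range_zero]
  rw [← qPow_zero]
  norm_num

theorem sum_perm_three {M : Type} [AddCommMonoid M] (F : Fin 3 → Fin 3 → Fin 3 → M) :
    ∑ σ : Equiv.Perm (Fin 3), F (σ 0) (σ 1) (σ 2) =
      F 0 1 2 + F 0 2 1 + F 1 0 2 + F 1 2 0 + F 2 0 1 + F 2 1 0 := by
  have h : (Finset.univ : Finset (Equiv.Perm (Fin 3))) =
      {1, Equiv.swap 1 2, Equiv.swap 0 1, Equiv.swap 0 1 * Equiv.swap 1 2,
        Equiv.swap 0 2 * Equiv.swap 1 2, Equiv.swap 0 2} := by decide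
  rw [h, Finset.sum_insert (by decide), Finset.sum_insert (by decide), Finset.sum_insert (by decide),
    Finset.sum_insert (by decide), Finset.sum_insert (by decide), Finset.sum_singleton]
  simp only [← add_assoc]
  rfl

/-- The six permutations and four positions of the Serre relation, written out. -/
theorem serre_eq {B : Type} [Ring B] [Algebra ℂ B] (x : Fin 2 → ℤ → B) (i j : Fin 2)
    (m : Fin 3 → ℤ) (n : ℤ) : serre x i j m n =
      letI := seriesAlgebra B
      serreRel (qInt 3) (fun n => PowerSeries.C (x i n)) (fun n => PowerSeries.C (x j n))
        (m 0) (m 1) (m 2) n := by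
  let W : Fin 3 → Fin 3 → Fin 3 → B⟦X⟧ := fun a b c =>
    PowerSeries.C (x j n) * PowerSeries.C (x i (m a)) * PowerSeries.C (x i (m b)) *
      PowerSeries.C (x i (m c)) - scalar (qInt 3) * (PowerSeries.C (x i (m a)) *
        PowerSeries.C (x j n) * PowerSeries.C (x i (m b)) * PowerSeries.C (x i (m c))) +
      scalar (qInt 3) * (PowerSeries.C (x i (m a)) * PowerSeries.C (x i (m b)) *
        PowerSeries.C (x j n) * PowerSeries.C (x i (m c))) -
      PowerSeries.C (x i (m a)) * PowerSeries.C (x i (m b)) * PowerSeries.C (x i (m c)) *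
        PowerSeries.C (x j n)
  have h : serre x i j m n = ∑ σ : Equiv.Perm (Fin 3), W (σ 0) (σ 1) (σ 2) := by
    refine Finset.sum_congr rfl fun σ _ => ?_
    simp only [Finset.sum_range_succ, Finset.sum_range_zero, List.ofFn_succ, List.ofFn_zero,
      qBinom_three_zero, qBinom_three_one, qBinom_three_two, qBinom_three_three]
    simp only [W, List.take, List.drop, List.prod_cons, List.prod_nil, map_mul, map_neg, map_one,
      pow_zero, one_mul, mul_one, zero_add, pow_succ, mul_neg, neg_mul, neg_neg, mul_assoc]
    simp only [Fin.succ_zero_eq_one, Fin.succ_one_eq_two]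
    abel
  rw [h, sum_perm_three]
  rfl

section Naturality
variable {B B' : Type} [Ring B] [Algebra ℂ B] [Ring B'] [Algebra ℂ B'] (f : B →ₐ[ℂ] B')

theorem map_quad (ε : ℤˣ) (x : Fin 2 → ℤ → B) (i j : Fin 2) (m n : ℤ) :
    PowerSeries.map (f : B →+* B') (quad ε x i j m n) = quad ε (fun i n => f (x i n)) i j m n := by
  simp only [quad, map_sub, map_mul, map_scalar, PowerSeries.map_C]
  rfl

theorem map_serre (x : Fin 2 → ℤ → B) (i j : Fin 2) (m : Fin 3 → ℤ) (n : ℤ) :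
    PowerSeries.map (f : B →+* B') (serre x i j m n) = serre (fun i n => f (x i n)) i j m n := by
  simp only [serre, map_sum, map_mul, map_scalar, PowerSeries.map_C]
  refine Finset.sum_congr rfl fun σ _ => Finset.sum_congr rfl fun r _ => ?_
  simp [map_list_prod, List.map_take, List.map_drop]

theorem map_mem_relHalf {ε : ℤˣ} {x : Fin 2 → ℤ → B} {r : B⟦X⟧} (hr : r ∈ relHalf ε x) :
    PowerSeries.map (f : B →+* B') r ∈ relHalf ε fun i n => f (x i n) := by
  rcases hr with ((⟨i, m, n, rfl⟩ | ⟨i, j, m, n, h, rfl⟩) | ⟨i, j, l, m, n, h, rfl⟩) |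
    ⟨i, j, m, n, h, rfl⟩
  · exact Or.inl (Or.inl (Or.inl ⟨i, m, n, map_quad ..⟩))
  · refine Or.inl (Or.inl (Or.inr ⟨i, j, m, n, h, ?_⟩))
    rw [map_sub, map_quad, map_quad]
  · refine Or.inl (Or.inr ⟨i, j, l, m, n, h, ?_⟩)
    rw [map_sub, map_mul, map_mul, map_quad, PowerSeries.map_C]
    rfl
  · exact Or.inr ⟨i, j, m, n, h, map_serre ..⟩

theorem exists_of_mem_relHalf {ε : ℤˣ} {x : Fin 2 → ℤ → B} {r : B'⟦X⟧}
    (hr : r ∈ relHalf ε fun i n => f (x i n)) :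
    ∃ r' ∈ relHalf ε x, PowerSeries.map (f : B →+* B') r' = r := by
  rcases hr with ((⟨i, m, n, rfl⟩ | ⟨i, j, m, n, h, rfl⟩) | ⟨i, j, l, m, n, h, rfl⟩) |
    ⟨i, j, m, n, h, rfl⟩
  · exact ⟨_, Or.inl (Or.inl (Or.inl ⟨i, m, n, rfl⟩)), map_quad ..⟩
  · refine ⟨_, Or.inl (Or.inl (Or.inr ⟨i, j, m, n, h, rfl⟩)), ?_⟩
    rw [map_sub, map_quad, map_quad]
  · refine ⟨_, Or.inl (Or.inr ⟨i, j, l, m, n, h, rfl⟩), ?_⟩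
    rw [map_sub, map_mul, map_mul, map_quad, PowerSeries.map_C]
    rfl
  · exact ⟨_, Or.inr ⟨i, j, m, n, h, rfl⟩, map_serre ..⟩

theorem map_mem_cancelHbar {R : Set B⟦X⟧} {R' : Set B'⟦X⟧}
    (h : ∀ r ∈ R, PowerSeries.map (f : B →+* B') r ∈ R') {r : B⟦X⟧} (hr : r ∈ cancelHbar R) :
    PowerSeries.map (f : B →+* B') r ∈ cancelHbar R' := by
  obtain ⟨k, hk⟩ := hr
  refine ⟨k, ?_⟩
  have := h _ hk
  rwa [map_mul, map_pow, PowerSeries.map_X] at this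

/-- If no relation vanishes modulo `ħ`, there are no common powers of `ħ` to be cancelled. -/
theorem mem_of_mem_cancelHbar {R : Set B⟦X⟧} (h : ∀ r ∈ R, constantCoeff r ≠ 0) {r : B⟦X⟧}
    (hr : r ∈ cancelHbar R) : r ∈ R := by
  obtain ⟨k, hk⟩ := hr
  cases k with
  | zero => simpa using hk
  | succ k => exact absurd (by simp) (h _ hk)

end Naturality

section NonVanishing

theorem constantCoeff_scalar {B : Type} [Ring B] [Algebra ℂ B] (s : Base) :
    constantCoeff (scalar (B := B) s) = algebraMap ℂ B (constantCoeff s) := by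
  rw [← coeff_zero_eq_constantCoeff_apply, scalar, coeff_map, coeff_zero_eq_constantCoeff_apply]

theorem constantCoeff_quad {B : Type} [Ring B] [Algebra ℂ B] (ε : ℤˣ) (x : Fin 2 → ℤ → B)
    (i j : Fin 2) (m n : ℤ) : constantCoeff (quad ε x i j m n) =
      (x i (m + 1) * x j n - x i m * x j (n + 1)) - (x j n * x i (m + 1) - x j (n + 1) * x i m) := by
  simp [quad, constantCoeff_scalar, constantCoeff_qPow]

/-- The relations (Q6)-(Q9) do not vanish modulo `ħ`. -/
theorem constantCoeff_ne_zero_of_mem_halfRelations (ε : ℤˣ) :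
    ∀ r ∈ halfRelations ε, constantCoeff r ≠ 0 := by
  classical
  -- evaluate at the operators which prepend a letter, and apply the result to the empty word
  let f : FreeAlgebra ℂ HalfGen →ₐ[ℂ] Module.End ℂ (Words HalfGen ℂ) := FreeAlgebra.lift ℂ prepend
  have hf : ∀ g, f (FreeAlgebra.ι ℂ g) = prepend g := fun g => by simp [f]
  have key : ∀ a : FreeAlgebra ℂ HalfGen, ∀ w : List HalfGen,
      Finsupp.lapply (R := ℂ) w (f a (Words.single [] 1)) ≠ 0 → a ≠ 0 := by
    rintro a w h rfl
    exact h (by rw [map_zero, LinearMap.zero_apply]; exact map_zero (Finsupp.lapply w))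
  have happ : ∀ w w' : List HalfGen, Finsupp.lapply (R := ℂ) w
      (Words.single w' (1 : ℂ) : Words HalfGen ℂ) = if w' = w then (1 : ℂ) else 0 := by
    intro w w'
    exact Finsupp.single_apply
  have hadd : ∀ (w : List HalfGen) (a b : Words HalfGen ℂ),
    Finsupp.lapply (R := ℂ) w (a + b) = Finsupp.lapply (R := ℂ) w a + Finsupp.lapply (R := ℂ) w b :=
      fun _ _ _ => rfl
  have hsub : ∀ (w : List HalfGen) (a b : Words HalfGen ℂ),
    Finsupp.lapply (R := ℂ) w (a - b) = Finsupp.lapply (R := ℂ) w a - Finsupp.lapply (R := ℂ) w b :=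
      fun _ _ _ => rfl
  rintro r (((⟨i, m, n, rfl⟩ | ⟨i, j, m, n, h, rfl⟩) | ⟨i, j, l, m, n, h, rfl⟩) |
    ⟨i, j, m, n, h, rfl⟩)
  · rw [constantCoeff_quad]
    by_cases hmn : n = m + 1
    · refine key _ [HalfGen.x i m, HalfGen.x i (n + 1)] ?_
      simp only [map_sub, map_mul, hf, LinearMap.sub_apply, Module.End.mul_apply, prepend_single,
        hsub, happ]
      simp [hmn, show ¬(m + 1 + 1 = m) by omega]
    · refine key _ [HalfGen.x i (m + 1), HalfGen.x i n] ?_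
      simp only [map_sub, map_mul, hf, LinearMap.sub_apply, Module.End.mul_apply, prepend_single,
        hsub, happ]
      simp only [List.cons.injEq, HalfGen.x.injEq]
      by_cases hmn' : m = n
      · subst hmn'; simp
      · simp [hmn, Ne.symm hmn', hmn']
  · rw [map_sub, constantCoeff_quad, constantCoeff_quad]
    refine key _ [HalfGen.x i (m + 2), HalfGen.x j n] ?_
    simp only [map_sub, map_mul, hf, LinearMap.sub_apply, Module.End.mul_apply, prepend_single,
      hsub, happ]
    simp [h, Ne.symm h, add_assoc]
  · rw [map_sub, map_mul, map_mul, constantCoeff_quad]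
    refine key _ [HalfGen.x i l, HalfGen.x i (m + 1), HalfGen.x j n] ?_
    simp only [map_sub, map_mul, hf, LinearMap.sub_apply, Module.End.mul_apply, prepend_single,
      hsub, happ, constantCoeff_C]
    simp [h, Ne.symm h]
  · rw [serre_eq]
    refine key _ [HalfGen.x j n, HalfGen.x i (m 0), HalfGen.x i (m 1), HalfGen.x i (m 2)] ?_
    simp only [serreRel, map_sub, map_add, Algebra.smul_def, map_mul, constantCoeff_C, hf, LinearMap.sub_apply,
      LinearMap.add_apply]
    have hs : ∀ (s : Base) (v : Words HalfGen ℂ) (w : List HalfGen), Finsupp.lapply (R := ℂ) w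
        (f (constantCoeff ((seriesAlgebra (FreeAlgebra ℂ HalfGen)).algebraMap s)) v) =
        constantCoeff s * Finsupp.lapply (R := ℂ) w v := by
      intro s v w
      change Finsupp.lapply (R := ℂ) w (f (constantCoeff (scalar s)) v) = _
      rw [constantCoeff_scalar, AlgHom.commutes, Module.algebraMap_end_apply]
      rfl
    simp only [Module.End.mul_apply, prepend_single, hsub, hadd]
    erw [hs, hs, hs, hs, hs, hs, hs, hs, hs, hs, hs, hs]
    simp only [happ]
    simp [Ne.symm h]
    intro h0
    have h1 := congrArg Complex.re h0
    simp [apply_ite Complex.re] at h1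
    split_ifs at h1 <;> norm_num at h1

end NonVanishing

/-! ### Commutators of the relations (Q6)-(Q9) with other generators -/

section Shift
variable {A : Type} [Ring A] [Algebra Base A] {z κ κ' : A} {e f : ℤ → A} {l : ℤ}

theorem commutator_quadRel (t : Base) (he : ∀ m, z * e m - e m * z = κ * e (l + m))
    (hf : ∀ m, z * f m - f m * z = κ' * f (l + m)) (hκf : ∀ m, Commute κ (f m))
    (hκ'e : ∀ m, Commute κ' (e m)) (m n : ℤ) :
    z * quadRel t e f m n - quadRel t e f m n * z =
      κ * quadRel t e f (l + m) n + κ' * quadRel t e f m (l + n) := by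
  have he1 : ∀ m, z * e m = e m * z + κ * e (l + m) := fun m => by rw [← he]; abel
  have hf1 : ∀ m, z * f m = f m * z + κ' * f (l + m) := fun m => by rw [← hf]; abel
  have he2 : ∀ m x, z * (e m * x) = e m * (z * x) + κ * (e (l + m) * x) := fun m x => by
    rw [← mul_assoc, he1, add_mul, mul_assoc, mul_assoc]
  have hf2 : ∀ m x, z * (f m * x) = f m * (z * x) + κ' * (f (l + m) * x) := fun m x => by
    rw [← mul_assoc, hf1, add_mul, mul_assoc, mul_assoc]
  have hc1 : ∀ m x, f m * (κ * x) = κ * (f m * x) := fun m x => by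
    rw [← mul_assoc, ← (hκf m).eq, mul_assoc]
  have hc2 : ∀ m x, e m * (κ' * x) = κ' * (e m * x) := fun m x => by
    rw [← mul_assoc, ← (hκ'e m).eq, mul_assoc]
  simp only [quadRel, mul_sub, sub_mul, mul_smul_comm, smul_mul_assoc, mul_assoc, he2, hf2, he1, hf1,
    mul_add, hc1, hc2, smul_add, add_assoc]
  abel

/-- The contribution to the Serre relation of one ordering of the factors. -/
def serreWord (s : Base) (f a b c : A) : A :=
  f * a * b * c - s • (a * f * b * c) + s • (a * b * f * c) - a * b * c * f

theorem commutator_serreWord (s : Base) {f a b c f' a' b' c' : A} (hf : z * f - f * z = κ' * f')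
    (ha : z * a - a * z = κ * a') (hb : z * b - b * z = κ * b') (hc : z * c - c * z = κ * c')
    (h1 : Commute κ f) (h2 : Commute κ a) (h3 : Commute κ b) (h1' : Commute κ' a)
    (h2' : Commute κ' b) (h3' : Commute κ' c) :
    z * serreWord s f a b c - serreWord s f a b c * z = κ' * serreWord s f' a b c +
      κ * serreWord s f a' b c + κ * serreWord s f a b' c + κ * serreWord s f a b c' := by
  have e1 : ∀ {u u' k : A}, z * u - u * z = k * u' → z * u = u * z + k * u' :=
    fun h => by rw [← h]; abel
  have e2 : ∀ {u u' k : A}, z * u - u * z = k * u' → ∀ x, z * (u * x) = u * (z * x) + k * (u' * x) :=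
    fun h x => by rw [← mul_assoc, e1 h, add_mul, mul_assoc, mul_assoc]
  have e3 : ∀ {k u : A}, Commute k u → ∀ x, u * (k * x) = k * (u * x) := fun h x => by
    rw [← mul_assoc, ← h.eq, mul_assoc]
  simp only [serreWord, mul_sub, sub_mul, mul_add, add_mul, mul_smul_comm, smul_mul_assoc, mul_assoc,
    e2 hf, e2 ha, e2 hb, e2 hc, e1 hf, e1 hc, e3 h1, e3 h2, e3 h3, e3 h1', e3 h2',
    e3 h3', smul_add]
  abel

theorem serreRel_eq_serreWord (s : Base) (e f : ℤ → A) (a b c n : ℤ) : serreRel s e f a b c n =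
    serreWord s (f n) (e a) (e b) (e c) + serreWord s (f n) (e a) (e c) (e b) +
    serreWord s (f n) (e b) (e a) (e c) + serreWord s (f n) (e b) (e c) (e a) +
    serreWord s (f n) (e c) (e a) (e b) + serreWord s (f n) (e c) (e b) (e a) := rfl

theorem commutator_serreRel (s : Base) (he : ∀ m, z * e m - e m * z = κ * e (l + m))
    (hf : ∀ m, z * f m - f m * z = κ' * f (l + m)) (hκf : ∀ m, Commute κ (f m))
    (hκe : ∀ m, Commute κ (e m)) (hκ'e : ∀ m, Commute κ' (e m)) (a b c n : ℤ) :
    z * serreRel s e f a b c n - serreRel s e f a b c n * z =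
      κ' * serreRel s e f a b c (l + n) + κ * serreRel s e f (l + a) b c n +
      κ * serreRel s e f a (l + b) c n + κ * serreRel s e f a b (l + c) n := by
  have h : ∀ a b c, z * serreWord s (f n) (e a) (e b) (e c) -
    serreWord s (f n) (e a) (e b) (e c) * z = κ' * serreWord s (f (l + n)) (e a) (e b) (e c) +
      κ * serreWord s (f n) (e (l + a)) (e b) (e c) + κ * serreWord s (f n) (e a) (e (l + b)) (e c) +
      κ * serreWord s (f n) (e a) (e b) (e (l + c)) := fun a b c =>
    commutator_serreWord s (hf n) (he a) (he b) (he c) (hκf n) (hκe a) (hκe b) (hκ'e a) (hκ'e b)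
      (hκ'e c)
  have h' : ∀ x₁ x₂ x₃ x₄ x₅ x₆ : A, z * (x₁ + x₂ + x₃ + x₄ + x₅ + x₆) -
      (x₁ + x₂ + x₃ + x₄ + x₅ + x₆) * z = (z * x₁ - x₁ * z) + (z * x₂ - x₂ * z) +
      (z * x₃ - x₃ * z) + (z * x₄ - x₄ * z) + (z * x₅ - x₅ * z) + (z * x₆ - x₆ * z) := by
    intros; noncomm_ring
  simp only [serreRel_eq_serreWord]
  rw [h', h, h, h, h, h, h]
  simp only [mul_add]
  abel

end Shift

section HalfRelations
variable {B K : Type} [Ring B] [Algebra ℂ B] [Ring K] [Algebra ℂ K]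
attribute [local instance] seriesAlgebra

theorem liftTopAlg_smul (g : B →ₐ[ℂ] K⟦X⟧) (s : Base) (f : B⟦X⟧) :
    liftTopAlg g (s • f) = s • liftTopAlg g f := by
  rw [Algebra.smul_def, Algebra.smul_def, map_mul]
  congr 1
  exact liftTopAlg_scalar g s

theorem liftTopAlg_quad (g : B →ₐ[ℂ] K⟦X⟧) (ε : ℤˣ) (x : Fin 2 → ℤ → B) (i j : Fin 2) (m n : ℤ) :
    liftTopAlg g (quad ε x i j m n) = quadRel (qPow ((ε * cartan i j : ℤ) : ℂ))
      (fun n => g (x i n)) (fun n => g (x j n)) m n := by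
  simp only [quad, map_sub, map_mul, liftTopAlg_scalar, liftTopAlg_C]
  rfl

theorem liftTopAlg_serre (g : B →ₐ[ℂ] K⟦X⟧) (x : Fin 2 → ℤ → B) (i j : Fin 2) (m : Fin 3 → ℤ)
    (n : ℤ) : liftTopAlg g (serre x i j m n) = serreRel (qInt 3)
      (fun n => g (x i n)) (fun n => g (x j n)) (m 0) (m 1) (m 2) n := by
  rw [serre_eq]
  simp only [serreRel, map_add, map_sub, map_mul, liftTopAlg_smul, liftTopAlg_C]

/-- The relations (Q6) and (Q7), the relations (Q8), and the relations (Q9): three stages, each of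
which is stable under the commutators with the other half modulo the preceding ones. -/
def relStage (ε : ℤˣ) (x : Fin 2 → ℤ → B) : Fin 3 → Set B⟦X⟧
  | 0 => {r | ∃ (i : Fin 2) (m n : ℤ), r = quad ε x i i m n} ∪
      {r | ∃ (i j : Fin 2) (m n : ℤ), i ≠ j ∧
        r = quad ε x i j (m + 1) n - quad ε x i j m (n + 1)}
  | 1 => {r | ∃ (i j : Fin 2) (l m n : ℤ), i ≠ j ∧ r =
      PowerSeries.C (x i l) * quad ε x i j m n - quad ε x i j m n * PowerSeries.C (x i l)}
  | 2 => {r | ∃ (i j : Fin 2) (m : Fin 3 → ℤ) (n : ℤ), i ≠ j ∧ r = serre x i j m n}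

theorem mem_relHalf_iff {ε : ℤˣ} {x : Fin 2 → ℤ → B} {r : B⟦X⟧} :
    r ∈ relHalf ε x ↔ ∃ s, r ∈ relStage ε x s := by
  constructor
  · rintro ((h | h) | h)
    exacts [⟨0, h⟩, ⟨1, h⟩, ⟨2, h⟩]
  · rintro ⟨s, h⟩
    match s, h with
    | 0, h => exact Or.inl (Or.inl h)
    | 1, h => exact Or.inl (Or.inr h)
    | 2, h => exact Or.inr h

theorem relStage_cases {ε : ℤˣ} {x : Fin 2 → ℤ → B} {s : Fin 3} {r : B⟦X⟧}
    (hr : r ∈ relStage ε x s) : (∃ (i : Fin 2) (m n : ℤ), s = 0 ∧ r = quad ε x i i m n) ∨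
      (∃ (i j : Fin 2) (m n : ℤ), s = 0 ∧ i ≠ j ∧
        r = quad ε x i j (m + 1) n - quad ε x i j m (n + 1)) ∨
      (∃ (i j : Fin 2) (l m n : ℤ), s = 1 ∧ i ≠ j ∧ r =
        PowerSeries.C (x i l) * quad ε x i j m n - quad ε x i j m n * PowerSeries.C (x i l)) ∨
      ∃ (i j : Fin 2) (m : Fin 3 → ℤ) (n : ℤ), s = 2 ∧ i ≠ j ∧ r = serre x i j m n := by
  match s, hr with
  | 0, Or.inl ⟨i, m, n, h⟩ => exact Or.inl ⟨i, m, n, rfl, h⟩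
  | 0, Or.inr ⟨i, j, m, n, h⟩ => exact Or.inr (Or.inl ⟨i, j, m, n, rfl, h⟩)
  | 1, ⟨i, j, l, m, n, h⟩ => exact Or.inr (Or.inr (Or.inl ⟨i, j, l, m, n, rfl, h⟩))
  | 2, ⟨i, j, m, n, h⟩ => exact Or.inr (Or.inr (Or.inr ⟨i, j, m, n, rfl, h⟩))

variable {g : B →ₐ[ℂ] K⟦X⟧} {ε : ℤˣ} {x : Fin 2 → ℤ → B} {T : Submodule Base K⟦X⟧}

/-- The span of the relations is stable under the commutator with an element which shifts the
modes of all currents. -/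
theorem shift_commutator_mem {s : Fin 3} {z : K⟦X⟧} {κ : Fin 2 → K⟦X⟧} {l : ℤ}
    (hz : ∀ i m, z * g (x i m) - g (x i m) * z = κ i * g (x i (l + m)))
    (hκ : ∀ i j m, Commute (κ i) (g (x j m))) (hκT : ∀ i, ∀ a ∈ T, κ i * a ∈ T)
    (hR : ∀ r ∈ relStage ε x s, liftTopAlg g r ∈ T) {r : B⟦X⟧} (hr : r ∈ relStage ε x s) :
    z * liftTopAlg g r - liftTopAlg g r * z ∈ T := by
  have hq : ∀ i j m n, z * liftTopAlg g (quad ε x i j m n) - liftTopAlg g (quad ε x i j m n) * z =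
      κ i * liftTopAlg g (quad ε x i j (l + m) n) + κ j * liftTopAlg g (quad ε x i j m (l + n)) := by
    intro i j m n
    simp only [liftTopAlg_quad]
    exact commutator_quadRel _ (hz i) (hz j) (hκ i j) (hκ j i) m n
  have hκq : ∀ k i j m n, Commute (κ k) (liftTopAlg g (quad ε x i j m n)) := by
    intro k i j m n
    have hs : ∀ s : Base, Commute (κ k) (scalar s) := fun s => (scalar_commute s _).symm
    simp only [quad, map_sub, map_mul, liftTopAlg_scalar, liftTopAlg_C]
    exact (((hκ _ _ _).mul_right (hκ _ _ _)).sub_right ((hs _).mul_right ((hκ _ _ _).mul_right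
      (hκ _ _ _)))).sub_right (((hs _).mul_right ((hκ _ _ _).mul_right (hκ _ _ _))).sub_right
      ((hκ _ _ _).mul_right (hκ _ _ _)))
  rcases relStage_cases hr with ⟨i, m, n, rfl, rfl⟩ | ⟨i, j, m, n, rfl, h, rfl⟩ | ⟨i, j, k, m, n, rfl, h, rfl⟩ |
    ⟨i, j, m, n, rfl, h, rfl⟩
  · rw [hq]
    exact T.add_mem (hκT _ _ (hR _ (Or.inl ⟨i, _, _, rfl⟩)))
      (hκT _ _ (hR _ (Or.inl ⟨i, _, _, rfl⟩)))
  · have h1 := hκT i _ (hR _ (Or.inr ⟨i, j, l + m, n, h, rfl⟩))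
    have h2 := hκT j _ (hR _ (Or.inr ⟨i, j, m, l + n, h, rfl⟩))
    convert T.add_mem h1 h2 using 1
    simp only [map_sub]
    rw [mul_sub, sub_mul, sub_sub_sub_comm, hq, hq, mul_sub, mul_sub, add_assoc l, add_assoc l]
    abel
  · have h1 := hκT i _ (hR _ ⟨i, j, l + k, m, n, h, rfl⟩)
    have h2 := hκT i _ (hR _ ⟨i, j, k, l + m, n, h, rfl⟩)
    have h3 := hκT j _ (hR _ ⟨i, j, k, m, l + n, h, rfl⟩)
    convert T.add_mem (T.add_mem h1 h2) h3 using 1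
    simp only [map_sub, map_mul, liftTopAlg_C]
    have e1 := hq i j m n
    have e2 := hz i k
    have c1 := (hκq i i j m n).eq
    have c2 := (hκ i i k).eq
    have c3 := (hκ j i k).eq
    set Q := liftTopAlg g (quad ε x i j m n)
    set a := g (x i k)
    have : z * (a * Q - Q * a) - (a * Q - Q * a) * z = (z * a - a * z) * Q - Q * (z * a - a * z) +
      (a * (z * Q - Q * z) - (z * Q - Q * z) * a) := by noncomm_ring
    rw [this, e1, e2, ← mul_assoc Q, ← c1, mul_add, ← mul_assoc a, ← mul_assoc a, ← c2, ← c3]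
    noncomm_ring
  · have h1 := hκT j _ (hR _ ⟨i, j, m, l + n, h, rfl⟩)
    have h2 := fun k : Fin 3 => hκT i _ (hR _ ⟨i, j, m + Pi.single k l, n, h, rfl⟩)
    convert T.add_mem (T.add_mem (T.add_mem h1 (h2 0)) (h2 1)) (h2 2) using 1
    simp only [liftTopAlg_serre]
    rw [commutator_serreRel _ (hz i) (hz j) (hκ i j) (hκ i i) (hκ j i)]
    simp [add_comm l]

theorem currentRel_zero (t : Base) (e : ℤ → K⟦X⟧) : CurrentRel t (fun _ => 0) e := by
  intro k l; simp

/-- The commutators of the relations (Q6)-(Q9) with an element `y` of the other half are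
consequences of the relations of the preceding stages: `y` commutes with one of the two currents,
and its commutator with the other one is, up to the factor `q - q⁻¹`, a difference of two
one-sided currents with known commutation relations. -/
theorem half_commutator_mem {s : Fin 3} {y : K⟦X⟧} {j₀ : Fin 2} {D P P' : ℤ → K⟦X⟧}
    (hT : ∀ a ∈ T, ∀ b, a * b ∈ T) (hTe : ∀ a ∈ T, ∀ i m, g (x i m) * a ∈ T)
    (hD : ∀ m, qd * D m = P m - P' m)
    (hy : ∀ i m, g (x i m) * y - y * g (x i m) = if i = j₀ then D m else 0)
    (hP : ∀ i, CurrentRel (qPow ((ε * cartan j₀ i : ℤ) : ℂ)) P fun m => g (x i m))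
    (hP' : ∀ i, CurrentRel (qPow ((ε * cartan j₀ i : ℤ) : ℂ)) P' fun m => g (x i m))
    (hs : OneSidedModes P) (hs' : OneSidedModes P')
    (hR : ∀ s' < s, ∀ r ∈ relStage ε x s', liftTopAlg g r ∈ T) {r : B⟦X⟧} (hr : r ∈ relStage ε x s) :
    liftTopAlg g r * y - y * liftTopAlg g r ∈ T := by
  have hk : ∀ a b : K⟦X⟧, (qPow 1 - qPow (-1)) • a = (qPow 1 - qPow (-1)) • b → a = b :=
    fun a b h => qd_mul_inj.1 h
  have hD' : ∀ m, (qPow 1 - qPow (-1) : Base) • D m = P m - P' m := hD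
  have hcur : ∀ i, CurrentRel (qPow ((ε * cartan j₀ i : ℤ) : ℂ)) D fun m => g (x i m) := fun i =>
    CurrentRel.of_smul hk hD' (hP i) (hP' i)
  have hy0 : ∀ {i}, i ≠ j₀ → ∀ m, g (x i m) * y = y * g (x i m) := fun {i} h m => by
    have := hy i m
    rwa [if_neg h, sub_eq_zero] at this
  have hy1 : ∀ m, g (x j₀ m) * y - y * g (x j₀ m) = D m := fun m => by rw [hy, if_pos rfl]
  have hoff : ∀ i j : Fin 2, i ≠ j → cartan i j = -2 := fun i j h => if_neg h
  have hdiag : ∀ i : Fin 2, cartan i i = 2 := fun i => if_pos rfl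
  have ht : qPow ((ε * 2 : ℤ) : ℂ) * qPow ((ε * (-2) : ℤ) : ℂ) = 1 := by
    rw [qPow_mul, ← Int.cast_add, show (ε * 2 + ε * (-2) : ℤ) = 0 by ring, Int.cast_zero, qPow_zero]
  -- `t² - 1` is divisible by `q - q⁻¹` for `t = q^{±2}`
  obtain ⟨v, hv⟩ : ∃ v, qPow ((ε * 2 : ℤ) : ℂ) ^ 2 - 1 = (qPow 1 - qPow (-1)) * v := by
    have e : qPow 1 * qPow (-1) = 1 := by rw [qPow_mul, add_neg_cancel, qPow_zero]
    rcases Int.units_eq_one_or ε with rfl | rfl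
    · refine ⟨qPow 1 ^ 2 * (qPow 1 + qPow (-1)), ?_⟩
      have : qPow (((1 : ℤˣ) * 2 : ℤ) : ℂ) = qPow 1 * qPow 1 := by rw [qPow_mul]; norm_num
      rw [this]
      linear_combination (qPow 1 * qPow (-1) + 1) * e
    · refine ⟨-(qPow (-1) ^ 2 * (qPow 1 + qPow (-1))), ?_⟩
      have : qPow (((-1 : ℤˣ) * 2 : ℤ) : ℂ) = qPow (-1) * qPow (-1) := by rw [qPow_mul]; norm_num
      rw [this]
      linear_combination (qPow 1 * qPow (-1) + 1) * e
  have hst : qPow ((ε * 2 : ℤ) : ℂ) * qInt 3 =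
      qPow ((ε * 2 : ℤ) : ℂ) ^ 2 + qPow ((ε * 2 : ℤ) : ℂ) + 1 := by
    rw [qInt_three]
    have e : qPow 2 * qPow (-2) = 1 := by rw [qPow_mul, add_neg_cancel, qPow_zero]
    rcases Int.units_eq_one_or ε with rfl | rfl
    · have : qPow (((1 : ℤˣ) * 2 : ℤ) : ℂ) = qPow 2 := by norm_num
      rw [this]
      linear_combination e
    · have : qPow (((-1 : ℤˣ) * 2 : ℤ) : ℂ) = qPow (-2) := by norm_num
      rw [this]
      linear_combination e
  have hquad : ∀ i j, i ≠ j → ∀ m n, liftTopAlg g (quad ε x i j m n) * y =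
      y * liftTopAlg g (quad ε x i j m n) := by
    intro i j hij m n
    rw [liftTopAlg_quad]
    by_cases hi : i = j₀
    · subst hi
      exact quadRel_commute_left hy1 (hy0 (Ne.symm hij)) (hcur j) m n
    · have hj : j = j₀ := by omega
      subst hj
      have := hcur i
      rw [cartan_symm] at this
      exact quadRel_commute_right hy1 (hy0 hij) this m n
  have hR6 : 0 < s → ∀ i m n, quadRel (qPow ((ε * 2 : ℤ) : ℂ)) (fun n => g (x i n))
      (fun n => g (x i n)) m n ∈ T := fun hs i m n => by
    have := hR 0 hs _ (Or.inl ⟨i, m, n, rfl⟩)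
    rwa [liftTopAlg_quad, hdiag] at this
  have hR7 : 0 < s → ∀ i j, i ≠ j → ∀ m n, quadRel (qPow ((ε * (-2) : ℤ) : ℂ)) (fun n => g (x i n))
      (fun n => g (x j n)) (m + 1) n - quadRel (qPow ((ε * (-2) : ℤ) : ℂ)) (fun n => g (x i n))
      (fun n => g (x j n)) m (n + 1) ∈ T := fun hs i j h m n => by
    have := hR 0 hs _ (Or.inr ⟨i, j, m, n, h, rfl⟩)
    rwa [map_sub, liftTopAlg_quad, liftTopAlg_quad, hoff i j h] at this
  have hR8 : 1 < s → ∀ i j, i ≠ j → ∀ l m n, g (x i l) * quadRel (qPow ((ε * (-2) : ℤ) : ℂ))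
      (fun n => g (x i n)) (fun n => g (x j n)) m n - quadRel (qPow ((ε * (-2) : ℤ) : ℂ))
      (fun n => g (x i n)) (fun n => g (x j n)) m n * g (x i l) ∈ T := fun hs i j h l m n => by
    have := hR 1 hs _ ⟨i, j, l, m, n, h, rfl⟩
    rwa [map_sub, map_mul, map_mul, liftTopAlg_quad, liftTopAlg_C, hoff i j h] at this
  rcases relStage_cases hr with ⟨i, m, n, rfl, rfl⟩ | ⟨i, j, m, n, rfl, h, rfl⟩ |
    ⟨i, j, l, m, n, rfl, h, rfl⟩ | ⟨i, j, m, n, rfl, h, rfl⟩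
  · rw [liftTopAlg_quad]
    convert T.zero_mem
    rw [sub_eq_zero]
    by_cases hi : i = j₀
    · subst hi
      exact quadRel_self_commute hy1 (hcur i) m n
    · exact quadRel_self_commute (D := fun _ => 0) (fun m => sub_eq_zero.2 (hy0 hi m))
        (currentRel_zero _ _) m n
  · convert T.zero_mem
    rw [map_sub, sub_mul, mul_sub, hquad i j h, hquad i j h, sub_self]
  · by_cases hi : i = j₀
    · subst hi
      have hPi := hP i
      have hPj := hP j
      have hPi' := hP' i
      have hPj' := hP' j
      rw [hdiag] at hPi hPi'
      rw [hoff i j h] at hPj hPj'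
      rw [map_sub, map_mul, map_mul, liftTopAlg_quad, liftTopAlg_C, hoff i j h]
      exact quad_commutator_mem ht hv hk hT hD' hy1 (hy0 (Ne.symm h)) hPi hPj hPi' hPj' hs hs'
        (hR7 (by decide) i j h) l m n
    · convert T.zero_mem
      rw [map_sub, map_mul, map_mul, liftTopAlg_C, sub_mul, mul_sub, mul_assoc, hquad i j h,
        ← mul_assoc, hy0 hi, mul_assoc, mul_assoc, hy0 hi, ← mul_assoc _ y, hquad i j h]
      noncomm_ring
  · rw [liftTopAlg_serre]
    by_cases hi : i = j₀
    · subst hi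
      have hPi := hP i
      have hPj := hP j
      have hPi' := hP' i
      have hPj' := hP' j
      rw [hdiag] at hPi hPi'
      rw [hoff i j h] at hPj hPj'
      exact serre_commutator_mem_of_first ht hv hst hk hT (fun a ha m => hTe a ha j m) hD' hy1
        (hy0 (Ne.symm h)) hPi hPj hPi' hPj' hs hs' (hR6 (by decide) i) (hR8 (by decide) i j h) _ _ _ n
    · have hj : j = j₀ := by omega
      subst hj
      have hPi := hP i
      have hPi' := hP' i
      rw [hoff j i (Ne.symm h)] at hPi hPi'
      exact serre_commutator_mem_of_last ht hv hst hk hT (fun a ha m => hTe a ha i m) hD' hy1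
        (hy0 h) hPi hPi' hs hs' (hR6 (by decide) i) _ _ _ n

end HalfRelations

/-! ### Separatedness and stability -/

theorem Ser.isHbarClosed_zero {V : Type} [AddCommGroup V] [Module ℂ V] :
    IsHbarClosed ({0} : Set (Ser V)) := by
  intro y hy
  funext n
  obtain ⟨s, hs, t, rfl⟩ := hy (n + 1)
  rw [Set.mem_singleton_iff] at hs
  rw [hs, zero_add, Ser.hbar_pow_smul_apply, if_neg (by omega)]
  rfl

theorem endSeries_hbar_pow_smul {V : Type} [AddCommGroup V] [Module ℂ V] (n : ℕ)
    (f : (Module.End ℂ V)⟦X⟧) : hbar ^ n • f = X ^ n * f := by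
  rw [Algebra.smul_def]
  congr 1
  change scalar (hbar ^ n) = _
  rw [map_pow, scalar_X]

theorem endSeries_isHbarClosed_zero {V : Type} [AddCommGroup V] [Module ℂ V] :
    IsHbarClosed ({0} : Set (Module.End ℂ V)⟦X⟧) := by
  intro y hy
  ext1 n
  obtain ⟨s, hs, t, rfl⟩ := hy (n + 1)
  rw [Set.mem_singleton_iff] at hs
  rw [hs, zero_add, endSeries_hbar_pow_smul, coeff_X_pow_mul', if_neg (by omega), map_zero]

section FreeTop
variable {G : Type}

/-- A closed submodule of `ℂ⟨G⟩⟦ħ⟧` which contains the constants and is stable under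
multiplication by the generators on the right is everything. -/
theorem FreeTop.mem_of_mul_gen {S : Submodule Base (FreeTop G)}
    (hS : IsHbarClosed (S : Set (FreeTop G))) (h1 : 1 ∈ S)
    (h : ∀ g, ∀ f ∈ S, f * PowerSeries.C (FreeAlgebra.ι ℂ g) ∈ S) (f : FreeTop G) : f ∈ S := by
  have hmul : ∀ (a : FreeAlgebra ℂ G), ∀ f ∈ S, f * PowerSeries.C a ∈ S := by
    intro a
    induction a with
    | grade0 r =>
      intro f hf
      rw [← scalar_C, ← (scalar_commute _ f).eq]
      exact S.smul_mem _ hf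
    | grade1 g => exact h g
    | mul a b ha hb => intro f hf; rw [map_mul, ← mul_assoc]; exact hb _ (ha _ hf)
    | add a b ha hb => intro f hf; rw [map_add, mul_add]; exact S.add_mem (ha _ hf) (hb _ hf)
  refine Submodule.eq_top_of_closed hS (fun v => ⟨PowerSeries.C (coeff 0 v), ?_,
    PowerSeries.mk fun n => coeff (n + 1) v, ?_⟩) f
  · simpa using hmul (coeff 0 v) 1 h1
  · rw [FreeTop.hbar_smul, add_comm]
    simpa using eq_X_mul_shift_add_const v

variable {V : Type} [AddCommGroup V] [Module ℂ V]

/-- The continuous extension of a homomorphism, as a `ℂ⟦ħ⟧`-linear map. -/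
def liftTopLin (f : FreeAlgebra ℂ G →ₐ[ℂ] (Module.End ℂ V)⟦X⟧) :
    FreeTop G →ₗ[Base] (Module.End ℂ V)⟦X⟧ where
  toFun := liftTopAlg f
  map_add' := map_add _
  map_smul' a r := by
    rw [FreeTop.smul_def, map_mul, liftTopAlg_scalar]
    rfl

/-- The orbit map of a vector. -/
def orbit (f : FreeAlgebra ℂ G →ₐ[ℂ] (Module.End ℂ V)⟦X⟧) (v : Ser V) :
    FreeTop G →ₗ[Base] Ser V where
  toFun r := liftTopAlg f r • v
  map_add' r s := by rw [map_add, add_smul]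
  map_smul' a r := by
    rw [FreeTop.smul_def, map_mul, liftTopAlg_scalar, mul_smul]
    rfl

theorem commute_liftTopAlg {f : FreeAlgebra ℂ G →ₐ[ℂ] (Module.End ℂ V)⟦X⟧}
    {z : (Module.End ℂ V)⟦X⟧} (h : ∀ g, Commute z (f (FreeAlgebra.ι ℂ g))) (r : FreeTop G) :
    Commute z (liftTopAlg f r) := by
  have := FreeTop.mem_of_gen_mul (S := LinearMap.ker
    ((LinearMap.mulLeft Base z - LinearMap.mulRight Base z) ∘ₗ liftTopLin f))
    (endSeries_isHbarClosed_zero.preimage _) (by simp [liftTopLin]) (fun g r hr => ?_) r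
  · exact sub_eq_zero.1 this
  · have hr' : Commute z (liftTopAlg f r) := sub_eq_zero.1 hr
    refine sub_eq_zero.2 (?_ : Commute z (liftTopAlg f _))
    rw [map_mul, liftTopAlg_C]
    exact (h g).mul_right hr'

theorem liftTopAlg_map {B B' K : Type} [Ring B] [Algebra ℂ B] [Ring B'] [Algebra ℂ B'] [Ring K]
    [Algebra ℂ K] (f : B' →ₐ[ℂ] K⟦X⟧) (g : B →ₐ[ℂ] B') (r : B⟦X⟧) :
    liftTopAlg f (PowerSeries.map (g : B →+* B') r) = liftTopAlg (f.comp g) r := by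
  ext n
  rw [coeff_liftTopAlg, coeff_liftTopAlg]
  rfl

end FreeTop

section Stabilizer
variable {V : Type} [AddCommGroup V] [Module ℂ V] (S : Submodule Base (Ser V))

/-- The operators which preserve a submodule of `V⟦ħ⟧`. -/
def stabilizer : Subalgebra Base (Module.End ℂ V)⟦X⟧ where
  carrier := {a | ∀ s ∈ S, a • s ∈ S}
  mul_mem' ha hb s hs := by rw [mul_smul]; exact ha _ (hb _ hs)
  add_mem' ha hb s hs := by rw [add_smul]; exact S.add_mem (ha _ hs) (hb _ hs)
  algebraMap_mem' r s hs := S.smul_mem r hs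

/-- The operators which map a vector into a submodule of `V⟦ħ⟧`. -/
def transporter (v : Ser V) : Submodule Base (Module.End ℂ V)⟦X⟧ where
  carrier := {a | a • v ∈ S}
  zero_mem' := by simp
  add_mem' {a b} ha hb := by
    change (a + b) • v ∈ S
    rw [add_smul]; exact S.add_mem ha hb
  smul_mem' r a ha := by
    change (r • a) • v ∈ S
    rw [Algebra.smul_def, mul_smul]; exact S.smul_mem r ha

/-- The operators which map everything into a submodule of `V⟦ħ⟧`. -/
def annihilator : Submodule Base (Module.End ℂ V)⟦X⟧ where
  carrier := {a | ∀ v, a • v ∈ S}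
  zero_mem' v := by simp
  add_mem' ha hb v := by rw [add_smul]; exact S.add_mem (ha _) (hb _)
  smul_mem' r a ha v := by rw [Algebra.smul_def, mul_smul]; exact S.smul_mem r (ha _)

variable {S}

theorem isHbarClosed_stabilizer (hS : IsHbarClosed (S : Set (Ser V))) :
    IsHbarClosed (stabilizer S : Set (Module.End ℂ V)⟦X⟧) := by
  intro y hy s hs
  refine hS _ fun n => ?_
  obtain ⟨a, ha, t, rfl⟩ := hy n
  exact ⟨a • s, ha s hs, t • s, by rw [add_smul, Algebra.smul_def, mul_smul]; rfl⟩

end Stabilizer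

namespace Verma

/-- The homomorphism from the free algebra which gives the action of the `x^-_{i,n}`. -/
def xmHom : FreeAlgebra ℂ HalfGen →ₐ[ℂ] (Module.End ℂ VermaSpace)⟦X⟧ :=
  FreeAlgebra.lift ℂ fun g => PowerSeries.C (prepend g)

/-- The homomorphism from the free algebra which gives the action on the words in the right factor
by left multiplication. -/
def yHom : FreeAlgebra ℂ HalfGen →ₐ[ℂ] (Module.End ℂ VermaSpace)⟦X⟧ :=
  FreeAlgebra.lift ℂ fun g => PowerSeries.C (y g)

/-- The homomorphism from the free algebra which gives the action of the `x^+_{i,n}`. -/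
def xpHom : FreeAlgebra ℂ HalfGen →ₐ[ℂ] (Module.End ℂ VermaSpace)⟦X⟧ :=
  FreeAlgebra.lift ℂ fun g => match g with | HalfGen.x i n => xp i n

/-- The homomorphism from the free algebra which gives the action of the `h_{i,n}` and `c`. -/
def cartanHom : FreeAlgebra ℂ CartanGen →ₐ[ℂ] (Module.End ℂ VermaSpace)⟦X⟧ :=
  FreeAlgebra.lift ℂ fun g => match g with
    | CartanGen.h i n => h i n
    | CartanGen.c => PowerSeries.C c

theorem xmHom_ι (g : HalfGen) : xmHom (FreeAlgebra.ι ℂ g) = PowerSeries.C (prepend g) := by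
  simp [xmHom]

theorem yHom_ι (g : HalfGen) : yHom (FreeAlgebra.ι ℂ g) = PowerSeries.C (y g) := by
  simp [yHom]

theorem xpHom_ι (i : Fin 2) (n : ℤ) : xpHom (FreeAlgebra.ι ℂ (HalfGen.x i n)) = xp i n := by
  simp [xpHom]

theorem cartanHom_h (i : Fin 2) (n : ℤ) :
    cartanHom (FreeAlgebra.ι ℂ (CartanGen.h i n)) = h i n := by simp [cartanHom]

theorem cartanHom_c : cartanHom (FreeAlgebra.ι ℂ CartanGen.c) = PowerSeries.C c := by
  simp [cartanHom]

end Verma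

/-! ### The submodule of relations -/

/-- The closed ideal generated by the relations (Q6)-(Q9) with sign `ε`. -/
abbrev halfIdeal (ε : ℤˣ) : Ideal (FreeTop HalfGen) := closedIdeal (cancelHbar (halfRelations ε))

theorem mem_halfIdeal_of_mem {ε : ℤˣ} {r : FreeTop HalfGen} (hr : r ∈ halfRelations ε) :
    r ∈ halfIdeal ε := subset_closedIdeal _ ⟨0, by simpa using hr⟩

/-- There are no common powers of `ħ` in the relations (Q6)-(Q9). -/
theorem mem_halfRelations_of_cancel {ε : ℤˣ} {r : FreeTop HalfGen}
    (hr : r ∈ cancelHbar (halfRelations ε)) : r ∈ halfRelations ε :=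
  mem_of_mem_cancelHbar (constantCoeff_ne_zero_of_mem_halfRelations ε) hr

namespace Verma

/-- The closed submodule generated by `I⁻ ⊗ ℂ[h, c] ⊗ ℂ⟨y⟩` and `ℂ⟨x⁻⟩ ⊗ ℂ[h, c] ⊗ I⁺`, where
`I^±` are the ideals of the relations (Q6)-(Q9) in the two halves. -/
def relSpace : Submodule Base (Ser VermaSpace) :=
  sInf {S | IsHbarClosed (S : Set (Ser VermaSpace)) ∧
    (∀ r ∈ halfIdeal (-1), ∀ v, liftTopAlg xmHom r • v ∈ S) ∧
    ∀ r ∈ halfIdeal 1, ∀ v, liftTopAlg yHom r • v ∈ S}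

theorem isHbarClosed_relSpace : IsHbarClosed (relSpace : Set (Ser VermaSpace)) := by
  intro v hv
  rw [SetLike.mem_coe, relSpace, Submodule.mem_sInf]
  intro S hS
  refine hS.1 v fun n => ?_
  obtain ⟨s, hs, t, rfl⟩ := hv n
  exact ⟨s, by rw [SetLike.mem_coe, relSpace, Submodule.mem_sInf] at hs; exact hs S hS, t, rfl⟩

theorem xmHom_mem_relSpace {r : FreeTop HalfGen} (hr : r ∈ halfIdeal (-1)) (v : Ser VermaSpace) :
    liftTopAlg xmHom r • v ∈ relSpace := by
  rw [relSpace, Submodule.mem_sInf]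
  exact fun S hS => hS.2.1 r hr v

theorem yHom_mem_relSpace {r : FreeTop HalfGen} (hr : r ∈ halfIdeal 1) (v : Ser VermaSpace) :
    liftTopAlg yHom r • v ∈ relSpace := by
  rw [relSpace, Submodule.mem_sInf]
  exact fun S hS => hS.2.2 r hr v

theorem relSpace_le {S : Submodule Base (Ser VermaSpace)}
    (hS : IsHbarClosed (S : Set (Ser VermaSpace)))
    (h1 : ∀ r ∈ halfIdeal (-1), ∀ v, liftTopAlg xmHom r • v ∈ S)
    (h2 : ∀ r ∈ halfIdeal 1, ∀ v, liftTopAlg yHom r • v ∈ S) : relSpace ≤ S :=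
  sInf_le ⟨hS, h1, h2⟩

theorem mem_stabilizer {a : (Module.End ℂ VermaSpace)⟦X⟧}
    (h1 : ∀ r ∈ halfIdeal (-1), ∀ v, a • liftTopAlg xmHom r • v ∈ relSpace)
    (h2 : ∀ r ∈ halfIdeal 1, ∀ v, a • liftTopAlg yHom r • v ∈ relSpace) :
    a ∈ stabilizer relSpace :=
  relSpace_le (S := relSpace.comap (Ser.act a)) (isHbarClosed_relSpace.preimage _) h1 h2

theorem smul_yHom_of_commute {a : (Module.End ℂ VermaSpace)⟦X⟧}
    (h : ∀ g, Commute a (PowerSeries.C (y g))) {r : FreeTop HalfGen} (hr : r ∈ halfIdeal 1)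
    (v : Ser VermaSpace) : a • liftTopAlg yHom r • v ∈ relSpace := by
  rw [← mul_smul, (commute_liftTopAlg (fun g => by rw [yHom_ι]; exact h g) r).eq, mul_smul]
  exact yHom_mem_relSpace hr _

/-- Operators which commute with the `x^-` and with `y` preserve `relSpace`. -/
theorem mem_stabilizer_of_commute {a : (Module.End ℂ VermaSpace)⟦X⟧}
    (h1 : ∀ j n, Commute a (xm j n)) (h2 : ∀ g, Commute a (PowerSeries.C (y g))) :
    a ∈ stabilizer relSpace := by
  refine mem_stabilizer (fun r hr v => ?_) fun r hr v => smul_yHom_of_commute h2 hr v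
  rw [← mul_smul, (commute_liftTopAlg (fun g => by rw [xmHom_ι]; exact h1 _ _) r).eq, mul_smul]
  exact xmHom_mem_relSpace hr _

theorem c_mem_stabilizer : PowerSeries.C c ∈ stabilizer relSpace :=
  mem_stabilizer_of_commute commute_c_xm fun g => (commute_y_c g).symm

theorem kappa_mem_stabilizer (ε : ℤˣ) (a m : ℤ) : kappa c ε a m ∈ stabilizer relSpace :=
  mem_stabilizer_of_commute (fun j n => commute_kappa (commute_c_xm j n) _ _ _)
    fun g => commute_kappa (commute_y_c g).symm _ _ _

theorem prepend_mem_stabilizer (g : HalfGen) : PowerSeries.C (prepend g) ∈ stabilizer relSpace := by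
  refine mem_stabilizer (fun r hr v => ?_) fun r hr v => smul_yHom_of_commute (fun g' =>
    (commute_y_xm g' _ _).symm) hr v
  rw [← mul_smul, ← xmHom_ι, ← liftTopAlg_C, ← map_mul]
  exact xmHom_mem_relSpace ((halfIdeal (-1)).mul_mem_left _ hr) v

theorem xm_mem_stabilizer (j : Fin 2) (n : ℤ) : xm j n ∈ stabilizer relSpace :=
  prepend_mem_stabilizer _

/-- An operator maps `I⁻ ⊗ ℂ[h, c] ⊗ ℂ⟨y⟩` into `relSpace` if this is true for its commutators
with the `x⁻` and with the relations. -/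
theorem smul_xmHom_mem {D : (Module.End ℂ VermaSpace)⟦X⟧}
    (h1 : ∀ j n, D * xm j n - xm j n * D ∈ stabilizer relSpace)
    (h2 : ∀ r ∈ halfRelations (-1), D * liftTopAlg xmHom r - liftTopAlg xmHom r * D ∈
      annihilator relSpace) {r : FreeTop HalfGen} (hr : r ∈ halfIdeal (-1)) (v : Ser VermaSpace) :
    D • liftTopAlg xmHom r • v ∈ relSpace := by
  -- both conditions are needed: the first one makes the second one stable under multiplication
  let J : Submodule Base (FreeTop HalfGen) := (⨅ v, relSpace.comap (orbit xmHom v)) ⊓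
    ⨅ v, relSpace.comap (Ser.act D ∘ₗ orbit xmHom v)
  have hJ : ∀ r, r ∈ J ↔ (∀ v, liftTopAlg xmHom r • v ∈ relSpace) ∧
      ∀ v, D • liftTopAlg xmHom r • v ∈ relSpace := fun r => by
    simp only [J, Submodule.mem_inf, Submodule.mem_iInf]
    rfl
  refine ((hJ r).1 ?_).2 v
  refine FreeTop.closedIdeal_induction (S := J) ?_ (fun r hr => ?_) (fun g r hr => ?_)
    (fun g r hr => ?_) hr
  · simp only [J, Submodule.coe_inf, Submodule.coe_iInf]
    exact (IsHbarClosed.iInter fun v => isHbarClosed_relSpace.preimage _).inter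
      (IsHbarClosed.iInter fun v => isHbarClosed_relSpace.preimage _)
  · have hr' := mem_halfRelations_of_cancel hr
    have h3 := fun v => xmHom_mem_relSpace (mem_halfIdeal_of_mem hr') v
    refine (hJ r).2 ⟨h3, fun v => ?_⟩
    have := relSpace.add_mem (h2 r hr' v) (h3 (D • v))
    rwa [sub_smul, mul_smul, mul_smul, sub_add_cancel] at this
  · rw [hJ] at hr ⊢
    obtain ⟨j, n⟩ := g
    simp only [map_mul, liftTopAlg_C, xmHom_ι, mul_smul]
    refine ⟨fun v => prepend_mem_stabilizer _ _ (hr.1 v), fun v => ?_⟩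
    have := relSpace.add_mem (h1 j n _ (hr.1 v)) (prepend_mem_stabilizer (HalfGen.x j n) _ (hr.2 v))
    rw [sub_smul, mul_smul, mul_smul] at this
    change _ - xm j n • _ + xm j n • _ ∈ _ at this
    rwa [sub_add_cancel] at this
  · rw [hJ] at hr ⊢
    simp only [map_mul, liftTopAlg_C, mul_smul]
    exact ⟨fun v => hr.1 _, fun v => hr.2 _⟩

theorem relStage_mem_relSpace {s : Fin 3} {r : FreeTop HalfGen}
    (hr : r ∈ relStage (-1) (fun i n => FreeAlgebra.ι ℂ (HalfGen.x i n)) s) :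
    liftTopAlg xmHom r ∈ annihilator relSpace := fun v =>
  xmHom_mem_relSpace (mem_halfIdeal_of_mem (mem_relHalf_iff.2 ⟨s, hr⟩)) v

theorem h_mem_stabilizer (i : Fin 2) (l : ℤ) : h i l ∈ stabilizer relSpace := by
  refine mem_stabilizer (fun r hr v => smul_xmHom_mem (fun j n => ?_) (fun r hr => ?_) hr v)
    fun r hr v => smul_yHom_of_commute (fun g => (commute_y_h g i l).symm) hr v
  · rw [h_xm]
    exact mul_mem (kappa_mem_stabilizer _ _ _) (xm_mem_stabilizer _ _)
  · obtain ⟨s, hs⟩ := mem_relHalf_iff.1 hr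
    refine shift_commutator_mem (T := annihilator relSpace) (κ := fun j => kappa c (-1) (cartan i j) l) (l := l)
      (fun j m => ?_) (fun j k m => ?_) (fun j a ha v => ?_)
      (fun r hr => relStage_mem_relSpace hr) hs
    · rw [xmHom_ι, xmHom_ι]
      exact h_xm i j l m
    · rw [xmHom_ι]
      exact commute_kappa (commute_c_xm k m) _ _ _
    · rw [mul_smul]
      exact kappa_mem_stabilizer _ _ _ _ (ha v)

theorem cartanHom_mem_stabilizer (r : FreeTop CartanGen) :
    liftTopAlg cartanHom r ∈ stabilizer relSpace := by
  refine FreeTop.mem_of_gen_mul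
    (S := (Subalgebra.toSubmodule (stabilizer relSpace)).comap (liftTopLin cartanHom))
    ((isHbarClosed_stabilizer isHbarClosed_relSpace).preimage _) ?_ (fun g r hr => ?_) r
  · change liftTopAlg cartanHom 1 ∈ stabilizer relSpace
    rw [map_one]
    exact one_mem _
  · change liftTopAlg cartanHom _ ∈ stabilizer relSpace
    rw [map_mul, liftTopAlg_C]
    refine mul_mem ?_ hr
    cases g with
    | h i n => rw [cartanHom_h]; exact h_mem_stabilizer i n
    | c => rw [cartanHom_c]; exact c_mem_stabilizer

end Verma

theorem liftTopAlg_commutatorMode {B K : Type} [Ring B] [Algebra ℂ B] [Ring K] [Algebra ℂ K]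
    (f : B →ₐ[ℂ] K⟦X⟧) {c : K} {b : Fin 2 → K} {H : Fin 2 → ℤ → K⟦X⟧} {c' : B} {h : Fin 2 → ℤ → B}
    (hc : f c' = PowerSeries.C c) (hh : ∀ i n, f (h i n) = H i n)
    (hb : ∀ i, H i 0 = PowerSeries.C (b i)) (i : Fin 2) (m n : ℤ) :
    liftTopAlg f (commutatorMode c' (fun i => h i 0) (fun i n => PowerSeries.C (h i n)) i m n) =
      commutatorMode c b H i m n := by
  have hd : ∀ σ, liftTopAlg f (phiDelta c' (fun i => h i 0) (fun i n => PowerSeries.C (h i n))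
      σ i m n) = phiDelta c b H σ i m n := by
    intro σ
    rw [phiDelta, phiDelta, map_mul, liftTopAlg_qExp f hc]
    exact congrArg (· * _) (liftTopAlg_phiMode f hh hb σ i _)
  rw [← qd_mul_inj, qd_mul_commutatorMode, ← hd, ← hd, ← map_sub, ← qd_mul_commutatorMode, map_mul]
  congr 1
  exact (liftTopAlg_scalar f _).symm

namespace Verma

theorem commutatorMode_mem_stabilizer (i : Fin 2) (m n : ℤ) :
    commutatorMode c h0 h i m n ∈ stabilizer relSpace := by
  rw [← liftTopAlg_commutatorMode cartanHom cartanHom_c cartanHom_h h_zero]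
  exact cartanHom_mem_stabilizer _

/-- The modes of `φ_i^±` vanish on one side, hence so do the values in (Q5) as functions of one
index. -/
theorem phiDelta_oneSided_left (σ : ℤˣ) (i : Fin 2) (n : ℤ) :
    OneSidedModes fun m => phiDelta c h0 h σ i m n := by
  rcases Int.units_eq_one_or σ with rfl | rfl
  · refine Or.inl ⟨-n, fun m hm => ?_⟩
    simp only [phiDelta]
    rw [phiOpMode, if_neg (by simp; omega), zero_mul]
  · refine Or.inr ⟨-n, fun m hm => ?_⟩
    simp only [phiDelta]
    rw [phiOpMode, if_neg (by simp; omega), zero_mul]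

theorem phiDelta_oneSided_right (σ : ℤˣ) (i : Fin 2) (n : ℤ) :
    OneSidedModes fun m => phiDelta c h0 h σ i n m := by
  rcases Int.units_eq_one_or σ with rfl | rfl
  · refine Or.inl ⟨-n, fun m hm => ?_⟩
    simp only [phiDelta]
    rw [phiOpMode, if_neg (by simp; omega), zero_mul]
  · refine Or.inr ⟨-n, fun m hm => ?_⟩
    simp only [phiDelta]
    rw [phiOpMode, if_neg (by simp; omega), zero_mul]

theorem phiDelta_currentRel_xp (σ : ℤˣ) (i j : Fin 2) (n : ℤ) :
    CurrentRel (qPow (((1 : ℤˣ) * cartan i j : ℤ) : ℂ)) (fun m => phiDelta c h0 h σ i m n)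
      (xp j) := by
  have e : (fun m => phiDelta c h0 h σ i m n) = fun m => phiOpMode h0 h σ i (m + n) *
      qExp (((σ : ℤ) : ℂ) * (((1 : ℤˣ) : ℤ) : ℂ) * ((m : ℂ) - n) / 2) c := by
    funext m
    simp [phiDelta]
  rw [e]
  exact isCartanAction.phi_currentRel (isCurrent_xp j) σ i n

theorem phiDelta_currentRel_xm (σ : ℤˣ) (i j : Fin 2) (n : ℤ) :
    CurrentRel (qPow (((-1 : ℤˣ) * cartan i j : ℤ) : ℂ)) (fun m => phiDelta c h0 h σ i n m)
      (xm j) := by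
  have e : (fun m => phiDelta c h0 h σ i n m) = fun m => phiOpMode h0 h σ i (m + n) *
      qExp (((σ : ℤ) : ℂ) * (((-1 : ℤˣ) : ℤ) : ℂ) * ((m : ℂ) - n) / 2) c := by
    funext m
    rw [phiDelta, add_comm n m]
    congr 2
    simp
    ring
  rw [e]
  exact isCartanAction.phi_currentRel (isCurrent_xm j) σ i n

end Verma

theorem Words.mem_of_single {L W : Type} [AddCommGroup W] [Module ℂ W]
    {N : Submodule ℂ (Words L W)} (h : ∀ w u, Words.single w u ∈ N) (v : Words L W) : v ∈ N := by
  have : N.mkQ = 0 := Words.hom_ext fun w u => by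
    rw [LinearMap.zero_apply, Submodule.mkQ_apply, Submodule.Quotient.mk_eq_zero]
    exact h w u
  rw [← Submodule.Quotient.mk_eq_zero, ← Submodule.mkQ_apply, this, LinearMap.zero_apply]

/-- The constant series in a submodule. -/
def Ser.constPart {V : Type} [AddCommGroup V] [Module ℂ V] (Q : Submodule Base (Ser V)) :
    Submodule ℂ V where
  carrier := {v | Ser.const v ∈ Q}
  zero_mem' := by
    have : Ser.const (0 : V) = 0 := by
      funext n
      simp only [Ser.const, ite_self]
      rfl
    change Ser.const 0 ∈ Q
    rw [this]
    exact Q.zero_mem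
  add_mem' {v w} hv hw := by
    change Ser.const (v + w) ∈ Q
    rw [Ser.const_add]
    exact Q.add_mem hv hw
  smul_mem' a v hv := by
    change Ser.const (a • v) ∈ Q
    rw [Ser.const_smul]
    exact Q.smul_mem _ hv

/-! ### Normally ordered monomials -/

/-- The generators `h_{i,n}` with `n > 0`. -/
def CartanGen.isPos : CartanGen → Bool
  | CartanGen.h _ n => 0 < n
  | CartanGen.c => false

/-- The product of a list of Cartan generators, where the factors `h_{i,n}` with `n > 0` are moved
to the right. -/
def normalProd {A : Type} [Monoid A] (f : CartanGen → A) (L : List CartanGen) : A :=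
  ((L.filter fun g => !g.isPos).map f).prod * ((L.filter fun g => g.isPos).map f).prod

theorem map_normalProd {A A' F : Type} [Monoid A] [Monoid A'] [FunLike F A A'] [MonoidHomClass F A A']
    (θ : F) (f : CartanGen → A) (L : List CartanGen) :
    θ (normalProd f L) = normalProd (fun g => θ (f g)) L := by
  rw [normalProd, normalProd, map_mul, map_list_prod, map_list_prod, List.map_map, List.map_map]
  rfl

theorem normalProd_of_comm {A : Type} [CommMonoid A] (f : CartanGen → A) (L : List CartanGen) :
    normalProd f L = (L.map f).prod := by
  rw [normalProd, mul_comm]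
  induction L with
  | nil => simp
  | cons g L ih =>
    rw [List.map_cons, List.prod_cons, ← ih]
    by_cases h : g.isPos = true
    · simp [h, mul_assoc]
    · simp [h, mul_left_comm]

theorem CartanPoly.mem_of_list {N : Submodule ℂ CartanPoly}
    (h : ∀ L : List CartanGen, (L.map MvPolynomial.X).prod ∈ N) (p : CartanPoly) : p ∈ N := by
  let N' : Submodule ℂ CartanPoly := Submodule.span ℂ
    (Set.range fun L : List CartanGen => (L.map (MvPolynomial.X (R := ℂ))).prod)
  have hN' : N' ≤ N := Submodule.span_le.2 (by rintro _ ⟨L, rfl⟩; exact h L)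
  refine hN' ?_
  induction p using MvPolynomial.induction_on with
  | C a =>
    rw [← mul_one (MvPolynomial.C a), ← MvPolynomial.smul_eq_C_mul]
    exact N'.smul_mem _ (Submodule.subset_span ⟨[], by simp⟩)
  | add p q hp hq => exact N'.add_mem hp hq
  | mul_X p g hp =>
    rw [mul_comm]
    have : N' ≤ N'.comap (LinearMap.mulLeft ℂ (MvPolynomial.X g)) := Submodule.span_le.2 (by
      rintro _ ⟨L, rfl⟩
      exact Submodule.subset_span ⟨g :: L, by simp⟩)
    exact this hp

theorem pderiv_list_prod {g : CartanGen} {L : List CartanGen} (h : g ∉ L) :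
    MvPolynomial.pderiv g (L.map (MvPolynomial.X (R := ℂ))).prod = 0 := by
  induction L with
  | nil => simp
  | cons g' L ih =>
    rw [List.mem_cons, not_or] at h
    rw [List.map_cons, List.prod_cons, Derivation.leibniz, ih h.2, smul_zero, zero_add,
      MvPolynomial.pderiv_X_of_ne (Ne.symm h.1), smul_zero]

namespace Verma

theorem cartanHom_smul (g : CartanGen) (w : List HalfGen) (p : CartanPoly)
    (hp : g.isPos → ∀ g' : CartanGen, g'.isPos = false → MvPolynomial.pderiv g' p = 0) :
    cartanHom (FreeAlgebra.ι ℂ g) • Ser.const (emb (Words.single w p) : VermaSpace) =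
      Ser.const (emb (Words.single w (MvPolynomial.X g * p))) := by
  cases g with
  | h i l =>
    rw [cartanHom_h]
    exact h_emb_single i l w p fun hl => ⟨hp (by simpa [CartanGen.isPos] using hl) _
      (by simp [CartanGen.isPos]; omega), hp (by simpa [CartanGen.isPos] using hl) _
      (by simp [CartanGen.isPos]; omega)⟩
  | c => rw [cartanHom_c, Ser.C_smul_const, c_emb_single]

/-- Normally ordered monomials act on the vectors `1 ⊗ 1 ⊗ w` by creation operators. -/
theorem normalProd_smul_vac (L : List CartanGen) (w : List HalfGen) :
    normalProd (fun g => cartanHom (FreeAlgebra.ι ℂ g)) L • Ser.const (vac w) =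
      Ser.const (emb (Words.single w (L.map MvPolynomial.X).prod)) := by
  have h1 : ∀ L : List CartanGen, (∀ g ∈ L, g.isPos = true) →
      (L.map fun g => cartanHom (FreeAlgebra.ι ℂ g)).prod • Ser.const (vac w) =
      Ser.const (emb (Words.single w (L.map MvPolynomial.X).prod)) := by
    intro L
    induction L with
    | nil => intro _; simp [vac]
    | cons g L ih =>
      intro hL
      rw [List.map_cons, List.prod_cons, mul_smul, ih fun g hg => hL g (List.mem_cons_of_mem _ hg),
        cartanHom_smul, List.map_cons, List.prod_cons]
      intro _ g' hg'
      refine pderiv_list_prod fun hm => ?_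
      rw [hL g' (List.mem_cons_of_mem _ hm)] at hg'
      exact absurd hg' (by simp)
  have h2 : ∀ L : List CartanGen, (∀ g ∈ L, g.isPos = false) → ∀ p : CartanPoly,
      (L.map fun g => cartanHom (FreeAlgebra.ι ℂ g)).prod •
        Ser.const (emb (Words.single w p) : VermaSpace) =
      Ser.const (emb (Words.single w ((L.map MvPolynomial.X).prod * p))) := by
    intro L
    induction L with
    | nil => intro _ p; simp
    | cons g L ih =>
      intro hL p
      rw [List.map_cons, List.prod_cons, mul_smul, ih fun g hg => hL g (List.mem_cons_of_mem _ hg),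
        cartanHom_smul, List.map_cons, List.prod_cons, mul_assoc]
      intro hg
      rw [hL g List.mem_cons_self] at hg
      exact absurd hg (by simp)
  rw [← normalProd_of_comm, normalProd, mul_smul, h1 _ (by simp), h2 _ (by simp), normalProd]

/-- A closed submodule which contains the vectors `1 ⊗ 1 ⊗ w` and is stable under the `x^-_{i,n}`,
the `h_{i,n}` and `c` is everything. -/
theorem mem_of_stable {Q : Submodule Base (Ser VermaSpace)}
    (hQ : IsHbarClosed (Q : Set (Ser VermaSpace))) (hvac : ∀ w, Ser.const (vac w) ∈ Q)
    (hx : ∀ j n, ∀ v ∈ Q, xm j n • v ∈ Q) (hh : ∀ i l, ∀ v ∈ Q, h i l • v ∈ Q)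
    (hc : ∀ v ∈ Q, (PowerSeries.C c : (Module.End ℂ VermaSpace)⟦X⟧) • v ∈ Q) (v : Ser VermaSpace) :
    v ∈ Q := by
  have hcartan : ∀ g, ∀ v ∈ Q, cartanHom (FreeAlgebra.ι ℂ g) • v ∈ Q := fun g => by
    cases g with
    | h i l => rw [cartanHom_h]; exact hh i l
    | c => rw [cartanHom_c]; exact hc
  have hlist : ∀ L : List CartanGen, ∀ v ∈ Q,
      (L.map fun g => cartanHom (FreeAlgebra.ι ℂ g)).prod • v ∈ Q := by
    intro L
    induction L with
    | nil => intro v hv; simpa using hv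
    | cons g L ih =>
      intro v hv
      rw [List.map_cons, List.prod_cons, mul_smul]
      exact hcartan g _ (ih v hv)
  have h1 : ∀ w p, (emb (Words.single w p) : VermaSpace) ∈ Ser.constPart Q := fun w =>
    CartanPoly.mem_of_list (N := (Ser.constPart Q).comap (emb ∘ₗ Words.single w)) fun L => by
      change Ser.const _ ∈ Q
      rw [LinearMap.comp_apply, ← normalProd_smul_vac, normalProd, mul_smul]
      exact hlist _ _ (hlist _ _ (hvac w))
  have h2 : ∀ u, (emb u : VermaSpace) ∈ Ser.constPart Q :=
    Words.mem_of_single (N := (Ser.constPart Q).comap emb) fun w p => h1 w p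
  refine Ser.mem_of_const hQ (Words.mem_of_single (N := Ser.constPart Q) fun w u => ?_) v
  induction w with
  | nil => exact h2 u
  | cons x w ih =>
    obtain ⟨j, n⟩ := x
    have := hx j n _ ih
    rwa [xm, Ser.C_smul_const, prepend_single] at this

/-- On the vacuum vectors, `x^+` acts by multiplication in the right factor. -/
theorem xpHom_smul_vac (r : FreeTop HalfGen) (w : List HalfGen) :
    liftTopAlg xpHom r • Ser.const (vac w) = liftTopAlg yHom r • Ser.const (vac w) := by
  have := FreeTop.mem_of_mul_gen
    (S := ⨅ w, LinearMap.ker (orbit xpHom (Ser.const (vac w)) - orbit yHom (Ser.const (vac w)))) ?_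
    ?_ (fun g f hf => ?_) r
  · rw [Submodule.mem_iInf] at this
    exact sub_eq_zero.1 (this w)
  · rw [Submodule.coe_iInf]
    exact IsHbarClosed.iInter fun w => Ser.isHbarClosed_zero.preimage _
  · rw [Submodule.mem_iInf]
    intro w
    refine sub_eq_zero.2 ?_
    change liftTopAlg xpHom 1 • Ser.const (vac w) = liftTopAlg yHom 1 • Ser.const (vac w)
    rw [map_one, map_one]
  · rw [Submodule.mem_iInf] at hf ⊢
    intro w
    refine sub_eq_zero.2 ?_
    obtain ⟨j, m⟩ := g
    have h1 : liftTopAlg xpHom f • Ser.const (vac (HalfGen.x j m :: w)) =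
      liftTopAlg yHom f • Ser.const (vac (HalfGen.x j m :: w)) := sub_eq_zero.1 (hf _)
    change liftTopAlg xpHom (f * PowerSeries.C (FreeAlgebra.ι ℂ (HalfGen.x j m))) • Ser.const (vac w) =
      liftTopAlg yHom (f * PowerSeries.C (FreeAlgebra.ι ℂ (HalfGen.x j m))) • Ser.const (vac w)
    rw [map_mul, map_mul, liftTopAlg_C, liftTopAlg_C, xpHom_ι, yHom_ι, mul_smul, mul_smul, xp_vac,
      Ser.C_smul_const, y_vac, h1]

theorem c_smul_yHom (r : FreeTop HalfGen) (v : Ser VermaSpace) : liftTopAlg yHom r •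
    (PowerSeries.C c : (Module.End ℂ VermaSpace)⟦X⟧) • v =
      (PowerSeries.C c : (Module.End ℂ VermaSpace)⟦X⟧) • liftTopAlg yHom r • v := by
  rw [← mul_smul, ← mul_smul, (commute_liftTopAlg (z := PowerSeries.C c) (fun g => by
    rw [yHom_ι]; exact (commute_y_c g).symm) r).eq]

/-- The operators `x^+_{j,m}` preserve `relSpace`. On `I⁻ ⊗ ℂ[h, c] ⊗ ℂ⟨y⟩` this is
`half_commutator_mem`. On `ℂ⟨x⁻⟩ ⊗ ℂ[h, c] ⊗ I⁺` one moves `x^+` to the vacuum vectors, where it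
acts by multiplication and `I⁺` is an ideal. -/
theorem xp_mem_stabilizer (j : Fin 2) (m : ℤ) : xp j m ∈ stabilizer relSpace := by
  have hD : ∀ j k m n, xp j m * xm k n - xm k n * xp j m ∈ stabilizer relSpace := fun j k m n => by
    rw [xp_xm]
    split_ifs
    · exact commutatorMode_mem_stabilizer _ _ _
    · exact zero_mem _
  have hswap : ∀ {a b : (Module.End ℂ VermaSpace)⟦X⟧}, Commute a b → ∀ v : Ser VermaSpace,
      a • b • v = b • a • v := fun hab v => by rw [← mul_smul, hab.eq, mul_smul]
  refine mem_stabilizer (fun r hr v => smul_xmHom_mem (hD j · m ·) (fun r hr => ?_) hr v) ?_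
  · obtain ⟨s, hs⟩ := mem_relHalf_iff.1 hr
    have := half_commutator_mem (T := annihilator relSpace) (g := xmHom) (y := xp j m) (j₀ := j)
      (D := fun n => -commutatorMode c h0 h j m n) (P := fun n => phiDelta c h0 h (-1) j m n)
      (P' := fun n => phiDelta c h0 h 1 j m n) (fun a ha b v => ?_) (fun a ha i n v => ?_)
      (fun n => ?_) (fun i n => ?_) (fun i => ?_) (fun i => ?_) (phiDelta_oneSided_right _ _ _)
      (phiDelta_oneSided_right _ _ _) (fun s' _ r hr => relStage_mem_relSpace hr) hs
    · intro v
      have h2 := relSpace.neg_mem (this v)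
      rwa [← neg_smul, neg_sub] at h2
    · rw [mul_smul]
      exact ha _
    · rw [mul_smul, xmHom_ι]
      exact prepend_mem_stabilizer _ _ (ha v)
    · rw [mul_neg, qd_mul_commutatorMode, neg_sub]
    · rw [xmHom_ι, ← neg_sub]
      change -(xp j m * xm i n - xm i n * xp j m) = _
      rw [xp_xm]
      simp only [eq_comm (a := i)]
      split_ifs <;> simp
    · simp only [xmHom_ι]
      exact phiDelta_currentRel_xm (-1) j i m
    · simp only [xmHom_ι]
      exact phiDelta_currentRel_xm 1 j i m
  · -- the vectors which satisfy the claim for all `x^+_{j,m}` form a stable submodule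
    have key := fun v => mem_of_stable (Q := ⨅ (j : Fin 2) (m : ℤ) (r : halfIdeal 1),
      relSpace.comap (Ser.act (xp j m) ∘ₗ Ser.act (liftTopAlg yHom r))) ?_ ?_ ?_ ?_ ?_ v
    · intro r hr v
      have := key v
      simp only [Submodule.mem_iInf] at this
      exact this j m ⟨r, hr⟩
    · simp only [Submodule.coe_iInf]
      exact IsHbarClosed.iInter fun j => IsHbarClosed.iInter fun m => IsHbarClosed.iInter fun r =>
        isHbarClosed_relSpace.preimage _
    · intro w
      simp only [Submodule.mem_iInf]
      rintro j m ⟨r, hr⟩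
      change xp j m • liftTopAlg yHom r • Ser.const (vac w) ∈ relSpace
      rw [← xpHom_smul_vac, ← mul_smul, ← xpHom_ι, ← liftTopAlg_C, ← map_mul, xpHom_smul_vac]
      exact yHom_mem_relSpace ((halfIdeal 1).mul_mem_left _ hr) _
    · intro k n v hv
      simp only [Submodule.mem_iInf] at hv ⊢
      rintro j m ⟨r, hr⟩
      have h1 : xp j m • liftTopAlg yHom r • v ∈ relSpace := hv j m ⟨r, hr⟩
      change xp j m • liftTopAlg yHom r • xm k n • v ∈ relSpace
      rw [← hswap (commute_liftTopAlg (z := xm k n) (fun g => by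
        rw [yHom_ι]; exact (commute_y_xm g k n).symm) r)]
      have := relSpace.add_mem (hD j k m n _ (yHom_mem_relSpace hr v))
        (xm_mem_stabilizer k n _ h1)
      rwa [sub_smul, mul_smul, mul_smul, sub_add_cancel] at this
    · intro i l v hv
      simp only [Submodule.mem_iInf] at hv ⊢
      rintro j m ⟨r, hr⟩
      have h1 : ∀ m, xp j m • liftTopAlg yHom r • v ∈ relSpace := fun m => hv j m ⟨r, hr⟩
      change xp j m • liftTopAlg yHom r • h i l • v ∈ relSpace
      rw [← hswap (commute_liftTopAlg (z := h i l) (fun g => by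
        rw [yHom_ι]; exact (commute_y_h g i l).symm) r)]
      have h2 := congrArg (· • liftTopAlg yHom r • v) ((isCurrent_xp j).comm i l m)
      simp only [sub_smul, mul_smul] at h2
      have := relSpace.sub_mem (h_mem_stabilizer i l _ (h1 m))
        (kappa_mem_stabilizer 1 (cartan i j) l _ (h1 (l + m)))
      rwa [← h2, sub_sub_cancel] at this
    · intro v hv
      simp only [Submodule.mem_iInf] at hv ⊢
      rintro j m ⟨r, hr⟩
      have h1 : xp j m • liftTopAlg yHom r • v ∈ relSpace := hv j m ⟨r, hr⟩
      change xp j m • liftTopAlg yHom r • PowerSeries.C c • v ∈ relSpace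
      rw [c_smul_yHom, ← hswap (commute_c_xp j m)]
      exact c_mem_stabilizer _ h1

/-- The relations (Q6)-(Q9) between the `x^+` map everything into `relSpace`. They do so on the
vacuum vectors, and the commutators with the `x^-` are consequences of the relations of the
preceding stages, which have already been treated. -/
theorem xpHom_relStage (s : Fin 3) : ∀ r ∈ relStage 1 (fun i n =>
    FreeAlgebra.ι ℂ (HalfGen.x i n)) s, liftTopAlg xpHom r ∈ annihilator relSpace := by
  induction s using WellFoundedLT.induction with
  | ind s ih =>
    have key := fun v => mem_of_stable (Q := ⨅ r : relStage 1 (fun i n =>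
      FreeAlgebra.ι ℂ (HalfGen.x i n)) s, relSpace.comap (Ser.act (liftTopAlg xpHom (r : FreeTop HalfGen))))
      ?_ ?_ ?_ ?_ ?_ v
    · intro r hr v
      have := key v
      rw [Submodule.mem_iInf] at this
      exact this ⟨r, hr⟩
    · simp only [Submodule.coe_iInf]
      exact IsHbarClosed.iInter fun r => isHbarClosed_relSpace.preimage _
    · intro w
      rw [Submodule.mem_iInf]
      rintro ⟨r, hr⟩
      change liftTopAlg xpHom r • _ ∈ relSpace
      rw [xpHom_smul_vac]
      exact yHom_mem_relSpace (mem_halfIdeal_of_mem (mem_relHalf_iff.2 ⟨s, hr⟩)) _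
    · intro k n v hv
      rw [Submodule.mem_iInf] at hv ⊢
      rintro ⟨r, hr⟩
      have h1 : liftTopAlg xpHom r • v ∈ relSpace := hv ⟨r, hr⟩
      have := half_commutator_mem (T := annihilator relSpace) (g := xpHom) (y := xm k n) (j₀ := k)
        (D := fun m => commutatorMode c h0 h k m n) (P := fun m => phiDelta c h0 h 1 k m n)
        (P' := fun m => phiDelta c h0 h (-1) k m n) (fun a ha b v => ?_) (fun a ha i n v => ?_)
        (fun m => ?_) (fun i m => ?_) (fun i => ?_) (fun i => ?_) (phiDelta_oneSided_left _ _ _)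
        (phiDelta_oneSided_left _ _ _) ih hr
      · have h2 := relSpace.add_mem (this v) (xm_mem_stabilizer k n _ h1)
        rwa [sub_smul, mul_smul, mul_smul, sub_add_cancel] at h2
      · rw [mul_smul]
        exact ha _
      · rw [mul_smul, xpHom_ι]
        exact xp_mem_stabilizer _ _ _ (ha v)
      · rw [qd_mul_commutatorMode]
      · rw [xpHom_ι, xp_xm]
        split_ifs with hik
        · rw [hik]
        · rfl
      · simp only [xpHom_ι]
        exact phiDelta_currentRel_xp 1 k i n
      · simp only [xpHom_ι]
        exact phiDelta_currentRel_xp (-1) k i n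
    · intro i l v hv
      rw [Submodule.mem_iInf] at hv ⊢
      rintro ⟨r, hr⟩
      have h1 : liftTopAlg xpHom r • v ∈ relSpace := hv ⟨r, hr⟩
      have := shift_commutator_mem (T := transporter relSpace v) (g := xpHom) (z := h i l)
        (κ := fun j => kappa c 1 (cartan i j) l) (l := l)
        (fun j m => ?_) (fun j k m => ?_) (fun j a ha => ?_) (fun r hr => hv ⟨r, hr⟩) hr
      · change (_ - _) • v ∈ relSpace at this
        have h2 := relSpace.sub_mem (h_mem_stabilizer i l _ h1) this
        rwa [sub_smul, mul_smul, mul_smul, sub_sub_cancel] at h2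
      · rw [xpHom_ι, xpHom_ι]
        exact (isCurrent_xp j).comm i l m
      · rw [xpHom_ι]
        exact commute_kappa (commute_c_xp k m) _ _ _
      · change (_ * _) • v ∈ relSpace
        rw [mul_smul]
        exact kappa_mem_stabilizer _ _ _ _ ha
    · intro v hv
      rw [Submodule.mem_iInf] at hv ⊢
      rintro ⟨r, hr⟩
      have h1 : liftTopAlg xpHom r • v ∈ relSpace := hv ⟨r, hr⟩
      change liftTopAlg xpHom r • PowerSeries.C c • v ∈ relSpace
      rw [← mul_smul, ← (commute_liftTopAlg (z := PowerSeries.C c) (fun ⟨j, m⟩ => by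
        rw [xpHom_ι]; exact commute_c_xp j m) r).eq, mul_smul]
      exact c_mem_stabilizer _ h1

/-! ### The representation of the quantum toroidal algebra -/

/-- The operators by which the generators act. -/
def genOp : Gen → (Module.End ℂ VermaSpace)⟦X⟧
  | Gen.x ε i n => if ε = 1 then xp i n else xm i n
  | Gen.h i n => h i n
  | Gen.c => PowerSeries.C c

/-- The homomorphism which extends the action of the generators. -/
def rep : FreeAlgebra ℂ Gen →ₐ[ℂ] (Module.End ℂ VermaSpace)⟦X⟧ := FreeAlgebra.lift ℂ genOp

theorem rep_ι (g : Gen) : rep (FreeAlgebra.ι ℂ g) = genOp g := by simp [rep]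

theorem genOp_mem_stabilizer (g : Gen) : genOp g ∈ stabilizer relSpace := by
  cases g with
  | x ε i n =>
    rw [genOp]
    split_ifs
    · exact xp_mem_stabilizer i n
    · exact xm_mem_stabilizer i n
  | h i n => exact h_mem_stabilizer i n
  | c => exact c_mem_stabilizer

end Verma

/-- The inclusion of the free algebra on the `x^ε_{i,n}`. -/
def halfIncl (ε : ℤˣ) : FreeAlgebra ℂ HalfGen →ₐ[ℂ] FreeAlgebra ℂ Gen :=
  FreeAlgebra.lift ℂ fun g => match g with | HalfGen.x i n => FreeAlgebra.ι ℂ (Gen.x ε i n)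

theorem halfIncl_ι (ε : ℤˣ) (i : Fin 2) (n : ℤ) :
    halfIncl ε (FreeAlgebra.ι ℂ (HalfGen.x i n)) = FreeAlgebra.ι ℂ (Gen.x ε i n) := by
  simp [halfIncl]

/-- The inclusion of the free algebra on the `h_{i,n}` and `c`. -/
def cartanIncl : FreeAlgebra ℂ CartanGen →ₐ[ℂ] FreeAlgebra ℂ Gen :=
  FreeAlgebra.lift ℂ fun g => match g with
    | CartanGen.h i n => FreeAlgebra.ι ℂ (Gen.h i n)
    | CartanGen.c => FreeAlgebra.ι ℂ Gen.c

namespace Verma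

theorem rep_comp_halfIncl_one : rep.comp (halfIncl 1) = xpHom := by
  refine FreeAlgebra.hom_ext (funext fun ⟨i, n⟩ => ?_)
  simp only [Function.comp_apply, AlgHom.comp_apply]
  rw [halfIncl_ι, rep_ι, xpHom_ι]
  simp [genOp]

theorem rep_comp_halfIncl_neg_one : rep.comp (halfIncl (-1)) = xmHom := by
  refine FreeAlgebra.hom_ext (funext fun ⟨i, n⟩ => ?_)
  simp only [Function.comp_apply, AlgHom.comp_apply]
  rw [halfIncl_ι, rep_ι, xmHom_ι]
  simp [genOp, xm]

theorem rep_comp_cartanIncl : rep.comp cartanIncl = cartanHom := by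
  refine FreeAlgebra.hom_ext (funext fun g => ?_)
  cases g <;> simp [cartanIncl, cartanHom, rep_ι, genOp]

theorem rep_relQ5 {r : FreeTop Gen} (hr : r ∈ relQ5 (FreeAlgebra.ι ℂ Gen.c)
    (fun i n => FreeAlgebra.ι ℂ (Gen.h i n)) (fun ε i n => FreeAlgebra.ι ℂ (Gen.x ε i n))) :
    liftTopAlg rep r = 0 := by
  have hc : rep (FreeAlgebra.ι ℂ Gen.c) = PowerSeries.C c := rep_ι _
  have hh : ∀ i n, rep (FreeAlgebra.ι ℂ (Gen.h i n)) = h i n := fun i n => rep_ι _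
  obtain ⟨i, j, m, n, rfl⟩ := hr
  have h1 := liftTopAlg_phiDelta rep isCartanAction hc hh 1 i m n
  have h2 := liftTopAlg_phiDelta rep isCartanAction hc hh (-1) i m n
  rw [map_sub, map_mul, liftTopAlg_scalar, liftTopAlg_C, map_sub rep, map_mul rep, map_mul rep, rep_ι,
    rep_ι]
  have h3 : genOp (Gen.x 1 i m) * genOp (Gen.x (-1) j n) - genOp (Gen.x (-1) j n) *
      genOp (Gen.x 1 i m) = if i = j then commutatorMode c h0 h i m n else 0 := by
    rw [← xp_xm]; simp [genOp]
  rw [h3]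
  split_ifs with hij
  · simp only [Units.val_neg, Units.val_one, Int.cast_neg, Int.cast_one, neg_mul, one_mul,
      neg_neg] at h1 h2
    rw [map_sub (liftTopAlg rep), h1, h2, ← qd_mul_commutatorMode, qd, sub_self]
  · rw [mul_zero, map_zero, sub_zero]

/-- The relations of the quantum toroidal algebra, with common powers of `ħ` cancelled, map
everything into `relSpace`. For (Q1)-(Q5) one can cancel because these hold exactly; in (Q6)-(Q9)
there is nothing to cancel. -/
theorem rep_relation {r : FreeTop Gen} (hr : r ∈ cancelHbar relations) (v : Ser VermaSpace) :
    liftTopAlg rep r • v ∈ relSpace := by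
  have hc : rep (FreeAlgebra.ι ℂ Gen.c) = PowerSeries.C c := rep_ι _
  have hh : ∀ i n, rep (FreeAlgebra.ι ℂ (Gen.h i n)) = h i n := fun i n => rep_ι _
  obtain ⟨k, hk⟩ := hr
  have hzero : liftTopAlg rep (X ^ k * r) = 0 → liftTopAlg rep r • v ∈ relSpace := by
    intro h0
    rw [map_mul, map_pow, liftTopAlg_X, ← mul_zero (X ^ k), X_pow_mul_inj] at h0
    rw [h0, zero_smul]
    exact relSpace.zero_mem
  rcases hk with ((hk | hk) | hk) | hk
  · exact hzero (liftTopAlg_relCartan rep isCartanAction hc hh hk)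
  · refine hzero (liftTopAlg_relMixed rep isCartanAction hc hh (fun ε j => ?_) hk)
    rcases Int.units_eq_one_or ε with rfl | rfl
    · convert isCurrent_xp j using 2 with n
      simp [rep_ι, genOp]
    · convert isCurrent_xm j using 2 with n
      simp [rep_ι, genOp]
  · exact hzero (rep_relQ5 hk)
  · obtain ⟨ε, hk⟩ := Set.mem_iUnion.1 hk
    have e : (fun i n => FreeAlgebra.ι ℂ (Gen.x ε i n)) =
        fun i n => halfIncl ε (FreeAlgebra.ι ℂ (HalfGen.x i n)) := by
      funext i n; rw [halfIncl_ι]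
    -- the nonvanishing modulo `ħ` is checked after projection to the algebra of one half
    have hne : ∀ r ∈ relHalf ε fun i n => FreeAlgebra.ι ℂ (Gen.x ε i n), constantCoeff r ≠ 0 := by
      let p : FreeAlgebra ℂ Gen →ₐ[ℂ] FreeAlgebra ℂ HalfGen := FreeAlgebra.lift ℂ fun g => match g with
        | Gen.x _ i n => FreeAlgebra.ι ℂ (HalfGen.x i n)
        | _ => 0
      intro r hr h0
      have h1 := map_mem_relHalf p hr
      simp only [p, FreeAlgebra.lift_ι_apply] at h1
      refine constantCoeff_ne_zero_of_mem_halfRelations ε _ h1 ?_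
      rw [← coeff_zero_eq_constantCoeff_apply, coeff_map, coeff_zero_eq_constantCoeff_apply, h0,
        map_zero]
    have hr := mem_of_mem_cancelHbar hne ⟨k, hk⟩
    rw [e] at hr
    obtain ⟨r', hr', rfl⟩ := exists_of_mem_relHalf _ hr
    rw [liftTopAlg_map]
    rcases Int.units_eq_one_or ε with rfl | rfl
    · rw [rep_comp_halfIncl_one]
      obtain ⟨s, hs⟩ := mem_relHalf_iff.1 hr'
      exact xpHom_relStage s _ hs v
    · rw [rep_comp_halfIncl_neg_one]
      exact xmHom_mem_relSpace (mem_halfIdeal_of_mem hr') v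

/-- The relations of the quantum toroidal algebra map everything into `relSpace`. -/
theorem rep_smul_mem {r : FreeTop Gen} (hr : r ∈ closedIdeal (cancelHbar relations))
    (v : Ser VermaSpace) : liftTopAlg rep r • v ∈ relSpace := by
  have := FreeTop.closedIdeal_induction (S := ⨅ v, relSpace.comap (orbit rep v)) ?_ ?_ ?_ ?_ hr
  · rw [Submodule.mem_iInf] at this
    exact this v
  · rw [Submodule.coe_iInf]
    exact IsHbarClosed.iInter fun v => isHbarClosed_relSpace.preimage _
  · intro r hr
    rw [Submodule.mem_iInf]
    exact rep_relation hr
  · intro g r hr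
    rw [Submodule.mem_iInf] at hr ⊢
    intro v
    have h1 : liftTopAlg rep r • v ∈ relSpace := hr v
    change liftTopAlg rep (_ * r) • v ∈ relSpace
    rw [map_mul, liftTopAlg_C, rep_ι, mul_smul]
    exact genOp_mem_stabilizer g _ h1
  · intro g r hr
    rw [Submodule.mem_iInf] at hr ⊢
    intro v
    change liftTopAlg rep (r * _) • v ∈ relSpace
    rw [map_mul, liftTopAlg_C, mul_smul]
    exact hr _

end Verma

/-! ### Completeness and completions -/

section Completion
variable {M N : Type} [AddCommGroup M] [Module Base M] [AddCommGroup N] [Module Base N]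

theorem mem_hbarIdeal_pow_smul_top {n : ℕ} {x : M} :
    x ∈ (hbarIdeal ^ n • ⊤ : Submodule Base M) ↔ ∃ t, x = hbar ^ n • t := by
  rw [hbarIdeal, Ideal.span_singleton_pow, Submodule.ideal_span_singleton_smul,
    Submodule.mem_smul_pointwise_iff_exists]
  simp [eq_comm]

theorem mk_hbar_pow_smul (n : ℕ) (t : M) :
    (Submodule.Quotient.mk (hbar ^ n • t) : M ⧸ (hbarIdeal ^ n • ⊤ : Submodule Base M)) = 0 :=
  (Submodule.Quotient.mk_eq_zero _).2 (mem_hbarIdeal_pow_smul_top.2 ⟨t, rfl⟩)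

/-- The convergence of the series `∑ₖ ħᵏ tₖ` in a module: the remainders are sums `Tₘ` of the
series `∑ₖ ħᵏ tₖ₊ₘ`. -/
def IsHbarComplete (M : Type) [AddCommGroup M] [Module Base M] : Prop :=
  ∀ t : ℕ → M, ∃ T : ℕ → M, ∀ m, T m = t m + hbar • T (m + 1)

theorem IsHbarComplete.of_surjective (hM : IsHbarComplete M) {f : M →ₗ[Base] N}
    (hf : Function.Surjective f) : IsHbarComplete N := by
  intro t
  obtain ⟨T, hT⟩ := hM fun n => (hf (t n)).choose
  refine ⟨fun n => f (T n), fun m => ?_⟩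
  change f (T m) = t m + hbar • f (T (m + 1))
  rw [hT m, map_add, map_smul, (hf (t m)).choose_spec]

theorem IsHbarClosed.eq_zero (hM : IsHbarClosed ({0} : Set M)) {x : M}
    (hx : ∀ n, ∃ t, x = hbar ^ n • t) : x = 0 :=
  hM x fun n => let ⟨t, ht⟩ := hx n; ⟨0, rfl, t, by rw [ht, zero_add]⟩

/-- The image of an element of the completion of `M` in a complete module `N` under the extension
of a linear map. -/
theorem IsHbarComplete.exists_limit (hN : IsHbarComplete N) (f : M →ₗ[Base] N)
    (z : AdicCompletion hbarIdeal M) : ∃ y : N, ∀ n, ∃ (m : M) (s : N),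
      z.val n = Submodule.Quotient.mk m ∧ y = f m + hbar ^ n • s := by
  choose m hm using fun n => Submodule.Quotient.mk_surjective _ (z.val n)
  have hd : ∀ n, ∃ t, m (n + 1) - m n = hbar ^ n • t := fun n => by
    rw [← mem_hbarIdeal_pow_smul_top, ← Submodule.Quotient.eq, hm n]
    have := AdicCompletion.transitionMap_comp_eval_apply hbarIdeal M (Nat.le_succ n) z
    rw [← this]
    change _ = AdicCompletion.transitionMap hbarIdeal M (Nat.le_succ n) (z.val (n + 1))
    rw [← hm (n + 1)]
    rfl
  choose t ht using hd
  obtain ⟨T, hT⟩ := hN fun n => f (t n)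
  refine ⟨f (m 0) + T 0, fun n => ⟨m n, T n, (hm n).symm, ?_⟩⟩
  induction n with
  | zero => simp
  | succ n ih =>
    rw [ih, hT n, ← sub_add_cancel (m (n + 1)) (m n), ht n]
    simp only [map_add, map_smul, smul_add, smul_smul, ← pow_succ]
    abel

theorem IsHbarComplete.of_surjective_of (hM : IsHbarComplete M) :
    Function.Surjective (AdicCompletion.of hbarIdeal M) := by
  intro z
  obtain ⟨y, hy⟩ := hM.exists_limit LinearMap.id z
  refine ⟨y, AdicCompletion.ext fun n => ?_⟩
  obtain ⟨m, s, h1, h2⟩ := hy n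
  rw [h1, AdicCompletion.of_apply, h2, Submodule.mkQ_apply, Submodule.Quotient.mk_add,
    mk_hbar_pow_smul, add_zero]
  rfl

/-- The `ħ`-adic topology of a module is induced from its completion. -/
theorem exists_of_eq_zero {n : ℕ} {x : M} {z : AdicCompletion hbarIdeal M}
    (h : AdicCompletion.of hbarIdeal M x = hbar ^ n • z) : ∃ t, x = hbar ^ n • t := by
  rw [← mem_hbarIdeal_pow_smul_top, ← Submodule.Quotient.mk_eq_zero]
  obtain ⟨m, hm⟩ := Submodule.Quotient.mk_surjective _ (z.val n)
  have := congrArg (fun z => z.val n) h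
  rw [AdicCompletion.of_apply] at this
  change Submodule.Quotient.mk x = hbar ^ n • z.val n at this
  rw [this, ← hm, ← Submodule.Quotient.mk_smul, mk_hbar_pow_smul]

theorem of_injective_of_separated (hM : IsHbarClosed ({0} : Set M)) :
    Function.Injective (AdicCompletion.of hbarIdeal M) := by
  rw [injective_iff_map_eq_zero]
  exact fun x hx => hM.eq_zero fun n => exists_of_eq_zero (z := 0) (by rw [hx, smul_zero])

theorem AdicCompletion.isHbarClosed_zero : IsHbarClosed ({0} : Set (AdicCompletion hbarIdeal M)) := by
  intro z hz
  refine AdicCompletion.ext fun n => ?_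
  obtain ⟨s, rfl, t, ht⟩ := hz n
  obtain ⟨m, hm⟩ := Submodule.Quotient.mk_surjective _ (t.val n)
  rw [ht, zero_add]
  change hbar ^ n • t.val n = 0
  rw [← hm, ← Submodule.Quotient.mk_smul, mk_hbar_pow_smul]

/-- A submodule of a separated module which is complete for its own `ħ`-adic topology, and on
which this topology is induced by the one of the ambient module, is closed. Here the latter
condition is ensured by the extension `p` of the identity to the ambient module. -/
theorem isHbarClosed_range (hM : IsHbarComplete M) (hN : IsHbarClosed ({0} : Set N))
    {j : M →ₗ[Base] N} {p : N →ₗ[Base] AdicCompletion hbarIdeal M}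
    (hp : ∀ m, p (j m) = AdicCompletion.of hbarIdeal M m) :
    IsHbarClosed (LinearMap.range j : Set N) := by
  intro y hy
  obtain ⟨m, hm⟩ := hM.of_surjective_of (p y)
  refine ⟨m, ?_⟩
  rw [← sub_eq_zero]
  refine hN.eq_zero fun n => ?_
  obtain ⟨_, ⟨m', rfl⟩, t, rfl⟩ := hy n
  rw [map_add, map_smul, hp, ← sub_eq_iff_eq_add', ← map_sub] at hm
  obtain ⟨s, hs⟩ := exists_of_eq_zero hm
  exact ⟨j s - t, by rw [smul_sub, ← map_smul, ← hs, map_sub]; abel⟩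

theorem injective_of_extension (hM : IsHbarClosed ({0} : Set M))
    {j : M →ₗ[Base] N} {p : N →ₗ[Base] AdicCompletion hbarIdeal M}
    (hp : ∀ m, p (j m) = AdicCompletion.of hbarIdeal M m) : Function.Injective j := by
  intro m m' h
  refine of_injective_of_separated hM ?_
  rw [← hp, ← hp, h]

/-- A complete separated module is the completion of `M` if it contains a submodule which is dense
modulo `ħ` and on which the `ħ`-adic topology of `M` is induced. -/
theorem exists_completion_equiv (hN : IsHbarComplete N) (hN0 : IsHbarClosed ({0} : Set N))
    {f : M →ₗ[Base] N} {p : N →ₗ[Base] AdicCompletion hbarIdeal M}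
    (hp : ∀ m, p (f m) = AdicCompletion.of hbarIdeal M m)
    (hf : ∀ y : N, ∃ m s, y = f m + hbar • s) :
    ∃ e : AdicCompletion hbarIdeal M ≃ₗ[Base] N, ∀ m, e (AdicCompletion.of hbarIdeal M m) = f m := by
  have hf' : ∀ n, ∀ y : N, ∃ m s, y = f m + hbar ^ n • s := by
    intro n y
    induction n with
    | zero => exact ⟨0, y, by simp⟩
    | succ n ih =>
      obtain ⟨m, s, rfl⟩ := ih
      obtain ⟨m', s', rfl⟩ := hf s
      exact ⟨m + hbar ^ n • m', s', by
        rw [map_add, map_smul, smul_add, smul_smul, pow_succ, add_assoc]⟩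
  have hbij : Function.Bijective p := by
    constructor
    · rw [injective_iff_map_eq_zero]
      intro y hy
      refine hN0.eq_zero fun n => ?_
      obtain ⟨m, s, rfl⟩ := hf' n y
      rw [map_add, map_smul, hp, add_eq_zero_iff_eq_neg, ← smul_neg] at hy
      obtain ⟨t, rfl⟩ := exists_of_eq_zero hy
      exact ⟨f t + s, by rw [map_smul, smul_add]⟩
    · intro z
      obtain ⟨y, hy⟩ := hN.exists_limit f z
      refine ⟨y, AdicCompletion.ext fun n => ?_⟩
      obtain ⟨m, s, h1, h2⟩ := hy n
      obtain ⟨m', hm'⟩ := Submodule.Quotient.mk_surjective _ ((p s).val n)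
      rw [h2, map_add, map_smul, hp, h1]
      change Submodule.Quotient.mk m + hbar ^ n • (p s).val n = _
      rw [← hm', ← Submodule.Quotient.mk_smul, mk_hbar_pow_smul, add_zero]
  refine ⟨(LinearEquiv.ofBijective p hbij).symm, fun m => ?_⟩
  rw [LinearEquiv.symm_apply_eq, LinearEquiv.ofBijective_apply, hp]

end Completion

section Presented
variable {G : Type}

theorem FreeTop.isHbarComplete : IsHbarComplete (FreeTop G) := by
  intro t
  refine ⟨fun m => PowerSeries.mk fun k => ∑ n ∈ range (k + 1), coeff (k - n) (t (m + n)),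
    fun m => ?_⟩
  rw [FreeTop.hbar_smul]
  ext1 k
  cases k with
  | zero => simp
  | succ k =>
    rw [map_add, coeff_succ_X_mul, coeff_mk, coeff_mk, sum_range_succ', add_comm]
    congr 1
    refine sum_congr rfl fun n _ => ?_
    rw [Nat.add_sub_add_right, add_right_comm, add_assoc]

variable (R : Set (FreeTop G))

/-- The quotient map, as a homomorphism of `ℂ⟦ħ⟧`-algebras. -/
def Presented.mk : FreeTop G →ₐ[Base] Presented G R := Ideal.Quotient.mkₐ Base _

theorem Presented.mk_surjective : Function.Surjective (Presented.mk R) :=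
  Ideal.Quotient.mk_surjective

theorem Presented.mk_eq_zero {f : FreeTop G} :
    Presented.mk R f = 0 ↔ f ∈ closedIdeal (cancelHbar R) := Ideal.Quotient.eq_zero_iff_mem

theorem Presented.isHbarComplete : IsHbarComplete (Presented G R) :=
  FreeTop.isHbarComplete.of_surjective (f := (Presented.mk R).toLinearMap)
    (Presented.mk_surjective R)

theorem Presented.isHbarClosed_zero : IsHbarClosed ({0} : Set (Presented G R)) := by
  intro y hy
  obtain ⟨f, rfl⟩ := Presented.mk_surjective R y
  refine (Presented.mk_eq_zero R).2 (isHbarClosed_closedIdeal _ f fun n => ?_)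
  obtain ⟨s, rfl, t, ht⟩ := hy n
  obtain ⟨t, rfl⟩ := Presented.mk_surjective R t
  rw [zero_add, ← map_smul, ← sub_eq_zero, ← map_sub, Presented.mk_eq_zero] at ht
  exact ⟨_, ht, t, by abel⟩

end Presented

/-! ### Extension of linear maps to formal series -/

section SerLift
variable {V M : Type} [AddCommGroup V] [Module ℂ V] [AddCommGroup M] [Module Base M] [Module ℂ M]
  [IsScalarTower ℂ Base M]

theorem complex_smul_eq (a : ℂ) (m : M) : a • m = (PowerSeries.C a : Base) • m := by
  rw [← one_smul Base m, ← smul_assoc, ← smul_assoc]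
  congr 1
  rw [smul_eq_mul, mul_one, PowerSeries.smul_eq_C_mul, mul_one]

/-- The partial sums `∑_{k < n} ħᵏ θ(vₖ)`. -/
def partialSum (θ : V →ₗ[ℂ] M) (n : ℕ) : Ser V →+ M where
  toFun v := ∑ k ∈ range n, hbar ^ k • θ (v k)
  map_zero' := Finset.sum_eq_zero fun k _ => by
    change hbar ^ k • θ 0 = 0
    rw [map_zero, smul_zero]
  map_add' v w := by
    rw [← sum_add_distrib]
    refine sum_congr rfl fun k _ => ?_
    change hbar ^ k • θ (v k + w k) = _
    rw [map_add, smul_add]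

theorem partialSum_apply (θ : V →ₗ[ℂ] M) (n : ℕ) (v : Ser V) :
    partialSum θ n v = ∑ k ∈ range n, hbar ^ k • θ (v k) := rfl

theorem partialSum_hbar_smul (θ : V →ₗ[ℂ] M) (n : ℕ) (v : Ser V) :
    ∃ t, partialSum θ n (hbar • v) = hbar • partialSum θ n v + hbar ^ n • t := by
  have h : ∀ k, (hbar • v) k = if 1 ≤ k then v (k - 1) else 0 := fun k => by
    rw [← Ser.hbar_pow_smul_apply, pow_one]
  rw [partialSum_apply, partialSum_apply]
  cases n with
  | zero => exact ⟨0, by simp⟩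
  | succ n =>
    refine ⟨-θ (v n), ?_⟩
    rw [sum_range_succ', sum_range_succ, smul_add, smul_sum, h 0, if_neg (by omega), map_zero,
      smul_zero, add_zero, smul_neg, smul_smul, ← pow_succ', add_neg_cancel_right]
    refine sum_congr rfl fun k _ => ?_
    rw [h, if_pos (by omega), Nat.add_sub_cancel, smul_smul, ← pow_succ']

theorem partialSum_C_smul (θ : V →ₗ[ℂ] M) (n : ℕ) (a : ℂ) (v : Ser V) :
    partialSum θ n ((PowerSeries.C a : Base) • v) = (PowerSeries.C a : Base) • partialSum θ n v := by
  rw [partialSum_apply, partialSum_apply, smul_sum]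
  refine sum_congr rfl fun k _ => ?_
  have : ((PowerSeries.C a : Base) • v) k = a • v k := by
    rw [Ser.base_smul_def, scalar_C, Ser.smul_apply, Finset.sum_eq_single (0, k)]
    · simp [Module.algebraMap_end_apply]
    · rintro ⟨i, j⟩ hp hne
      have hi : i ≠ 0 := by
        rintro rfl
        simp at hp
        simp [hp] at hne
      simp [coeff_C, hi]
    · simp
  rw [this, map_smul, complex_smul_eq, smul_comm]

/-- Partial sums are linear up to multiples of `ħⁿ`. -/
theorem partialSum_smul (θ : V →ₗ[ℂ] M) (n : ℕ) (a : Base) (v : Ser V) :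
    ∃ t, partialSum θ n (a • v) = a • partialSum θ n v + hbar ^ n • t := by
  have key : ∀ k ≤ n, ∀ (a : Base) (v : Ser V), ∃ t,
      partialSum θ n (a • v) = a • partialSum θ n v + hbar ^ k • t := by
    intro k
    induction k with
    | zero => exact fun _ a v => ⟨partialSum θ n (a • v) - a • partialSum θ n v, by simp⟩
    | succ k ih =>
      intro hk a v
      obtain ⟨a', b, rfl⟩ : ∃ (a' : Base) (b : ℂ), a = hbar * a' + PowerSeries.C b :=
        ⟨_, _, eq_X_mul_shift_add_const a⟩
      obtain ⟨t, ht⟩ := ih (by omega) a' v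
      obtain ⟨s, hs⟩ := partialSum_hbar_smul θ n (a' • v)
      refine ⟨t + hbar ^ (n - (k + 1)) • s, ?_⟩
      rw [add_smul, map_add, partialSum_C_smul, mul_smul, hs, ht, add_smul, mul_smul, smul_add,
        smul_add, smul_smul (hbar ^ (k + 1)), ← pow_add, Nat.add_sub_cancel' hk, pow_succ' hbar k,
        mul_smul hbar (hbar ^ k)]
      abel
  exact key n le_rfl a v

/-- The `ℂ⟦ħ⟧`-linear extension `∑ₖ ħᵏ vₖ ↦ ∑ₖ ħᵏ θ(vₖ)` of a linear map `θ`. -/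
def serLift (θ : V →ₗ[ℂ] M) : Ser V →ₗ[Base] AdicCompletion hbarIdeal M :=
  AdicCompletion.lift hbarIdeal
    (fun n =>
      { toFun := fun v => Submodule.Quotient.mk (partialSum θ n v)
        map_add' := fun v w => by rw [map_add, Submodule.Quotient.mk_add]
        map_smul' := fun a v => by
          obtain ⟨t, ht⟩ := partialSum_smul θ n a v
          rw [ht, Submodule.Quotient.mk_add, mk_hbar_pow_smul, add_zero]
          rfl })
    (by
      intro m n hmn
      refine LinearMap.ext fun v => ?_
      change Submodule.Quotient.mk (partialSum θ n v) = Submodule.Quotient.mk (partialSum θ m v)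
      rw [Submodule.Quotient.eq, mem_hbarIdeal_pow_smul_top, partialSum_apply, partialSum_apply,
        ← Finset.sum_range_add_sum_Ico _ hmn, add_sub_cancel_left]
      refine ⟨∑ k ∈ Finset.Ico m n, hbar ^ (k - m) • θ (v k), ?_⟩
      rw [smul_sum]
      refine sum_congr rfl fun k hk => ?_
      rw [smul_smul, ← pow_add, Nat.add_sub_cancel' (Finset.mem_Ico.1 hk).1])

theorem serLift_const (θ : V →ₗ[ℂ] M) (v : V) :
    serLift θ (Ser.const v) = AdicCompletion.of hbarIdeal M (θ v) := by
  refine AdicCompletion.ext fun n => ?_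
  change Submodule.Quotient.mk (partialSum θ n (Ser.const v)) = Submodule.Quotient.mk (θ v)
  rw [Submodule.Quotient.eq, mem_hbarIdeal_pow_smul_top, partialSum_apply]
  cases n with
  | zero => exact ⟨-θ v, by simp⟩
  | succ n =>
    refine ⟨0, ?_⟩
    rw [sum_range_succ', Finset.sum_eq_zero fun k _ => by simp [Ser.const]]
    simp [Ser.const]

end SerLift

/-! ### The relations to leading order in `ħ` -/

section Leading
variable {B : Type} [Ring B] [Algebra ℂ B]

theorem coeff_one_mul' (f g : B⟦X⟧) : coeff 1 (f * g) =
    constantCoeff f * coeff 1 g + coeff 1 f * constantCoeff g := by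
  rw [coeff_mul, Finset.Nat.antidiagonal_succ]
  simp

theorem coeff_smul_complex (n : ℕ) (a : ℂ) (f : B⟦X⟧) : coeff n (a • f) = a • coeff n f := rfl

theorem coeff_one_qExp (s : ℂ) (b : B) : coeff 1 (qExp s b) = s • b := by
  simp [qExp]

/-- The coefficient of `ħ` in the modes of `φ_i^±(z)`. -/
def phiLin (h : Fin 2 → ℤ → B) (ε : ℤˣ) (i : Fin 2) (m : ℕ) : B :=
  if m = 0 then ((ε : ℤ) : ℂ) • h i 0 else (2 * ((ε : ℤ) : ℂ)) • h i ((ε : ℤ) * (m : ℤ))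

theorem constantCoeff_phi (h : Fin 2 → ℤ → B) (ε : ℤˣ) (i : Fin 2) (m : ℕ) :
    constantCoeff (phi h ε i m) = if m = 0 then 1 else 0 := by
  have h1 := constantCoeff_phiOpMode (fun i => h i 0) (fun i n => PowerSeries.C (h i n)) ε i
    ((ε : ℤ) * m)
  have h2 : ((ε : ℤ) * (m : ℤ) = 0) ↔ m = 0 := by
    simp
  have h3 : (0 : ℤ) ≤ (ε : ℤ) * ((ε : ℤ) * m) := by
    rw [← mul_assoc, ← Units.val_mul, Int.units_mul_self]
    simp
  rw [phiOpMode, if_pos h3, Int.natAbs_mul] at h1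
  simp only [h2, Int.units_natAbs, one_mul, Int.natAbs_natCast] at h1
  exact h1

/-- To first order in `ħ`, the exponential series `φ_i^±(z)` is linear in the `h_{i,n}`. -/
theorem coeff_one_phi (h : Fin 2 → ℤ → B) (ε : ℤˣ) (i : Fin 2) (m : ℕ) :
    coeff 1 (phi h ε i m) = phiLin h ε i m := by
  have hc : ∀ {m : ℕ}, constantCoeff (coeff m (formalExp (phiExponent h ε i))) =
      if m = 0 then 1 else 0 := by
    intro m
    have := constantCoeff_phi h ε i m
    rwa [phi, map_mul, constantCoeff_qExp, one_mul] at this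
  have h1 : ∀ m, m ≠ 0 → coeff 1 (coeff m (formalExp (phiExponent h ε i))) =
      (2 * ((ε : ℤ) : ℂ)) • h i ((ε : ℤ) * (m : ℤ)) := by
    intro m hm
    have h0 : PowerSeries.map (constantCoeff (R := B)) (phiExponent h ε i) = 0 := by
      ext n
      rw [coeff_map, phiExponent, coeff_mk]
      split_ifs
      · simp
      · rw [map_mul, ← coeff_zero_eq_constantCoeff_apply, scalar, coeff_map]
        simp [constantCoeff_qPow]
    have hk : ∀ k, coeff 1 (coeff m (phiExponent h ε i ^ (k + 2))) = 0 := by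
      intro k
      have e : ∀ n k, constantCoeff (coeff n (phiExponent h ε i ^ (k + 1))) = 0 := fun n k => by
        rw [← coeff_map, map_pow, h0, zero_pow (by omega), map_zero]
      rw [pow_succ, coeff_mul, map_sum]
      refine Finset.sum_eq_zero fun p _ => ?_
      have e1 := e p.2 0
      rw [zero_add, pow_one] at e1
      rw [coeff_one_mul', e, e1, zero_mul, mul_zero, add_zero]
    rw [formalExp, coeff_mk, map_sum]
    obtain ⟨m, rfl⟩ := Nat.exists_eq_succ_of_ne_zero hm
    rw [sum_range_succ', sum_range_succ', Finset.sum_eq_zero fun k _ => by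
      rw [coeff_smul_complex, add_assoc, hk, smul_zero]]
    simp only [Nat.succ_eq_add_one, zero_add, pow_one, pow_zero, Nat.factorial_one, Nat.cast_one, inv_one, one_smul,
      Nat.factorial_zero, coeff_one, if_neg (Nat.succ_ne_zero m), map_zero, add_zero]
    rw [phiExponent, coeff_mk, if_neg (Nat.succ_ne_zero m), coeff_mul_C, scalar, coeff_map, Algebra.smul_def]
    congr 2
    have : ((ε : ℤ) : Base) = PowerSeries.C ((ε : ℤ) : ℂ) := by simp
    rw [this, coeff_C_mul, map_sub, coeff_one_qPow, coeff_one_qPow]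
    ring
  rw [phi, coeff_one_mul', constantCoeff_qExp, one_mul, coeff_one_qExp, hc, phiLin]
  split_ifs with hm
  · subst hm
    have : coeff 0 (formalExp (phiExponent h ε i)) = 1 := by
      simp [formalExp]
    rw [this, coeff_one, if_neg one_ne_zero, zero_add, mul_one]
  · rw [h1 m hm, mul_zero, add_zero]

theorem constantCoeff_gUnit (i j : Fin 2) (ε : ℤˣ) (k : ℕ) :
    constantCoeff (coeff k (gUnit i j ^ (ε : ℤ) : (Base⟦X⟧)ˣ).val) = if k = 0 then 1 else 0 := by
  rw [gUnit_zpow_eq]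
  induction k with
  | zero => rw [gSeries_coeff_zero, constantCoeff_qPow, if_pos rfl]
  | succ k ih =>
    rw [gSeries_coeff_succ, if_neg (Nat.succ_ne_zero k)]
    simp [constantCoeff_qPow, ih]

theorem constantCoeff_twist (c : B) {G : Base⟦X⟧} {k : ℕ} (s : ℂ)  :
    constantCoeff (twist c G s k) = algebraMap ℂ B (constantCoeff (coeff k G)) := by
  rw [twist, map_mul, constantCoeff_qExp, mul_one, constantCoeff_scalar]

theorem coeff_one_twist (c : B) {G : Base⟦X⟧} {k : ℕ} (hk : k ≠ 0 → constantCoeff (coeff k G) = 0)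
    (s : ℂ) : coeff 1 (twist c G s k) = algebraMap ℂ B (coeff 1 (coeff k G)) := by
  rw [twist, coeff_one_mul', constantCoeff_qExp, mul_one, coeff_one_qExp, constantCoeff_scalar,
    scalar, coeff_map]
  rcases eq_or_ne k 0 with rfl | hk'
  · simp
  · rw [hk hk', map_zero, zero_mul, zero_add]

theorem constantCoeff_gUnit_val (i j : Fin 2) (k : ℕ) :
    constantCoeff (coeff k (gUnit i j).val) = if k = 0 then 1 else 0 := by
  simpa using constantCoeff_gUnit i j 1 k

theorem constantCoeff_gUnit_inv (i j : Fin 2) (k : ℕ) :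
    constantCoeff (coeff k (gUnit i j)⁻¹.val) = if k = 0 then 1 else 0 := by
  simpa using constantCoeff_gUnit i j (-1) k

theorem constantCoeff_twistPair (c : B) (i j : Fin 2) {k : ℕ} (hk : k ≠ 0) :
    constantCoeff (twistPair c i j k) = 0 := by
  rw [twistPair, map_sum]
  refine Finset.sum_eq_zero fun p hp => ?_
  rw [HasAntidiagonal.mem_antidiagonal] at hp
  rw [map_mul, constantCoeff_twist, constantCoeff_twist, constantCoeff_gUnit_val,
    constantCoeff_gUnit_inv]
  rcases eq_or_ne p.1 0 with h | h
  · rw [if_neg (c := p.2 = 0) (by omega), map_zero, mul_zero]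
  · rw [if_neg h, map_zero, zero_mul]

/-- Modulo `ħ²`, the twists by powers of `q^c` play no role, and `g⁻¹ g = 1`. -/
theorem coeff_one_twistPair (c : B) (i j : Fin 2) {k : ℕ} (hk : k ≠ 0) :
    coeff 1 (twistPair c i j k) = 0 := by
  have h : coeff k ((gUnit i j)⁻¹.val * (gUnit i j).val) = 0 := by
    rw [Units.inv_mul, coeff_one, if_neg hk]
  have h' := congrArg (fun a => algebraMap ℂ B (coeff 1 a)) h
  simp only [map_zero] at h'
  rw [← h', coeff_mul, map_sum, map_sum, twistPair, map_sum]
  refine sum_congr rfl fun p _ => ?_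
  rw [coeff_one_mul', coeff_one_mul', coeff_one_twist c (fun h => by
    rw [constantCoeff_gUnit_val, if_neg h]), coeff_one_twist c (fun h => by
    rw [constantCoeff_gUnit_inv, if_neg h]), constantCoeff_twist, constantCoeff_twist, map_add,
    map_mul, map_mul]

theorem coeff_twist_mem (c : B) (G : Base⟦X⟧) (s : ℂ) (k n : ℕ) :
    coeff n (twist c G s k) ∈ Algebra.adjoin ℂ {c} := by
  rw [twist, coeff_mul]
  refine sum_mem fun p _ => mul_mem ?_ ?_
  · rw [scalar, coeff_map]
    exact Subalgebra.algebraMap_mem _ _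
  · rw [qExp, coeff_mk]
    exact Subalgebra.smul_mem _ (pow_mem (Algebra.self_mem_adjoin_singleton ℂ c) _) _

theorem coeff_twistPair_mem (c : B) (i j : Fin 2) (k n : ℕ) :
    coeff n (twistPair c i j k) ∈ Algebra.adjoin ℂ {c} := by
  rw [twistPair, map_sum]
  refine sum_mem fun p _ => ?_
  rw [coeff_mul]
  exact sum_mem fun r _ => mul_mem (coeff_twist_mem _ _ _ _ _) (coeff_twist_mem _ _ _ _ _)

/-- Every `h_{i,l}` is a multiple of a coefficient `phiLin`. -/
theorem exists_eq_smul_phiLin (h : Fin 2 → ℤ → B) {ε : ℤˣ} (i : Fin 2) {l : ℤ}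
    (hl : 0 ≤ (ε : ℤ) * l) : ∃ z : ℂ, h i l = z • phiLin h ε i l.natAbs := by
  rcases eq_or_ne l 0 with rfl | hl0
  · refine ⟨((ε : ℤ) : ℂ), ?_⟩
    rw [phiLin, if_pos (by simp), smul_smul, ← Int.cast_mul, ← Units.val_mul, Int.units_mul_self]
    simp
  · refine ⟨2⁻¹ * ((ε : ℤ) : ℂ), ?_⟩
    have e : (ε : ℤ) * (l.natAbs : ℤ) = l := by
      rcases Int.units_eq_one_or ε with rfl | rfl <;>
        simp only [Units.val_one, Units.val_neg, one_mul, neg_mul] at hl ⊢ <;> omega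
    have e2 : 2⁻¹ * ((ε : ℤ) : ℂ) * (2 * ((ε : ℤ) : ℂ)) = 1 := by
      rcases Int.units_eq_one_or ε with rfl | rfl <;> simp
    rw [phiLin, if_neg (by omega), e, smul_smul, e2, one_smul]

/-- A homomorphism annihilates the leading coefficients of a set of relations, that is, the
coefficients of `ħᵏ` in those relations which are divisible by `ħᵏ`. -/
def KillsLeading {A : Type} [Ring A] [Algebra ℂ A] (π : B →ₐ[ℂ] A) (R : Set B⟦X⟧) : Prop :=
  ∀ r ∈ R, ∀ k, (∀ i < k, coeff i r = 0) → π (coeff k r) = 0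

variable {A : Type} [Ring A] [Algebra ℂ A] {π : B →ₐ[ℂ] A} {c : B} {h : Fin 2 → ℤ → B}
  {x : ℤˣ → Fin 2 → ℤ → B}

theorem KillsLeading.mono {R R' : Set B⟦X⟧} (hπ : KillsLeading π R') (hR : R ⊆ R') :
    KillsLeading π R := fun r hr => hπ r (hR hr)

theorem KillsLeading.commute_c_h (hπ : KillsLeading π (relCartan c h)) (i : Fin 2) (l : ℤ) :
    Commute (π c) (π (h i l)) := by
  have := hπ _ (Or.inl (Or.inl ⟨i, l, rfl⟩)) 0 (by simp)
  rw [coeff_zero_C, map_sub π, map_mul π, map_mul π] at this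
  exact sub_eq_zero.1 this

theorem coeff_of_lt_two {f : B⟦X⟧} (h0 : constantCoeff f = 0) (h1 : coeff 1 f = 0) :
    ∀ i < 2, coeff i f = 0 := by
  intro i hi
  interval_cases i
  · simpa using h0
  · exact h1

theorem coeff_two_mul (f g : B⟦X⟧) : coeff 2 (f * g) = constantCoeff f * coeff 2 g +
    coeff 1 f * coeff 1 g + coeff 2 f * constantCoeff g := by
  rw [coeff_mul, Finset.Nat.sum_antidiagonal_eq_sum_range_succ_mk]
  simp [sum_range_succ]

theorem commute_constantCoeff_phi (ε : ℤˣ) (i : Fin 2) (m : ℕ) (b : B) :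
    Commute (constantCoeff (phi h ε i m)) b := by
  rw [constantCoeff_phi]
  split_ifs
  · exact Commute.one_left b
  · exact Commute.zero_left b

/-- The commutator of two series whose constant terms are central is `ħ²` times the commutator of
the coefficients of `ħ`, to leading order. -/
theorem coeff_commutator_phi (ε ε' : ℤˣ) (i j : Fin 2) (m n : ℕ) :
    constantCoeff (phi h ε i m * phi h ε' j n - phi h ε' j n * phi h ε i m) = 0 ∧
    coeff 1 (phi h ε i m * phi h ε' j n - phi h ε' j n * phi h ε i m) = 0 ∧
    coeff 2 (phi h ε i m * phi h ε' j n - phi h ε' j n * phi h ε i m) =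
      phiLin h ε i m * phiLin h ε' j n - phiLin h ε' j n * phiLin h ε i m := by
  have e1 := fun b => (commute_constantCoeff_phi (h := h) ε i m b).eq
  have e2 := fun b => (commute_constantCoeff_phi (h := h) ε' j n b).eq
  refine ⟨?_, ?_, ?_⟩
  · rw [map_sub, map_mul, map_mul, e1, sub_self]
  · rw [map_sub, coeff_one_mul', coeff_one_mul', e1, e2]
    abel
  · rw [map_sub, coeff_two_mul, coeff_two_mul, e1, e2, coeff_one_phi, coeff_one_phi]
    abel

theorem KillsLeading.commute_phiLin (hπ : KillsLeading π (relCartan c h)) (ε : ℤˣ) (i j : Fin 2)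
    (m n : ℕ) : Commute (π (phiLin h ε i m)) (π (phiLin h ε j n)) := by
  obtain ⟨e0, e1, e2⟩ := coeff_commutator_phi (h := h) ε ε i j m n
  have := hπ _ (Or.inl (Or.inr ⟨ε, i, j, m, n, rfl⟩)) 2 (coeff_of_lt_two e0 e1)
  rw [e2, map_sub π, map_mul π, map_mul π] at this
  exact sub_eq_zero.1 this

/-- Extracting the coefficient of `ħ²` from (Q2): the terms with `k > 0` only contribute
polynomials in `c`, since the twists vanish modulo `ħ²` and `φ^±` have scalar constant terms. -/
theorem KillsLeading.phiLin_commutator_mem (hπ : KillsLeading π (relCartan c h)) (i j : Fin 2)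
    (m n : ℕ) : π (phiLin h 1 i m) * π (phiLin h (-1) j n) -
      π (phiLin h (-1) j n) * π (phiLin h 1 i m) ∈ Algebra.adjoin ℂ {π c} := by
  obtain ⟨e0, e1, e2⟩ := coeff_commutator_phi (h := h) 1 (-1) i j m n
  have hr : phi h 1 i m * phi h (-1) j n - ∑ k ∈ range (min m n + 1),
      phi h (-1) j (n - k) * phi h 1 i (m - k) * twistPair c i j k =
      (phi h 1 i m * phi h (-1) j n - phi h (-1) j n * phi h 1 i m) -
      ∑ k ∈ range (min m n), phi h (-1) j (n - (k + 1)) * phi h 1 i (m - (k + 1)) *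
        twistPair c i j (k + 1) := by
    rw [sum_range_succ', twistPair_zero, mul_one, Nat.sub_zero, Nat.sub_zero]
    abel
  have h0 : ∀ k, constantCoeff (phi h (-1) j (n - (k + 1)) * phi h 1 i (m - (k + 1)) *
      twistPair c i j (k + 1)) = 0 := fun k => by
    rw [map_mul, constantCoeff_twistPair c i j (Nat.succ_ne_zero k), mul_zero]
  have h1 : ∀ k, coeff 1 (phi h (-1) j (n - (k + 1)) * phi h 1 i (m - (k + 1)) *
      twistPair c i j (k + 1)) = 0 := fun k => by
    rw [coeff_one_mul', coeff_one_twistPair c i j (Nat.succ_ne_zero k),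
      constantCoeff_twistPair c i j (Nat.succ_ne_zero k), mul_zero, mul_zero, add_zero]
  have h2 : ∀ k, coeff 2 (phi h (-1) j (n - (k + 1)) * phi h 1 i (m - (k + 1)) *
      twistPair c i j (k + 1)) ∈ Algebra.adjoin ℂ {c} := fun k => by
    rw [coeff_two_mul, coeff_one_twistPair c i j (Nat.succ_ne_zero k),
      constantCoeff_twistPair c i j (Nat.succ_ne_zero k), mul_zero, mul_zero, add_zero, add_zero,
      map_mul, constantCoeff_phi, constantCoeff_phi]
    refine mul_mem (mul_mem ?_ ?_) (coeff_twistPair_mem _ _ _ _ _) <;> split_ifs <;>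
      first | exact one_mem _ | exact zero_mem _
  have := hπ _ (Or.inr ⟨i, j, m, n, rfl⟩) 2 (by
    rw [hr]
    refine coeff_of_lt_two ?_ ?_
    · rw [map_sub, e0, map_sum, Finset.sum_eq_zero fun k _ => h0 k, sub_zero]
    · rw [map_sub, e1, map_sum, Finset.sum_eq_zero fun k _ => h1 k, sub_zero])
  rw [hr, map_sub, e2, map_sub π, map_sub π, map_mul π, map_mul π, sub_eq_zero] at this
  rw [this, map_sum, ← Set.image_singleton, Algebra.adjoin_image]
  exact ⟨_, sum_mem fun k _ => h2 k, rfl⟩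

/-- To leading order, the commutators of the `h_{i,l}` are polynomials in `c`. -/
theorem KillsLeading.commutator_h_mem (hπ : KillsLeading π (relCartan c h)) (i j : Fin 2)
    (l l' : ℤ) : π (h i l) * π (h j l') - π (h j l') * π (h i l) ∈ Algebra.adjoin ℂ {π c} := by
  have same : ∀ ε : ℤˣ, 0 ≤ (ε : ℤ) * l → 0 ≤ (ε : ℤ) * l' →
      π (h i l) * π (h j l') - π (h j l') * π (h i l) ∈ Algebra.adjoin ℂ {π c} := by
    intro ε hl hl'
    obtain ⟨z, hz⟩ := exists_eq_smul_phiLin h i hl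
    obtain ⟨z', hz'⟩ := exists_eq_smul_phiLin h j hl'
    rw [hz, hz', map_smul π, map_smul π, (((hπ.commute_phiLin ε i j _ _).smul_left z).smul_right z').eq,
      sub_self]
    exact zero_mem _
  have opp : ∀ i j (l l' : ℤ), 0 ≤ l → l' ≤ 0 →
      π (h i l) * π (h j l') - π (h j l') * π (h i l) ∈ Algebra.adjoin ℂ {π c} := by
    intro i j l l' hl hl'
    obtain ⟨z, hz⟩ := exists_eq_smul_phiLin h (ε := 1) i (l := l) (by simpa using hl)
    obtain ⟨z', hz'⟩ := exists_eq_smul_phiLin h (ε := -1) j (l := l') (by simpa using hl')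
    rw [hz, hz', map_smul π, map_smul π]
    simp only [smul_mul_assoc, mul_smul_comm, smul_comm z' z]
    rw [← smul_sub, ← smul_sub]
    exact Subalgebra.smul_mem _ (Subalgebra.smul_mem _ (hπ.phiLin_commutator_mem i j _ _) _) _
  rcases le_total 0 l with hl | hl <;> rcases le_total 0 l' with hl' | hl'
  · exact same 1 (by simpa using hl) (by simpa using hl')
  · exact opp i j l l' hl hl'
  · rw [← neg_sub]
    exact neg_mem (opp j i l' l hl' hl)
  · exact same (-1) (by simpa using hl) (by simpa using hl')

theorem KillsLeading.commute_c_x (hπ : KillsLeading π (relMixed c h x)) (ε : ℤˣ) (i : Fin 2)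
    (n : ℤ) : Commute (π c) (π (x ε i n)) := by
  have := hπ _ (Or.inl (Or.inl ⟨ε, i, n, rfl⟩)) 0 (by simp)
  rw [coeff_zero_C, map_sub π, map_mul π, map_mul π] at this
  exact sub_eq_zero.1 this

/-- Extracting the coefficient of `ħ` from (Q3) and (Q4), which have the same shape. -/
theorem commutator_phiLin_x {σ : ℤˣ} {i : Fin 2} {m : ℕ} {G : Base⟦X⟧}
    (hG : ∀ k, constantCoeff (coeff k G) = if k = 0 then 1 else 0) {y : ℕ → B} {s : ℂ}
    (hπ : KillsLeading π {phi h σ i m * PowerSeries.C (y 0) - ∑ k ∈ range (m + 1),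
      PowerSeries.C (y k) * phi h σ i (m - k) * twist c G s k}) :
    ∃ z : ℂ, π (phiLin h σ i m) * π (y 0) - π (y 0) * π (phiLin h σ i m) = z • π (y m) := by
  have ht0 : ∀ k, constantCoeff (twist c G s k) = if k = 0 then 1 else 0 := fun k => by
    rw [constantCoeff_twist, hG]
    split_ifs <;> simp
  have ht1 : ∀ k, coeff 1 (twist c G s k) = algebraMap ℂ B (coeff 1 (coeff k G)) := fun k =>
    coeff_one_twist c (fun hk => by rw [hG, if_neg hk]) s
  have e0 : ∀ k ∈ range (m + 1), k ≠ 0 → constantCoeff (PowerSeries.C (y k) * phi h σ i (m - k) *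
      twist c G s k) = 0 := fun k _ hk => by rw [map_mul, ht0, if_neg hk, mul_zero]
  have e1 : ∀ k, coeff 1 (PowerSeries.C (y k) * phi h σ i (m - k) * twist c G s k) =
      (if k = 0 then y k * phiLin h σ i (m - k) else 0) +
      if m - k = 0 then coeff 1 (coeff k G) • y k else 0 := fun k => by
    rw [coeff_one_mul', ht0, ht1, coeff_C_mul, coeff_one_phi, map_mul, constantCoeff_C,
      constantCoeff_phi, add_comm]
    congr 1
    · split_ifs <;> simp
    · split_ifs
      · rw [mul_one, Algebra.smul_def, Algebra.commutes]
      · simp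
  have hk := hπ _ rfl 1 (fun k hk => by
    obtain rfl : k = 0 := by omega
    rw [coeff_zero_eq_constantCoeff_apply, map_sub, map_sum, Finset.sum_eq_single 0 e0 (by simp)]
    rw [map_mul, map_mul, map_mul, ht0, if_pos rfl, mul_one, Nat.sub_zero, constantCoeff_C,
      (commute_constantCoeff_phi σ i m _).eq, sub_self])
  refine ⟨coeff 1 (coeff m G), ?_⟩
  rw [map_sub, map_sum, sum_congr rfl fun k _ => e1 k, sum_add_distrib,
    Finset.sum_eq_single_of_mem 0 (by simp) (fun k _ hk => if_neg hk), if_pos rfl, Nat.sub_zero,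
    Finset.sum_eq_single_of_mem m (by simp) (fun k hk hkm => if_neg (by
      have := mem_range.1 hk; omega)), if_pos (Nat.sub_self m), coeff_mul_C, coeff_one_phi,
    map_sub π, map_add π, map_mul π, map_mul π, map_smul π, ← sub_sub, sub_eq_zero] at hk
  exact hk

/-- To leading order, the `h_{i,l}` act on the `x^ε_{j,n}` by multiples of shifts. -/
theorem KillsLeading.commutator_h_x (hπ : KillsLeading π (relMixed c h x)) (ε : ℤˣ) (i j : Fin 2)
    (l n : ℤ) : ∃ z : ℂ, π (h i l) * π (x ε j n) - π (x ε j n) * π (h i l) = z • π (x ε j (n + l)) := by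
  have key : ∀ σ : ℤˣ, 0 ≤ (σ : ℤ) * l → ∃ z : ℂ, π (phiLin h σ i l.natAbs) * π (x ε j n) -
      π (x ε j n) * π (phiLin h σ i l.natAbs) = z • π (x ε j (n + l)) := by
    intro σ hl
    rcases Int.units_eq_one_or σ with rfl | rfl
    · have e := commutator_phiLin_x (π := π) (c := c) (h := h) (σ := 1) (i := i) (m := l.natAbs)
        (y := fun k => x ε j (n + k)) (s := -((ε : ℤ) : ℂ) / 2) (constantCoeff_gUnit i j ε)
        (hπ.mono (by
          rintro _ rfl
          refine Or.inl (Or.inr ⟨ε, i, j, l.natAbs, n, ?_⟩)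
          simp))
      have h2 : n + (l.natAbs : ℤ) = n + l := by simp at hl; omega
      simp only [Nat.cast_zero, add_zero, h2] at e
      exact e
    · have e := commutator_phiLin_x (π := π) (c := c) (h := h) (σ := -1) (i := i) (m := l.natAbs)
        (y := fun k => x ε j (n - k)) (s := -((ε : ℤ) : ℂ) / 2) (G := (gUnit j i ^ (-(ε : ℤ)) :
          (Base⟦X⟧)ˣ).val) (fun k => by
            have := constantCoeff_gUnit j i (-ε) k
            rwa [Units.val_neg] at this)
        (hπ.mono (by
          rintro _ rfl
          refine Or.inr ⟨ε, i, j, l.natAbs, n, ?_⟩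
          simp))
      have h2 : n - (l.natAbs : ℤ) = n + l := by simp at hl; omega
      simp only [Nat.cast_zero, sub_zero, h2] at e
      exact e
  obtain ⟨σ, hl⟩ : ∃ σ : ℤˣ, 0 ≤ (σ : ℤ) * l := by
    rcases le_total 0 l with hl | hl
    · exact ⟨1, by simpa using hl⟩
    · exact ⟨-1, by simpa using hl⟩
  obtain ⟨z, hz⟩ := exists_eq_smul_phiLin h i hl
  obtain ⟨z', hz'⟩ := key σ hl
  refine ⟨z * z', ?_⟩
  rw [hz, map_smul π, smul_mul_assoc, mul_smul_comm, ← smul_sub, hz', smul_smul]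

/-- The terms on the right hand side of (Q5), to first order in `ħ`. -/
theorem coeff_phiMode_mem (ε : ℤˣ) (i : Fin 2) (k : ℤ) (s t : ℂ) :
    constantCoeff (phiMode h ε i k * qExp s c * qExp t c) = (if k = 0 then 1 else 0) ∧
    coeff 1 (phiMode h ε i k * qExp s c * qExp t c) ∈
      Algebra.adjoin ℂ ({b | ∃ i l, b = h i l} ∪ {c}) := by
  have h0 : constantCoeff (phiMode h ε i k) = if k = 0 then 1 else 0 :=
    constantCoeff_phiOpMode (fun i => h i 0) (fun i n => PowerSeries.C (h i n)) ε i k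
  have hh : ∀ i l, h i l ∈ Algebra.adjoin ℂ ({b | ∃ i l, b = h i l} ∪ {c}) := fun i l =>
    Algebra.subset_adjoin (Or.inl ⟨i, l, rfl⟩)
  have hc : c ∈ Algebra.adjoin ℂ ({b | ∃ i l, b = h i l} ∪ {c}) :=
    Algebra.subset_adjoin (Or.inr rfl)
  have hq : ∀ (s : ℂ) {f : B⟦X⟧} {k : ℤ}, constantCoeff f = (if k = 0 then 1 else 0) →
      coeff 1 f ∈ Algebra.adjoin ℂ ({b | ∃ i l, b = h i l} ∪ {c}) →
      constantCoeff (f * qExp s c) = (if k = 0 then 1 else 0) ∧ coeff 1 (f * qExp s c) ∈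
        Algebra.adjoin ℂ ({b | ∃ i l, b = h i l} ∪ {c}) := by
    intro s f k hf0 hf1
    rw [map_mul, coeff_one_mul', constantCoeff_qExp, mul_one, mul_one, coeff_one_qExp, hf0]
    refine ⟨rfl, add_mem (mul_mem ?_ (Subalgebra.smul_mem _ hc _)) hf1⟩
    split_ifs
    · exact one_mem _
    · exact zero_mem _
  have h1 : coeff 1 (phiMode h ε i k) ∈ Algebra.adjoin ℂ ({b | ∃ i l, b = h i l} ∪ {c}) := by
    rw [phiMode]
    split_ifs
    · rw [coeff_one_phi, phiLin]
      split_ifs <;> exact Subalgebra.smul_mem _ (hh _ _) _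
    · rw [map_zero]
      exact zero_mem _
  obtain ⟨h2, h3⟩ := hq s h0 h1
  exact hq t h2 h3

/-- To leading order, the commutators of the `x^+_{i,m}` with the `x^-_{j,n}` belong to the
algebra generated by the `h_{i,l}` and `c`. -/
theorem KillsLeading.commutator_x_mem (hπ : KillsLeading π (relQ5 c h x)) (i j : Fin 2) (m n : ℤ) :
    π (x 1 i m) * π (x (-1) j n) - π (x (-1) j n) * π (x 1 i m) ∈
      (Algebra.adjoin ℂ ({b | ∃ i l, b = h i l} ∪ {c})).map π := by
  have hqd : constantCoeff (scalar (B := B) (qPow 1 - qPow (-1))) = 0 := by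
    rw [constantCoeff_scalar, map_sub, constantCoeff_qPow, constantCoeff_qPow, sub_self, map_zero]
  have hqd1 : coeff 1 (scalar (B := B) (qPow 1 - qPow (-1))) = algebraMap ℂ B 2 := by
    rw [scalar, coeff_map, map_sub, coeff_one_qPow, coeff_one_qPow]
    norm_num
  obtain ⟨p0, p1⟩ := coeff_phiMode_mem (c := c) (h := h) 1 i (m + n) (((m + n : ℤ) : ℂ) / 2) (-(n : ℂ))
  obtain ⟨m0, m1⟩ := coeff_phiMode_mem (c := c) (h := h) (-1) i (m + n) (-((m + n : ℤ) : ℂ) / 2) n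
  have := hπ _ ⟨i, j, m, n, rfl⟩ 1 (fun k hk => by
    obtain rfl : k = 0 := by omega
    rw [coeff_zero_eq_constantCoeff_apply, map_sub, map_mul, hqd, zero_mul, zero_sub, neg_eq_zero]
    split_ifs
    · rw [map_sub, p0, m0, sub_self]
    · exact map_zero _)
  rw [map_sub, coeff_one_mul', hqd, hqd1, zero_mul, zero_add, constantCoeff_C, ← Algebra.smul_def,
    map_sub π, map_smul π, sub_eq_zero] at this
  rw [← map_mul π, ← map_mul π, ← map_sub π,
    ← one_smul ℂ (π _), ← inv_mul_cancel₀ (two_ne_zero (α := ℂ)), mul_smul, this]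
  refine Subalgebra.smul_mem _ (Subalgebra.mem_map.2 ⟨_, ?_, rfl⟩) _
  split_ifs
  · rw [map_sub]
    exact sub_mem p1 m1
  · rw [map_zero]
    exact zero_mem _

end Leading

/-! ### The reduction of a presented algebra modulo `ħ` -/

section Residue
variable {G : Type} (R : Set (FreeTop G))

theorem Presented.mk_C_smul (z : ℂ) (a : FreeAlgebra ℂ G) :
    Presented.mk R (PowerSeries.C (z • a)) = (PowerSeries.C z : Base) • Presented.mk R (PowerSeries.C a) := by
  rw [← map_smul, FreeTop.smul_def, scalar_C, ← map_mul PowerSeries.C, Algebra.smul_def]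

theorem Presented.mk_X_mul (f : FreeTop G) :
    Presented.mk R (X * f) = hbar • Presented.mk R f := by
  rw [← map_smul, FreeTop.hbar_smul]

/-- The ideal of the elements of `ℂ⟨G⟩` whose images in the presented algebra are divisible
by `ħ`. -/
def residueIdeal : Ideal (FreeAlgebra ℂ G) where
  carrier := {a | ∃ t, Presented.mk R (PowerSeries.C a) = hbar • t}
  zero_mem' := ⟨0, by rw [map_zero, map_zero, smul_zero]⟩
  add_mem' := by
    rintro a b ⟨t, ht⟩ ⟨t', ht'⟩
    exact ⟨t + t', by rw [map_add, map_add, ht, ht', smul_add]⟩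
  smul_mem' := by
    rintro a b ⟨t, ht⟩
    exact ⟨Presented.mk R (PowerSeries.C a) * t, by
      rw [smul_eq_mul, map_mul, map_mul, ht, mul_smul_comm]⟩

instance : (residueIdeal R).IsTwoSided where
  mul_mem_of_left := by
    rintro a b ⟨t, ht⟩
    exact ⟨t * Presented.mk R (PowerSeries.C b), by
      rw [map_mul, map_mul, ht, smul_mul_assoc]⟩

/-- The quotient of the presented algebra by its ideal generated by `ħ`. -/
abbrev Residue : Type := FreeAlgebra ℂ G ⧸ residueIdeal R

/-- The projection from the free algebra to the reduction of the presented algebra modulo `ħ`. -/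
def residue : FreeAlgebra ℂ G →ₐ[ℂ] Residue R := Ideal.Quotient.mkₐ ℂ _

variable {R}

theorem residue_surjective : Function.Surjective (residue R) := Ideal.Quotient.mk_surjective

theorem residue_eq_zero {a : FreeAlgebra ℂ G} :
    residue R a = 0 ↔ ∃ t, Presented.mk R (PowerSeries.C a) = hbar • t :=
  Ideal.Quotient.eq_zero_iff_mem

/-- The leading coefficient of a relation vanishes modulo `ħ`, because powers of `ħ` are
cancelled. -/
theorem killsLeading_residue : KillsLeading (residue R) R := by
  intro r hr k hk
  rw [residue_eq_zero]
  let f : FreeTop G := PowerSeries.mk fun i => coeff (i + k) r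
  have hf : X ^ k * f = r := by
    ext1 i
    rw [coeff_X_pow_mul']
    split_ifs with h
    · rw [coeff_mk, Nat.sub_add_cancel h]
    · exact (hk i (by omega)).symm
  have h0 : Presented.mk R f = 0 :=
    (Presented.mk_eq_zero R).2 (subset_closedIdeal _ ⟨k, by rwa [hf]⟩)
  refine ⟨-Presented.mk R (PowerSeries.mk fun i => coeff (i + 1) f), ?_⟩
  rw [eq_X_mul_shift_add_const f, map_add, Presented.mk_X_mul, add_eq_zero_iff_eq_neg'] at h0
  rw [smul_neg, ← h0, ← coeff_zero_eq_constantCoeff_apply, coeff_mk, zero_add]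

/-- The image of a submodule of the presented algebra in the reduction modulo `ħ`. -/
def residueImage (S : Submodule Base (Presented G R)) : Submodule ℂ (Residue R) where
  carrier := {q | ∃ a, residue R a = q ∧ ∃ s ∈ S, ∃ t,
    Presented.mk R (PowerSeries.C a) = s + hbar • t}
  zero_mem' := ⟨0, map_zero _, 0, S.zero_mem, 0, by rw [map_zero, map_zero, smul_zero, add_zero]⟩
  add_mem' := by
    rintro _ _ ⟨a, rfl, s, hs, t, h⟩ ⟨a', rfl, s', hs', t', h'⟩
    refine ⟨a + a', map_add _ _ _, s + s', S.add_mem hs hs', t + t', ?_⟩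
    rw [map_add, map_add, h, h', smul_add]
    abel
  smul_mem' := by
    rintro z _ ⟨a, rfl, s, hs, t, h⟩
    refine ⟨z • a, map_smul _ _ _, (PowerSeries.C z : Base) • s, S.smul_mem _ hs,
      (PowerSeries.C z : Base) • t, ?_⟩
    rw [Presented.mk_C_smul, h, smul_add, smul_comm]

theorem residue_mem_residueImage {S : Submodule Base (Presented G R)} {a : FreeAlgebra ℂ G}
    (h : Presented.mk R (PowerSeries.C a) ∈ S) : residue R a ∈ residueImage S :=
  ⟨a, rfl, _, h, 0, by rw [smul_zero, add_zero]⟩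

/-- A submodule which spans modulo `ħ` has translates by multiples of `ħ` covering the algebra. -/
theorem exists_add_hbar_smul {S : Submodule Base (Presented G R)} (h : ∀ q, q ∈ residueImage S)
    (y : Presented G R) : ∃ s ∈ S, ∃ t, y = s + hbar • t := by
  obtain ⟨f, rfl⟩ := Presented.mk_surjective R y
  obtain ⟨a, ha, s, hs, t, h⟩ := h (residue R (coeff 0 f))
  rw [← sub_eq_zero, ← map_sub, residue_eq_zero] at ha
  obtain ⟨t', ht'⟩ := ha
  rw [map_sub, map_sub, h] at ht'
  refine ⟨s, hs, t - t' + Presented.mk R (PowerSeries.mk fun i => coeff (i + 1) f), ?_⟩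
  conv_lhs => rw [eq_X_mul_shift_add_const f, map_add, Presented.mk_X_mul]
  rw [smul_add, smul_sub, ← ht', coeff_zero_eq_constantCoeff_apply]
  abel

end Residue

/-! ### Spanning sets of algebras filtered by commutation relations -/

section Spanning
variable {A : Type} [Ring A] [Algebra ℂ A]

/-- The range of a homomorphism, as a subspace. -/
abbrev rangeSpace {G : Type} (f : FreeAlgebra ℂ G →ₐ[ℂ] A) : Submodule ℂ A :=
  Subalgebra.toSubmodule f.range

theorem one_mem_rangeSpace {G : Type} (f : FreeAlgebra ℂ G →ₐ[ℂ] A) : 1 ∈ rangeSpace f :=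
  one_mem f.range

theorem rangeSpace_mul_self {G : Type} (f : FreeAlgebra ℂ G →ₐ[ℂ] A) :
    rangeSpace f * rangeSpace f = rangeSpace f :=
  Subalgebra.isIdempotentElem_toSubmodule _

theorem ι_mem_rangeSpace {G : Type} (f : FreeAlgebra ℂ G →ₐ[ℂ] A) (g : G) :
    f (FreeAlgebra.ι ℂ g) ∈ rangeSpace f := ⟨_, rfl⟩

/-- Commutators with the elements of a subalgebra are controlled by those with its generators. -/
theorem commutator_mem_of_gen {G : Type} {f : FreeAlgebra ℂ G →ₐ[ℂ] A} {N : Submodule ℂ A} {z : A}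
    (hl : rangeSpace f * N ≤ N) (hr : N * rangeSpace f ≤ N)
    (h : ∀ g, z * f (FreeAlgebra.ι ℂ g) - f (FreeAlgebra.ι ℂ g) * z ∈ N) {a : A}
    (ha : a ∈ rangeSpace f) : z * a - a * z ∈ N := by
  obtain ⟨a, rfl⟩ := ha
  change z * f a - f a * z ∈ N
  induction a with
  | grade0 r => rw [AlgHom.commutes, Algebra.commutes, sub_self]; exact N.zero_mem
  | grade1 g => exact h g
  | mul a b ha hb =>
    have e : z * f (a * b) - f (a * b) * z =
        (z * f a - f a * z) * f b + f a * (z * f b - f b * z) := by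
      rw [map_mul f]
      noncomm_ring
    rw [e]
    exact N.add_mem (hr (Submodule.mul_mem_mul ha ⟨b, rfl⟩)) (hl (Submodule.mul_mem_mul ⟨a, rfl⟩ hb))
  | add a b ha hb =>
    rw [map_add f, mul_add, add_mul, add_sub_add_comm]
    exact N.add_mem ha hb

theorem mul_le_of_gen_left {G : Type} {f : FreeAlgebra ℂ G →ₐ[ℂ] A} {T N : Submodule ℂ A}
    (hT : T ≤ N) (h : ∀ g, ∀ n ∈ N, f (FreeAlgebra.ι ℂ g) * n ∈ N) : rangeSpace f * T ≤ N := by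
  have key : ∀ a, ∀ n ∈ N, f a * n ∈ N := by
    intro a
    induction a with
    | grade0 r => intro n hn; rw [AlgHom.commutes, ← Algebra.smul_def]; exact N.smul_mem _ hn
    | grade1 g => exact h g
    | mul a b ha hb => intro n hn; rw [map_mul f, mul_assoc]; exact ha _ (hb _ hn)
    | add a b ha hb => intro n hn; rw [map_add f, add_mul]; exact N.add_mem (ha _ hn) (hb _ hn)
  rw [Submodule.mul_le]
  rintro _ ⟨a, rfl⟩ n hn
  exact key a n (hT hn)

theorem mul_le_of_gen_right {G : Type} {f : FreeAlgebra ℂ G →ₐ[ℂ] A} {T N : Submodule ℂ A}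
    (hT : T ≤ N) (h : ∀ g, ∀ n ∈ N, n * f (FreeAlgebra.ι ℂ g) ∈ N) : T * rangeSpace f ≤ N := by
  have key : ∀ a, ∀ n ∈ N, n * f a ∈ N := by
    intro a
    induction a with
    | grade0 r =>
      intro n hn; rw [AlgHom.commutes, ← Algebra.commutes, ← Algebra.smul_def]; exact N.smul_mem _ hn
    | grade1 g => exact h g
    | mul a b ha hb => intro n hn; rw [map_mul f, ← mul_assoc]; exact hb _ (ha _ hn)
    | add a b ha hb => intro n hn; rw [map_add f, mul_add]; exact N.add_mem (ha _ hn) (hb _ hn)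
  rw [Submodule.mul_le]
  rintro n hn _ ⟨a, rfl⟩
  exact key a n (hT hn)

/-- The span of the products of elements of three subalgebras is a left ideal, if the commutators
of their generators have the form which occurs in a triangular decomposition. -/
theorem mul_rangeSpace_stable {Gm G0 Gp : Type} {fm : FreeAlgebra ℂ Gm →ₐ[ℂ] A}
    {f0 : FreeAlgebra ℂ G0 →ₐ[ℂ] A} {fp : FreeAlgebra ℂ Gp →ₐ[ℂ] A}
    (h1 : ∀ g g', f0 (FreeAlgebra.ι ℂ g) * fm (FreeAlgebra.ι ℂ g') -
      fm (FreeAlgebra.ι ℂ g') * f0 (FreeAlgebra.ι ℂ g) ∈ rangeSpace fm)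
    (h2 : ∀ g g', f0 (FreeAlgebra.ι ℂ g) * fp (FreeAlgebra.ι ℂ g') -
      fp (FreeAlgebra.ι ℂ g') * f0 (FreeAlgebra.ι ℂ g) ∈ rangeSpace fp)
    (h3 : ∀ g g', fp (FreeAlgebra.ι ℂ g) * fm (FreeAlgebra.ι ℂ g') -
      fm (FreeAlgebra.ι ℂ g') * fp (FreeAlgebra.ι ℂ g) ∈ rangeSpace f0) :
    let N := rangeSpace fm * rangeSpace f0 * rangeSpace fp
    (∀ g, ∀ n ∈ N, fm (FreeAlgebra.ι ℂ g) * n ∈ N) ∧ (∀ g, ∀ n ∈ N, f0 (FreeAlgebra.ι ℂ g) * n ∈ N) ∧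
      ∀ g, ∀ n ∈ N, fp (FreeAlgebra.ι ℂ g) * n ∈ N := by
  intro N
  have hm0 : rangeSpace fm ≤ rangeSpace fm * rangeSpace f0 := fun a ha => by
    simpa using Submodule.mul_mem_mul ha (one_mem_rangeSpace f0)
  have h0p : rangeSpace fp ≤ rangeSpace f0 * rangeSpace fp := fun a ha => by
    simpa using Submodule.mul_mem_mul (one_mem_rangeSpace f0) ha
  have h0m : rangeSpace f0 ≤ rangeSpace fm * rangeSpace f0 := fun a ha => by
    simpa using Submodule.mul_mem_mul (one_mem_rangeSpace fm) ha
  have hmp : rangeSpace fm * rangeSpace f0 ≤ N := fun a ha => by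
    simpa using Submodule.mul_mem_mul ha (one_mem_rangeSpace fp)
  have c0m : rangeSpace f0 * rangeSpace fm ≤ rangeSpace fm * rangeSpace f0 := by
    refine mul_le_of_gen_left hm0 fun g n hn => ?_
    induction hn using Submodule.mul_induction_on' with
    | mem_mul_mem a ha b hb =>
      have e : f0 (FreeAlgebra.ι ℂ g) * (a * b) =
        a * (f0 (FreeAlgebra.ι ℂ g) * b) + (f0 (FreeAlgebra.ι ℂ g) * a - a * f0 (FreeAlgebra.ι ℂ g)) * b := by
        noncomm_ring
      rw [e]
      refine Submodule.add_mem _ (Submodule.mul_mem_mul ha ?_) (Submodule.mul_mem_mul ?_ hb)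
      · rw [← rangeSpace_mul_self]
        exact Submodule.mul_mem_mul (ι_mem_rangeSpace _ _) hb
      · exact commutator_mem_of_gen (rangeSpace_mul_self _).le (rangeSpace_mul_self _).le (h1 g) ha
    | add a _ b _ ha hb => rw [mul_add]; exact Submodule.add_mem _ ha hb
  have cp0 : rangeSpace fp * rangeSpace f0 ≤ rangeSpace f0 * rangeSpace fp := by
    refine mul_le_of_gen_right h0p fun g n hn => ?_
    induction hn using Submodule.mul_induction_on' with
    | mem_mul_mem b hb a ha =>
      have e : b * a * f0 (FreeAlgebra.ι ℂ g) =
        b * f0 (FreeAlgebra.ι ℂ g) * a - b * (f0 (FreeAlgebra.ι ℂ g) * a - a * f0 (FreeAlgebra.ι ℂ g)) := by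
        noncomm_ring
      rw [e]
      refine Submodule.sub_mem _ (Submodule.mul_mem_mul ?_ ha) (Submodule.mul_mem_mul hb ?_)
      · rw [← rangeSpace_mul_self]
        exact Submodule.mul_mem_mul hb (ι_mem_rangeSpace _ _)
      · exact commutator_mem_of_gen (rangeSpace_mul_self _).le (rangeSpace_mul_self _).le (h2 g) ha
    | add a _ b _ ha hb => rw [add_mul]; exact Submodule.add_mem _ ha hb
  have sm : rangeSpace fm * N ≤ N := by
    rw [← mul_assoc, ← mul_assoc, rangeSpace_mul_self]
  have s0 : rangeSpace f0 * N ≤ N := by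
    calc rangeSpace f0 * N = (rangeSpace f0 * rangeSpace fm) * (rangeSpace f0 * rangeSpace fp) := by
          simp only [N, mul_assoc]
      _ ≤ (rangeSpace fm * rangeSpace f0) * (rangeSpace f0 * rangeSpace fp) := by gcongr
      _ = rangeSpace fm * (rangeSpace f0 * rangeSpace f0) * rangeSpace fp := by
          simp only [mul_assoc]
      _ = N := by rw [rangeSpace_mul_self]
  have sN : N * (rangeSpace f0 * rangeSpace fp) ≤ N := by
    calc N * (rangeSpace f0 * rangeSpace fp) =
          rangeSpace fm * rangeSpace f0 * (rangeSpace fp * rangeSpace f0) * rangeSpace fp := by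
          simp only [N, mul_assoc]
      _ ≤ rangeSpace fm * rangeSpace f0 * (rangeSpace f0 * rangeSpace fp) * rangeSpace fp := by gcongr
      _ = rangeSpace fm * (rangeSpace f0 * rangeSpace f0) * (rangeSpace fp * rangeSpace fp) := by
          simp only [mul_assoc]
      _ = N := by rw [rangeSpace_mul_self, rangeSpace_mul_self]
  refine ⟨fun g n hn => sm (Submodule.mul_mem_mul (ι_mem_rangeSpace _ _) hn),
    fun g n hn => s0 (Submodule.mul_mem_mul (ι_mem_rangeSpace _ _) hn), fun g n hn => ?_⟩
  have hga : ∀ a ∈ rangeSpace fm, fp (FreeAlgebra.ι ℂ g) * a ∈ N := by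
    intro a ha
    rw [← sub_add_cancel (fp (FreeAlgebra.ι ℂ g) * a) (a * fp (FreeAlgebra.ι ℂ g))]
    refine N.add_mem (hmp (commutator_mem_of_gen (f := fm) ?_ ?_ (fun g' => h0m (h3 g g')) ha))
      (Submodule.mul_mem_mul (hm0 ha) (ι_mem_rangeSpace _ _))
    · rw [← mul_assoc, rangeSpace_mul_self]
    · calc rangeSpace fm * rangeSpace f0 * rangeSpace fm =
            rangeSpace fm * (rangeSpace f0 * rangeSpace fm) := by rw [mul_assoc]
        _ ≤ rangeSpace fm * (rangeSpace fm * rangeSpace f0) := by gcongr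
        _ = rangeSpace fm * rangeSpace f0 := by rw [← mul_assoc, rangeSpace_mul_self]
  have hn' : n ∈ rangeSpace fm * (rangeSpace f0 * rangeSpace fp) := by rwa [← mul_assoc]
  clear hn
  induction hn' using Submodule.mul_induction_on' with
  | mem_mul_mem a ha b hb =>
    rw [← mul_assoc]
    exact sN (Submodule.mul_mem_mul (hga a ha) hb)
  | add a ha b hb iha ihb =>
    rw [mul_add]
    exact N.add_mem iha ihb

/-- The number of factors other than `c`. -/
def CartanGen.deg : CartanGen → ℕ
  | CartanGen.h _ _ => 1
  | CartanGen.c => 0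

/-- The span of the products with less than `k` factors `h_{i,n}`. -/
def degSpan (γ : CartanGen → A) (k : ℕ) : Submodule ℂ A :=
  Submodule.span ℂ {a | ∃ L : List CartanGen, (L.map CartanGen.deg).sum < k ∧ a = (L.map γ).prod}

theorem prod_mem_degSpan (γ : CartanGen → A) {L : List CartanGen} {k : ℕ}
    (h : (L.map CartanGen.deg).sum < k) : (L.map γ).prod ∈ degSpan γ k :=
  Submodule.subset_span ⟨L, h, rfl⟩

/-- Multiplication by a generator raises the degree by that of the generator. -/
theorem mul_mem_degSpan (γ : CartanGen → A) (g : CartanGen) {a : A} {k : ℕ} (h : a ∈ degSpan γ k) :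
    γ g * a ∈ degSpan γ (g.deg + k) := by
  have : degSpan γ k ≤ (degSpan γ (g.deg + k)).comap (LinearMap.mulLeft ℂ (γ g)) := by
    refine Submodule.span_le.2 ?_
    rintro _ ⟨L, hL, rfl⟩
    exact Submodule.subset_span ⟨g :: L, by simpa using hL, by simp⟩
  exact this h

variable {γ : CartanGen → A} (hc : ∀ g, Commute (γ CartanGen.c) (γ g))
  (hh : ∀ g g', γ g * γ g' - γ g' * γ g ∈ Algebra.adjoin ℂ {γ CartanGen.c})
include hc hh

/-- Up to terms with fewer factors `h_{i,n}`, the factors of a product can be permuted. -/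
theorem prod_sub_prod_mem_degSpan {L L' : List CartanGen} (h : L.Perm L') :
    (L.map γ).prod - (L'.map γ).prod ∈ degSpan γ (L.map CartanGen.deg).sum := by
  induction h with
  | nil => simp
  | cons g _ ih =>
    simp only [List.map_cons, List.prod_cons, List.sum_cons, ← mul_sub]
    exact mul_mem_degSpan γ g ih
  | swap g g' L =>
    simp only [List.map_cons, List.prod_cons, List.sum_cons, ← mul_assoc]
    rw [← sub_mul]
    have hcc : ∀ a ∈ Algebra.adjoin ℂ {γ CartanGen.c}, ∀ k, ∀ n ∈ degSpan γ k, a * n ∈ degSpan γ k := by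
      intro a ha k
      induction ha using Algebra.adjoin_induction with
      | mem a ha =>
        rw [Set.mem_singleton_iff] at ha
        subst ha
        intro n hn
        simpa [CartanGen.deg] using mul_mem_degSpan γ CartanGen.c hn
      | algebraMap r => intro n hn; rw [← Algebra.smul_def]; exact Submodule.smul_mem _ _ hn
      | add a b _ _ ha hb => intro n hn; rw [add_mul]; exact Submodule.add_mem _ (ha n hn) (hb n hn)
      | mul a b _ _ ha hb => intro n hn; rw [mul_assoc]; exact ha _ (hb n hn)
    rcases Nat.eq_zero_or_pos (g'.deg + g.deg) with h0 | h0
    · have hg : g = CartanGen.c := by cases g <;> simp [CartanGen.deg] at h0 ⊢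
      rw [hg, (hc g').eq, sub_self, zero_mul]
      exact Submodule.zero_mem _
    · exact hcc _ (hh g' g) _ _ (prod_mem_degSpan γ (by omega))
  | trans h1 _ ih1 ih2 =>
    rw [← (h1.map CartanGen.deg).sum_eq] at ih2
    rw [← sub_add_sub_cancel]
    exact Submodule.add_mem _ ih1 ih2

/-- The normally ordered monomials span. -/
theorem prod_mem_span_normalProd (L : List CartanGen) : (L.map γ).prod ∈ Submodule.span ℂ
    (Set.range fun s : CartanGen →₀ ℕ => normalProd γ s.toMultiset.toList) := by
  induction hk : (L.map CartanGen.deg).sum using Nat.strong_induction_on generalizing L with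
  | _ k ih =>
    classical
    let s : CartanGen →₀ ℕ := Multiset.toFinsupp (L : Multiset CartanGen)
    have hs : s.toMultiset.toList.Perm L := by
      rw [← Multiset.coe_eq_coe, Multiset.coe_toList]
      exact Multiset.toFinsupp_toMultiset _
    have hs' : ((s.toMultiset.toList.filter fun g => !g.isPos) ++
        s.toMultiset.toList.filter fun g => g.isPos).Perm L := by
      refine List.Perm.trans ?_ hs
      refine List.perm_append_comm.trans ?_
      exact List.filter_append_perm _ _
    have hd := prod_sub_prod_mem_degSpan hc hh hs'.symm
    rw [List.map_append, List.prod_append, hk] at hd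
    have hle : degSpan γ k ≤ Submodule.span ℂ
        (Set.range fun s : CartanGen →₀ ℕ => normalProd γ s.toMultiset.toList) := by
      refine Submodule.span_le.2 ?_
      rintro _ ⟨L', hL', rfl⟩
      exact ih _ hL' L' rfl
    rw [← sub_add_cancel (L.map γ).prod (normalProd γ s.toMultiset.toList)]
    exact Submodule.add_mem _ (hle hd) (Submodule.subset_span ⟨s, rfl⟩)

end Spanning

/-! ### Homomorphisms between presented algebras -/

section Maps
variable {G G' : Type} {R : Set (FreeTop G)} {R' : Set (FreeTop G')}

/-- The linear map on a presented algebra induced by a linear map which kills the relations. -/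
def Presented.liftLin {M : Type} [AddCommGroup M] [Module Base M] (F : FreeTop G →ₗ[Base] M)
    (h : ∀ r ∈ closedIdeal (cancelHbar R), F r = 0) : Presented G R →ₗ[Base] M where
  toFun := QuotientAddGroup.lift (closedIdeal (cancelHbar R)).toAddSubgroup F.toAddMonoidHom h
  map_add' := map_add _
  map_smul' a y := by
    obtain ⟨f, rfl⟩ := Presented.mk_surjective R y
    rw [← map_smul]
    exact map_smul F a f

/-- A homomorphism to a separated algebra which kills relations kills the closed ideal they
generate. -/
theorem algHom_eq_zero_of_mem_closedIdeal {A : Type} [Ring A] [Algebra Base A]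
    (hA : IsHbarClosed ({0} : Set A)) (F : FreeTop G →ₐ[Base] A) (h : ∀ r ∈ cancelHbar R, F r = 0)
    {r : FreeTop G} (hr : r ∈ closedIdeal (cancelHbar R)) : F r = 0 :=
  closedIdeal_induction (S := LinearMap.ker F.toLinearMap) (hA.preimage F.toLinearMap) h
    (fun a r hr => by
      have : F r = 0 := hr
      change F (a * r) = 0
      rw [map_mul, this, mul_zero])
    (fun a r hr => by
      have : F r = 0 := hr
      change F (r * a) = 0
      rw [map_mul, this, zero_mul]) hr

/-- The homomorphism on a presented algebra induced by a homomorphism which kills the relations.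
-/
def Presented.lift {A : Type} [Ring A] [Algebra Base A] (hA : IsHbarClosed ({0} : Set A))
    (F : FreeTop G →ₐ[Base] A) (h : ∀ r ∈ cancelHbar R, F r = 0) : Presented G R →ₐ[Base] A :=
  Ideal.Quotient.liftₐ _ F fun _ hr => algHom_eq_zero_of_mem_closedIdeal hA F h hr

/-- The homomorphism `ℂ⟨G⟩⟦ħ⟧ → ℂ⟨G'⟩⟦ħ⟧` induced by a homomorphism `ℂ⟨G⟩ → ℂ⟨G'⟩`. -/
def FreeTop.map (g : FreeAlgebra ℂ G →ₐ[ℂ] FreeAlgebra ℂ G') : FreeTop G →ₐ[Base] FreeTop G' where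
  __ := PowerSeries.map (g : FreeAlgebra ℂ G →+* FreeAlgebra ℂ G')
  commutes' a := map_scalar g a

/-- The homomorphism of presented algebras induced by a homomorphism `ℂ⟨G⟩ → ℂ⟨G'⟩`. -/
def Presented.map (g : FreeAlgebra ℂ G →ₐ[ℂ] FreeAlgebra ℂ G')
    (h : ∀ r ∈ R, PowerSeries.map (g : FreeAlgebra ℂ G →+* FreeAlgebra ℂ G') r ∈ R') :
    Presented G R →ₐ[Base] Presented G' R' :=
  Presented.lift (Presented.isHbarClosed_zero R') ((Presented.mk R').comp (FreeTop.map g))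
    fun _ hr => (Presented.mk_eq_zero R').2 (subset_closedIdeal _ (map_mem_cancelHbar g h hr))

theorem Presented.map_mk (g : FreeAlgebra ℂ G →ₐ[ℂ] FreeAlgebra ℂ G')
    (h : ∀ r ∈ R, PowerSeries.map (g : FreeAlgebra ℂ G →+* FreeAlgebra ℂ G') r ∈ R')
    (f : FreeTop G) : Presented.map g h (Presented.mk R f) =
      Presented.mk R' (PowerSeries.map (g : FreeAlgebra ℂ G →+* FreeAlgebra ℂ G') f) := rfl

theorem Base.isHbarClosed_zero : IsHbarClosed ({0} : Set Base) := by
  intro y hy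
  ext1 n
  obtain ⟨s, rfl, t, rfl⟩ := hy (n + 1)
  rw [zero_add, smul_eq_mul, hbar, coeff_X_pow_mul', if_neg (by omega), map_zero]

/-- The augmentation `ℂ⟨G⟩⟦ħ⟧ → ℂ⟦ħ⟧`, which maps the generators to zero. -/
def FreeTop.augmentation : FreeTop G →ₐ[Base] Base where
  __ := PowerSeries.map (FreeAlgebra.lift ℂ (0 : G → ℂ) : FreeAlgebra ℂ G →+* ℂ)
  commutes' a := by
    refine (map_scalar (FreeAlgebra.lift ℂ (0 : G → ℂ)) a).trans ?_
    ext n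
    simp [scalar]

/-- The augmentation of an algebra whose relations have no constant terms. -/
def Presented.augmentation (h : ∀ r ∈ R,
      PowerSeries.map (FreeAlgebra.lift ℂ (0 : G → ℂ) : FreeAlgebra ℂ G →+* ℂ) r = 0) :
    Presented G R →ₐ[Base] Base :=
  Presented.lift Base.isHbarClosed_zero FreeTop.augmentation fun r ⟨k, hk⟩ => by
    have := h _ hk
    rw [map_mul, map_pow, PowerSeries.map_X, ← mul_zero (X ^ k), X_pow_mul_inj] at this
    exact this

end Maps

/-! ### The three factors -/

/-- The algebra of the `x^ε_{i,n}` subject to the relations (Q6)-(Q9). -/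
abbrev HalfAlg (ε : ℤˣ) : Type := Presented HalfGen (halfRelations ε)

/-- The algebra of the `h_{i,n}` and `c` subject to the relations (Q1) and (Q2). -/
abbrev CartanAlg : Type := Presented CartanGen cartanRelations

theorem halfIncl_relation (ε : ℤˣ) : ∀ r ∈ halfRelations ε, PowerSeries.map
    (halfIncl ε : FreeAlgebra ℂ HalfGen →+* FreeAlgebra ℂ Gen) r ∈ relations := by
  intro r hr
  have := map_mem_relHalf (halfIncl ε) hr
  simp only [halfIncl_ι] at this
  exact Or.inr (Set.mem_iUnion.2 ⟨ε, this⟩)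

/-- The homomorphism of the algebra of the `x^ε_{i,n}` to the quantum toroidal algebra. -/
def halfMap (ε : ℤˣ) : HalfAlg ε →ₐ[Base] U := Presented.map (halfIncl ε) (halfIncl_relation ε)

theorem cartanIncl_h (i : Fin 2) (n : ℤ) : cartanIncl (FreeAlgebra.ι ℂ (CartanGen.h i n)) =
    FreeAlgebra.ι ℂ (Gen.h i n) := by simp [cartanIncl]

theorem cartanIncl_c : cartanIncl (FreeAlgebra.ι ℂ CartanGen.c) = FreeAlgebra.ι ℂ Gen.c := by
  simp [cartanIncl]

section MapCartan
variable {B B' : Type} [Ring B] [Algebra ℂ B] [Ring B'] [Algebra ℂ B'] (f : B →ₐ[ℂ] B')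

/-- An algebra homomorphism, as a homomorphism to the formal series. -/
def constHom : B →ₐ[ℂ] B'⟦X⟧ where
  __ := (PowerSeries.C (R := B')).comp (f : B →+* B')
  commutes' a := by
    change PowerSeries.C (f (algebraMap ℂ B a)) = _
    rw [AlgHom.commutes]
    simp [PowerSeries.algebraMap_apply]

theorem constHom_apply (b : B) : constHom f b = PowerSeries.C (f b) := rfl

theorem map_eq_liftTopAlg (r : B⟦X⟧) :
    PowerSeries.map (f : B →+* B') r = liftTopAlg (constHom f) r := by
  ext n
  rw [coeff_liftTopAlg, coeff_map, Finset.sum_eq_single (n, 0)]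
  · simp [constHom_apply]
  · rintro ⟨i, j⟩ hp hne
    have hj : j ≠ 0 := by
      rintro rfl
      simp at hp
      simp [hp] at hne
    simp [constHom_apply, coeff_C, hj]
  · simp

theorem map_phi (h : Fin 2 → ℤ → B) (ε : ℤˣ) (i : Fin 2) (m : ℕ) :
    PowerSeries.map (f : B →+* B') (phi h ε i m) = phi (fun i n => f (h i n)) ε i m := by
  rw [map_eq_liftTopAlg]
  exact liftTopAlg_phi (b := fun i => f (h i 0)) (H := fun i n => PowerSeries.C (f (h i n)))
    (constHom f) (fun _ _ => rfl) (fun _ => rfl) ε i m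

theorem map_mem_relCartan {c : B} {h : Fin 2 → ℤ → B} {r : B⟦X⟧} (hr : r ∈ relCartan c h) :
    PowerSeries.map (f : B →+* B') r ∈ relCartan (f c) fun i n => f (h i n) := by
  have ht : ∀ i j k, PowerSeries.map (f : B →+* B') (twistPair c i j k) = twistPair (f c) i j k :=
    fun i j k => by
      rw [map_eq_liftTopAlg]
      exact liftTopAlg_twistPair (constHom f) rfl i j k
  rcases hr with (⟨i, m, rfl⟩ | ⟨ε, i, j, m, n, rfl⟩) | ⟨i, j, m, n, rfl⟩
  · exact Or.inl (Or.inl ⟨i, m, by simp⟩)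
  · exact Or.inl (Or.inr ⟨ε, i, j, m, n, by simp only [map_sub, map_mul, map_phi]⟩)
  · exact Or.inr ⟨i, j, m, n, by simp only [map_sub, map_mul, map_sum, map_phi, ht]⟩

end MapCartan

theorem cartanIncl_relation : ∀ r ∈ cartanRelations, PowerSeries.map
    (cartanIncl : FreeAlgebra ℂ CartanGen →+* FreeAlgebra ℂ Gen) r ∈ relations := by
  intro r hr
  have := map_mem_relCartan cartanIncl hr
  simp only [cartanIncl_h, cartanIncl_c] at this
  exact Or.inl (Or.inl (Or.inl this))

/-- The homomorphism of the algebra of the `h_{i,n}` and `c` to the quantum toroidal algebra. -/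
def cartanMap : CartanAlg →ₐ[Base] U := Presented.map cartanIncl cartanIncl_relation

/-- The relations (Q6)-(Q9) are homogeneous, hence they hold for zero. -/
theorem relHalf_zero {ε : ℤˣ} {r : ℂ⟦X⟧} (hr : r ∈ relHalf ε fun _ _ => (0 : ℂ)) : r = 0 := by
  have hq : ∀ i j m n, quad ε (fun _ _ => (0 : ℂ)) i j m n = 0 := fun i j m n => by simp [quad]
  rcases hr with ((⟨i, m, n, rfl⟩ | ⟨i, j, m, n, h, rfl⟩) | ⟨i, j, l, m, n, h, rfl⟩) |
    ⟨i, j, m, n, h, rfl⟩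
  · exact hq ..
  · rw [hq, hq, sub_zero]
  · rw [hq, mul_zero, zero_mul, sub_zero]
  · simp [serre]

/-- The augmentation of the algebra of the `x^ε_{i,n}`. -/
def halfAug (ε : ℤˣ) : HalfAlg ε →ₐ[Base] Base := Presented.augmentation fun r hr => by
  have := map_mem_relHalf (FreeAlgebra.lift ℂ (0 : HalfGen → ℂ)) hr
  simp only [FreeAlgebra.lift_ι_apply] at this
  exact relHalf_zero this

theorem isCartanAction_zero : IsCartanAction (0 : ℂ) (fun _ => 0) (fun _ _ => 0) where
  commute_c _ _ := Commute.zero_right _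
  zero _ := (map_zero _).symm
  comm i j m n := by
    have : mu (0 : ℂ) (cartan i j) m = 0 := by
      have h : ∀ s : ℂ, qExp s (0 : ℂ) = 1 := fun s => by
        rw [qExp_eq, smul_zero, ← smul_zero (0 : ℂ), ← qExp_eq, qExp_zero]
      have h0 : (PowerSeries.mk fun _ => 0 : ℂ⟦X⟧) = 0 := by ext; simp
      rw [mu, h, h, sub_self, qdDiv]
      simp [h0]
    simp [this]

/-- The augmentation of the algebra of the `h_{i,n}` and `c`. -/
def cartanAug : CartanAlg →ₐ[Base] Base := Presented.augmentation fun r hr => by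
  rw [map_eq_liftTopAlg]
  exact liftTopAlg_relCartan (constHom _) isCartanAction_zero (by simp [constHom_apply])
    (by simp [constHom_apply]) hr

/-! ### Density modulo `ħ` -/

/-- The normally ordered monomials in the `h_{i,n}` and `c`. -/
def cartanMonomial (s : CartanGen →₀ ℕ) : CartanAlg :=
  normalProd (Presented.gen cartanRelations) s.toMultiset.toList

theorem cartanMonomial_eq (s : CartanGen →₀ ℕ) : cartanMonomial s = Presented.mk cartanRelations
    (PowerSeries.C (normalProd (FreeAlgebra.ι ℂ) s.toMultiset.toList)) := by
  rw [map_normalProd (PowerSeries.C (R := FreeAlgebra ℂ CartanGen)),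
    map_normalProd (Presented.mk cartanRelations)]
  rfl

/-- The normally ordered monomials span a dense submodule of the algebra of the `h_{i,n}` and `c`.
-/
theorem cartanAlg_mem_of_closed {S : Submodule Base CartanAlg} (hS : IsHbarClosed (S : Set CartanAlg))
    (h : ∀ s, cartanMonomial s ∈ S) (n : CartanAlg) : n ∈ S := by
  refine Submodule.eq_top_of_closed hS (exists_add_hbar_smul fun q => ?_) n
  let γ : CartanGen → Residue cartanRelations := fun g => residue cartanRelations (FreeAlgebra.ι ℂ g)
  have hk : KillsLeading (residue cartanRelations) (relCartan (FreeAlgebra.ι ℂ CartanGen.c)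
    fun i n => FreeAlgebra.ι ℂ (CartanGen.h i n)) := killsLeading_residue
  have hc : ∀ g, Commute (γ CartanGen.c) (γ g) := fun g => by
    cases g with
    | h i n => exact hk.commute_c_h i n
    | c => exact Commute.refl _
  have hh : ∀ g g', γ g * γ g' - γ g' * γ g ∈ Algebra.adjoin ℂ {γ CartanGen.c} := fun g g' => by
    cases g with
    | c => rw [(hc g').eq, sub_self]; exact zero_mem _
    | h i n =>
      cases g' with
      | c => rw [(hc _).eq, sub_self]; exact zero_mem _
      | h j m => exact hk.commutator_h_mem i j n m
  let N : Submodule ℂ (Residue cartanRelations) :=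
    Submodule.span ℂ (Set.range fun L : List CartanGen => (L.map γ).prod)
  have hN : N ≤ residueImage S := by
    refine Submodule.span_le.2 ?_
    rintro _ ⟨L, rfl⟩
    refine (Submodule.span_le.2 ?_) (prod_mem_span_normalProd hc hh L)
    rintro _ ⟨s, rfl⟩
    have := residue_mem_residueImage (S := S) (by rw [← cartanMonomial_eq]; exact h s)
    rwa [map_normalProd] at this
  have h1 : (1 : Residue cartanRelations) ∈ N := Submodule.subset_span ⟨[], rfl⟩
  have hg : ∀ g, ∀ n ∈ N, γ g * n ∈ N := fun g n hn => by
    have : N ≤ N.comap (LinearMap.mulLeft ℂ (γ g)) := by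
      refine Submodule.span_le.2 ?_
      rintro _ ⟨L, rfl⟩
      exact Submodule.subset_span ⟨g :: L, by simp⟩
    exact this hn
  obtain ⟨a, rfl⟩ := residue_surjective q
  have := mul_le_of_gen_left (le_refl N) hg (Submodule.mul_mem_mul
    (show residue cartanRelations a ∈ rangeSpace _ from ⟨a, rfl⟩) h1)
  rw [mul_one] at this
  exact hN this

theorem relMixed_subset_relations : relMixed (FreeAlgebra.ι ℂ Gen.c)
    (fun i n => FreeAlgebra.ι ℂ (Gen.h i n)) (fun ε i n => FreeAlgebra.ι ℂ (Gen.x ε i n)) ⊆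
      relations := fun _ h => Or.inl (Or.inl (Or.inr h))

theorem relQ5_subset_relations : relQ5 (FreeAlgebra.ι ℂ Gen.c)
    (fun i n => FreeAlgebra.ι ℂ (Gen.h i n)) (fun ε i n => FreeAlgebra.ι ℂ (Gen.x ε i n)) ⊆
      relations := fun _ h => Or.inl (Or.inr h)

/-- The products of elements of the three subalgebras span the quantum toroidal algebra
modulo `ħ`. -/
theorem exists_triangular_add_hbar_smul {S : Submodule Base U}
    (hS : ∀ a n b, halfMap (-1) a * cartanMap n * halfMap 1 b ∈ S) (y : U) :
    ∃ s ∈ S, ∃ t, y = s + hbar • t := by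
  refine exists_add_hbar_smul (fun q => ?_) y
  let π := residue relations
  let fm := π.comp (halfIncl (-1))
  let f0 := π.comp cartanIncl
  let fp := π.comp (halfIncl 1)
  have hfm : ∀ i n, fm (FreeAlgebra.ι ℂ (HalfGen.x i n)) = π (FreeAlgebra.ι ℂ (Gen.x (-1) i n)) :=
    fun i n => congrArg π (halfIncl_ι _ _ _)
  have hfp : ∀ i n, fp (FreeAlgebra.ι ℂ (HalfGen.x i n)) = π (FreeAlgebra.ι ℂ (Gen.x 1 i n)) :=
    fun i n => congrArg π (halfIncl_ι _ _ _)
  have hf0 : ∀ i n, f0 (FreeAlgebra.ι ℂ (CartanGen.h i n)) = π (FreeAlgebra.ι ℂ (Gen.h i n)) :=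
    fun i n => congrArg π (cartanIncl_h _ _)
  have hfc : f0 (FreeAlgebra.ι ℂ CartanGen.c) = π (FreeAlgebra.ι ℂ Gen.c) := congrArg π cartanIncl_c
  have kM := (killsLeading_residue (R := relations)).mono relMixed_subset_relations
  have kQ := (killsLeading_residue (R := relations)).mono relQ5_subset_relations
  have r1 : ∀ g g', f0 (FreeAlgebra.ι ℂ g) * fm (FreeAlgebra.ι ℂ g') -
      fm (FreeAlgebra.ι ℂ g') * f0 (FreeAlgebra.ι ℂ g) ∈ rangeSpace fm := by
    rintro g ⟨j, n⟩
    cases g with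
    | h i l =>
      obtain ⟨z, hz⟩ := kM.commutator_h_x (-1) i j l n
      rw [hfm, hf0, hz, ← hfm]
      exact Submodule.smul_mem _ _ (ι_mem_rangeSpace _ _)
    | c =>
      rw [hfm, hfc, (kM.commute_c_x (-1) j n).eq, sub_self]
      exact Submodule.zero_mem _
  have r2 : ∀ g g', f0 (FreeAlgebra.ι ℂ g) * fp (FreeAlgebra.ι ℂ g') -
      fp (FreeAlgebra.ι ℂ g') * f0 (FreeAlgebra.ι ℂ g) ∈ rangeSpace fp := by
    rintro g ⟨j, n⟩
    cases g with
    | h i l =>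
      obtain ⟨z, hz⟩ := kM.commutator_h_x 1 i j l n
      rw [hfp, hf0, hz, ← hfp]
      exact Submodule.smul_mem _ _ (ι_mem_rangeSpace _ _)
    | c =>
      rw [hfp, hfc, (kM.commute_c_x 1 j n).eq, sub_self]
      exact Submodule.zero_mem _
  have r3 : ∀ g g', fp (FreeAlgebra.ι ℂ g) * fm (FreeAlgebra.ι ℂ g') -
      fm (FreeAlgebra.ι ℂ g') * fp (FreeAlgebra.ι ℂ g) ∈ rangeSpace f0 := by
    rintro ⟨i, m⟩ ⟨j, n⟩
    rw [hfp, hfm]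
    have := kQ.commutator_x_mem i j m n
    rw [← Algebra.adjoin_image] at this
    refine (Algebra.adjoin_le ?_ : _ ≤ f0.range) this
    rintro _ ⟨b, ⟨i, l, rfl⟩ | rfl, rfl⟩
    · exact ⟨_, hf0 i l⟩
    · exact ⟨_, hfc⟩
  obtain ⟨s1, s2, s3⟩ := mul_rangeSpace_stable r1 r2 r3
  let N := rangeSpace fm * rangeSpace f0 * rangeSpace fp
  have hN : N ≤ residueImage S := by
    have : ∀ a b d, fm a * f0 b * fp d ∈ residueImage S := fun a b d => by
      have e : fm a * f0 b * fp d = π (halfIncl (-1) a * cartanIncl b * halfIncl 1 d) := by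
        rw [map_mul π, map_mul π]; rfl
      rw [e]
      refine residue_mem_residueImage ?_
      have := hS (Presented.mk _ (PowerSeries.C a)) (Presented.mk _ (PowerSeries.C b))
        (Presented.mk _ (PowerSeries.C d))
      rw [halfMap, halfMap, cartanMap, Presented.map_mk, Presented.map_mk, Presented.map_mk,
        PowerSeries.map_C, PowerSeries.map_C, PowerSeries.map_C, ← map_mul, ← map_mul, ← map_mul,
        ← map_mul] at this
      exact this
    refine Submodule.mul_le.2 fun m hm p hp => ?_
    obtain ⟨d, rfl⟩ := hp
    induction hm using Submodule.mul_induction_on' with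
    | mem_mul_mem a ha b hb =>
      obtain ⟨a, rfl⟩ := ha
      obtain ⟨b, rfl⟩ := hb
      exact this a b d
    | add a _ b _ ha hb => rw [add_mul]; exact Submodule.add_mem _ ha hb
  have h1 : (1 : Residue relations) ∈ N := by
    have := Submodule.mul_mem_mul (Submodule.mul_mem_mul (one_mem_rangeSpace fm)
      (one_mem_rangeSpace f0)) (one_mem_rangeSpace fp)
    rwa [mul_one, mul_one] at this
  obtain ⟨a, rfl⟩ := residue_surjective q
  have := mul_le_of_gen_left (f := π) (le_refl N) (fun g n hn => ?_) (Submodule.mul_mem_mul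
    (show π a ∈ rangeSpace _ from ⟨a, rfl⟩) h1)
  · rw [mul_one] at this
    exact hN this
  · cases g with
    | x ε i m =>
      rcases Int.units_eq_one_or ε with rfl | rfl
      · rw [← hfp]; exact s3 _ n hn
      · rw [← hfm]; exact s1 _ n hn
    | h i m => rw [← hf0]; exact s2 _ n hn
    | c => rw [← hfc]; exact s2 _ n hn

/-! ### Coordinates on the quantum toroidal algebra -/

theorem CartanPoly.mem_of_monomial {N : Submodule ℂ CartanPoly}
    (h : ∀ s, MvPolynomial.monomial s 1 ∈ N) (p : CartanPoly) : p ∈ N := by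
  have := (MvPolynomial.basisMonomials CartanGen ℂ).span_eq
  rw [MvPolynomial.coe_basisMonomials] at this
  exact Submodule.span_le.2 (by rintro _ ⟨s, rfl⟩; exact h s) (this ▸ Submodule.mem_top (x := p))

/-- Monomials as products of lists, which are the form in which noncommutative monomials are
written. -/
theorem prod_X_toMultiset (s : CartanGen →₀ ℕ) :
    (s.toMultiset.toList.map (MvPolynomial.X (R := ℂ))).prod = MvPolynomial.monomial s 1 := by
  rw [← Multiset.prod_coe, ← Multiset.map_coe, Multiset.coe_toList, Finsupp.toMultiset_map,
    Finsupp.prod_toMultiset, MvPolynomial.monomial_eq, map_one, one_mul]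
  exact Finsupp.prod_mapDomain_index (fun _ => pow_zero _) fun _ _ _ => pow_add _ _ _

theorem liftTopAlg_cartanHom_relation {r : FreeTop CartanGen} (hr : r ∈ cancelHbar cartanRelations) :
    liftTopAlg Verma.cartanHom r = 0 := by
  obtain ⟨k, hk⟩ := hr
  have := liftTopAlg_relCartan Verma.cartanHom Verma.isCartanAction Verma.cartanHom_c
    Verma.cartanHom_h hk
  rwa [map_mul, map_pow, liftTopAlg_X, ← mul_zero (X ^ k), X_pow_mul_inj] at this

namespace Verma

/-- The action of the algebra of the `h_{i,n}` and `c`. -/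
def cartanRep : CartanAlg →ₐ[Base] (Module.End ℂ VermaSpace)⟦X⟧ :=
  Presented.lift endSeries_isHbarClosed_zero
    { __ := liftTopAlg cartanHom
      commutes' := liftTopAlg_scalar cartanHom } fun _ hr => liftTopAlg_cartanHom_relation hr

theorem cartanRep_mk (f : FreeTop CartanGen) :
    cartanRep (Presented.mk _ f) = liftTopAlg cartanHom f := rfl

theorem cartanRep_cartanMonomial (s : CartanGen →₀ ℕ) (w : List HalfGen) :
    cartanRep (cartanMonomial s) • Ser.const (vac w) =
      Ser.const (emb (Words.single w (MvPolynomial.monomial s 1)) : VermaSpace) := by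
  rw [cartanMonomial_eq, cartanRep_mk, liftTopAlg_C, map_normalProd, normalProd_smul_vac,
    prod_X_toMultiset]

/-- The basis vectors of the representation space. -/
def basisVec (w : List HalfGen) (s : CartanGen →₀ ℕ) (w' : List HalfGen) : VermaSpace :=
  Words.single w (Words.single w' (MvPolynomial.monomial s 1))

theorem mem_of_basisVec {Q : Submodule Base (Ser VermaSpace)}
    (hQ : IsHbarClosed (Q : Set (Ser VermaSpace))) (h : ∀ w s w', Ser.const (basisVec w s w') ∈ Q)
    (v : Ser VermaSpace) : v ∈ Q :=
  Ser.mem_of_const hQ (Words.mem_of_single (N := Ser.constPart Q) fun w =>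
    Words.mem_of_single (N := (Ser.constPart Q).comap (Words.single w)) fun w' =>
      CartanPoly.mem_of_monomial (N := (Ser.constPart Q).comap (Words.single w ∘ₗ Words.single w'))
        fun s => h w s w') v

theorem y_single (g : HalfGen) (w : List HalfGen) (u : HighestSpace) :
    y g (Words.single w u) = Words.single w (prepend g u) := by
  induction w with
  | nil => exact extOp_emb _ _
  | cons x w ih =>
    obtain ⟨j, n⟩ := x
    have h1 := commute_y_xm g j n
    rw [xm, commute_iff_eq, ← map_mul, ← map_mul] at h1
    have h2 := congrArg (fun D : (Module.End ℂ VermaSpace)⟦X⟧ => coeff 0 D (Words.single w u)) h1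
    simp only [coeff_zero_C, Module.End.mul_apply, prepend_single] at h2
    rw [h2, ih, prepend_single]

theorem y_basisVec (g : HalfGen) (w : List HalfGen) (s : CartanGen →₀ ℕ) (w' : List HalfGen) :
    y g (basisVec w s w') = basisVec w s (g :: w') := by
  rw [basisVec, y_single, prepend_single, basisVec]

end Verma

/-- The projection to the algebra of the `x^ε_{i,n}`. -/
abbrev halfMk (ε : ℤˣ) : FreeTop HalfGen →ₐ[Base] HalfAlg ε := Presented.mk (halfRelations ε)

/-- The product of the generators in a word. -/
def wordProd (ε : ℤˣ) (w : List HalfGen) : HalfAlg ε := (w.map (Presented.gen (halfRelations ε))).prod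

theorem wordProd_cons (ε : ℤˣ) (g : HalfGen) (w : List HalfGen) : wordProd ε (g :: w) =
    halfMk ε (PowerSeries.C (FreeAlgebra.ι ℂ g)) * wordProd ε w := by
  rw [wordProd, List.map_cons, List.prod_cons]
  rfl

section Coordinates
variable {M : Type} [AddCommGroup M] [Module Base M] [Module ℂ M] [IsScalarTower ℂ Base M]
  (T : HalfAlg (-1) →ₗ[Base] CartanAlg →ₗ[Base] HalfAlg 1 →ₗ[Base] M)

/-- The linear map on the representation space which corresponds to a trilinear map on the
factors. -/
def coordLin : VermaSpace →ₗ[ℂ] M := Words.lift fun w => Words.lift fun w' =>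
  (MvPolynomial.basisMonomials CartanGen ℂ).constr ℂ fun s =>
    T (wordProd (-1) w) (cartanMonomial s) (wordProd 1 w')

theorem coordLin_basisVec (w : List HalfGen) (s : CartanGen →₀ ℕ) (w' : List HalfGen) :
    coordLin T (Verma.basisVec w s w') =
      T (wordProd (-1) w) (cartanMonomial s) (wordProd 1 w') := by
  rw [coordLin, Verma.basisVec, Words.lift_single, Words.lift_single]
  have := (MvPolynomial.basisMonomials CartanGen ℂ).constr_basis ℂ (fun s =>
    T (wordProd (-1) w) (cartanMonomial s) (wordProd 1 w')) s
  rwa [MvPolynomial.coe_basisMonomials] at this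

/-- The extension of `coordLin` to formal series. -/
abbrev coordSer : Ser VermaSpace →ₗ[Base] AdicCompletion hbarIdeal M := serLift (coordLin T)

/-- The coordinates of `x_w ⊗ h^s ⊗ g y_{w'}`, for an arbitrary `g` in the free algebra of the
`y`. -/
theorem coordSer_yHom (w : List HalfGen) (s : CartanGen →₀ ℕ) (g : FreeTop HalfGen)
    (w' : List HalfGen) :
    coordSer T (liftTopAlg Verma.yHom g • Ser.const (Verma.basisVec w s w')) =
      AdicCompletion.of hbarIdeal M
        (T (wordProd (-1) w) (cartanMonomial s) (halfMk 1 g * wordProd 1 w')) := by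
  let F : List HalfGen → FreeTop HalfGen →ₗ[Base] AdicCompletion hbarIdeal M := fun w' =>
    coordSer T ∘ₗ orbit Verma.yHom (Ser.const (Verma.basisVec w s w')) -
    AdicCompletion.of hbarIdeal M ∘ₗ T (wordProd (-1) w) (cartanMonomial s) ∘ₗ
      LinearMap.mulRight Base (wordProd 1 w') ∘ₗ (halfMk 1).toLinearMap
  have := FreeTop.mem_of_mul_gen (S := ⨅ w', LinearMap.ker (F w')) ?_ ?_ (fun x f hf => ?_) g
  · rw [Submodule.mem_iInf] at this
    exact sub_eq_zero.1 (this w')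
  · rw [Submodule.coe_iInf]
    exact IsHbarClosed.iInter fun w' => AdicCompletion.isHbarClosed_zero.preimage _
  · rw [Submodule.mem_iInf]
    intro w'
    refine sub_eq_zero.2 ?_
    change coordSer T (liftTopAlg Verma.yHom 1 • Ser.const (Verma.basisVec w s w')) = AdicCompletion.of hbarIdeal M
      (T (wordProd (-1) w) (cartanMonomial s) (halfMk 1 1 * wordProd 1 w'))
    rw [map_one, map_one (halfMk 1), one_smul, one_mul, coordSer, serLift_const, coordLin_basisVec]
  · rw [Submodule.mem_iInf] at hf ⊢
    intro w'
    have h1 : coordSer T (liftTopAlg Verma.yHom f • Ser.const (Verma.basisVec w s (x :: w'))) =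
      AdicCompletion.of hbarIdeal M
        (T (wordProd (-1) w) (cartanMonomial s) (halfMk 1 f * wordProd 1 (x :: w'))) :=
      sub_eq_zero.1 (hf (x :: w'))
    refine sub_eq_zero.2 ?_
    change coordSer T (liftTopAlg Verma.yHom (f * PowerSeries.C (FreeAlgebra.ι ℂ x)) •
      Ser.const (Verma.basisVec w s w')) =
      AdicCompletion.of hbarIdeal M
        (T (wordProd (-1) w) (cartanMonomial s)
          (halfMk 1 (f * PowerSeries.C (FreeAlgebra.ι ℂ x)) * wordProd 1 w'))
    rw [map_mul, map_mul (halfMk 1), liftTopAlg_C, Verma.yHom_ι, mul_smul, Ser.C_smul_const, Verma.y_basisVec,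
      h1, wordProd_cons, mul_assoc]

/-- The coordinates of `f x_w ⊗ h^s ⊗ g y_{w'}`, for arbitrary `f` and `g` in the two free
algebras. -/
theorem coordSer_xmHom (f : FreeTop HalfGen) (w : List HalfGen) (s : CartanGen →₀ ℕ)
    (g : FreeTop HalfGen) (w' : List HalfGen) :
    coordSer T (liftTopAlg Verma.yHom g • liftTopAlg Verma.xmHom f •
      Ser.const (Verma.basisVec w s w')) =
      AdicCompletion.of hbarIdeal M
        (T (halfMk (-1) f * wordProd (-1) w) (cartanMonomial s)
          (halfMk 1 g * wordProd 1 w')) := by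
  let F : List HalfGen → FreeTop HalfGen →ₗ[Base] AdicCompletion hbarIdeal M := fun w =>
    coordSer T ∘ₗ Ser.act (liftTopAlg Verma.yHom g) ∘ₗ
      orbit Verma.xmHom (Ser.const (Verma.basisVec w s w')) -
    AdicCompletion.of hbarIdeal M ∘ₗ LinearMap.applyₗ (halfMk 1 g * wordProd 1 w') ∘ₗ
      LinearMap.applyₗ (cartanMonomial s) ∘ₗ T ∘ₗ
      LinearMap.mulRight Base (wordProd (-1) w) ∘ₗ (halfMk (-1)).toLinearMap
  have := FreeTop.mem_of_mul_gen (S := ⨅ w, LinearMap.ker (F w)) ?_ ?_ (fun x f hf => ?_) f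
  · rw [Submodule.mem_iInf] at this
    exact sub_eq_zero.1 (this w)
  · rw [Submodule.coe_iInf]
    exact IsHbarClosed.iInter fun w' => AdicCompletion.isHbarClosed_zero.preimage _
  · rw [Submodule.mem_iInf]
    intro w
    refine sub_eq_zero.2 ?_
    change coordSer T (liftTopAlg Verma.yHom g • liftTopAlg Verma.xmHom 1 •
      Ser.const (Verma.basisVec w s w')) = AdicCompletion.of hbarIdeal M
      (T (halfMk (-1) 1 * wordProd (-1) w) (cartanMonomial s) (halfMk 1 g * wordProd 1 w'))
    rw [map_one, map_one (halfMk (-1)), one_smul, one_mul, coordSer_yHom]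
  · rw [Submodule.mem_iInf] at hf ⊢
    intro w
    have h1 : coordSer T (liftTopAlg Verma.yHom g • liftTopAlg Verma.xmHom f •
        Ser.const (Verma.basisVec (x :: w) s w')) = AdicCompletion.of hbarIdeal M
        (T (halfMk (-1) f * wordProd (-1) (x :: w)) (cartanMonomial s)
          (halfMk 1 g * wordProd 1 w')) :=
      sub_eq_zero.1 (hf (x :: w))
    refine sub_eq_zero.2 ?_
    change coordSer T (liftTopAlg Verma.yHom g • liftTopAlg Verma.xmHom
      (f * PowerSeries.C (FreeAlgebra.ι ℂ x)) • Ser.const (Verma.basisVec w s w')) =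
      AdicCompletion.of hbarIdeal M
        (T (halfMk (-1) (f * PowerSeries.C (FreeAlgebra.ι ℂ x)) * wordProd (-1) w) (cartanMonomial s)
          (halfMk 1 g * wordProd 1 w'))
    rw [map_mul, map_mul (halfMk (-1)), liftTopAlg_C, Verma.xmHom_ι, mul_smul, Ser.C_smul_const, Verma.basisVec,
      prepend_single]
    rw [Verma.basisVec] at h1
    rw [h1, wordProd_cons, mul_assoc]

theorem coordSer_eq_zero {f g : FreeTop HalfGen} (h : ∀ w s w', coordSer T (liftTopAlg Verma.yHom g •
    liftTopAlg Verma.xmHom f • Ser.const (Verma.basisVec w s w')) = 0) (v : Ser VermaSpace) :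
    coordSer T (liftTopAlg Verma.yHom g • liftTopAlg Verma.xmHom f • v) = 0 := by
  let F : Ser VermaSpace →ₗ[Base] AdicCompletion hbarIdeal M :=
    coordSer T ∘ₗ Ser.act (liftTopAlg Verma.yHom g) ∘ₗ Ser.act (liftTopAlg Verma.xmHom f)
  exact Verma.mem_of_basisVec (Q := LinearMap.ker F)
    (AdicCompletion.isHbarClosed_zero.preimage F) h v

/-- The coordinates vanish on `relSpace`, since `T` is defined on the quotients by the relations.
-/
theorem relSpace_le_ker : Verma.relSpace ≤ LinearMap.ker (coordSer T) := by
  refine Verma.relSpace_le (AdicCompletion.isHbarClosed_zero.preimage (coordSer T)) ?_ ?_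
  · intro r hr v
    have := coordSer_eq_zero T (f := r) (g := 1) (fun w s w' => ?_) v
    · rwa [map_one, one_smul] at this
    · rw [coordSer_xmHom, (Presented.mk_eq_zero (halfRelations (-1))).2 hr, zero_mul, map_zero,
        LinearMap.zero_apply, LinearMap.zero_apply, map_zero]
  · intro r hr v
    have := coordSer_eq_zero T (f := 1) (g := r) (fun w s w' => ?_) v
    · rwa [map_one, one_smul] at this
    · rw [coordSer_xmHom, (Presented.mk_eq_zero (halfRelations 1)).2 hr, zero_mul, map_zero, map_zero]

/-- The linear map on the quantum toroidal algebra which corresponds to a trilinear map on the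
factors: the action on the vacuum vector, followed by `coordSer`. -/
def coord : U →ₗ[Base] AdicCompletion hbarIdeal M :=
  Presented.liftLin (coordSer T ∘ₗ orbit Verma.rep (Ser.const (Verma.vac []))) fun _ hr =>
    relSpace_le_ker T (Verma.rep_smul_mem hr _)

/-- Acting on the vacuum vector, `x⁻ h x⁺` gives `x⁻ ⊗ h ⊗ x⁺`. By density it suffices to
consider normally ordered monomials `h`, which act by creation operators. -/
theorem coord_mul (a : HalfAlg (-1)) (n : CartanAlg) (b : HalfAlg 1) :
    coord T (halfMap (-1) a * cartanMap n * halfMap 1 b) = AdicCompletion.of hbarIdeal M (T a n b) := by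
  obtain ⟨f, rfl⟩ := Presented.mk_surjective _ a
  obtain ⟨g, rfl⟩ := Presented.mk_surjective _ b
  have h0 : ∀ n : CartanAlg, coord T (halfMap (-1) (halfMk (-1) f) * cartanMap n *
      halfMap 1 (halfMk 1 g)) = coordSer T (liftTopAlg Verma.xmHom f • Verma.cartanRep n •
        liftTopAlg Verma.yHom g • Ser.const (Verma.vac [])) := by
    intro n
    obtain ⟨k, rfl⟩ := Presented.mk_surjective _ n
    rw [halfMap, halfMap, cartanMap, Presented.map_mk, Presented.map_mk, Presented.map_mk, ← map_mul,
      ← map_mul]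
    change coordSer T (liftTopAlg Verma.rep _ • _) = _
    rw [map_mul, map_mul, liftTopAlg_map, liftTopAlg_map, liftTopAlg_map,
      Verma.rep_comp_halfIncl_one, Verma.rep_comp_halfIncl_neg_one, Verma.rep_comp_cartanIncl,
      mul_smul, mul_smul, Verma.xpHom_smul_vac, Verma.cartanRep_mk]
  let F : CartanAlg →ₗ[Base] AdicCompletion hbarIdeal M :=
    coord T ∘ₗ LinearMap.mulRight Base (halfMap 1 (halfMk 1 g)) ∘ₗ
      LinearMap.mulLeft Base (halfMap (-1) (halfMk (-1) f)) ∘ₗ cartanMap.toLinearMap -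
    AdicCompletion.of hbarIdeal M ∘ₗ LinearMap.applyₗ (halfMk 1 g) ∘ₗ T (halfMk (-1) f)
  refine sub_eq_zero.1 (cartanAlg_mem_of_closed (S := LinearMap.ker F)
    (AdicCompletion.isHbarClosed_zero.preimage _) (fun s => sub_eq_zero.2 ?_) n)
  change coord T (halfMap (-1) (halfMk (-1) f) * cartanMap (cartanMonomial s) *
    halfMap 1 (halfMk 1 g)) = AdicCompletion.of hbarIdeal M (T _ _ _)
  have hy : ∀ (r : FreeTop CartanGen) (v : Ser VermaSpace), liftTopAlg Verma.cartanHom r •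
      liftTopAlg Verma.yHom g • v = liftTopAlg Verma.yHom g • liftTopAlg Verma.cartanHom r • v := by
    intro r v
    rw [← mul_smul, ← mul_smul]
    congr 1
    refine (commute_liftTopAlg (fun x => ?_) g).eq
    rw [Verma.yHom_ι]
    refine (commute_liftTopAlg (fun x' => ?_) r).symm
    cases x' with
    | h i l => rw [Verma.cartanHom_h]; exact Verma.commute_y_h _ _ _
    | c => rw [Verma.cartanHom_c]; exact Verma.commute_y_c _
  have hx : ∀ v : Ser VermaSpace, liftTopAlg Verma.xmHom f • liftTopAlg Verma.yHom g • v =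
      liftTopAlg Verma.yHom g • liftTopAlg Verma.xmHom f • v := by
    intro v
    rw [← mul_smul, ← mul_smul]
    congr 1
    refine (commute_liftTopAlg (fun x => ?_) g).eq
    rw [Verma.yHom_ι]
    refine (commute_liftTopAlg (fun ⟨j, n⟩ => ?_) f).symm
    rw [Verma.xmHom_ι]
    exact Verma.commute_y_xm _ _ _
  have hs := Verma.cartanRep_cartanMonomial s []
  rw [h0]
  rw [cartanMonomial_eq, Verma.cartanRep_mk] at hs ⊢
  rw [hy, hx, hs]
  have := coordSer_xmHom T f [] s g []
  rw [show ∀ ε, wordProd ε [] = 1 from fun _ => rfl, show ∀ ε, wordProd ε [] = 1 from fun _ => rfl,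
    mul_one, mul_one, cartanMonomial_eq] at this
  exact this

end Coordinates

/-- Trilinear maps on the three presented algebras factor through the multiplication in the
quantum toroidal algebra, up to completion. -/
theorem exists_coord {M : Type} [AddCommGroup M] [Module Base M]
    (T : HalfAlg (-1) →ₗ[Base] CartanAlg →ₗ[Base] HalfAlg 1 →ₗ[Base] M) :
    ∃ F : U →ₗ[Base] AdicCompletion hbarIdeal M, ∀ a n b,
      F (halfMap (-1) a * cartanMap n * halfMap 1 b) = AdicCompletion.of hbarIdeal M (T a n b) := by
  let _ : Module ℂ M := Module.compHom M (algebraMap ℂ Base)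
  have : IsScalarTower ℂ Base M := ⟨fun z a m => by
    rw [Algebra.smul_def, mul_smul]
    rfl⟩
  exact ⟨coord T, coord_mul T⟩

/-! ### The triangular decomposition -/

/-- The trilinear map with given values, from its additivity and homogeneity in each argument. -/
def trilinear {A B C M : Type} [AddCommGroup A] [Module Base A] [AddCommGroup B] [Module Base B]
    [AddCommGroup C] [Module Base C] [AddCommGroup M] [Module Base M] (f : A → B → C → M)
    (h1 : ∀ a a' b c, f (a + a') b c = f a b c + f a' b c)
    (h2 : ∀ (r : Base) a b c, f (r • a) b c = r • f a b c)
    (h3 : ∀ a b b' c, f a (b + b') c = f a b c + f a b' c)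
    (h4 : ∀ (r : Base) a b c, f a (r • b) c = r • f a b c)
    (h5 : ∀ a b c c', f a b (c + c') = f a b c + f a b c')
    (h6 : ∀ (r : Base) a b c, f a b (r • c) = r • f a b c) : A →ₗ[Base] B →ₗ[Base] C →ₗ[Base] M :=
  LinearMap.mk₂ Base (fun a b => { toFun := f a b, map_add' := h5 a b, map_smul' := fun r => h6 r a b })
    (fun a a' b => LinearMap.ext (h1 a a' b)) (fun r a b => LinearMap.ext (h2 r a b))
    (fun a b b' => LinearMap.ext (h3 a b b')) (fun r a b => LinearMap.ext (h4 r a b))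

/-- The identity of the algebra of the `x^ε_{i,n}` extends to the quantum toroidal algebra. -/
theorem exists_halfMap_extension (ε : ℤˣ) : ∃ p : U →ₗ[Base] AdicCompletion hbarIdeal (HalfAlg ε),
    ∀ a, p (halfMap ε a) = AdicCompletion.of hbarIdeal _ a := by
  rcases Int.units_eq_one_or ε with rfl | rfl
  · obtain ⟨p, hp⟩ := exists_coord (trilinear (fun a n b => (halfAug (-1) a * cartanAug n) • b)
      (fun a a' b c => by rw [map_add, add_mul, add_smul])
      (fun r a b c => by rw [map_smul, smul_mul_assoc, smul_assoc])
      (fun a b b' c => by rw [map_add, mul_add, add_smul])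
      (fun r a b c => by rw [map_smul, mul_smul_comm, smul_assoc])
      (fun a b c c' => by rw [smul_add]) (fun r a b c => by rw [smul_comm]))
    refine ⟨p, fun a => ?_⟩
    have := hp 1 1 a
    rw [map_one, map_one, one_mul, one_mul] at this
    rw [this]
    change AdicCompletion.of hbarIdeal _ ((halfAug (-1) 1 * cartanAug 1) • a) = _
    rw [map_one, map_one, one_mul, one_smul]
  · obtain ⟨p, hp⟩ := exists_coord (trilinear (fun a n b => (cartanAug n * halfAug 1 b) • a)
      (fun a a' b c => by rw [smul_add]) (fun r a b c => by rw [smul_comm])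
      (fun a b b' c => by rw [map_add, add_mul, add_smul])
      (fun r a b c => by rw [map_smul, smul_mul_assoc, smul_assoc])
      (fun a b c c' => by rw [map_add, mul_add, add_smul])
      (fun r a b c => by rw [map_smul, mul_smul_comm, smul_assoc]))
    refine ⟨p, fun a => ?_⟩
    have := hp a 1 1
    rw [map_one, map_one, mul_one, mul_one] at this
    rw [this]
    change AdicCompletion.of hbarIdeal _ ((cartanAug 1 * halfAug 1 1) • a) = _
    rw [map_one, map_one, one_mul, one_smul]

/-- The identity of the algebra of the `h_{i,n}` and `c` extends to the quantum toroidal algebra.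
-/
theorem exists_cartanMap_extension : ∃ p : U →ₗ[Base] AdicCompletion hbarIdeal CartanAlg,
    ∀ n, p (cartanMap n) = AdicCompletion.of hbarIdeal _ n := by
  obtain ⟨p, hp⟩ := exists_coord (trilinear (fun a n b => (halfAug (-1) a * halfAug 1 b) • n)
    (fun a a' b c => by rw [map_add, add_mul, add_smul])
    (fun r a b c => by rw [map_smul, smul_mul_assoc, smul_assoc])
    (fun a b b' c => by rw [smul_add]) (fun r a b c => by rw [smul_comm])
    (fun a b c c' => by rw [map_add, mul_add, add_smul])
    (fun r a b c => by rw [map_smul, mul_smul_comm, smul_assoc]))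
  refine ⟨p, fun n => ?_⟩
  have := hp 1 n 1
  rw [map_one, map_one, mul_one, one_mul] at this
  rw [this]
  change AdicCompletion.of hbarIdeal _ ((halfAug (-1) 1 * halfAug 1 1) • n) = _
  rw [map_one, map_one, one_mul, one_smul]

/-- The closed subalgebra generated by the images of the generators of a presented algebra is the
image of this algebra, if the latter is closed. -/
theorem closedAdjoin_eq_range {G : Type} {R : Set (FreeTop G)} {A : Type} [Ring A] [Algebra Base A]
    (f : Presented G R →ₐ[Base] A) (hf : IsHbarClosed (f.range : Set A)) {S : Set A}
    (hS : S = Set.range fun g => f (Presented.gen R g)) : closedAdjoin S = f.range := by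
  subst hS
  refine le_antisymm (sInf_le ⟨hf, ?_⟩) (le_sInf ?_)
  · rintro _ ⟨g, rfl⟩
    exact ⟨_, rfl⟩
  · rintro T ⟨hT, hTS⟩ _ ⟨y, rfl⟩
    obtain ⟨r, rfl⟩ := Presented.mk_surjective R y
    refine FreeTop.mem_of_gen_mul (S := (Subalgebra.toSubmodule T).comap
      (f.toLinearMap ∘ₗ (Presented.mk R).toLinearMap)) (hT.preimage _) ?_ (fun g r hr => ?_) r
    · change f (Presented.mk R 1) ∈ T
      rw [map_one, map_one]
      exact one_mem T
    · change f (Presented.mk R (_ * r)) ∈ T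
      rw [map_mul, map_mul]
      exact mul_mem (hTS ⟨g, rfl⟩) hr

theorem halfMap_gen (ε : ℤˣ) (i : Fin 2) (n : ℤ) :
    halfMap ε (Presented.gen (halfRelations ε) (HalfGen.x i n)) = U.x ε i n := by
  change Presented.mk relations (PowerSeries.map _ (PowerSeries.C _)) = _
  rw [PowerSeries.map_C]
  change Presented.mk relations (PowerSeries.C (halfIncl ε _)) = _
  rw [halfIncl_ι]
  rfl

theorem cartanMap_h (i : Fin 2) (n : ℤ) :
    cartanMap (Presented.gen cartanRelations (CartanGen.h i n)) = U.h i n := by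
  change Presented.mk relations (PowerSeries.map _ (PowerSeries.C _)) = _
  rw [PowerSeries.map_C]
  change Presented.mk relations (PowerSeries.C (cartanIncl _)) = _
  rw [cartanIncl_h]
  rfl

theorem cartanMap_c : cartanMap (Presented.gen cartanRelations CartanGen.c) = U.c := by
  change Presented.mk relations (PowerSeries.map _ (PowerSeries.C _)) = _
  rw [PowerSeries.map_C]
  change Presented.mk relations (PowerSeries.C (cartanIncl _)) = _
  rw [cartanIncl_c]
  rfl

theorem isHbarClosed_halfMap_range (ε : ℤˣ) : IsHbarClosed ((halfMap ε).range : Set U) := by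
  obtain ⟨p, hp⟩ := exists_halfMap_extension ε
  exact isHbarClosed_range (j := (halfMap ε).toLinearMap) (Presented.isHbarComplete _)
    (Presented.isHbarClosed_zero _) hp

theorem halfMap_injective (ε : ℤˣ) : Function.Injective (halfMap ε) := by
  obtain ⟨p, hp⟩ := exists_halfMap_extension ε
  exact injective_of_extension (j := (halfMap ε).toLinearMap) (Presented.isHbarClosed_zero _) hp

theorem isHbarClosed_cartanMap_range : IsHbarClosed (cartanMap.range : Set U) := by
  obtain ⟨p, hp⟩ := exists_cartanMap_extension
  exact isHbarClosed_range (j := cartanMap.toLinearMap) (Presented.isHbarComplete _)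
    (Presented.isHbarClosed_zero _) hp

theorem cartanMap_injective : Function.Injective cartanMap := by
  obtain ⟨p, hp⟩ := exists_cartanMap_extension
  exact injective_of_extension (j := cartanMap.toLinearMap) (Presented.isHbarClosed_zero _) hp

theorem uHalf_eq (ε : ℤˣ) : UHalf ε = (halfMap ε).range := by
  refine closedAdjoin_eq_range _ (isHbarClosed_halfMap_range ε) ?_
  ext y
  constructor
  · rintro ⟨i, m, rfl⟩
    exact ⟨HalfGen.x i m, halfMap_gen ε i m⟩
  · rintro ⟨⟨i, m⟩, rfl⟩
    exact ⟨i, m, halfMap_gen ε i m⟩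

theorem uCartan_eq : UCartan = cartanMap.range := by
  refine closedAdjoin_eq_range _ isHbarClosed_cartanMap_range ?_
  ext y
  constructor
  · rintro (⟨i, m, rfl⟩ | rfl)
    · exact ⟨CartanGen.h i m, cartanMap_h i m⟩
    · exact ⟨CartanGen.c, cartanMap_c⟩
  · rintro ⟨g, rfl⟩
    cases g with
    | h i m => exact Or.inl ⟨i, m, cartanMap_h i m⟩
    | c => exact Or.inr cartanMap_c

/-- The algebra of the `x^ε_{i,n}` is isomorphic to the subalgebra which they generate. -/
def halfEquiv (ε : ℤˣ) : HalfAlg ε ≃ₐ[Base] UHalf ε :=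
  (AlgEquiv.ofInjective (halfMap ε) (halfMap_injective ε)).trans
    (Subalgebra.equivOfEq _ _ (uHalf_eq ε).symm)

theorem halfEquiv_apply (ε : ℤˣ) (a : HalfAlg ε) : (halfEquiv ε a : U) = halfMap ε a := rfl

/-- The algebra of the `h_{i,n}` and `c` is isomorphic to the subalgebra which they generate. -/
def cartanEquiv : CartanAlg ≃ₐ[Base] UCartan :=
  (AlgEquiv.ofInjective cartanMap cartanMap_injective).trans
    (Subalgebra.equivOfEq _ _ uCartan_eq.symm)

theorem cartanEquiv_apply (n : CartanAlg) : (cartanEquiv n : U) = cartanMap n := rfl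

/-- The multiplication `x⁻ ⊗ h ⊗ x⁺ ↦ x⁻ h x⁺`. -/
def tripleMul {A : Type} [Ring A] [Algebra Base A] (Am H Ap : Subalgebra Base A) :
    (Am ⊗[Base] H) ⊗[Base] Ap →ₗ[Base] A :=
  LinearMap.mul' Base A ∘ₗ TensorProduct.map
    (LinearMap.mul' Base A ∘ₗ TensorProduct.map Am.val.toLinearMap H.val.toLinearMap)
    Ap.val.toLinearMap

theorem tripleMul_tmul {A : Type} [Ring A] [Algebra Base A] (Am H Ap : Subalgebra Base A) (a : Am)
    (h : H) (b : Ap) : tripleMul Am H Ap ((a ⊗ₜ[Base] h) ⊗ₜ[Base] b) = (a : A) * (h : A) * (b : A) :=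
  rfl

/-- The tensor product is dense modulo `ħ` and carries the induced topology, hence its completion
is the quantum toroidal algebra. -/
theorem isTriangularDecomposition : IsTriangularDecomposition (UHalf (-1)) UCartan (UHalf 1) := by
  have hclosed : ∀ ε, IsHbarClosed (UHalf ε : Set U) := fun ε => by
    rw [uHalf_eq]; exact isHbarClosed_halfMap_range ε
  refine ⟨hclosed _, by rw [uCartan_eq]; exact isHbarClosed_cartanMap_range, hclosed _, ?_⟩
  obtain ⟨p, hp⟩ := exists_coord (trilinear
    (fun a n b => (halfEquiv (-1) a ⊗ₜ[Base] cartanEquiv n) ⊗ₜ[Base] halfEquiv 1 b)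
    (fun a a' b c => by rw [map_add, TensorProduct.add_tmul, TensorProduct.add_tmul])
    (fun r a b c => by rw [map_smul, ← TensorProduct.smul_tmul', ← TensorProduct.smul_tmul'])
    (fun a b b' c => by rw [map_add, TensorProduct.tmul_add, TensorProduct.add_tmul])
    (fun r a b c => by rw [map_smul, TensorProduct.tmul_smul, ← TensorProduct.smul_tmul'])
    (fun a b c c' => by rw [map_add, TensorProduct.tmul_add])
    (fun r a b c => by rw [map_smul, TensorProduct.tmul_smul]))
  have hp' : p ∘ₗ tripleMul (UHalf (-1)) UCartan (UHalf 1) = AdicCompletion.of hbarIdeal _ := by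
    refine TensorProduct.ext_threefold fun a h b => ?_
    obtain ⟨a, rfl⟩ := (halfEquiv (-1)).surjective a
    obtain ⟨h, rfl⟩ := cartanEquiv.surjective h
    obtain ⟨b, rfl⟩ := (halfEquiv 1).surjective b
    rw [LinearMap.comp_apply, tripleMul_tmul, halfEquiv_apply, halfEquiv_apply, cartanEquiv_apply]
    exact hp a h b
  obtain ⟨e, he⟩ := exists_completion_equiv (Presented.isHbarComplete _)
    (Presented.isHbarClosed_zero _) (fun m => LinearMap.congr_fun hp' m) fun y => by
      obtain ⟨_, ⟨m, rfl⟩, t, ht⟩ := exists_triangular_add_hbar_smul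
        (S := LinearMap.range (tripleMul (UHalf (-1)) UCartan (UHalf 1)))
        (fun a n b => ⟨(halfEquiv (-1) a ⊗ₜ[Base] cartanEquiv n) ⊗ₜ[Base] halfEquiv 1 b, rfl⟩) y
      exact ⟨m, t, ht⟩
  exact ⟨e, fun a h b => he _⟩

end QuantumToroidal
end
theorem theorem3p1 :
    QuantumToroidal.IsTriangularDecomposition
      (QuantumToroidal.UHalf (-1)) QuantumToroidal.UCartan (QuantumToroidal.UHalf 1) ∧
    (∀ ε : ℤˣ,
      ∃ e : QuantumToroidal.Presented QuantumToroidal.HalfGen (QuantumToroidal.halfRelations ε)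
          ≃ₐ[QuantumToroidal.Base] QuantumToroidal.UHalf ε,
        ∀ (i : Fin 2) (m : ℤ),
          (e (QuantumToroidal.Presented.gen (QuantumToroidal.halfRelations ε)
              (QuantumToroidal.HalfGen.x i m)) : QuantumToroidal.U) =
            QuantumToroidal.U.x ε i m) ∧
    (∃ e : QuantumToroidal.Presented QuantumToroidal.CartanGen QuantumToroidal.cartanRelations
          ≃ₐ[QuantumToroidal.Base] QuantumToroidal.UCartan,
        (∀ (i : Fin 2) (m : ℤ),
          (e (QuantumToroidal.Presented.gen QuantumToroidal.cartanRelations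
              (QuantumToroidal.CartanGen.h i m)) : QuantumToroidal.U) =
            QuantumToroidal.U.h i m) ∧
        (e (QuantumToroidal.Presented.gen QuantumToroidal.cartanRelations
              QuantumToroidal.CartanGen.c) : QuantumToroidal.U) = QuantumToroidal.U.c) :=
  ⟨QuantumToroidal.isTriangularDecomposition,
    fun ε => ⟨QuantumToroidal.halfEquiv ε, QuantumToroidal.halfMap_gen ε⟩,
    QuantumToroidal.cartanEquiv, QuantumToroidal.cartanMap_h, QuantumToroidal.cartanMap_c⟩
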